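/- Let $T^2=\mathbb R^2/\mathbb Z^2$. A *polygonal graph* $\Gamma\subset T^2$ is a finite embedded graph without free ends (at least two ends of edges meet at every vertex; loops and multiple edges are allowed) that divides $T^2$ into polygons: $T^2$ is obtained from finitely many closed discs, each with its boundary circle divided into finitely many sides, by gluing the sides in pairs, in such a way that the open discs embed disjointly onto $T^2\setminus\Gamma$ and the sides are mapped onto the edges of $\Gamma$. The *regions* of $\Gamma$ are the connected components of $T^2\setminus\Gamma$. A *type two singular fiber with graph* $\Gamma$ is a space $X$ with a map $p:X\to T^2$ which, over $T^2$, is homeomorphic to the quotient $X_\Gamma$ of the 3-torus $T^2\times S^1$ in which the circle $\{t\}\times S^1$ (the vanishing cycle) is collapsed to a point for each $t\in\Gamma$; thus the fibers of $p$ are points over $\Gamma$ and circles elsewhere. Two such fibers $p:X\to T^2$, $q:Y\to T^2$ have the same type if there are homeomorphisms $\Phi:X\to Y$ and $h:T^2\to T^2$ with $q\circ\Phi=h\circ p$. The Euler number is the alternating sum of the ranks of rational singular homology (which is required to be of finite total dimension). Let $H$ be the hexagon with vertices $\pm(\tfrac23,\tfrac13),\ \pm(\tfrac13,\tfrac23),\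 \pm(\tfrac13,-\tfrac13)$, let $P$ be the parallelogram with vertices $(0,0),(1,0),(1,1),(0,1)$, and let $\Gamma_H,\Gamma_P\subset T^2$ be the images of their boundaries. The fibers $X_{\Gamma_H}$ and $X_{\Gamma_P}$ with their maps to $T^2$ represent *type $II$* and *type $\widetilde{II}$*, respectively. Then there are exactly two types of type two singular fibers with Euler number $-1$, namely $II$ and $\widetilde{II}$. More precisely: 1. A type two singular fiber whose graph is a polygonal graph $\Gamma$ has Euler number $-1$ if and only if $\Gamma$ divides $T^2$ into exactly one region. In that case it is of exactly one of the two types $II$ and $\widetilde{II}$. 2. $H$ and $P$ are fundamental domains for $\mathbb Z^2$ (their $\mathbb Z^2$-translates cover $\mathbb R^2$ and have pairwise disjoint interiors), $\Gamma_H$ and $\Gamma_P$ are polygonal graphs, and $X_{\Gamma_H}$ and $X_{\Gamma_P}$ have Euler number $-1$. -/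

import Mathlib

open Set

noncomputable section

/-- The 2-torus `ℝ² / ℤ²`. -/
abbrev Torus2 : Type := UnitAddCircle × UnitAddCircle

/-- The universal covering map `ℝ² → ℝ² / ℤ²`. -/
def torusMk (x : ℝ × ℝ) : Torus2 := ((x.1 : UnitAddCircle), (x.2 : UnitAddCircle))

/-- The point with parameter `t ∈ [0, 1]` on the `j`-th of the `k` equal arcs into which the unit
circle is divided; these arcs are the sides of the closed unit disc regarded as a `k`-gon. -/
def polygonSide (k j : ℕ) (t : ℝ) : ℂ :=
  Complex.exp (2 * Real.pi * Complex.I * ((j + t : ℝ) / (k : ℝ) : ℝ))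

/-- A finite graph without free ends, embedded in the 2-torus and dividing it into polygons:
the torus is obtained from finitely many (topological) polygons by gluing their sides in pairs,
and the graph consists of the images of the sides and corners. -/
structure PolygonalGraph where
  /-- the vertices -/
  V : Finset Torus2
  /-- the edges -/
  E : Type
  [fintypeE : Fintype E]
  /-- each edge is parametrized by `[0, 1]` -/
  edge : E → ℝ → Torus2
  continuousOn_edge : ∀ e, ContinuousOn (edge e) (Icc 0 1)
  edge_zero_mem : ∀ e, edge e 0 ∈ V
  edge_one_mem : ∀ e, edge e 1 ∈ V
  /-- the open edges are embedded and pairwise disjoint -/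
  injOn_edge : InjOn (fun x : E × ℝ => edge x.1 x.2) (univ ×ˢ Ioo 0 1)
  edge_notMem : ∀ e, ∀ t ∈ Ioo (0 : ℝ) 1, edge e t ∉ V
  /-- no free ends: at least two ends of edges meet at every vertex -/
  two_le_degree : ∀ v ∈ V,
    2 ≤ Nat.card {e : E // edge e 0 = v} + Nat.card {e : E // edge e 1 = v}
  /-- the polygons -/
  F : Type
  [fintypeF : Fintype F]
  /-- the number of sides of each polygon -/
  sides : F → ℕ
  sides_pos : ∀ f, 0 < sides f
  /-- each polygon is parametrized by the closed unit disc -/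
  cell : F → ℂ → Torus2
  continuousOn_cell : ∀ f, ContinuousOn (cell f) (Metric.closedBall 0 1)
  /-- the open polygons are embedded and pairwise disjoint -/
  injOn_cell : InjOn (fun x : F × ℂ => cell x.1 x.2) (univ ×ˢ Metric.ball 0 1)
  /-- the open polygons fill the complement of the graph -/
  iUnion_cell : (⋃ f, cell f '' Metric.ball 0 1) = ((V : Set Torus2) ∪ ⋃ e, edge e '' Icc 0 1)ᶜ
  /-- each side of a polygon is an edge, traversed forwards (`true`) or backwards (`false`) -/
  side : (f : F) → Fin (sides f) → E × Bool
  cell_side : ∀ (f : F) (j : Fin (sides f)), ∀ t ∈ Icc (0 : ℝ) 1,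
    cell f (polygonSide (sides f) j t) =
      edge (side f j).1 (if (side f j).2 then t else 1 - t)
  /-- the sides are glued in pairs -/
  card_side : ∀ e : E, Nat.card {s : Σ f : F, Fin (sides f) // (side s.1 s.2).1 = e} = 2

/-- The graph as a subset of the torus. -/
def PolygonalGraph.carrier (G : PolygonalGraph) : Set Torus2 :=
  (G.V : Set Torus2) ∪ ⋃ e, G.edge e '' Icc 0 1

/-- The number of regions into which a subset divides the torus. -/
def numRegions (Γ : Set Torus2) : ℕ := Nat.card (ConnectedComponents (Γᶜ : Set Torus2))

/-- The relation on the 3-torus `T² × S¹` that collapses the circle `{t} × S¹` to a point for each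
`t ∈ Γ`, and identifies nothing else. -/
def collapseSetoid (Γ : Set Torus2) : Setoid (Torus2 × Circle) where
  r a b := a = b ∨ (a.1 = b.1 ∧ a.1 ∈ Γ)
  iseqv :=
    { refl := fun _ => Or.inl rfl
      symm := by
        rintro a b (h | ⟨h, h'⟩)
        · exact Or.inl h.symm
        · exact Or.inr ⟨h.symm, h ▸ h'⟩
      trans := by
        rintro a b c (rfl | ⟨h, h'⟩) (rfl | ⟨k, k'⟩)
        · exact Or.inl rfl
        · exact Or.inr ⟨k, k'⟩
        · exact Or.inr ⟨h, h'⟩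
        · exact Or.inr ⟨h.trans k, h'⟩ }

/-- The 3-torus with the vanishing circle collapsed over `Γ`, with the quotient topology. -/
abbrev CollapsedTorus (Γ : Set Torus2) : Type := Quotient (collapseSetoid Γ)

/-- The natural map to the 2-torus: its fibers are points over `Γ` and circles elsewhere. -/
def CollapsedTorus.proj (Γ : Set Torus2) : CollapsedTorus Γ → Torus2 :=
  Quotient.lift Prod.fst (by
    rintro a b (h | h)
    · exact congrArg Prod.fst h
    · exact h.1)

/-- `p : X → T²` is a type two singular fiber with graph `Γ`: over `T²`, it is the 3-torus with
one 1-cycle, the circle factor, collapsed over `Γ`. -/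
def IsTypeTwoFiber {X : Type} [TopologicalSpace X] (Γ : Set Torus2) (p : X → Torus2) : Prop :=
  ∃ Φ : X ≃ₜ CollapsedTorus Γ, ∀ x, CollapsedTorus.proj Γ (Φ x) = p x

/-- Two spaces over the 2-torus are of the same type if there is a homeomorphism between them that
covers a self-homeomorphism of the torus. -/
def SameType {X Y : Type} [TopologicalSpace X] [TopologicalSpace Y]
    (p : X → Torus2) (q : Y → Torus2) : Prop :=
  ∃ (Φ : X ≃ₜ Y) (h : Torus2 ≃ₜ Torus2), ∀ x, q (Φ x) = h (p x)

/-- The singular chain complex of a space with rational coefficients. -/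
def rationalSingularChains (X : Type) [TopologicalSpace X] : ChainComplex (ModuleCat.{0} ℚ) ℕ :=
  ((AlgebraicTopology.singularChainComplexFunctor (ModuleCat.{0} ℚ)).obj (ModuleCat.of ℚ ℚ)).obj
    (TopCat.of X)

/-- The rational singular homology of `X` has finite total dimension, and the Euler number of `X`
(the alternating sum of its Betti numbers) is `χ`. -/
def HasEulerNumber (X : Type) [TopologicalSpace X] (χ : ℤ) : Prop :=
  (∀ n, Module.Finite ℚ ((rationalSingularChains X).homology n)) ∧
  {n | Nontrivial ((rationalSingularChains X).homology n)}.Finite ∧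
  (rationalSingularChains X).homologyEulerChar = χ

/-- A plane set is a fundamental domain for `ℤ²`: its translates cover the plane and their
interiors are pairwise disjoint. -/
def IsFundamentalPolygon (P : Set (ℝ × ℝ)) : Prop :=
  torusMk '' P = univ ∧ InjOn torusMk (interior P)

/-- The graph on the torus formed by the boundary of a plane polygon. -/
def boundaryGraph (P : Set (ℝ × ℝ)) : Set Torus2 := torusMk '' frontier P

/-- A hexagon with parallel opposite sides that tiles the plane under translation by `ℤ²`. -/
def parallelHexagon : Set (ℝ × ℝ) :=
  convexHull ℝ {(2/3, 1/3), (1/3, 2/3), (-1/3, 1/3), (-2/3, -1/3), (-1/3, -2/3), (1/3, -1/3)}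

/-- The parallelogram that tiles the plane under translation by `ℤ²`. -/
def parallelogram : Set (ℝ × ℝ) :=
  convexHull ℝ {(0, 0), (1, 0), (1, 1), (0, 1)}

/-- The type `II` fiber: the graph is the boundary of the hexagon. -/
def IsTypeII {X : Type} [TopologicalSpace X] (p : X → Torus2) : Prop :=
  SameType p (CollapsedTorus.proj (boundaryGraph parallelHexagon))

/-- The type `ĨI` fiber: the graph is the boundary of the parallelogram. -/
def IsTypeIITilde {X : Type} [TopologicalSpace X] (p : X → Torus2) : Prop :=
  SameType p (CollapsedTorus.proj (boundaryGraph parallelogram))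

end

/-! The Euler numbers come from additivity. Barycentric subdivision gives Mayer–Vietoris for
rational singular homology, hence χ(Y) = χ(A) + χ(L) − χ(S × L) when product cells D × L are
attached to A, S being the boundary sphere of D (`HasEulerNumber.attach`). The same sequence read
backwards computes A from Y (`HasEulerNumber.boundary_of_attach`). Products with a circle have Euler
number 0. The torus is Γ with |F| discs attached, so χ(Γ) = −|F|. Also Γ is its vertex set with
edges attached, so χ(Γ) = |V| − |E|, and comparing the two gives Euler's formula. The fiber X_Γ is Γ
with solid cylinders D × S¹ attached, which contribute nothing, so χ(X_Γ) = −|F|. The regions are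
the open polygons, so the value −1 means exactly one region.

For the classification, let there be one polygon. The definition of a polygonal graph does not say
directly that the two sides at an edge run in opposite directions, nor which corners meet at a
vertex. Both facts come from linear algebra instead of local topology. Lift the polygon to the
plane, with coordinates y₁ and y₂. A combination h + a y₁ + b y₂, with h a function of the vertices,
is determined by its value at one corner and its increments along the edges, because a combination a
y₁ + b y₂ compatible with the gluing must vanish (`lift_combination_eq_zero`). Euler's formula |V| +
2 = 1 + |E| makes this injection bijective (`exists_corner_decomposition`); in effect, this computes
H¹ of the torus. Summing increments around the polygon gives opposite directions (`cside_opposite`),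
and decomposing indicator functions of cycles shows that the corners at a vertex form a single cycle
of the rotation j ↦ partner j + 1 (`cornerVertex_eq_iff`).

The polygon then has n = 2|V| + 2 sides, so the numbers (degree − 2), summed over the vertices, give
2. Without free ends all degrees are at least 2, so apart from vertices of degree 2 there is one
vertex of degree 4 or there are two of degree 3. Forgetting the vertices of degree 2 turns the
polygon into a square or a hexagon, and then the pairing must glue opposite sides. Rescaling the
sides realizes this by a homeomorphism of boundary circles (`SidePairing.exists_circleHomeo`).
Coning it to the disc shows that two graphs with the same standard form differ by a homeomorphism of
the torus, which lifts to the fibers.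

The two models are treated uniformly as centrally symmetric tiles described by gauge functions.
Their types differ: Γ is recovered from p as the set of points with one-point fibers, and the
hexagon gives a theta graph, which has no cut point, whereas the square gives a wedge of two
circles, which has one. Hence the two models account for both standard forms. -/

open Set

noncomputable section

/-! ### Euler characteristics of chain complexes -/

section

open CategoryTheory

/-- The homology of a rational chain complex has finite total dimension and Euler
characteristic `χ`. -/
def HasEulerChar (K : ChainComplex (ModuleCat.{0} ℚ) ℕ) (χ : ℤ) : Prop :=
  (∀ n, Module.Finite ℚ (K.homology n)) ∧ {n | Nontrivial (K.homology n)}.Finite ∧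
    K.homologyEulerChar = χ

theorem homologyEulerChar_eq_sum (K : ChainComplex (ModuleCat.{0} ℚ) ℕ) (N : ℕ)
    (h : ∀ n, N ≤ n → Subsingleton (K.homology n)) :
    K.homologyEulerChar =
      ∑ n ∈ Finset.range N, (-1 : ℤ) ^ n * Module.finrank ℚ (K.homology n) := by
  rw [HomologicalComplex.homologyEulerChar_eq_sum_finSet_of_finrankSupport_subset K
    (Finset.range N)]
  · simp
  · intro n hn
    by_contra hc
    have := h n (by simpa using hc)
    exact hn Module.finrank_zero_of_subsingleton

theorem exists_bound_of_finite {K : ChainComplex (ModuleCat.{0} ℚ) ℕ}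
    (h : {n | Nontrivial (K.homology n)}.Finite) :
    ∃ N, ∀ n, N ≤ n → Subsingleton (K.homology n) := by
  obtain ⟨M, hM⟩ := h.bddAbove
  refine ⟨M + 1, fun n hn => ?_⟩
  by_contra hc
  have := hM (show n ∈ {n | Nontrivial (K.homology n)} from not_subsingleton_iff_nontrivial.1 hc)
  omega

theorem finite_of_bound {K : ChainComplex (ModuleCat.{0} ℚ) ℕ} (N : ℕ)
    (h : ∀ n, N ≤ n → Subsingleton (K.homology n)) :
    {n | Nontrivial (K.homology n)}.Finite := by
  refine (Set.finite_lt_nat N).subset fun n hn => ?_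
  by_contra hc
  exact not_subsingleton_iff_nontrivial.2 hn (h n (by simpa using hc))

theorem Function.Exact.finite_middle {A B C : Type*} [AddCommGroup A] [AddCommGroup B]
    [AddCommGroup C] [Module ℚ A] [Module ℚ B] [Module ℚ C] {f : A →ₗ[ℚ] B} {g : B →ₗ[ℚ] C}
    (h : Function.Exact f g) [Module.Finite ℚ A] [Module.Finite ℚ C] : Module.Finite ℚ B := by
  have : IsNoetherian ℚ B := isNoetherian_of_range_eq_ker f g (LinearMap.exact_iff.1 h).symm
  infer_instance

theorem Function.Exact.subsingleton_middle {A B C : Type*} [AddCommGroup A] [AddCommGroup B]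
    [AddCommGroup C] [Module ℚ A] [Module ℚ B] [Module ℚ C] {f : A →ₗ[ℚ] B} {g : B →ₗ[ℚ] C}
    (h : Function.Exact f g) [Subsingleton A] [Subsingleton C] : Subsingleton B := by
  refine subsingleton_of_forall_eq 0 fun b => ?_
  obtain ⟨a, rfl⟩ := (h b).1 (Subsingleton.elim _ _)
  rw [Subsingleton.elim a 0, map_zero]

/-- Rank–nullity for `f`, `g` and `δ'`. The ranks of the incoming and outgoing connecting maps stay
as correction terms, which cancel between neighbouring degrees of the long exact sequence. -/
theorem exact_finrank {A B C C' A' : Type*} [AddCommGroup A] [AddCommGroup B]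
    [AddCommGroup C] [AddCommGroup C'] [AddCommGroup A'] [Module ℚ A] [Module ℚ B] [Module ℚ C]
    [Module ℚ C'] [Module ℚ A'] [Module.Finite ℚ A] [Module.Finite ℚ B] [Module.Finite ℚ C]
    {δ : C' →ₗ[ℚ] A} {f : A →ₗ[ℚ] B} {g : B →ₗ[ℚ] C} {δ' : C →ₗ[ℚ] A'}
    (h₁ : Function.Exact δ f) (h₂ : Function.Exact f g) (h₃ : Function.Exact g δ') :
    Module.finrank ℚ B + Module.finrank ℚ (LinearMap.range δ) +
      Module.finrank ℚ (LinearMap.range δ') = Module.finrank ℚ A + Module.finrank ℚ C := by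
  have e₁ := LinearMap.finrank_range_add_finrank_ker f
  have e₂ := LinearMap.finrank_range_add_finrank_ker g
  have e₃ := LinearMap.finrank_range_add_finrank_ker δ'
  rw [LinearMap.exact_iff.1 h₁] at e₁
  rw [LinearMap.exact_iff.1 h₂] at e₂
  rw [LinearMap.exact_iff.1 h₃] at e₃
  omega

/-- Here `r n` stands for the rank of the connecting map from degree n + 1 to degree n. It occurs in
two successive degrees with opposite signs, so the sum telescopes and only the last rank survives.
-/
theorem sum_alternating_of_exact (a b c r : ℕ → ℕ) (N : ℕ)
    (h0 : b 0 + r 0 = a 0 + c 0) (h : ∀ n, b (n + 1) + r (n + 1) + r n = a (n + 1) + c (n + 1)) :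
    ∑ n ∈ Finset.range (N + 1), (-1 : ℤ) ^ n * b n + (-1) ^ N * r N =
      ∑ n ∈ Finset.range (N + 1), (-1 : ℤ) ^ n * a n +
      ∑ n ∈ Finset.range (N + 1), (-1 : ℤ) ^ n * c n := by
  induction N with
  | zero => simp; exact_mod_cast h0
  | succ N ih =>
    rw [Finset.sum_range_succ, Finset.sum_range_succ _ (N + 1), Finset.sum_range_succ _ (N + 1)]
    have h' : (b (N + 1) : ℤ) + r (N + 1) + r N = a (N + 1) + c (N + 1) := by exact_mod_cast h N
    rw [pow_succ]
    linear_combination ih - (-1 : ℤ) ^ N * h'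

/-! ### Long exact sequences and additivity of the Euler characteristic -/

section ShortExact

variable {S : ShortComplex (ChainComplex (ModuleCat.{0} ℚ) ℕ)} (hS : S.ShortExact)
include hS

theorem les_exact_mid (n : ℕ) : Function.Exact (HomologicalComplex.homologyMap S.f n).hom
    (HomologicalComplex.homologyMap S.g n).hom := by
  have := hS.homology_exact₂ n
  rw [ShortComplex.ShortExact.moduleCat_exact_iff_function_exact] at this
  exact this

theorem les_exact_left (n : ℕ) : Function.Exact (hS.δ (n + 1) n rfl).hom
    (HomologicalComplex.homologyMap S.f n).hom := by
  have := hS.homology_exact₁ (n + 1) n rfl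
  rw [ShortComplex.ShortExact.moduleCat_exact_iff_function_exact] at this
  exact this

theorem les_exact_right (n : ℕ) : Function.Exact (HomologicalComplex.homologyMap S.g (n + 1)).hom
    (hS.δ (n + 1) n rfl).hom := by
  have := hS.homology_exact₃ (n + 1) n rfl
  rw [ShortComplex.ShortExact.moduleCat_exact_iff_function_exact] at this
  exact this

theorem les_surjective_zero :
    Function.Surjective (HomologicalComplex.homologyMap S.g 0).hom := by
  have := hS.epi_g
  have : Epi (HomologicalComplex.homologyMap S.g 0) :=
    HomologicalComplex.epi_homologyMap_of_epi_of_not_rel _ _ (by simp)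
  exact (ModuleCat.epi_iff_surjective _).1 this

/-- The zero map stands in for the missing connecting map out of degree 0, so that this degree obeys
the same rank formula as the others. -/
theorem les_exact_right_zero : Function.Exact (HomologicalComplex.homologyMap S.g 0).hom
    (0 : S.X₃.homology 0 →ₗ[ℚ] PUnit.{1}) := by
  intro x
  simpa using les_surjective_zero hS x

theorem homologyEulerChar_add (h₁ : ∀ n, Module.Finite ℚ (S.X₁.homology n))
    (h₂ : ∀ n, Module.Finite ℚ (S.X₂.homology n)) (h₃ : ∀ n, Module.Finite ℚ (S.X₃.homology n))
    (f₁ : {n | Nontrivial (S.X₁.homology n)}.Finite)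
    (f₂ : {n | Nontrivial (S.X₂.homology n)}.Finite)
    (f₃ : {n | Nontrivial (S.X₃.homology n)}.Finite) :
    S.X₂.homologyEulerChar = S.X₁.homologyEulerChar + S.X₃.homologyEulerChar := by
  obtain ⟨N₁, b₁⟩ := exists_bound_of_finite f₁
  obtain ⟨N₂, b₂⟩ := exists_bound_of_finite f₂
  obtain ⟨N₃, b₃⟩ := exists_bound_of_finite f₃
  set N := max N₁ (max N₂ N₃)
  rw [homologyEulerChar_eq_sum S.X₁ (N + 1) fun n hn => b₁ n (by grind),
    homologyEulerChar_eq_sum S.X₂ (N + 1) fun n hn => b₂ n (by grind),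
    homologyEulerChar_eq_sum S.X₃ (N + 1) fun n hn => b₃ n (by grind)]
  have key := sum_alternating_of_exact (fun n => Module.finrank ℚ (S.X₁.homology n))
    (fun n => Module.finrank ℚ (S.X₂.homology n)) (fun n => Module.finrank ℚ (S.X₃.homology n))
    (fun n => Module.finrank ℚ (LinearMap.range (hS.δ (n + 1) n rfl).hom)) N ?_ ?_
  -- The surviving rank is that of a map into the homology of `S.X₁` in degree `N`, which is zero by
  -- the choice of `N`.
  · have : Subsingleton (S.X₁.homology N) := b₁ N (by grind)
    rw [← key, Module.finrank_zero_of_subsingleton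
      (M := LinearMap.range (hS.δ (N + 1) N rfl).hom)]
    simp
  · have := exact_finrank (les_exact_left hS 0) (les_exact_mid hS 0) (les_exact_right_zero hS)
    rwa [LinearMap.range_zero, finrank_bot, add_zero] at this
  · intro n
    exact exact_finrank (les_exact_left hS (n + 1)) (les_exact_mid hS (n + 1))
      (les_exact_right hS n)

/-- Two out of three: finiteness of the third homology follows from exactness and is not assumed,
and additivity then gives its Euler characteristic. The other two positions are handled in the same
way. -/
theorem HasEulerChar.middle {a c : ℤ} (h₁ : HasEulerChar S.X₁ a) (h₃ : HasEulerChar S.X₃ c) :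
    HasEulerChar S.X₂ (a + c) := by
  obtain ⟨N₁, b₁⟩ := exists_bound_of_finite h₁.2.1
  obtain ⟨N₃, b₃⟩ := exists_bound_of_finite h₃.2.1
  have i₁ := h₁.1
  have i₃ := h₃.1
  have i₂ : ∀ n, Module.Finite ℚ (S.X₂.homology n) := fun n => (les_exact_mid hS n).finite_middle
  have f₂ : {n | Nontrivial (S.X₂.homology n)}.Finite := by
    refine finite_of_bound (max N₁ N₃) fun n hn => ?_
    have := b₁ n (by grind)
    have := b₃ n (by grind)
    exact (les_exact_mid hS n).subsingleton_middle
  refine ⟨i₂, f₂, ?_⟩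
  rw [homologyEulerChar_add hS i₁ i₂ i₃ h₁.2.1 f₂ h₃.2.1, h₁.2.2, h₃.2.2]

theorem HasEulerChar.left {b c : ℤ} (h₂ : HasEulerChar S.X₂ b) (h₃ : HasEulerChar S.X₃ c) :
    HasEulerChar S.X₁ (b - c) := by
  obtain ⟨N₂, b₂⟩ := exists_bound_of_finite h₂.2.1
  obtain ⟨N₃, b₃⟩ := exists_bound_of_finite h₃.2.1
  have i₂ := h₂.1
  have i₃ := h₃.1
  have i₁ : ∀ n, Module.Finite ℚ (S.X₁.homology n) := fun n => (les_exact_left hS n).finite_middle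
  have f₁ : {n | Nontrivial (S.X₁.homology n)}.Finite := by
    refine finite_of_bound (max N₂ N₃) fun n hn => ?_
    have := b₂ n (by grind)
    have := b₃ (n + 1) (by grind)
    exact (les_exact_left hS n).subsingleton_middle
  refine ⟨i₁, f₁, ?_⟩
  have := homologyEulerChar_add hS i₁ i₂ i₃ f₁ h₂.2.1 h₃.2.1
  rw [h₂.2.2, h₃.2.2] at this
  omega

theorem HasEulerChar.right {a b : ℤ} (h₁ : HasEulerChar S.X₁ a) (h₂ : HasEulerChar S.X₂ b) :
    HasEulerChar S.X₃ (b - a) := by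
  obtain ⟨N₂, b₂⟩ := exists_bound_of_finite h₂.2.1
  obtain ⟨N₁, b₁⟩ := exists_bound_of_finite h₁.2.1
  have i₂ := h₂.1
  have i₁ := h₁.1
  have i₃ : ∀ n, Module.Finite ℚ (S.X₃.homology n) := by
    rintro (_ | n)
    · exact (les_exact_right_zero hS).finite_middle
    · exact (les_exact_right hS n).finite_middle
  have f₃ : {n | Nontrivial (S.X₃.homology n)}.Finite := by
    -- The shift by one is needed because the homology of the quotient in degree n + 1 also involves
    -- degree n of the subcomplex.
    refine finite_of_bound (max N₁ N₂ + 1) fun n hn => ?_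
    obtain ⟨n, rfl⟩ : ∃ m, n = m + 1 := ⟨n - 1, by omega⟩
    have := b₂ (n + 1) (by grind)
    have := b₁ n (by grind)
    exact (les_exact_right hS n).subsingleton_middle
  refine ⟨i₃, f₃, ?_⟩
  have := homologyEulerChar_add hS i₁ i₂ i₃ h₁.2.1 h₂.2.1 f₃
  rw [h₂.2.2, h₁.2.2] at this
  omega

end ShortExact

theorem HasEulerChar.of_homologyIso {K L : ChainComplex (ModuleCat.{0} ℚ) ℕ} {a : ℤ}
    (e : ∀ n, K.homology n ≅ L.homology n) (h : HasEulerChar K a) : HasEulerChar L a := by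
  refine ⟨fun n => ?_, ?_, ?_⟩
  · have := h.1 n
    exact Module.Finite.equiv (e n).toLinearEquiv
  · refine h.2.1.subset fun n (hn : Nontrivial _) => ?_
    exact (e n).toLinearEquiv.toEquiv.nontrivial
  · rw [← h.2.2]
    unfold HomologicalComplex.homologyEulerChar GradedObject.eulerChar
    exact finsum_congr fun n => by rw [(e n).toLinearEquiv.finrank_eq]

theorem HasEulerChar.of_iso {K L : ChainComplex (ModuleCat.{0} ℚ) ℕ} {a : ℤ}
    (e : K ≅ L) (h : HasEulerChar K a) : HasEulerChar L a :=
  h.of_homologyIso fun n => (HomologicalComplex.homologyFunctor _ _ n).mapIso e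

theorem hasEulerChar_zero_of_subsingleton {K : ChainComplex (ModuleCat.{0} ℚ) ℕ}
    (h : ∀ n, Subsingleton (K.homology n)) : HasEulerChar K 0 := by
  refine ⟨fun n => ?_, finite_of_bound 0 fun n _ => h n, ?_⟩
  · have := h n
    infer_instance
  · simpa using homologyEulerChar_eq_sum K 0 fun n _ => h n

end

/-! ### Affine simplices -/

section

open CategoryTheory

/-- The standard `n`-simplex. -/
abbrev Splx (n : ℕ) : Type := stdSimplex ℝ (Fin (n + 1))

/-- The affine map of standard simplices with given images of the vertices. -/
def affMap {n m : ℕ} (v : Fin (n + 1) → Splx m) : C(Splx n, Splx m) where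
  toFun x := ⟨∑ i, x.1 i • (v i).1,
    (convex_stdSimplex ℝ _).sum_mem (fun i _ => x.2.1 i) x.2.2 (fun i _ => (v i).2)⟩
  continuous_toFun := by
    refine Continuous.subtype_mk (continuous_finsetSum _ fun i _ => ?_) _
    exact ((continuous_apply i).comp continuous_subtype_val).smul continuous_const

theorem affMap_coe {n m : ℕ} (v : Fin (n + 1) → Splx m) (x : Splx n) :
    (affMap v x).1 = ∑ i, x.1 i • (v i).1 := rfl

/-- The vertices of the standard simplex. -/
def vtx (n : ℕ) (i : Fin (n + 1)) : Splx n := stdSimplex.vertex i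

theorem affMap_vtx {n m : ℕ} (v : Fin (n + 1) → Splx m) (i : Fin (n + 1)) :
    affMap v (vtx n i) = v i := by
  apply Subtype.ext
  rw [affMap_coe, Finset.sum_eq_single i]
  · have : (vtx n i).1 i = 1 := by simp [vtx, stdSimplex.vertex]
    rw [this, one_smul]
  · intro j _ hj
    have : (vtx n i).1 j = 0 := by simp [vtx, stdSimplex.vertex, hj]
    rw [this, zero_smul]
  · simp

theorem affMap_affMap {n m k : ℕ} (v : Fin (n + 1) → Splx m) (w : Fin (k + 1) → Splx n)
    (x : Splx k) : affMap v (affMap w x) = affMap (fun i => affMap v (w i)) x := by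
  apply Subtype.ext
  simp only [affMap_coe, Finset.sum_apply, Pi.smul_apply, smul_eq_mul, Finset.sum_smul,
    Finset.smul_sum, mul_smul]
  exact Finset.sum_comm

theorem affMap_comp {n m k : ℕ} (v : Fin (n + 1) → Splx m) (w : Fin (k + 1) → Splx n) :
    (affMap v).comp (affMap w) = affMap (fun i => affMap v (w i)) :=
  ContinuousMap.ext (affMap_affMap v w)

theorem affMap_vtx_eq_id (n : ℕ) : affMap (vtx n) = ContinuousMap.id (Splx n) := by
  ext x : 1
  apply Subtype.ext
  rw [affMap_coe]
  funext i
  simp only [Finset.sum_apply, Pi.smul_apply, smul_eq_mul, vtx, stdSimplex.vertex]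
  rw [Finset.sum_eq_single i]
  · simp
  · intro j _ hj
    simp [hj.symm]
  · simp

/-- Closed balls are convex, and an affine simplex consists of convex combinations of its vertices.
-/
theorem dist_affMap_le {n m : ℕ} (v : Fin (n + 1) → Splx m) (x : Splx n) (b : Splx m) (r : ℝ)
    (h : ∀ i, dist b (v i) ≤ r) : dist b (affMap v x) ≤ r := by
  have := (convex_closedBall b.1 r).sum_mem (t := Finset.univ) (w := x.1) (z := fun i => (v i).1)
    (fun i _ => x.2.1 i) x.2.2 fun i _ => by
      rw [Metric.mem_closedBall, dist_comm]; exact h i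
  rw [Metric.mem_closedBall, dist_comm] at this
  exact this

/-- The barycenter of a tuple of points. -/
def bary {n m : ℕ} (v : Fin (n + 1) → Splx m) : Splx m := affMap v stdSimplex.barycenter

theorem affMap_bary {n m k : ℕ} (v : Fin (n + 1) → Splx m) (w : Fin (k + 1) → Splx n) :
    affMap v (bary w) = bary fun i => affMap v (w i) := affMap_affMap ..

/-- The barycenter minus `v i` is the average of the n + 1 differences `v j - v i`, one of which is
zero. The resulting factor n / (n + 1) < 1 makes iterated subdivision arbitrarily fine. -/
theorem dist_bary_le {n m : ℕ} (v : Fin (n + 1) → Splx m) (ε : ℝ)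
    (h : ∀ i j, dist (v i) (v j) ≤ ε) (i : Fin (n + 1)) :
    dist (bary v) (v i) ≤ n / (n + 1) * ε := by
  have hn : (0 : ℝ) < n + 1 := by positivity
  have e : (bary v).1 - (v i).1 = ∑ j, ((n : ℝ) + 1)⁻¹ • ((v j).1 - (v i).1) := by
    rw [← Finset.smul_sum, Finset.sum_sub_distrib, smul_sub, Finset.smul_sum]
    congr 1
    · rw [bary, affMap_coe]
      refine Finset.sum_congr rfl fun j _ => ?_
      congr 1
      simp
    · rw [Finset.sum_const, Finset.card_univ, Fintype.card_fin, ← Nat.cast_smul_eq_nsmul ℝ,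
        smul_smul]
      push_cast
      rw [inv_mul_cancel₀ hn.ne', one_smul]
  change dist (bary v).1 (v i).1 ≤ _
  rw [dist_eq_norm, e]
  refine (norm_sum_le _ _).trans ?_
  calc ∑ j, ‖((n : ℝ) + 1)⁻¹ • ((v j).1 - (v i).1)‖
      ≤ ∑ j, if j = i then 0 else ((n : ℝ) + 1)⁻¹ * ε := by
        refine Finset.sum_le_sum fun j _ => ?_
        split_ifs with hj
        · simp [hj]
        · rw [norm_smul, norm_inv, Real.norm_of_nonneg hn.le, ← dist_eq_norm]
          exact mul_le_mul_of_nonneg_left (h j i) (by positivity)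
    _ = n / (n + 1) * ε := by
        rw [Finset.sum_ite]
        simp [Finset.filter_ne']
        ring

/-! ### Chains of affine simplices -/

/-- Rational chains of tuples of points of a simplex. -/
abbrev AffC (n m : ℕ) : Type := (Fin (n + 1) → Splx m) →₀ ℚ

/-- The boundary of affine chains. -/
def affBd (n m : ℕ) : AffC (n + 1) m →ₗ[ℚ] AffC n m :=
  Finsupp.linearCombination ℚ fun v => ∑ i : Fin (n + 2), Finsupp.single (v ∘ i.succAbove) ((-1) ^ (i : ℕ))

/-- The tuple obtained by adding a point in front. -/
def consPt {n m : ℕ} (b : Splx m) (v : Fin (n + 1) → Splx m) : Fin (n + 2) → Splx m :=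
  Fin.cons (α := fun _ => Splx m) b v

@[simp] theorem consPt_zero {n m : ℕ} (b : Splx m) (v : Fin (n + 1) → Splx m) :
    consPt b v 0 = b := rfl

@[simp] theorem consPt_succ {n m : ℕ} (b : Splx m) (v : Fin (n + 1) → Splx m) (i : Fin (n + 1)) :
    consPt b v i.succ = v i := rfl

/-- The cone over an affine chain. -/
def affCone {m : ℕ} (b : Splx m) (n : ℕ) : AffC n m →ₗ[ℚ] AffC (n + 1) m :=
  Finsupp.lmapDomain ℚ ℚ (consPt b)

/-- The sum of the coefficients. -/
def affAug (m : ℕ) : AffC 0 m →ₗ[ℚ] ℚ := Finsupp.linearCombination ℚ fun _ => 1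

theorem affBd_single {n m : ℕ} (v : Fin (n + 2) → Splx m) : affBd n m (Finsupp.single v 1) =
    ∑ i : Fin (n + 2), Finsupp.single (v ∘ i.succAbove) ((-1) ^ (i : ℕ)) := by
  simp [affBd]

theorem affCone_single {n m : ℕ} (b : Splx m) (v : Fin (n + 1) → Splx m) (a : ℚ) :
    affCone b n (Finsupp.single v a) = Finsupp.single (consPt b v) a := by
  simp [affCone]

/-- The face opposite the cone point is the original simplex. The other faces are cones over its
faces, with the index and hence the sign shifted by one. -/
theorem affBd_affCone {n m : ℕ} (b : Splx m) (c : AffC (n + 1) m) :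
    affBd (n + 1) m (affCone b (n + 1) c) = c - affCone b n (affBd n m c) := by
  suffices h : affBd (n + 1) m ∘ₗ affCone b (n + 1) =
    LinearMap.id - affCone b n ∘ₗ affBd n m from LinearMap.congr_fun h c
  refine Finsupp.lhom_ext' fun v => LinearMap.ext_ring ?_
  simp only [LinearMap.comp_apply, Finsupp.lsingle_apply, LinearMap.sub_apply, LinearMap.id_apply,
    affCone_single, affBd_single, map_sum]
  rw [Fin.sum_univ_succ, sub_eq_add_neg, ← Finset.sum_neg_distrib]
  congr 1
  refine Finset.sum_congr rfl fun i _ => ?_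
  rw [← Finsupp.single_neg]
  congr 1
  · funext j
    refine Fin.cases ?_ (fun j => ?_) j <;> simp
  · simp [pow_succ]

/-- In degree 0 the other face of the cone is the cone point itself, counted with the sum of the
coefficients. -/
theorem affBd_affCone_zero {m : ℕ} (b : Splx m) (c : AffC 0 m) :
    affBd 0 m (affCone b 0 c) = c - Finsupp.single (fun _ => b) (affAug m c) := by
  suffices h : affBd 0 m ∘ₗ affCone b 0 =
    LinearMap.id - Finsupp.lsingle (fun _ => b) ∘ₗ affAug m from LinearMap.congr_fun h c
  refine Finsupp.lhom_ext' fun v => LinearMap.ext_ring ?_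
  simp only [LinearMap.comp_apply, Finsupp.lsingle_apply, LinearMap.sub_apply, LinearMap.id_apply,
    affCone_single, affBd_single]
  rw [Fin.sum_univ_two, sub_eq_add_neg]
  congr 1
  rw [← Finsupp.single_neg]
  congr 1
  · funext j
    have : j = 0 := Fin.fin_one_eq_zero j
    subst this
    rfl
  · simp [affAug]

theorem affAug_affBd {m : ℕ} (c : AffC 1 m) : affAug m (affBd 0 m c) = 0 := by
  suffices h : affAug m ∘ₗ affBd 0 m = 0 from LinearMap.congr_fun h c
  refine Finsupp.lhom_ext' fun v => LinearMap.ext_ring ?_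
  simp [affBd_single, affAug, Fin.sum_univ_two]

/-- Viewing every simplex as a cone from its first vertex turns ∂∂ = 0 into an induction with the
cone formula and avoids the usual double sum. -/
theorem affC_eq_cone {n m : ℕ} (v : Fin (n + 2) → Splx m) :
    (Finsupp.single v 1 : AffC (n + 1) m) = affCone (v 0) n (Finsupp.single (Fin.tail v) 1) := by
  rw [affCone_single]
  congr 1
  exact (Fin.cons_self_tail v).symm

theorem affBd_affBd {n m : ℕ} (c : AffC (n + 2) m) : affBd n m (affBd (n + 1) m c) = 0 := by
  suffices h : affBd n m ∘ₗ affBd (n + 1) m = 0 from LinearMap.congr_fun h c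
  refine Finsupp.lhom_ext' fun v => LinearMap.ext_ring ?_
  simp only [LinearMap.comp_apply, Finsupp.lsingle_apply, LinearMap.zero_apply]
  induction n with
  | zero => rw [affC_eq_cone, affBd_affCone, map_sub, affBd_affCone_zero, affAug_affBd]; simp
  | succ n ih =>
    rw [affC_eq_cone, affBd_affCone, map_sub, affBd_affCone, ih 0]
    simp

/-- The map of affine chains induced by an affine map. -/
def affPush {n m : ℕ} (w : Fin (n + 1) → Splx m) (k : ℕ) : AffC k n →ₗ[ℚ] AffC k m :=
  Finsupp.lmapDomain ℚ ℚ fun v i => affMap w (v i)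

theorem affPush_single {n m k : ℕ} (w : Fin (n + 1) → Splx m) (v : Fin (k + 1) → Splx n) (a : ℚ) :
    affPush w k (Finsupp.single v a) = Finsupp.single (fun i => affMap w (v i)) a := by
  simp [affPush]

theorem affPush_affBd {n m k : ℕ} (w : Fin (n + 1) → Splx m) (c : AffC (k + 1) n) :
    affPush w k (affBd k n c) = affBd k m (affPush w (k + 1) c) := by
  suffices h : affPush w k ∘ₗ affBd k n = affBd k m ∘ₗ affPush w (k + 1) from
    LinearMap.congr_fun h c
  refine Finsupp.lhom_ext' fun v => LinearMap.ext_ring ?_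
  simp only [LinearMap.comp_apply, Finsupp.lsingle_apply, affPush_single, affBd_single, map_sum]
  rfl

theorem affPush_affCone {n m k : ℕ} (w : Fin (n + 1) → Splx m) (b : Splx n) (c : AffC k n) :
    affPush w (k + 1) (affCone b k c) = affCone (affMap w b) k (affPush w k c) := by
  suffices h : affPush w (k + 1) ∘ₗ affCone b k = affCone (affMap w b) k ∘ₗ affPush w k from
    LinearMap.congr_fun h c
  refine Finsupp.lhom_ext' fun v => LinearMap.ext_ring ?_
  simp only [LinearMap.comp_apply, Finsupp.lsingle_apply, affPush_single, affCone_single]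
  congr 1
  funext j
  refine Fin.cases ?_ (fun j => ?_) j <;> simp

/-- Barycentric subdivision of affine chains. -/
def affSd (m : ℕ) : (n : ℕ) → AffC n m →ₗ[ℚ] AffC n m
  | 0 => LinearMap.id
  | n + 1 => Finsupp.linearCombination ℚ fun v =>
      affCone (bary v) n (affSd m n (affBd n m (Finsupp.single v 1)))

/-- The chain homotopy from barycentric subdivision to the identity. -/
def affT (m : ℕ) : (n : ℕ) → AffC n m →ₗ[ℚ] AffC (n + 1) m
  | 0 => 0
  | n + 1 => Finsupp.linearCombination ℚ fun v =>
      affCone (bary v) (n + 1)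
        (Finsupp.single v 1 - affT m n (affBd n m (Finsupp.single v 1)))

theorem affSd_single {n m : ℕ} (v : Fin (n + 2) → Splx m) :
    affSd m (n + 1) (Finsupp.single v 1) =
      affCone (bary v) n (affSd m n (affBd n m (Finsupp.single v 1))) := by
  simp [affSd]

theorem affT_single {n m : ℕ} (v : Fin (n + 2) → Splx m) :
    affT m (n + 1) (Finsupp.single v 1) = affCone (bary v) (n + 1)
        (Finsupp.single v 1 - affT m n (affBd n m (Finsupp.single v 1))) := by
  simp [affT]

theorem affBd_affSd {n m : ℕ} (c : AffC (n + 1) m) :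
    affBd n m (affSd m (n + 1) c) = affSd m n (affBd n m c) := by
  suffices h : affBd n m ∘ₗ affSd m (n + 1) = affSd m n ∘ₗ affBd n m from LinearMap.congr_fun h c
  induction n with
  | zero =>
    refine Finsupp.lhom_ext' fun v => LinearMap.ext_ring ?_
    simp only [LinearMap.comp_apply, Finsupp.lsingle_apply, affSd_single, affBd_affCone_zero]
    simp [affSd, affAug_affBd]
  | succ n ih =>
    have ih' := fun c => LinearMap.congr_fun (ih 0) c
    refine Finsupp.lhom_ext' fun v => LinearMap.ext_ring ?_
    simp only [LinearMap.comp_apply, Finsupp.lsingle_apply, affSd_single, affBd_affCone] at ih' ⊢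
    rw [ih', affBd_affBd]
    simp

theorem affBd_affT_zero {m : ℕ} (c : AffC 0 m) : affBd 0 m (affT m 0 c) = c - affSd m 0 c := by
  simp [affT, affSd]

theorem affBd_affT {n m : ℕ} (c : AffC (n + 1) m) :
    affBd (n + 1) m (affT m (n + 1) c) = c - affSd m (n + 1) c - affT m n (affBd n m c) := by
  suffices h : affBd (n + 1) m ∘ₗ affT m (n + 1) =
    LinearMap.id - affSd m (n + 1) - affT m n ∘ₗ affBd n m from LinearMap.congr_fun h c
  -- The cone formula reduces the identity on a tuple to the homotopy identity for its boundary,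
  -- where the term containing ∂∂ drops out.
  have key : ∀ (k : ℕ) (v : Fin (k + 2) → Splx m), affBd k m (affT m k
      (affBd k m (Finsupp.single v 1))) = affBd k m (Finsupp.single v 1) -
        affSd m k (affBd k m (Finsupp.single v 1)) →
      (affBd (k + 1) m ∘ₗ affT m (k + 1)) (Finsupp.single v 1) =
      (LinearMap.id - affSd m (k + 1) - affT m k ∘ₗ affBd k m :
        AffC (k + 1) m →ₗ[ℚ] AffC (k + 1) m) (Finsupp.single v 1) := by
    intro k v hk
    simp only [LinearMap.comp_apply, affT_single, affBd_affCone, LinearMap.sub_apply,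
      LinearMap.id_apply, affSd_single, map_sub]
    rw [hk]
    simp only [map_sub]
    abel
  induction n with
  | zero =>
    refine Finsupp.lhom_ext' fun v => LinearMap.ext_ring (key 0 v (affBd_affT_zero _))
  | succ n ih =>
    refine Finsupp.lhom_ext' fun v => LinearMap.ext_ring (key (n + 1) v ?_)
    have := LinearMap.congr_fun (ih 0) (affBd (n + 1) m (Finsupp.single v 1))
    simp only [LinearMap.comp_apply, LinearMap.sub_apply, LinearMap.id_apply, affBd_affBd,
      map_zero, sub_zero] at this
    exact this

/-- The only choice made in the construction is the barycenter, and affine maps preserve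
barycenters. This naturality lets subdivision pass to singular chains. -/
theorem affPush_affSd {n m k : ℕ} (w : Fin (n + 1) → Splx m) (c : AffC k n) :
    affPush w k (affSd n k c) = affSd m k (affPush w k c) := by
  suffices h : affPush w k ∘ₗ affSd n k = affSd m k ∘ₗ affPush w k from LinearMap.congr_fun h c
  induction k with
  | zero => rfl
  | succ k ih =>
    have ih' := fun c => LinearMap.congr_fun (ih 0) c
    simp only [LinearMap.comp_apply] at ih'
    refine Finsupp.lhom_ext' fun v => LinearMap.ext_ring ?_
    simp only [LinearMap.comp_apply, Finsupp.lsingle_apply, affSd_single, affPush_affCone, ih',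
      affPush_affBd, affMap_bary, affPush_single]

theorem affPush_affT {n m k : ℕ} (w : Fin (n + 1) → Splx m) (c : AffC k n) :
    affPush w (k + 1) (affT n k c) = affT m k (affPush w k c) := by
  suffices h : affPush w (k + 1) ∘ₗ affT n k = affT m k ∘ₗ affPush w k from
    LinearMap.congr_fun h c
  induction k with
  | zero => simp [affT]
  | succ k ih =>
    have ih' := fun c => LinearMap.congr_fun (ih 0) c
    simp only [LinearMap.comp_apply] at ih'
    refine Finsupp.lhom_ext' fun v => LinearMap.ext_ring ?_
    simp only [LinearMap.comp_apply, Finsupp.lsingle_apply, affT_single, affPush_affCone, ih',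
      affPush_affBd, affMap_bary, affPush_single, map_sub]

/-- The tuples that are as small and as close to a given tuple as those of its subdivision. -/
def sdTuples {n m : ℕ} (v : Fin (n + 1) → Splx m) (k : ℕ) : Set (Fin (k + 1) → Splx m) :=
  {w | (∀ b r, (∀ i, dist b (v i) ≤ r) → ∀ j, dist b (w j) ≤ r) ∧
    ∀ ε, (∀ i j, dist (v i) (v j) ≤ ε) → ∀ i j, dist (w i) (w j) ≤ k / (k + 1) * ε}

/-- The first condition in `sdTuples` is what carries the induction: it transfers the bound on the
distances from the barycenter to the vertices of `v` to the new vertices inside each face. -/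
theorem affSd_single_mem {n m : ℕ} (v : Fin (n + 1) → Splx m) :
    affSd m n (Finsupp.single v 1) ∈ Finsupp.supported ℚ ℚ (sdTuples v n) := by
  induction n with
  | zero =>
    refine Finsupp.single_mem_supported _ _ ⟨fun b r h j => ?_, fun ε h i j => ?_⟩
    · exact h j
    · rw [Fin.fin_one_eq_zero i, Fin.fin_one_eq_zero j]; simp
  | succ n ih =>
    rw [affSd_single, affBd_single, map_sum, map_sum]
    refine Submodule.sum_mem _ fun i _ => ?_
    rw [← Finsupp.smul_single_one, map_smul, map_smul]
    refine Submodule.smul_mem _ _ ?_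
    have h := ih (v ∘ i.succAbove)
    have : (affCone (bary v) n) '' (Finsupp.supported ℚ ℚ (sdTuples (v ∘ i.succAbove) n)) ⊆
        Finsupp.supported ℚ ℚ (sdTuples v (n + 1)) := by
      rintro _ ⟨c, hc, rfl⟩
      have := Finsupp.lmapDomain_supported ℚ ℚ (consPt (bary v)) (sdTuples (v ∘ i.succAbove) n)
      have h2 : affCone (bary v) n c ∈ Finsupp.supported ℚ ℚ
          (consPt (bary v) '' (sdTuples (v ∘ i.succAbove) n)) := by
        rw [← this]; exact ⟨c, hc, rfl⟩
      refine Finsupp.supported_mono ?_ h2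
      rintro _ ⟨w, ⟨hw₁, hw₂⟩, rfl⟩
      refine ⟨fun b r h j => ?_, fun ε h j k => ?_⟩
      · refine Fin.cases ?_ (fun j => ?_) j
        · exact dist_affMap_le _ _ _ _ h
        · exact hw₁ b r (fun i' => h _) j
      · have hε : 0 ≤ ε := dist_nonneg.trans (h 0 0)
        have hb : ∀ l, dist (bary v) (w l) ≤ (n + 1 : ℕ) / ((n + 1 : ℕ) + 1) * ε :=
          hw₁ _ _ fun i' => dist_bary_le v ε h _
        refine Fin.cases ?_ (fun j => ?_) j <;> refine Fin.cases ?_ (fun k => ?_) k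
        · simp; positivity
        · exact hb k
        · rw [dist_comm]; exact hb j
        -- Two vertices in the same subdivided face are closer by the factor n / (n + 1), which is
        -- less than the factor (n + 1) / (n + 2) required here.
        · refine (hw₂ ε (fun i' j' => h _ _) j k).trans ?_
          refine mul_le_mul_of_nonneg_right ?_ hε
          rw [div_le_div_iff₀ (by positivity) (by positivity)]
          push_cast
          nlinarith
    exact this ⟨_, h, rfl⟩

theorem affSd_iterate_mem {n m : ℕ} (v : Fin (n + 1) → Splx m) (ε : ℝ)
    (h : ∀ i j, dist (v i) (v j) ≤ ε) (k : ℕ) :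
    (affSd m n)^[k] (Finsupp.single v 1) ∈
      Finsupp.supported ℚ ℚ {w | ∀ i j, dist (w i) (w j) ≤ ((n : ℝ) / (n + 1)) ^ k * ε} := by
  induction k with
  | zero => exact Finsupp.single_mem_supported _ _ (by simpa using h)
  | succ k ih =>
    rw [Function.iterate_succ_apply']
    set c := (affSd m n)^[k] (Finsupp.single v 1)
    rw [← Finsupp.sum_single c, Finsupp.sum, map_sum]
    refine Submodule.sum_mem _ fun w hw => ?_
    rw [← Finsupp.smul_single_one, map_smul]
    refine Submodule.smul_mem _ _ (Finsupp.supported_mono ?_ (affSd_single_mem w))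
    intro u hu i j
    refine (hu.2 _ (ih hw) i j).trans (le_of_eq ?_)
    ring

end

/-! ### Singular chains and subdivision -/

section

open CategoryTheory

/-- Rational singular chains. -/
abbrev SingC (n : ℕ) (X : Type) [TopologicalSpace X] : Type := C(Splx n, X) →₀ ℚ

section Chains

variable {X Y : Type} [TopologicalSpace X] [TopologicalSpace Y]

/-- The singular chain obtained from an affine chain in the domain of a singular simplex. -/
def singOf {m : ℕ} (σ : C(Splx m, X)) (n : ℕ) : AffC n m →ₗ[ℚ] SingC n X :=
  Finsupp.lmapDomain ℚ ℚ fun v => σ.comp (affMap v)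

theorem singOf_single {n m : ℕ} (σ : C(Splx m, X)) (v : Fin (n + 1) → Splx m) (a : ℚ) :
    singOf σ n (Finsupp.single v a) = Finsupp.single (σ.comp (affMap v)) a := by
  simp [singOf]

theorem singOf_comp {n m k : ℕ} (σ : C(Splx m, X)) (v : Fin (n + 1) → Splx m) (c : AffC k n) :
    singOf (σ.comp (affMap v)) k c = singOf σ k (affPush v k c) := by
  suffices h : singOf (σ.comp (affMap v)) k = singOf σ k ∘ₗ affPush v k from
    LinearMap.congr_fun h c
  refine Finsupp.lhom_ext' fun w => LinearMap.ext_ring ?_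
  simp only [LinearMap.comp_apply, Finsupp.lsingle_apply, singOf_single, affPush_single,
    ContinuousMap.comp_assoc, affMap_comp]

theorem affPush_vtx {n m : ℕ} (v : Fin (n + 1) → Splx m) :
    affPush v n (Finsupp.single (vtx n) 1) = Finsupp.single v 1 := by
  rw [affPush_single]
  congr 1
  exact funext fun i => affMap_vtx v i

/-- The extension of a natural operator on affine chains to singular chains. -/
def singExt {n k : ℕ} (a : AffC k n) : SingC n X →ₗ[ℚ] SingC k X :=
  Finsupp.linearCombination ℚ fun σ => singOf σ k a

theorem singExt_single {n k : ℕ} (a : AffC k n) (σ : C(Splx n, X)) :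
    singExt a (Finsupp.single σ 1) = singOf σ k a := by
  simp [singExt]

/-- By naturality an operator on affine chains is determined by its value on the identity simplex
`vtx n`. So its extension to singular chains agrees with it on every chain pushed forward from a
simplex. -/
theorem singExt_singOf {n k m : ℕ} (F : ∀ m, AffC n m →ₗ[ℚ] AffC k m)
    (hF : ∀ (m m' : ℕ) (w : Fin (m + 1) → Splx m') c, affPush w k (F m c) = F m' (affPush w n c))
    (σ : C(Splx m, X)) (c : AffC n m) :
    singExt (F n (Finsupp.single (vtx n) 1)) (singOf σ n c) = singOf σ k (F m c) := by
  suffices h : singExt (F n (Finsupp.single (vtx n) 1)) ∘ₗ singOf σ n = singOf σ k ∘ₗ F m from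
    LinearMap.congr_fun h c
  refine Finsupp.lhom_ext' fun w => LinearMap.ext_ring ?_
  simp only [LinearMap.comp_apply, Finsupp.lsingle_apply, singOf_single, singExt_single,
    singOf_comp, hF, affPush_vtx]

/-- The singular boundary operator. -/
def singBd (n : ℕ) : SingC (n + 1) X →ₗ[ℚ] SingC n X :=
  singExt (affBd n (n + 1) (Finsupp.single (vtx (n + 1)) 1))

/-- Barycentric subdivision of singular chains. -/
def singSd (n : ℕ) : SingC n X →ₗ[ℚ] SingC n X :=
  singExt (affSd n n (Finsupp.single (vtx n) 1))

/-- The chain homotopy from barycentric subdivision to the identity. -/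
def singT (n : ℕ) : SingC n X →ₗ[ℚ] SingC (n + 1) X :=
  singExt (affT n n (Finsupp.single (vtx n) 1))

theorem singBd_singOf {n m : ℕ} (σ : C(Splx m, X)) (c : AffC (n + 1) m) :
    singBd n (singOf σ (n + 1) c) = singOf σ n (affBd n m c) :=
  singExt_singOf (fun m => affBd n m) (fun _ _ w c => affPush_affBd w c) σ c

theorem singSd_singOf {n m : ℕ} (σ : C(Splx m, X)) (c : AffC n m) :
    singSd n (singOf σ n c) = singOf σ n (affSd m n c) :=
  singExt_singOf (fun m => affSd m n) (fun _ _ w c => affPush_affSd w c) σ c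

theorem singT_singOf {n m : ℕ} (σ : C(Splx m, X)) (c : AffC n m) :
    singT n (singOf σ n c) = singOf σ (n + 1) (affT m n c) :=
  singExt_singOf (fun m => affT m n) (fun _ _ w c => affPush_affT w c) σ c

theorem single_eq_singOf {n : ℕ} (σ : C(Splx n, X)) :
    (Finsupp.single σ 1 : SingC n X) = singOf σ n (Finsupp.single (vtx n) 1) := by
  rw [singOf_single, affMap_vtx_eq_id, ContinuousMap.comp_id]

/-- A singular simplex is the image of the identity simplex. Testing on all pushed-forward affine
chains makes each identity between singular operators an immediate consequence of the affine one. -/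
theorem SingC.hom_ext {n : ℕ} {M : Type*} [AddCommGroup M] [Module ℚ M]
    {f g : SingC n X →ₗ[ℚ] M} (h : ∀ (σ : C(Splx n, X)) (c : AffC n n),
      f (singOf σ n c) = g (singOf σ n c)) : f = g := by
  refine Finsupp.lhom_ext' fun σ => LinearMap.ext_ring ?_
  simp only [LinearMap.comp_apply, Finsupp.lsingle_apply, single_eq_singOf, h]

theorem singBd_singBd {n : ℕ} (c : SingC (n + 2) X) : singBd n (singBd (n + 1) c) = 0 := by
  suffices h : singBd n ∘ₗ singBd (n + 1) = (0 : SingC (n + 2) X →ₗ[ℚ] SingC n X) from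
    LinearMap.congr_fun h c
  refine SingC.hom_ext fun σ c => ?_
  simp [singBd_singOf, affBd_affBd]

theorem singBd_singSd {n : ℕ} (c : SingC (n + 1) X) :
    singBd n (singSd (n + 1) c) = singSd n (singBd n c) := by
  suffices h : singBd n ∘ₗ singSd (n + 1) = singSd (X := X) n ∘ₗ singBd n from
    LinearMap.congr_fun h c
  refine SingC.hom_ext fun σ c => ?_
  simp only [LinearMap.comp_apply, singBd_singOf, singSd_singOf, affBd_affSd]

theorem singBd_singT_zero (c : SingC 0 X) : singBd 0 (singT 0 c) = c - singSd 0 c := by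
  suffices h : singBd 0 ∘ₗ singT 0 = LinearMap.id - singSd (X := X) 0 from
    LinearMap.congr_fun h c
  refine SingC.hom_ext fun σ c => ?_
  simp only [LinearMap.comp_apply, singBd_singOf, singSd_singOf, singT_singOf, affBd_affT_zero,
    LinearMap.sub_apply, LinearMap.id_apply, map_sub]

theorem singBd_singT {n : ℕ} (c : SingC (n + 1) X) :
    singBd (n + 1) (singT (n + 1) c) = c - singSd (n + 1) c - singT n (singBd n c) := by
  suffices h : singBd (n + 1) ∘ₗ singT (n + 1) =
      LinearMap.id - singSd (X := X) (n + 1) - singT n ∘ₗ singBd n from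
    LinearMap.congr_fun h c
  refine SingC.hom_ext fun σ c => ?_
  simp only [LinearMap.comp_apply, singBd_singOf, singSd_singOf, singT_singOf, affBd_affT,
    LinearMap.sub_apply, LinearMap.id_apply, map_sub]

/-- Singular chains with simplices in a subset. -/
def chainsIn (A : Set X) (n : ℕ) : Submodule ℚ (SingC n X) :=
  Finsupp.supported ℚ ℚ {σ | range σ ⊆ A}

theorem singOf_mem_chainsIn {A : Set X} {m n : ℕ} {σ : C(Splx m, X)} (h : range σ ⊆ A)
    (c : AffC n m) : singOf σ n c ∈ chainsIn A n := by
  have h2 : singOf σ n c ∈ Finsupp.supported ℚ ℚ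
      ((fun v : Fin (n + 1) → Splx m => σ.comp (affMap v)) '' univ) := by
    rw [← Finsupp.lmapDomain_supported]
    exact ⟨c, by simp [Finsupp.supported_univ], rfl⟩
  refine Finsupp.supported_mono ?_ h2
  rintro _ ⟨v, -, rfl⟩ _ ⟨x, rfl⟩
  exact h ⟨_, rfl⟩

theorem singExt_mem_chainsIn {A : Set X} {n k : ℕ} (a : AffC k n) {c : SingC n X}
    (hc : c ∈ chainsIn A n) : singExt a c ∈ chainsIn A k := by
  rw [← Finsupp.sum_single c, Finsupp.sum, map_sum]
  refine Submodule.sum_mem _ fun σ hσ => ?_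
  rw [← Finsupp.smul_single_one, map_smul, singExt_single]
  exact Submodule.smul_mem _ _ (singOf_mem_chainsIn (hc hσ) a)

theorem singExt_mem_sup {A B : Set X} {n k : ℕ} (a : AffC k n) {c : SingC n X}
    (hc : c ∈ chainsIn A n ⊔ chainsIn B n) : singExt a c ∈ chainsIn A k ⊔ chainsIn B k := by
  obtain ⟨x, hx, y, hy, rfl⟩ := Submodule.mem_sup.1 hc
  rw [map_add]
  exact Submodule.add_mem_sup (singExt_mem_chainsIn a hx) (singExt_mem_chainsIn a hy)

theorem chainsIn_inf (A B : Set X) (n : ℕ) :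
    chainsIn A n ⊓ chainsIn B n = chainsIn (A ∩ B) n := by
  rw [chainsIn, chainsIn, chainsIn, ← Finsupp.supported_inter]
  congr 1
  ext σ
  simp [subset_inter_iff]

theorem singSd_iterate_singOf {n m : ℕ} (σ : C(Splx m, X)) (c : AffC n m) (k : ℕ) :
    (singSd n)^[k] (singOf σ n c) = singOf σ n ((affSd m n)^[k] c) := by
  induction k with
  | zero => rfl
  | succ k ih => rw [Function.iterate_succ_apply', ih, singSd_singOf, Function.iterate_succ_apply']

theorem singSd_iterate_mem_sup {A B : Set X} {n : ℕ} {c : SingC n X}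
    (hc : c ∈ chainsIn A n ⊔ chainsIn B n) (k : ℕ) :
    (singSd n)^[k] c ∈ chainsIn A n ⊔ chainsIn B n := by
  induction k with
  | zero => exact hc
  | succ k ih => rw [Function.iterate_succ_apply']; exact singExt_mem_sup _ ih

/-- Take a Lebesgue number of the cover of the simplex by the preimages of A and B, and subdivide
until every affine piece has smaller diameter. -/
theorem exists_iterate_singSd_single_mem {A B : Set X} (hA : IsOpen A) (hB : IsOpen B)
    (hAB : A ∪ B = univ) {n : ℕ} (σ : C(Splx n, X)) :
    ∃ k, (singSd n)^[k] (Finsupp.single σ 1) ∈ chainsIn A n ⊔ chainsIn B n := by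
  obtain ⟨δ, hδ, hL⟩ := lebesgue_number_lemma_of_metric (s := (univ : Set (Splx n)))
    (c := fun b : Bool => σ ⁻¹' (if b then A else B)) isCompact_univ
    (fun b => by cases b <;> simp <;> [exact hB.preimage σ.continuous; exact hA.preimage σ.continuous])
    (fun x _ => by
      have : σ x ∈ A ∪ B := hAB ▸ mem_univ _
      rcases this with h | h
      · exact mem_iUnion.2 ⟨true, h⟩
      · exact mem_iUnion.2 ⟨false, h⟩)
  have hr : (n : ℝ) / (n + 1) < 1 := by rw [div_lt_one (by positivity)]; linarith
  obtain ⟨ε, hε⟩ : ∃ ε : ℝ, ∀ i j, dist (vtx n i) (vtx n j) ≤ ε := by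
    refine ⟨Metric.diam (univ : Set (Splx n)), fun i j => ?_⟩
    exact Metric.dist_le_diam_of_mem isCompact_univ.isBounded (mem_univ _) (mem_univ _)
  obtain ⟨k, hk⟩ : ∃ k : ℕ, ((n : ℝ) / (n + 1)) ^ k * ε < δ := by
    have := (tendsto_pow_atTop_nhds_zero_of_lt_one (by positivity) hr).mul_const ε
    rw [zero_mul] at this
    exact (this.eventually_lt_const hδ).exists
  refine ⟨k, ?_⟩
  rw [single_eq_singOf, singSd_iterate_singOf]
  have hmem := affSd_iterate_mem (vtx n) ε hε k
  set c := (affSd n n)^[k] (Finsupp.single (vtx n) 1)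
  rw [← Finsupp.sum_single c, Finsupp.sum, map_sum]
  refine Submodule.sum_mem _ fun w hw => ?_
  rw [← Finsupp.smul_single_one, map_smul, singOf_single]
  refine Submodule.smul_mem _ _ ?_
  have hw' := hmem hw
  obtain ⟨b, hb⟩ := hL (w 0) (mem_univ _)
  have : range (σ.comp (affMap w)) ⊆ if b then A else B := by
    rintro _ ⟨x, rfl⟩
    refine hb ?_
    rw [Metric.mem_ball, dist_comm]
    exact (dist_affMap_le w x (w 0) _ fun i => hw' 0 i).trans_lt hk
  cases b
  · exact Submodule.mem_sup_right (Finsupp.single_mem_supported _ _ (by simpa using this))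
  · exact Submodule.mem_sup_left (Finsupp.single_mem_supported _ _ (by simpa using this))

/-- A chain involves finitely many simplices, and further subdivision keeps small chains small, so
exponents that work for two summands may be added. -/
theorem exists_iterate_singSd_mem {A B : Set X} (hA : IsOpen A) (hB : IsOpen B)
    (hAB : A ∪ B = univ) {n : ℕ} (c : SingC n X) :
    ∃ k, (singSd n)^[k] c ∈ chainsIn A n ⊔ chainsIn B n := by
  induction c using Finsupp.induction_linear with
  | zero => exact ⟨0, Submodule.zero_mem _⟩
  | add c d hc hd =>
    obtain ⟨k, hk⟩ := hc
    obtain ⟨l, hl⟩ := hd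
    refine ⟨k + l, ?_⟩
    rw [iterate_map_add]
    refine Submodule.add_mem _ ?_ ?_
    · rw [add_comm k l, Function.iterate_add_apply]
      exact singSd_iterate_mem_sup hk l
    · rw [Function.iterate_add_apply]
      exact singSd_iterate_mem_sup hl k
  | single σ a =>
    obtain ⟨k, hk⟩ := exists_iterate_singSd_single_mem hA hB hAB σ
    refine ⟨k, ?_⟩
    have : (singSd n)^[k] (Finsupp.single σ a) = a • (singSd n)^[k] (Finsupp.single σ 1) := by
      rw [← Finsupp.smul_single_one, ← Module.End.pow_apply, ← Module.End.pow_apply, map_smul]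
    rw [this]
    exact Submodule.smul_mem _ _ hk

theorem exists_bd_add_mem_zero {A B : Set X} (hA : IsOpen A) (hB : IsOpen B)
    (hAB : A ∪ B = univ) (c : SingC 0 X) :
    ∃ d : SingC 1 X, c - singBd 0 d ∈ chainsIn A 0 ⊔ chainsIn B 0 := by
  obtain ⟨k, hk⟩ := exists_iterate_singSd_mem hA hB hAB c
  have : ∀ k, ∃ d : SingC 1 X, c - singBd 0 d = (singSd 0)^[k] c := by
    intro k
    induction k with
    | zero => exact ⟨0, by simp⟩
    | succ k ih =>
      obtain ⟨d, hd⟩ := ih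
      refine ⟨d + singT 0 ((singSd 0)^[k] c), ?_⟩
      rw [map_add, singBd_singT_zero, Function.iterate_succ_apply', ← hd]
      abel
  obtain ⟨d, hd⟩ := this k
  exact ⟨d, hd ▸ hk⟩

/-- By the homotopy formula, a chain differs from its subdivision by a boundary and by T applied to
its boundary. That boundary is small and T preserves smallness, so subdividing repeatedly makes the
chain small modulo boundaries. In other words, the complex of all chains modulo small chains is
acyclic. -/
theorem exists_bd_add_mem {A B : Set X} (hA : IsOpen A) (hB : IsOpen B)
    (hAB : A ∪ B = univ) {n : ℕ} (c : SingC (n + 1) X)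
    (hc : singBd n c ∈ chainsIn A n ⊔ chainsIn B n) :
    ∃ d : SingC (n + 2) X, c - singBd (n + 1) d ∈ chainsIn A (n + 1) ⊔ chainsIn B (n + 1) := by
  obtain ⟨k, hk⟩ := exists_iterate_singSd_mem hA hB hAB c
  have : ∀ k, singBd n ((singSd (n + 1))^[k] c) ∈ chainsIn A n ⊔ chainsIn B n ∧
      ∃ d : SingC (n + 2) X, c - singBd (n + 1) d - (singSd (n + 1))^[k] c ∈
        chainsIn A (n + 1) ⊔ chainsIn B (n + 1) := by
    intro k
    induction k with
    | zero => exact ⟨hc, 0, by simp⟩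
    | succ k ih =>
      obtain ⟨hb, d, hd⟩ := ih
      refine ⟨?_, d + singT (n + 1) ((singSd (n + 1))^[k] c), ?_⟩
      · rw [Function.iterate_succ_apply', singBd_singSd]
        exact singExt_mem_sup _ hb
      · rw [map_add, singBd_singT, Function.iterate_succ_apply']
        have := Submodule.add_mem _ hd
          (singExt_mem_sup (affT n n (Finsupp.single (vtx n) 1)) hb)
        convert this using 1
        simp only [singT]
        abel
  obtain ⟨-, d, hd⟩ := this k
  refine ⟨d, ?_⟩
  have := Submodule.add_mem _ hd hk
  simpa using this

end Chains

end

/-! ### Comparison with singular homology -/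

section

open CategoryTheory

/-! ### Complexes given by explicit modules and differentials -/

section Complexes

variable {M M' M'' : ℕ → Type} [∀ n, AddCommGroup (M n)] [∀ n, Module ℚ (M n)]
  [∀ n, AddCommGroup (M' n)] [∀ n, Module ℚ (M' n)]
  [∀ n, AddCommGroup (M'' n)] [∀ n, Module ℚ (M'' n)]

/-- The chain complex with given modules and differentials. -/
def linCx (d : ∀ n, M (n + 1) →ₗ[ℚ] M n) (h : ∀ n x, d n (d (n + 1) x) = 0) :
    ChainComplex (ModuleCat.{0} ℚ) ℕ :=
  ChainComplex.of (fun n => ModuleCat.of ℚ (M n)) (fun n => ModuleCat.ofHom (d n)) (fun n => by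
    ext x
    exact h n x)

theorem linCx_d (d : ∀ n, M (n + 1) →ₗ[ℚ] M n) (h : ∀ n x, d n (d (n + 1) x) = 0) (n : ℕ) :
    (linCx d h).d (n + 1) n = ModuleCat.ofHom (d n) :=
  ChainComplex.of_d (fun n => ModuleCat.of ℚ (M n)) (fun n => ModuleCat.ofHom (d n)) n

variable {d : ∀ n, M (n + 1) →ₗ[ℚ] M n} {h : ∀ n x, d n (d (n + 1) x) = 0}
  {d' : ∀ n, M' (n + 1) →ₗ[ℚ] M' n} {h' : ∀ n x, d' n (d' (n + 1) x) = 0}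
  {d'' : ∀ n, M'' (n + 1) →ₗ[ℚ] M'' n} {h'' : ∀ n x, d'' n (d'' (n + 1) x) = 0}

/-- The chain map with given components. -/
def linCxMap (f : ∀ n, M n →ₗ[ℚ] M' n) (hf : ∀ n x, d' n (f (n + 1) x) = f n (d n x)) :
    linCx d h ⟶ linCx d' h' :=
  ChainComplex.ofHom (X := linCx d h) (Y := linCx d' h') (fun n => ModuleCat.ofHom (f n))
    (fun n => by
      rw [linCx_d, linCx_d]
      ext x
      exact hf n x)

theorem exists_shortExact (f : ∀ n, M n →ₗ[ℚ] M' n)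
    (hf : ∀ n x, d' n (f (n + 1) x) = f n (d n x)) (g : ∀ n, M' n →ₗ[ℚ] M'' n)
    (hg : ∀ n x, d'' n (g (n + 1) x) = g n (d' n x)) (inj : ∀ n, Function.Injective (f n))
    (surj : ∀ n, Function.Surjective (g n)) (ex : ∀ n, Function.Exact (f n) (g n)) :
    ∃ (p : linCx d h ⟶ linCx d' h') (q : linCx d' h' ⟶ linCx d'' h'') (w : p ≫ q = 0),
      (ShortComplex.mk p q w).ShortExact := by
  refine ⟨linCxMap f hf, linCxMap g hg, ?_, ?_⟩
  · ext n x
    exact (ex n).apply_apply_eq_zero x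
  · refine HomologicalComplex.shortExact_of_degreewise_shortExact _ fun n => ?_
    exact ModuleCat.shortComplex_shortExact _ (ex n) (inj n) (surj n)

theorem linCx_homology_subsingleton (h0 : ∀ x : M 0, ∃ y, d 0 y = x)
    (h1 : ∀ n (x : M (n + 1)), d n x = 0 → ∃ y, d (n + 1) y = x) (n : ℕ) :
    Subsingleton ((linCx d h).homology n) := by
  rw [← ModuleCat.isZero_iff_subsingleton, ← HomologicalComplex.exactAt_iff_isZero_homology]
  rcases n with _ | n
  · rw [HomologicalComplex.exactAt_iff' _ 1 0 0 (by simp) (by simp), ShortComplex.moduleCat_exact_iff]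
    intro x _
    obtain ⟨y, hy⟩ := h0 x
    refine ⟨y, ?_⟩
    have := linCx_d d h 0
    simp only [HomologicalComplex.shortComplexFunctor'_obj_f]
    rw [this]
    exact hy
  · rw [HomologicalComplex.exactAt_iff' _ (n + 2) (n + 1) n (by simp) (by simp),
      ShortComplex.moduleCat_exact_iff]
    intro x hx
    simp only [HomologicalComplex.shortComplexFunctor'_obj_g,
      HomologicalComplex.shortComplexFunctor'_obj_f] at hx ⊢
    rw [linCx_d] at hx
    obtain ⟨y, hy⟩ := h1 n x hx
    refine ⟨y, ?_⟩
    have := linCx_d d h (n + 1)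
    rw [this]
    exact hy

theorem HasEulerChar.of_linearEquiv {a : ℤ} (e : ∀ n, M n ≃ₗ[ℚ] M' n)
    (he : ∀ n x, d' n (e (n + 1) x) = e n (d n x)) (H : HasEulerChar (linCx d h) a) :
    HasEulerChar (linCx d' h') a := by
  refine H.of_iso (HomologicalComplex.Hom.isoOfComponents
    (fun n => (LinearEquiv.toModuleIso (e n) : ModuleCat.of ℚ (M n) ≅ ModuleCat.of ℚ (M' n))) ?_)
  rintro _ n rfl
  rw [linCx_d, linCx_d]
  ext x
  exact he n x

/-- The product of two complexes. -/
def linCxProd (d : ∀ n, M (n + 1) →ₗ[ℚ] M n) (h : ∀ n x, d n (d (n + 1) x) = 0)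
    (d' : ∀ n, M' (n + 1) →ₗ[ℚ] M' n) (h' : ∀ n x, d' n (d' (n + 1) x) = 0) :
    ChainComplex (ModuleCat.{0} ℚ) ℕ :=
  linCx (M := fun n => M n × M' n) (fun n => (d n).prodMap (d' n)) (fun n x => by simp [h, h'])

theorem exists_shortExact_prod :
    ∃ (p : linCx d h ⟶ linCxProd d h d' h') (q : linCxProd d h d' h' ⟶ linCx d' h')
      (w : p ≫ q = 0), (ShortComplex.mk p q w).ShortExact :=
  exists_shortExact (fun n => LinearMap.inl ℚ (M n) (M' n)) (fun n x => by simp)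
    (fun n => LinearMap.snd ℚ (M n) (M' n)) (fun n x => by simp)
    (fun n => LinearMap.inl_injective) (fun n => LinearMap.snd_surjective)
    (fun n => Function.Exact.inl_snd)

theorem HasEulerChar.prod {a b : ℤ} (H : HasEulerChar (linCx d h) a)
    (H' : HasEulerChar (linCx d' h') b) : HasEulerChar (linCxProd d h d' h') (a + b) := by
  obtain ⟨p, q, w, hS⟩ := exists_shortExact_prod (h := h) (h' := h')
  exact HasEulerChar.middle hS H H'

theorem HasEulerChar.of_prod {a b : ℤ} (H : HasEulerChar (linCxProd d h d' h') a)
    (H' : HasEulerChar (linCx d' h') b) : HasEulerChar (linCx d h) (a - b) := by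
  obtain ⟨p, q, w, hS⟩ := exists_shortExact_prod (h := h) (h' := h')
  exact HasEulerChar.left hS H H'

/-- The subcomplex with given submodules. -/
def linSubCx (d : ∀ n, M (n + 1) →ₗ[ℚ] M n) (h : ∀ n x, d n (d (n + 1) x) = 0)
    (N : ∀ n, Submodule ℚ (M n)) (hN : ∀ n, ∀ x ∈ N (n + 1), d n x ∈ N n) :
    ChainComplex (ModuleCat.{0} ℚ) ℕ :=
  linCx (M := fun n => N n) (fun n => (d n).restrict (hN n)) (fun n x => Subtype.ext (h n x))

/-- The two hypotheses say that the quotient complex is acyclic. It therefore contributes 0 in the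
long exact sequence, in either direction. -/
theorem HasEulerChar.of_subCx {a : ℤ} {N : ∀ n, Submodule ℚ (M n)}
    {hN : ∀ n, ∀ x ∈ N (n + 1), d n x ∈ N n}
    (h0 : ∀ x : M 0, ∃ y, x - d 0 y ∈ N 0)
    (h1 : ∀ n (x : M (n + 1)), d n x ∈ N n → ∃ y, x - d (n + 1) y ∈ N (n + 1)) :
    HasEulerChar (linSubCx d h N hN) a ↔ HasEulerChar (linCx d h) a := by
  have hq : ∀ n x, (N (n + 1)).mapQ (N n) (d n) (hN n)
      ((N (n + 2)).mapQ (N (n + 1)) (d (n + 1)) (hN (n + 1)) x) = 0 := fun n x => by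
    obtain ⟨x, rfl⟩ := Submodule.mkQ_surjective _ x
    simp [h]
  obtain ⟨p, q, w, hS⟩ := exists_shortExact (h' := h)
    (h := fun n x => Subtype.ext (h n x.1)) (M := fun n => N n) (M'' := fun n => M n ⧸ N n)
    (d := fun n => (d n).restrict (hN n)) (d' := d)
    (d'' := fun n => (N (n + 1)).mapQ (N n) (d n) (hN n))
    (h'' := hq)
    (fun n => (N n).subtype) (fun n x => rfl) (fun n => (N n).mkQ) (fun n x => rfl)
    (fun n => Subtype.val_injective) (fun n => Submodule.mkQ_surjective _)
    (fun n => LinearMap.exact_subtype_mkQ _)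
  have hz := hasEulerChar_zero_of_subsingleton (K := (ShortComplex.mk p q w).X₃) (by
    refine linCx_homology_subsingleton (h := hq) ?_ ?_
    · intro x
      obtain ⟨x, rfl⟩ := Submodule.mkQ_surjective _ x
      obtain ⟨y, hy⟩ := h0 x
      refine ⟨(N 1).mkQ y, ?_⟩
      simp only [Submodule.mkQ_apply, Submodule.mapQ_apply]
      rw [eq_comm, Submodule.Quotient.eq]
      exact hy
    · intro n x hx
      obtain ⟨x, rfl⟩ := Submodule.mkQ_surjective _ x
      simp only [Submodule.mkQ_apply, Submodule.mapQ_apply, Submodule.Quotient.mk_eq_zero] at hx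
      obtain ⟨y, hy⟩ := h1 n x hx
      refine ⟨(N (n + 2)).mkQ y, ?_⟩
      simp only [Submodule.mkQ_apply, Submodule.mapQ_apply]
      rw [eq_comm, Submodule.Quotient.eq]
      exact hy)
  constructor
  · intro H
    simpa using HasEulerChar.middle hS H hz
  · intro H
    rw [← sub_zero a]
    exact HasEulerChar.left hS H hz

/-- This is the algebraic Mayer–Vietoris sequence, with x ↦ (x, −x) followed by (y, z) ↦ y + z.
Geometric input enters only when the sum of the two subcomplexes is compared with the whole complex.
-/
theorem exists_shortExact_sup {N N' : ∀ n, Submodule ℚ (M n)}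
    {hN : ∀ n, ∀ x ∈ N (n + 1), d n x ∈ N n} {hN' : ∀ n, ∀ x ∈ N' (n + 1), d n x ∈ N' n}
    {hi : ∀ n, ∀ x ∈ N (n + 1) ⊓ N' (n + 1), d n x ∈ N n ⊓ N' n}
    {hs : ∀ n, ∀ x ∈ N (n + 1) ⊔ N' (n + 1), d n x ∈ N n ⊔ N' n} :
    ∃ (p : linSubCx d h (fun n => N n ⊓ N' n) hi ⟶
        linCxProd (M := fun n => N n) (M' := fun n => N' n)
        (fun n => (d n).restrict (hN n)) (fun n x => Subtype.ext (h n x))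
        (fun n => (d n).restrict (hN' n)) (fun n x => Subtype.ext (h n x)))
      (q : linCxProd (M := fun n => N n) (M' := fun n => N' n)
        (fun n => (d n).restrict (hN n)) (fun n x => Subtype.ext (h n x))
        (fun n => (d n).restrict (hN' n)) (fun n x => Subtype.ext (h n x)) ⟶
        linSubCx d h (fun n => N n ⊔ N' n) hs) (w : p ≫ q = 0),
      (ShortComplex.mk p q w).ShortExact := by
  refine exists_shortExact (M := fun n => (N n ⊓ N' n : Submodule ℚ (M n)))
    (M' := fun n => N n × N' n) (M'' := fun n => (N n ⊔ N' n : Submodule ℚ (M n)))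
    (fun n => (Submodule.inclusion inf_le_left).prod (-Submodule.inclusion inf_le_right))
    (fun n x => ?_)
    (fun n => (Submodule.inclusion le_sup_left).coprod (Submodule.inclusion le_sup_right))
    (fun n x => ?_) (fun n => ?_) (fun n => ?_) (fun n => ?_)
  · ext <;> simp
  · ext; simp
  · intro x y hxy
    have := congrArg (fun z => (z.1 : M n)) hxy
    exact Subtype.ext this
  · rintro ⟨x, hx⟩
    obtain ⟨y, hy, z, hz, rfl⟩ := Submodule.mem_sup.1 hx
    exact ⟨(⟨y, hy⟩, ⟨z, hz⟩), Subtype.ext rfl⟩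
  · rintro ⟨⟨y, hy⟩, ⟨z, hz⟩⟩
    constructor
    · intro hyz
      have hyz' : y + z = 0 := congrArg Subtype.val hyz
      have e : z = -y := by rw [eq_neg_iff_add_eq_zero, add_comm]; exact hyz'
      refine ⟨⟨y, hy, ?_⟩, ?_⟩
      · have := (N' n).neg_mem hz
        rw [e, neg_neg] at this
        exact this
      · refine Prod.ext rfl (Subtype.ext e.symm)
    · rintro ⟨x, hx⟩
      rw [← hx]
      refine Subtype.ext ?_
      simp

end Complexes

/-! ### Explicit singular chains and the singular chain complex functor -/

section Comparison

open Limits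

/-- A coproduct of copies of the ground field is a module of finitely supported functions. -/
def sigmaIsoFinsupp {S T : Type} (e : S ≃ T) :
    (∐ fun _ : S => ModuleCat.of ℚ ℚ) ≅ ModuleCat.of ℚ (T →₀ ℚ) where
  hom := Sigma.desc fun s => ModuleCat.ofHom (Finsupp.lsingle (e s))
  inv := ModuleCat.ofHom (Finsupp.lsum ℚ fun t =>
    (Sigma.ι (fun _ : S => ModuleCat.of ℚ ℚ) (e.symm t)).hom)
  hom_inv_id := by
    refine Sigma.hom_ext _ _ fun s => ?_
    rw [Sigma.ι_desc_assoc]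
    ext
    simp
  inv_hom_id := by
    ext t : 2
    refine LinearMap.ext_ring ?_
    have := ConcreteCategory.congr_hom (Sigma.ι_desc
      (fun s => ModuleCat.ofHom (Finsupp.lsingle (R := ℚ) (M := ℚ) (e s))) (e.symm t)) (1 : ℚ)
    simp

theorem ι_sigmaIsoFinsupp_hom {S T : Type} (e : S ≃ T) (s : S) :
    Sigma.ι (fun _ : S => ModuleCat.of ℚ ℚ) s ≫ (sigmaIsoFinsupp e).hom =
      ModuleCat.ofHom (Finsupp.lsingle (e s)) := Sigma.ι_desc _ _

variable (X : Type) [TopologicalSpace X]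

/-- The complex of rational singular chains. -/
def singCx : ChainComplex (ModuleCat.{0} ℚ) ℕ :=
  linCx (M := fun n => SingC n X) singBd fun _ c => singBd_singBd c

/-- The simplices of the singular set. -/
abbrev singSimplex (n : ℕ) : Type :=
  (TopCat.toSSet.obj (TopCat.of X)).obj (Opposite.op (SimplexCategory.mk n))

def singSimplexEquiv (n : ℕ) : singSimplex X n ≃ C(Splx n, X) :=
  TopCat.toSSetObjEquiv (TopCat.of X) (Opposite.op (SimplexCategory.mk n))

/-- The face maps of the singular set are induced by `stdSimplex.map`. This matches them with the
affine maps in the explicit boundary operator. -/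
theorem affMap_vtx_comp {n m : ℕ} (f : Fin (n + 1) → Fin (m + 1)) (x : Splx n) :
    affMap (vtx m ∘ f) x = stdSimplex.map f x := by
  apply Subtype.ext
  rw [affMap_coe]
  funext j
  have h := congrFun (stdSimplex.map_coe f x) j
  refine Eq.trans ?_ h.symm
  rw [FunOnFinite.linearMap_apply_apply]
  simp only [Finset.sum_apply, Pi.smul_apply, smul_eq_mul, vtx, stdSimplex.vertex, Function.comp,
    Finset.sum_filter]
  refine Finset.sum_congr rfl fun i _ => ?_
  by_cases hij : f i = j
  · subst hij; simp; rfl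
  · simp [hij, Ne.symm hij]

theorem singSimplexEquiv_δ (n : ℕ) (i : Fin (n + 2)) (s : singSimplex X (n + 1)) :
    singSimplexEquiv X n ((TopCat.toSSet.obj (TopCat.of X)).δ i s) =
      (singSimplexEquiv X (n + 1) s).comp (affMap (vtx (n + 1) ∘ i.succAbove)) := by
  ext x
  rw [ContinuousMap.comp_apply, affMap_vtx_comp]
  rfl

theorem singBd_single (n : ℕ) (σ : C(Splx (n + 1), X)) :
    singBd n (Finsupp.single σ 1) = ∑ i : Fin (n + 2),
      Finsupp.single (σ.comp (affMap (vtx (n + 1) ∘ i.succAbove))) ((-1 : ℚ) ^ (i : ℕ)) := by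
  simp [singBd, singExt_single, affBd_single, singOf_single]

theorem ofHom_singBd (n : ℕ) (σ : C(Splx (n + 1), X)) :
    ModuleCat.ofHom (Finsupp.lsingle (R := ℚ) (M := ℚ) σ) ≫ ModuleCat.ofHom (singBd n) =
      ∑ i : Fin (n + 2), (-1 : ℤ) ^ (i : ℕ) • ModuleCat.ofHom
        (Finsupp.lsingle (R := ℚ) (M := ℚ) (σ.comp (affMap (vtx (n + 1) ∘ i.succAbove)))) := by
  ext : 1
  refine LinearMap.ext_ring ?_
  rw [ModuleCat.hom_sum, LinearMap.sum_apply]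
  refine (singBd_single X n _).trans (Finset.sum_congr rfl fun i _ => ?_)
  rw [ModuleCat.hom_zsmul, LinearMap.smul_apply, ModuleCat.hom_ofHom,
    Finsupp.lsingle_apply, Finsupp.smul_single]
  simp

/-- The comparison of singular chain complexes. -/
def singCxIso : rationalSingularChains X ≅ singCx X := by
  refine HomologicalComplex.Hom.isoOfComponents
    (fun n => (sigmaIsoFinsupp (singSimplexEquiv X n) : _)) ?_
  rintro _ n rfl
  have e : (rationalSingularChains X).d (n + 1) n = _ :=
    AlgebraicTopology.AlternatingFaceMapComplex.obj_d_eq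
      (((SimplicialObject.whiskering Type (ModuleCat ℚ)).obj (sigmaConst.obj (ModuleCat.of ℚ ℚ))).obj
            (TopCat.toSSet.obj (TopCat.of X))) n
  rw [e]
  have e2 : (singCx X).d (n + 1) n = ModuleCat.ofHom (singBd n) := linCx_d _ _ _
  have e3 : ∀ (i : Fin (n + 2)) (s : singSimplex X (n + 1)),
      Sigma.ι (fun _ : singSimplex X (n + 1) => ModuleCat.of ℚ ℚ) s ≫
        (((SimplicialObject.whiskering Type (ModuleCat ℚ)).obj
          (sigmaConst.obj (ModuleCat.of ℚ ℚ))).obj (TopCat.toSSet.obj (TopCat.of X))).δ i =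
      Sigma.ι (fun _ : singSimplex X n => ModuleCat.of ℚ ℚ)
        ((TopCat.toSSet.obj (TopCat.of X)).δ i s) := by
    intro i s
    refine (Sigma.ι_comp_map' _ _ _).trans ?_
    exact Category.id_comp _
  -- Both composites start at a coproduct, so they are compared on the summand of each simplex `s`,
  -- where both become the alternating sum over the faces of `s`.
  refine Sigma.hom_ext _ _ fun s => ?_
  have L : Sigma.ι (fun _ : singSimplex X (n + 1) => ModuleCat.of ℚ ℚ) s ≫
      (sigmaIsoFinsupp (singSimplexEquiv X (n + 1))).hom ≫ (singCx X).d (n + 1) n =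
      ModuleCat.ofHom (Finsupp.lsingle (singSimplexEquiv X (n + 1) s)) ≫
        ModuleCat.ofHom (singBd n) := by
    refine (Category.assoc _ _ _).symm.trans ?_
    exact congrArg₂ (· ≫ ·) (ι_sigmaIsoFinsupp_hom _ s) e2
  refine L.trans ?_
  refine Eq.trans ?_ (congrArg (Sigma.ι (fun _ : singSimplex X (n + 1) => ModuleCat.of ℚ ℚ) s ≫ ·)
    (Preadditive.sum_comp _ _ _).symm)
  refine Eq.trans ?_ (Preadditive.comp_sum _ _ _).symm
  have R : ∀ i : Fin (n + 2), Sigma.ι (fun _ : singSimplex X (n + 1) => ModuleCat.of ℚ ℚ) s ≫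
      ((-1 : ℤ) ^ (i : ℕ) • (((SimplicialObject.whiskering Type (ModuleCat ℚ)).obj
          (sigmaConst.obj (ModuleCat.of ℚ ℚ))).obj (TopCat.toSSet.obj (TopCat.of X))).δ i) ≫
        (sigmaIsoFinsupp (singSimplexEquiv X n)).hom = (-1 : ℤ) ^ (i : ℕ) •
        ModuleCat.ofHom (Finsupp.lsingle ((singSimplexEquiv X (n + 1) s).comp
          (affMap (vtx (n + 1) ∘ i.succAbove)))) := by
    intro i
    rw [← singSimplexEquiv_δ]
    refine (congrArg (Sigma.ι (fun _ : singSimplex X (n + 1) => ModuleCat.of ℚ ℚ) s ≫ ·)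
      (Preadditive.zsmul_comp _ _ _)).trans ?_
    refine (Preadditive.comp_zsmul _ _ _).trans ?_
    congr 1
    refine (Category.assoc _ _ _).symm.trans ?_
    exact (congrArg (· ≫ (sigmaIsoFinsupp (singSimplexEquiv X n)).hom) (e3 i s)).trans
      (ι_sigmaIsoFinsupp_hom _ _)
  refine Eq.trans ?_ (Finset.sum_congr rfl fun i _ => (R i).symm)
  exact ofHom_singBd X n _

end Comparison

end

/-! ### Euler numbers of spaces -/

section

open CategoryTheory

section Spaces

variable {X Y : Type} [TopologicalSpace X] [TopologicalSpace Y]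

theorem hasEulerNumber_iff {χ : ℤ} : HasEulerNumber X χ ↔ HasEulerChar (singCx X) χ :=
  ⟨fun h => HasEulerChar.of_iso (singCxIso X) h, fun h => HasEulerChar.of_iso (singCxIso X).symm h⟩

theorem HasEulerNumber.unique {a b : ℤ} (h : HasEulerNumber X a) (h' : HasEulerNumber X b) :
    a = b := h.2.2.symm.trans h'.2.2

theorem singBd_mem_chainsIn (A : Set X) (n : ℕ) : ∀ c ∈ chainsIn A (n + 1),
    singBd n c ∈ chainsIn A n := fun _ hc => singExt_mem_chainsIn _ hc

/-- The chains of a subspace are the chains with simplices in the subspace. -/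
def chainsInEquiv (A : Set X) (n : ℕ) : SingC n A ≃ₗ[ℚ] chainsIn A n := by
  let i : C(A, X) := ⟨Subtype.val, continuous_subtype_val⟩
  let f : SingC n A →ₗ[ℚ] SingC n X := Finsupp.lmapDomain ℚ ℚ fun σ => i.comp σ
  have hi : Function.Injective fun σ : C(Splx n, A) => i.comp σ := fun σ τ h =>
    ContinuousMap.ext fun x => Subtype.ext (ContinuousMap.congr_fun h x)
  have hf : Function.Injective f := Finsupp.mapDomain_injective hi
  have hr : LinearMap.range f = chainsIn A n := by
    rw [LinearMap.range_eq_map, ← Finsupp.supported_univ]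
    refine (Finsupp.lmapDomain_supported ℚ ℚ _ _).trans ?_
    unfold chainsIn
    congr 1
    ext σ
    simp only [image_univ, mem_range, mem_ofPred_eq]
    constructor
    · rintro ⟨τ, rfl⟩ _ ⟨x, rfl⟩
      exact (τ x).2
    · intro h
      exact ⟨⟨fun x => ⟨σ x, h ⟨x, rfl⟩⟩, by fun_prop⟩, rfl⟩
  exact (LinearEquiv.ofInjective f hf).trans (LinearEquiv.ofEq _ _ hr)

theorem chainsInEquiv_coe (A : Set X) (n : ℕ) (c : SingC n A) :
    (chainsInEquiv A n c : SingC n X) = Finsupp.lmapDomain ℚ ℚ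
      (fun σ : C(Splx n, A) => (⟨Subtype.val, continuous_subtype_val⟩ : C(A, X)).comp σ) c := rfl

theorem hasEulerChar_chainsIn {A : Set X} {a : ℤ} :
    HasEulerChar (linSubCx singBd (fun _ c => singBd_singBd c) (chainsIn A)
      (singBd_mem_chainsIn A)) a ↔ HasEulerNumber A a := by
  have key : ∀ (n : ℕ) (x : SingC (n + 1) A), (singBd n).restrict (singBd_mem_chainsIn A n)
      (chainsInEquiv A (n + 1) x) = chainsInEquiv A n (singBd n x) := by
    intro n x
    apply Subtype.ext
    simp only [LinearMap.coe_restrict_apply, chainsInEquiv_coe]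
    rw [← LinearMap.comp_apply, ← LinearMap.comp_apply]
    congr 1
    refine Finsupp.lhom_ext' fun σ => LinearMap.ext_ring ?_
    simp [singBd_single, ContinuousMap.comp_assoc]
  rw [hasEulerNumber_iff]
  constructor
  · refine HasEulerChar.of_linearEquiv (fun n => (chainsInEquiv A n).symm) fun n x => ?_
    rw [LinearEquiv.eq_symm_apply, ← key, LinearEquiv.apply_symm_apply]
  · exact HasEulerChar.of_linearEquiv (fun n => chainsInEquiv A n) key

/-! ### The Mayer–Vietoris sequence of an open cover by two sets -/

section MayerVietoris

variable {A B : Set X} (hA : IsOpen A) (hB : IsOpen B) (hAB : A ∪ B = univ)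
include hA hB hAB

/-- This is the theorem of small simplices: repeated subdivision makes the quotient by the chains
subordinate to the cover acyclic. -/
theorem hasEulerChar_sup_iff {a : ℤ} :
    HasEulerChar (linSubCx singBd (fun _ c => singBd_singBd c)
      (fun n => chainsIn A n ⊔ chainsIn B n) (fun _ _ hc => singExt_mem_sup _ hc)) a ↔
      HasEulerNumber X a := by
  rw [hasEulerNumber_iff]
  exact HasEulerChar.of_subCx (exists_bd_add_mem_zero hA hB hAB)
    fun n x hx => exists_bd_add_mem hA hB hAB x hx

/-- The third term is described by an equivalence for every possible value, because it is the
unknown in one application of the sequence and is given in the other. -/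
theorem exists_mayerVietoris {c : ℤ} (hc : HasEulerNumber ↥(A ∩ B) c) :
    ∃ S : ShortComplex (ChainComplex (ModuleCat.{0} ℚ) ℕ), S.ShortExact ∧ HasEulerChar S.X₁ c ∧
      (∀ a, HasEulerChar S.X₃ a ↔ HasEulerNumber X a) ∧
      S.X₂ = linCxProd (M := fun n => chainsIn A n) (M' := fun n => chainsIn B n)
        (fun n => (singBd n).restrict (singBd_mem_chainsIn A n))
        (fun _ x => Subtype.ext (singBd_singBd x.1))
        (fun n => (singBd n).restrict (singBd_mem_chainsIn B n))
        (fun _ x => Subtype.ext (singBd_singBd x.1)) := by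
  have hi : ∀ n, ∀ x ∈ chainsIn A (n + 1) ⊓ chainsIn B (n + 1),
      singBd n x ∈ chainsIn A n ⊓ chainsIn B n := fun n x hx =>
    ⟨singBd_mem_chainsIn A n x hx.1, singBd_mem_chainsIn B n x hx.2⟩
  obtain ⟨p, q, w, hS⟩ := exists_shortExact_sup (M := fun n => SingC n X) (d := singBd)
    (h := fun _ c => singBd_singBd c) (N := chainsIn A) (N' := chainsIn B)
    (hN := singBd_mem_chainsIn A) (hN' := singBd_mem_chainsIn B) (hi := hi)
    (hs := fun _ _ hc => singExt_mem_sup _ hc)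
  refine ⟨_, hS, ?_, fun a => hasEulerChar_sup_iff hA hB hAB, rfl⟩
  rw [← hasEulerChar_chainsIn] at hc
  convert hc using 2
  exact funext fun n => chainsIn_inf A B n

theorem HasEulerNumber.union {a b c : ℤ} (ha : HasEulerNumber A a) (hb : HasEulerNumber B b)
    (hc : HasEulerNumber ↥(A ∩ B) c) : HasEulerNumber X (a + b - c) := by
  obtain ⟨S, hS, h₁, h₃, h₂⟩ := exists_mayerVietoris hA hB hAB hc
  rw [← h₃]
  refine HasEulerChar.right hS h₁ ?_
  rw [h₂]
  exact HasEulerChar.prod (hasEulerChar_chainsIn.2 ha) (hasEulerChar_chainsIn.2 hb)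

/-- The middle term of the sequence is the direct sum of the chains in A and in B. It has Euler
characteristic x + c, and the summand for B splits off. The finiteness of the homology of A is thus
a conclusion. -/
theorem HasEulerNumber.left_of_union {x b c : ℤ} (hx : HasEulerNumber X x)
    (hb : HasEulerNumber B b) (hc : HasEulerNumber ↥(A ∩ B) c) :
    HasEulerNumber A (x + c - b) := by
  obtain ⟨S, hS, h₁, h₃, h₂⟩ := exists_mayerVietoris hA hB hAB hc
  rw [← h₃] at hx
  have := HasEulerChar.middle hS h₁ hx
  rw [h₂] at this
  rw [← hasEulerChar_chainsIn, add_comm x]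
  exact HasEulerChar.of_prod this (hasEulerChar_chainsIn.2 hb)

end MayerVietoris

theorem HasEulerNumber.of_homotopyEquiv {a : ℤ} (e : ContinuousMap.HomotopyEquiv X Y)
    (h : HasEulerNumber X a) : HasEulerNumber Y a := by
  let F := (AlgebraicTopology.singularChainComplexFunctor (ModuleCat.{0} ℚ)).obj (ModuleCat.of ℚ ℚ)
  have key : ∀ {Z : Type} [TopologicalSpace Z] (f : C(Z, Z)), f.Homotopic (ContinuousMap.id Z) →
      ∀ n, HomologicalComplex.homologyMap (F.map (TopCat.ofHom f)) n = 𝟙 _ := by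
    intro Z _ f ⟨H⟩ n
    have H' : TopCat.Homotopy (TopCat.ofHom f) (𝟙 (TopCat.of Z)) := H
    rw [H'.congr_homologyMap_singularChainComplexFunctor (ModuleCat.of ℚ ℚ) n,
      CategoryTheory.Functor.map_id, HomologicalComplex.homologyMap_id]
  have key' : ∀ {Z W : Type} [TopologicalSpace Z] [TopologicalSpace W] (f : C(Z, W)) (g : C(W, Z)),
      (g.comp f).Homotopic (ContinuousMap.id Z) → ∀ n,
      HomologicalComplex.homologyMap (F.map (TopCat.ofHom f)) n ≫
        HomologicalComplex.homologyMap (F.map (TopCat.ofHom g)) n = 𝟙 _ := by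
    intro Z W _ _ f g h n
    rw [← HomologicalComplex.homologyMap_comp, ← Functor.map_comp]
    exact key _ h n
  refine HasEulerChar.of_homologyIso (K := rationalSingularChains X) (L := rationalSingularChains Y)
    (fun n => ⟨HomologicalComplex.homologyMap (F.map (TopCat.ofHom e.toFun)) n,
      HomologicalComplex.homologyMap (F.map (TopCat.ofHom e.invFun)) n,
      key' _ _ e.left_inv n, key' _ _ e.right_inv n⟩) h

theorem HasEulerNumber.of_homeomorph {a : ℤ} (e : X ≃ₜ Y) (h : HasEulerNumber X a) :
    HasEulerNumber Y a := h.of_homotopyEquiv e.toHomotopyEquiv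

theorem hasEulerNumber_of_finite [TotallyDisconnectedSpace X] [Finite X] :
    HasEulerNumber X (Nat.card X) := by
  have hs : ∀ n, 1 ≤ n → Subsingleton ((rationalSingularChains X).homology n) := by
    intro n hn
    rw [← ModuleCat.isZero_iff_subsingleton]
    exact AlgebraicTopology.isZero_singularHomologyFunctor_of_totallyDisconnectedSpace
      (ModuleCat.{0} ℚ) n (ModuleCat.of ℚ ℚ) (TopCat.of X) (by omega)
  have e : (rationalSingularChains X).homology 0 ≅ ModuleCat.of ℚ (X →₀ ℚ) :=
    (AlgebraicTopology.singularHomologyFunctorZeroOfTotallyDisconnectedSpace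
      (ModuleCat.{0} ℚ) (ModuleCat.of ℚ ℚ) (TopCat.of X)).trans
      (sigmaIsoFinsupp (Equiv.refl X))
  refine ⟨fun n => ?_, finite_of_bound 1 hs, ?_⟩
  · rcases n with _ | n
    · exact Module.Finite.equiv e.symm.toLinearEquiv
    · have := hs (n + 1) (by omega)
      infer_instance
  · have := Fintype.ofFinite X
    rw [homologyEulerChar_eq_sum _ 1 hs, Finset.sum_range_one, e.toLinearEquiv.finrank_eq]
    simp

theorem HasEulerNumber.sum {a b : ℤ} (hX : HasEulerNumber X a) (hY : HasEulerNumber Y b) :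
    HasEulerNumber (X ⊕ Y) (a + b) := by
  have hc : HasEulerNumber ↥(range (Sum.inl : X → X ⊕ Y) ∩ range (Sum.inr : Y → X ⊕ Y)) 0 := by
    rw [show range (Sum.inl : X → X ⊕ Y) ∩ range Sum.inr = ⊥ from
      isCompl_range_inl_range_inr.inf_eq_bot]
    have : IsEmpty ↥(⊥ : Set (X ⊕ Y)) := ⟨fun x => x.2⟩
    simpa using hasEulerNumber_of_finite (X := ↥(⊥ : Set (X ⊕ Y)))
  have := HasEulerNumber.union (X := X ⊕ Y) isOpen_range_inl isOpen_range_inr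
    range_inl_union_range_inr
    (hX.of_homeomorph Topology.IsEmbedding.inl.toHomeomorph)
    (hY.of_homeomorph Topology.IsEmbedding.inr.toHomeomorph) hc
  simpa using this

theorem HasEulerNumber.discrete_prod {a : ℤ} (hX : HasEulerNumber X a) (F : Type) [Finite F]
    [TopologicalSpace F] [DiscreteTopology F] : HasEulerNumber (F × X) (Nat.card F * a) := by
  -- The topology is quantified after the type: the induction on finite types produces bare
  -- bijections, and any two discrete topologies then correspond.
  suffices h : ∀ (F : Type) [Finite F], ∀ [TopologicalSpace F] [DiscreteTopology F],
    HasEulerNumber (F × X) (Nat.card F * a) from h F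
  refine Finite.induction_empty_option ?_ ?_ ?_
  · intro F G e h _ _
    let _ : TopologicalSpace F := ⊥
    have : DiscreteTopology F := ⟨rfl⟩
    rw [← Nat.card_congr e]
    exact HasEulerNumber.of_homeomorph
      ((⟨e, continuous_of_discreteTopology, continuous_of_discreteTopology⟩ : F ≃ₜ G).prodCongr
        (Homeomorph.refl X)) h
  · intro _ _
    simpa using hasEulerNumber_of_finite (X := PEmpty × X)
  · intro F _ h _ _
    let _ : TopologicalSpace F := ⊥
    have : DiscreteTopology F := ⟨rfl⟩
    have e : F ⊕ PUnit.{1} ≃ₜ Option F :=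
      ⟨(Equiv.optionEquivSumPUnit F).symm, continuous_of_discreteTopology,
        continuous_of_discreteTopology⟩
    have h1 := (h.sum (hX.of_homeomorph (Homeomorph.punitProd X).symm)).of_homeomorph
      ((Homeomorph.sumProdDistrib (X := F) (Y := PUnit) (Z := X)).symm.trans
        (e.prodCongr (Homeomorph.refl X)))
    convert h1 using 1
    simp
    ring

end Spaces

end

/-! ### Attaching a product cell -/

section

open CategoryTheory

/-- Closed subsets of a compact space have closed images in a Hausdorff space, so the two maps
behave like a finite closed cover. Working relative to `O` allows the centers of the cells to be
removed. -/
theorem continuousOn_of_compact_cover {Z₁ Z₂ Y T : Type*} [TopologicalSpace Z₁]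
    [TopologicalSpace Z₂] [TopologicalSpace Y] [TopologicalSpace T] [CompactSpace Z₁]
    [CompactSpace Z₂] [T2Space Y] {p₁ : Z₁ → Y} {p₂ : Z₂ → Y} (h₁ : Continuous p₁)
    (h₂ : Continuous p₂) {O : Set Y} {H : Y → T}
    (hs : ∀ y ∈ O, y ∈ range p₁ ∨ y ∈ range p₂)
    (c₁ : ContinuousOn (H ∘ p₁) (p₁ ⁻¹' O)) (c₂ : ContinuousOn (H ∘ p₂) (p₂ ⁻¹' O)) :
    ContinuousOn H O := by
  rw [continuousOn_iff_isClosed] at *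
  intro F hF
  obtain ⟨u₁, hu₁, e₁⟩ := c₁ F hF
  obtain ⟨u₂, hu₂, e₂⟩ := c₂ F hF
  refine ⟨p₁ '' u₁ ∪ p₂ '' u₂, (hu₁.isCompact.image h₁).isClosed.union
    (hu₂.isCompact.image h₂).isClosed, ?_⟩
  ext y
  constructor
  · rintro ⟨hy, hO⟩
    refine ⟨?_, hO⟩
    rcases hs y hO with ⟨z, rfl⟩ | ⟨z, rfl⟩
    · exact Or.inl ⟨z, (e₁.subset ⟨hy, hO⟩).1, rfl⟩
    · exact Or.inr ⟨z, (e₂.subset ⟨hy, hO⟩).1, rfl⟩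
  · rintro ⟨⟨z, hz, rfl⟩ | ⟨z, hz, rfl⟩, hO⟩
    · exact ⟨(e₁.superset ⟨hz, hO⟩).1, hO⟩
    · exact ⟨(e₂.superset ⟨hz, hO⟩).1, hO⟩

section Attach

open Metric unitInterval

variable {E : Type} [NormedAddCommGroup E] [NormedSpace ℝ E] [ProperSpace E]
variable {L Y : Type} [TopologicalSpace L] [CompactSpace L]
  [TopologicalSpace Y] [CompactSpace Y] [T2Space Y]

/-- The radial retraction onto the closed unit ball. -/
def ballRetract (x : E) : closedBall (0 : E) 1 :=
  ⟨(max 1 ‖x‖)⁻¹ • x, by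
    rw [mem_closedBall_zero_iff, norm_smul, norm_inv, Real.norm_of_nonneg (by positivity),
      inv_mul_le_one₀ (by positivity)]
    exact le_max_right _ _⟩

omit [ProperSpace E] in
theorem continuous_ballRetract : Continuous (ballRetract : E → closedBall (0 : E) 1) := by
  refine Continuous.subtype_mk (Continuous.smul (Continuous.inv₀ (by fun_prop) ?_) continuous_id) _
  intro x
  positivity

omit [ProperSpace E] in
theorem ballRetract_of_le {x : E} (h : ‖x‖ ≤ 1) : (ballRetract x : E) = x := by
  simp [ballRetract, max_eq_left h]

omit [ProperSpace E] in
theorem ballRetract_coe (x : closedBall (0 : E) 1) : ballRetract (x : E) = x :=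
  Subtype.ext (ballRetract_of_le (mem_closedBall_zero_iff.1 x.2))

/-- The open solid ball bundle is homotopy equivalent to its base. -/
def openBallHomotopyEquiv : ContinuousMap.HomotopyEquiv
    {m : closedBall (0 : E) 1 × L | ‖(m.1 : E)‖ < 1} L where
  toFun := ⟨fun m => m.1.2, by fun_prop⟩
  invFun := ⟨fun l => ⟨(⟨0, by simp⟩, l), by simp⟩, by fun_prop⟩
  left_inv := ⟨{
    toFun := fun p => ⟨(⟨(p.1 : ℝ) • (p.2.1.1 : E), by
        rw [mem_closedBall_zero_iff, norm_smul, Real.norm_of_nonneg p.1.2.1]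
        exact mul_le_one₀ p.1.2.2 (norm_nonneg _) (le_of_lt p.2.2)⟩, p.2.1.2), by
        change ‖(p.1 : ℝ) • (p.2.1.1 : E)‖ < 1
        rw [norm_smul, Real.norm_of_nonneg p.1.2.1]
        exact (mul_le_of_le_one_left (norm_nonneg _) p.1.2.2).trans_lt p.2.2⟩
    continuous_toFun := by fun_prop
    map_zero_left := by
      intro m
      apply Subtype.ext
      simp
    map_one_left := by
      intro m
      apply Subtype.ext
      simp }⟩
  right_inv := ⟨ContinuousMap.Homotopy.refl _⟩

omit [ProperSpace E] in
theorem norm_radial_smul {x : E} (hx : x ≠ 0) {c : ℝ} (hc : 0 ≤ c) : ‖(c / ‖x‖) • x‖ = c := by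
  rw [norm_smul, Real.norm_of_nonneg (by positivity), div_mul_cancel₀ _ (norm_ne_zero_iff.2 hx)]

omit [NormedSpace ℝ E] [TopologicalSpace L] [ProperSpace E] [CompactSpace L] in
theorem ne_zero_of_mem_punctured
    (m : {m : closedBall (0 : E) 1 × L | 0 < ‖(m.1 : E)‖ ∧ ‖(m.1 : E)‖ < 1}) : (m.1.1 : E) ≠ 0 :=
  norm_pos_iff.1 m.2.1

/-- The radius moves linearly between 1/2 and c, so the homotopy stays in the punctured open ball.
-/
theorem radial_bounds {t c : ℝ} (ht : t ∈ Icc (0 : ℝ) 1) (hc : 0 < c ∧ c < 1) :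
    0 < (1 - t) * (1 / 2) + t * c ∧ (1 - t) * (1 / 2) + t * c < 1 := by
  obtain ⟨h0, h1⟩ := ht
  obtain ⟨h2, h3⟩ := hc
  rcases h0.eq_or_lt with rfl | h0
  · constructor <;> norm_num
  · constructor <;> nlinarith

/-- The punctured open solid ball bundle is homotopy equivalent to the sphere bundle. -/
def puncturedBallHomotopyEquiv : ContinuousMap.HomotopyEquiv
    {m : closedBall (0 : E) 1 × L | 0 < ‖(m.1 : E)‖ ∧ ‖(m.1 : E)‖ < 1}
    (sphere (0 : E) 1 × L) where
  toFun := ⟨fun m => (⟨((1 : ℝ) / ‖(m.1.1 : E)‖) • (m.1.1 : E), by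
      rw [mem_sphere_zero_iff_norm]
      exact norm_radial_smul (ne_zero_of_mem_punctured m) zero_le_one⟩, m.1.2), by
    refine Continuous.prodMk (Continuous.subtype_mk (Continuous.smul (Continuous.div₀ (by fun_prop)
      (by fun_prop) fun m => (norm_ne_zero_iff.2 (ne_zero_of_mem_punctured m))) (by fun_prop)) _)
      (by fun_prop)⟩
  invFun := ⟨fun s => ⟨(⟨(1 / 2 : ℝ) • (s.1 : E), by
      rw [mem_closedBall_zero_iff, norm_smul, norm_eq_of_mem_sphere]; norm_num⟩, s.2), by
      change 0 < ‖(1 / 2 : ℝ) • (s.1 : E)‖ ∧ ‖(1 / 2 : ℝ) • (s.1 : E)‖ < 1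
      rw [norm_smul, norm_eq_of_mem_sphere]; norm_num⟩, by fun_prop⟩
  left_inv := ⟨{
    toFun := fun p => ⟨(⟨(((1 - (p.1 : ℝ)) * (1 / 2) + p.1 * ‖(p.2.1.1 : E)‖) / ‖(p.2.1.1 : E)‖) •
          (p.2.1.1 : E), by
        rw [mem_closedBall_zero_iff, norm_radial_smul (ne_zero_of_mem_punctured p.2)
          (radial_bounds p.1.2 p.2.2).1.le]
        exact (radial_bounds p.1.2 p.2.2).2.le⟩, p.2.1.2), by
        change 0 < ‖(((1 - (p.1 : ℝ)) * (1 / 2) + p.1 * ‖(p.2.1.1 : E)‖) / ‖(p.2.1.1 : E)‖) •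
          (p.2.1.1 : E)‖ ∧ ‖(((1 - (p.1 : ℝ)) * (1 / 2) + p.1 * ‖(p.2.1.1 : E)‖) /
          ‖(p.2.1.1 : E)‖) • (p.2.1.1 : E)‖ < 1
        rw [norm_radial_smul (ne_zero_of_mem_punctured p.2) (radial_bounds p.1.2 p.2.2).1.le]
        exact radial_bounds p.1.2 p.2.2⟩
    continuous_toFun := by
      refine Continuous.subtype_mk (Continuous.prodMk (Continuous.subtype_mk (Continuous.smul
        (Continuous.div₀ (by fun_prop) (by fun_prop) fun p =>
        (norm_ne_zero_iff.2 (ne_zero_of_mem_punctured p.2))) (by fun_prop)) _) (by fun_prop)) _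
    map_zero_left := by
      intro m
      apply Subtype.ext
      refine Prod.ext (Subtype.ext ?_) rfl
      simp [smul_smul, div_eq_mul_inv]
    map_one_left := by
      intro m
      apply Subtype.ext
      refine Prod.ext (Subtype.ext ?_) rfl
      simp [div_self (norm_ne_zero_iff.2 (ne_zero_of_mem_punctured m))] }⟩
  right_inv := by
    convert ContinuousMap.Homotopic.refl _
    ext1 s
    refine Prod.ext (Subtype.ext ?_) rfl
    simp [smul_smul, norm_smul]

/-- A continuous map from a compact space to a Hausdorff space that is injective over a set
restricts to a homeomorphism over it. -/
def homeomorphOver {M : Type} [TopologicalSpace M] [CompactSpace M] (f : C(M, Y)) (O : Set Y)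
    (hs : O ⊆ range f) (hi : ∀ m m', f m ∈ O → f m = f m' → m = m') : f ⁻¹' O ≃ₜ O :=
  (Equiv.ofBijective (O.restrictPreimage f) ⟨fun m m' h =>
      Subtype.ext (hi _ _ m.2 (congrArg Subtype.val h)), fun y => by
        obtain ⟨m, hm⟩ := hs y.2
        exact ⟨⟨m, by rw [mem_preimage, hm]; exact y.2⟩, Subtype.ext hm⟩⟩).toHomeomorphOfContinuousClosed
    (f.continuous.restrictPreimage) (f.continuous.isClosedMap.restrictPreimage O)

variable (f : C(closedBall (0 : E) 1 × L, Y)) {A : Set Y} (hA : IsClosed A)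
  (h_sphere : ∀ m, ‖(m.1 : E)‖ = 1 → f m ∈ A) (h_ball : ∀ m, ‖(m.1 : E)‖ < 1 → f m ∉ A)
  (h_inj : ∀ m m', ‖(m.1 : E)‖ < 1 → f m = f m' → m = m') (h_surj : ∀ y, y ∉ A → ∃ m, f m = y)

include h_sphere h_ball in
omit [NormedSpace ℝ E] [CompactSpace L] [ProperSpace E] [CompactSpace Y] [T2Space Y] in
theorem attach_preimage : f ⁻¹' Aᶜ = {m | ‖(m.1 : E)‖ < 1} := by
  ext m
  refine ⟨fun h => ?_, h_ball m⟩
  have := mem_closedBall_zero_iff.1 m.1.2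
  exact lt_of_le_of_ne this fun e => h (h_sphere m e)

open Classical in
/-- The radial deformation pushing the punctured cells into the boundary. -/
def attachPush (p : I × Y) : Y :=
  if h : p.2 ∈ A then p.2 else
    f (ballRetract (((1 - (p.1 : ℝ)) + p.1 / ‖((h_surj p.2 h).choose.1 : E)‖) •
      ((h_surj p.2 h).choose.1 : E)), (h_surj p.2 h).choose.2)

omit [ProperSpace E] [CompactSpace L] [CompactSpace Y] [T2Space Y] in
theorem attachPush_of_mem {y : Y} (hy : y ∈ A) (t : I) : attachPush f h_surj (t, y) = y := by
  simp [attachPush, hy]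

include h_sphere h_ball h_inj in
omit [ProperSpace E] [CompactSpace L] [CompactSpace Y] [T2Space Y] in
-- The chosen preimage in `attachPush` does not matter: over the open ball `f` is injective, and on
-- the sphere the radial factor (1 − t) + t/‖m‖ equals 1. The formula therefore holds on the whole
-- closed ball.
theorem attachPush_apply (m : closedBall (0 : E) 1 × L) (t : I) :
    attachPush f h_surj (t, f m) =
      f (ballRetract (((1 - (t : ℝ)) + t / ‖(m.1 : E)‖) • (m.1 : E)), m.2) := by
  by_cases hm : f m ∈ A
  · rw [attachPush_of_mem f h_surj hm]
    have h1 : ‖(m.1 : E)‖ = 1 := by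
      by_contra hc
      exact h_ball m (lt_of_le_of_ne (mem_closedBall_zero_iff.1 m.1.2) hc) hm
    rw [h1]
    simp [ballRetract_coe]
  · have hm' : ‖(m.1 : E)‖ < 1 := lt_of_le_of_ne (mem_closedBall_zero_iff.1 m.1.2)
      fun e => hm (h_sphere m e)
    have : (h_surj (f m) hm).choose = m :=
      (h_inj _ _ hm' (h_surj (f m) hm).choose_spec.symm).symm
    simp [attachPush, hm, this]

include hA h_sphere h_ball h_inj in
-- Continuity is checked on the compact pieces I × A and I × (ball × L). The centers are left out
-- because the radial factor has a pole there.
theorem continuousOn_attachPush : ContinuousOn (attachPush f h_surj)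
    (univ ×ˢ (f '' {m | (m.1 : E) = 0})ᶜ) := by
  have := isCompact_iff_compactSpace.1 hA.isCompact
  refine continuousOn_of_compact_cover (Z₁ := I × A) (Z₂ := I × (closedBall (0 : E) 1 × L))
    (p₁ := fun p => (p.1, (p.2 : Y))) (p₂ := fun p => (p.1, f p.2)) (by fun_prop) (by fun_prop)
    ?_ ?_ ?_
  · rintro ⟨t, y⟩ -
    by_cases hy : y ∈ A
    · exact Or.inl ⟨(t, ⟨y, hy⟩), rfl⟩
    · obtain ⟨m, rfl⟩ := h_surj y hy
      exact Or.inr ⟨(t, m), rfl⟩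
  · refine Continuous.continuousOn ?_
    refine (continuous_subtype_val.comp continuous_snd : Continuous fun p : I × A => (p.2 : Y)).congr
      fun p => ?_
    exact (attachPush_of_mem f h_surj p.2.2 p.1).symm
  · have hz : ∀ p ∈ (fun p : I × (closedBall (0 : E) 1 × L) => (p.1, f p.2)) ⁻¹'
        (univ ×ˢ (f '' {m | (m.1 : E) = 0})ᶜ), (‖(p.2.1 : E)‖) ≠ 0 := by
      rintro ⟨t, m⟩ ⟨-, hm⟩ h0
      exact hm ⟨m, norm_eq_zero.1 h0, rfl⟩
    have hc : ContinuousOn (fun p : I × (closedBall (0 : E) 1 × L) =>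
        (((1 - (p.1 : ℝ)) + p.1 / ‖(p.2.1 : E)‖) • (p.2.1 : E)))
        ((fun p : I × (closedBall (0 : E) 1 × L) => (p.1, f p.2)) ⁻¹'
        (univ ×ˢ (f '' {m | (m.1 : E) = 0})ᶜ)) := by
      refine ContinuousOn.smul (ContinuousOn.add (by fun_prop) (ContinuousOn.div₀ (by fun_prop)
        (by fun_prop) hz)) (by fun_prop)
    refine (f.continuous.comp_continuousOn ((continuous_ballRetract.comp_continuousOn hc).prodMk
      (continuous_snd.comp continuous_snd).continuousOn)).congr fun p _ => ?_
    exact attachPush_apply f h_sphere h_ball h_inj h_surj p.2 p.1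

theorem radial_factor_norm {c t : ℝ} (hc : 0 < c) (h1 : c ≤ 1) (ht : t ∈ Icc (0 : ℝ) 1) :
    0 < ((1 - t) + t / c) * c ∧ ((1 - t) + t / c) * c ≤ 1 := by
  have : ((1 - t) + t / c) * c = (1 - t) * c + t := by field_simp
  rw [this]
  obtain ⟨h2, h3⟩ := ht
  rcases h3.eq_or_lt with rfl | h3
  · simp
  · constructor <;> nlinarith

include h_sphere h_ball h_inj in
omit [ProperSpace E] [CompactSpace L] [CompactSpace Y] [T2Space Y] in
theorem attachPush_mem {p : I × Y} (hp : p.2 ∉ f '' {m | (m.1 : E) = 0}) :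
    attachPush f h_surj p ∉ f '' {m | (m.1 : E) = 0} := by
  obtain ⟨t, y⟩ := p
  by_cases hy : y ∈ A
  · rwa [attachPush_of_mem f h_surj hy]
  · obtain ⟨m, rfl⟩ := h_surj y hy
    rw [attachPush_apply f h_sphere h_ball h_inj]
    rintro ⟨m', hm' : (m'.1 : E) = 0, e⟩
    have := h_inj m' _ (by simp [hm']) e
    have h0 := congrArg (fun z => ((z.1 : closedBall (0 : E) 1) : E)) this
    have hm0 : (m.1 : E) ≠ 0 := fun h => hp ⟨m, h, rfl⟩
    have hb := radial_factor_norm (norm_pos_iff.2 hm0) (mem_closedBall_zero_iff.1 m.1.2) t.2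
    have hn : ‖((1 - (t : ℝ)) + t / ‖(m.1 : E)‖) • (m.1 : E)‖ =
        ((1 - (t : ℝ)) + t / ‖(m.1 : E)‖) * ‖(m.1 : E)‖ := by
      rw [norm_smul, Real.norm_of_nonneg]
      exact (pos_of_mul_pos_left hb.1 (norm_nonneg _)).le
    simp only at h0
    rw [hm', ballRetract_of_le (hn ▸ hb.2), eq_comm, ← norm_eq_zero, hn] at h0
    exact hb.1.ne' h0

include h_sphere h_ball h_inj in
omit [ProperSpace E] [CompactSpace L] [CompactSpace Y] [T2Space Y] in
theorem attachPush_one_mem {y : Y} (hp : y ∉ f '' {m | (m.1 : E) = 0}) :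
    attachPush f h_surj (1, y) ∈ A := by
  by_cases hy : y ∈ A
  · rwa [attachPush_of_mem f h_surj hy]
  · obtain ⟨m, rfl⟩ := h_surj y hy
    rw [attachPush_apply f h_sphere h_ball h_inj]
    have hm0 : (m.1 : E) ≠ 0 := fun h => hp ⟨m, h, rfl⟩
    apply h_sphere
    have hn : ‖((1 - ((1 : I) : ℝ)) + (1 : I) / ‖(m.1 : E)‖) • (m.1 : E)‖ = 1 := by
      simpa using norm_radial_smul hm0 zero_le_one
    rw [ballRetract_of_le hn.le, hn]

include hA h_sphere h_ball h_inj h_surj in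
/-- The complement of the centers of the cells deforms to the boundary. -/
theorem attach_homotopyEquiv :
    Nonempty (ContinuousMap.HomotopyEquiv ↥((f '' {m | (m.1 : E) = 0})ᶜ) A) := by
  have hcont := continuousOn_attachPush f hA h_sphere h_ball h_inj h_surj
  have hAW : ∀ a ∈ A, a ∈ (f '' {m | (m.1 : E) = 0})ᶜ := by
    rintro a ha ⟨m, hm : (m.1 : E) = 0, rfl⟩
    exact h_ball m (by simp [hm]) ha
  have hc' : Continuous fun p : I × ↥((f '' {m | (m.1 : E) = 0})ᶜ) =>
      attachPush f h_surj (p.1, p.2.1) :=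
    hcont.comp_continuous (by fun_prop) fun p => ⟨mem_univ _, p.2.2⟩
  refine ⟨⟨⟨fun w => ⟨attachPush f h_surj (1, w.1),
      attachPush_one_mem f h_sphere h_ball h_inj h_surj w.2⟩, ?_⟩,
    ⟨fun a => ⟨a.1, hAW a.1 a.2⟩, by fun_prop⟩, ?_, ?_⟩⟩
  · exact Continuous.subtype_mk (hc'.comp (by fun_prop : Continuous fun w => ((1 : I), w))) _
  · refine ContinuousMap.Homotopic.symm ⟨⟨⟨fun p => ⟨attachPush f h_surj (p.1, p.2.1),
      attachPush_mem f h_sphere h_ball h_inj h_surj p.2.2⟩, Continuous.subtype_mk hc' _⟩, ?_, ?_⟩⟩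
    · intro w
      apply Subtype.ext
      change attachPush f h_surj (0, w.1) = w.1
      by_cases hw : w.1 ∈ A
      · exact attachPush_of_mem f h_surj hw 0
      · obtain ⟨m, hm⟩ := h_surj w.1 hw
        rw [← hm, attachPush_apply f h_sphere h_ball h_inj]
        simp [ballRetract_coe]
    · intro w
      rfl
  · convert ContinuousMap.Homotopic.refl _
    ext1 a
    exact Subtype.ext (attachPush_of_mem f h_surj a.2 1).symm

include h_sphere h_ball h_inj h_surj in
omit [CompactSpace Y] in
-- The cover used for Mayer–Vietoris consists of the complement of the centers and of the open
-- cells. The open cells contract to L, and the intersection consists of punctured cells, which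
-- contract to sphere × L. That the first set deforms to A is `attach_homotopyEquiv`.
theorem attach_data {l s : ℤ} (hl : HasEulerNumber L l)
    (hs : HasEulerNumber (sphere (0 : E) 1 × L) s) :
    IsOpen (f '' {m | (m.1 : E) = 0})ᶜ ∧ (f '' {m | (m.1 : E) = 0})ᶜ ∪ Aᶜ = univ ∧
      HasEulerNumber ↥(Aᶜ) l ∧ HasEulerNumber ↥((f '' {m | (m.1 : E) = 0})ᶜ ∩ Aᶜ) s := by
  have hpre := attach_preimage f h_sphere h_ball
  have hi : ∀ m m', f m ∈ Aᶜ → f m = f m' → m = m' := fun m m' h e =>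
    h_inj m m' (hpre.subset h) e
  refine ⟨?_, ?_, ?_, ?_⟩
  · rw [isOpen_compl_iff]
    refine (IsClosed.isCompact ?_).image f.continuous |>.isClosed
    exact isClosed_eq (by fun_prop) continuous_const
  · rw [← compl_inter, compl_univ_iff, ← disjoint_iff_inter_eq_empty, disjoint_left]
    rintro _ ⟨m, hm : (m.1 : E) = 0, rfl⟩ hmA
    exact h_ball m (by simp [hm]) hmA
  · have e := homeomorphOver f Aᶜ h_surj hi
    rw [hpre] at e
    exact (hl.of_homotopyEquiv openBallHomotopyEquiv.symm).of_homeomorph e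
  · have e := homeomorphOver f ((f '' {m | (m.1 : E) = 0})ᶜ ∩ Aᶜ) (fun y hy => h_surj y hy.2)
      (fun m m' h => hi m m' h.2)
    have : f ⁻¹' ((f '' {m | (m.1 : E) = 0})ᶜ ∩ Aᶜ) =
        {m | 0 < ‖(m.1 : E)‖ ∧ ‖(m.1 : E)‖ < 1} := by
      rw [preimage_inter, hpre]
      ext m
      refine and_congr_left fun hm => ⟨fun h => norm_pos_iff.2 fun h0 => h ⟨m, h0, rfl⟩, ?_⟩
      rintro h ⟨m', hm' : (m'.1 : E) = 0, e⟩
      rw [← h_inj m' m (by simp [hm']) e, hm', norm_zero] at h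
      exact h.false
    rw [this] at e
    exact (hs.of_homotopyEquiv puncturedBallHomotopyEquiv.symm).of_homeomorph e

include hA h_sphere h_ball h_inj h_surj in
theorem HasEulerNumber.attach {a l s : ℤ} (ha : HasEulerNumber A a) (hl : HasEulerNumber L l)
    (hs : HasEulerNumber (sphere (0 : E) 1 × L) s) : HasEulerNumber Y (a + l - s) := by
  obtain ⟨h1, h2, h3, h4⟩ := attach_data f h_sphere h_ball h_inj h_surj hl hs
  obtain ⟨e⟩ := attach_homotopyEquiv f hA h_sphere h_ball h_inj h_surj
  exact HasEulerNumber.union h1 hA.isOpen_compl h2 (ha.of_homotopyEquiv e.symm) h3 h4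

include hA h_sphere h_ball h_inj h_surj in
-- The same cover, solved for the boundary. It is applied to the torus, to find the Euler number of
-- a graph without prior knowledge of its homology.
theorem HasEulerNumber.boundary_of_attach {y l s : ℤ} (hy : HasEulerNumber Y y)
    (hl : HasEulerNumber L l) (hs : HasEulerNumber (sphere (0 : E) 1 × L) s) :
    HasEulerNumber A (y + s - l) := by
  obtain ⟨h1, h2, h3, h4⟩ := attach_data f h_sphere h_ball h_inj h_surj hl hs
  obtain ⟨e⟩ := attach_homotopyEquiv f hA h_sphere h_ball h_inj h_surj
  exact (HasEulerNumber.left_of_union h1 hA.isOpen_compl h2 hy h3 h4).of_homotopyEquiv e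

end Attach

end

/-! ### The Euler number of a type two fiber -/

section

open CategoryTheory Metric

theorem unitAddCircle_coe_eq_iff {a b : ℝ} : (a : UnitAddCircle) = b ↔ ∃ n : ℤ, b = a + n := by
  rw [QuotientAddGroup.eq, AddSubgroup.mem_zmultiples_iff]
  refine exists_congr fun n => ?_
  simp only [zsmul_eq_mul, mul_one]
  constructor <;> intro h <;> linarith

theorem unitAddCircle_coe_inj_of_mem {a b : ℝ} (ha : a ∈ Ioo (0 : ℝ) 1) (hb : b ∈ Icc (0 : ℝ) 1)
    (h : (a : UnitAddCircle) = b) : a = b := by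
  obtain ⟨n, hn⟩ := unitAddCircle_coe_eq_iff.1 h
  have h1 : (n : ℝ) < 1 := by linarith [ha.1, hb.2]
  have h2 : (-1 : ℝ) < n := by linarith [ha.2, hb.1]
  have h3 : n < 1 := by exact_mod_cast h1
  have h4 : -1 < n := by exact_mod_cast h2
  have : n = 0 := by omega
  rw [this] at hn
  simpa using hn.symm

theorem real_sphere_card : Nat.card (sphere (0 : ℝ) 1) = 2 := by
  have : sphere (0 : ℝ) 1 = {1, -1} := by
    ext x
    simp [abs_eq zero_le_one]
  rw [this, Nat.card_coe_set_eq, ncard_pair (by norm_num)]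

instance : Finite (sphere (0 : ℝ) 1) := Nat.finite_of_card_ne_zero (by rw [real_sphere_card]; simp)

theorem HasEulerNumber.real_sphere_prod {Z : Type} [TopologicalSpace Z] {z : ℤ}
    (h : HasEulerNumber Z z) : HasEulerNumber (sphere (0 : ℝ) 1 × Z) (2 * z) := by
  have := h.discrete_prod (sphere (0 : ℝ) 1)
  rwa [real_sphere_card] at this

/-- The product is Z with an interval times Z attached along both ends, so the Euler number is z + z
− 2z = 0. -/
theorem HasEulerNumber.unitAddCircle_prod {Z : Type} [TopologicalSpace Z] [CompactSpace Z]
    [T2Space Z] {z : ℤ} (h : HasEulerNumber Z z) : HasEulerNumber (UnitAddCircle × Z) 0 := by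
  let f : C(closedBall (0 : ℝ) 1 × Z, UnitAddCircle × Z) :=
    ⟨fun m => ((((m.1 : ℝ) + 1) / 2 : ℝ), m.2), by
      refine Continuous.prodMk ((AddCircle.continuous_mk' 1).comp ?_) continuous_snd
      fun_prop⟩
  have hA : IsClosed {y : UnitAddCircle × Z | y.1 = 0} :=
    isClosed_eq continuous_fst continuous_const
  have hz : ∀ x ∈ Ioo (0 : ℝ) 1, (x : UnitAddCircle) ≠ 0 := by
    intro x hx h
    have := unitAddCircle_coe_inj_of_mem hx (b := 0) (by simp) (by simpa using h)
    exact hx.1.ne' this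
  have hI : ∀ x : ℝ, ‖x‖ < 1 → (x + 1) / 2 ∈ Ioo (0 : ℝ) 1 := by
    intro x hx
    rw [Real.norm_eq_abs, abs_lt] at hx
    constructor <;> linarith
  have ha : HasEulerNumber {y : UnitAddCircle × Z | y.1 = 0} z := by
    refine h.of_homeomorph ⟨⟨fun x => ⟨(0, x), rfl⟩, fun y => y.1.2, fun x => rfl, ?_⟩, ?_, ?_⟩
    · rintro ⟨⟨t, x⟩, h : t = 0⟩
      subst h
      rfl
    · exact Continuous.subtype_mk (by fun_prop) _
    · exact continuous_snd.comp continuous_subtype_val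
  have key := HasEulerNumber.attach (E := ℝ) (L := Z) f hA ?_ ?_ ?_ ?_ ha h h.real_sphere_prod
  · convert key using 1
    ring
  · rintro ⟨⟨x, hx⟩, l⟩ h1
    simp only [Real.norm_eq_abs] at h1
    change (((x + 1) / 2 : ℝ) : UnitAddCircle) = 0
    rcases (abs_eq zero_le_one).1 h1 with rfl | rfl
    · norm_num
    · norm_num
  · rintro ⟨⟨x, hx⟩, l⟩ h1
    exact hz _ (hI x h1)
  · rintro ⟨⟨x, hx⟩, l⟩ ⟨⟨x', hx'⟩, l'⟩ h1 h2
    have e1 := congrArg Prod.fst h2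
    have e2 : l = l' := congrArg Prod.snd h2
    rw [mem_closedBall_zero_iff, Real.norm_eq_abs, abs_le] at hx'
    have := unitAddCircle_coe_inj_of_mem (hI x h1) ⟨by linarith [hx'.1], by linarith [hx'.2]⟩ e1
    have : x = x' := by linarith
    subst this e2
    rfl
  · rintro ⟨y, l⟩ hy
    obtain ⟨x, ⟨hx0, hx1⟩, rfl⟩ := (AddCircle.coe_image_Ico_eq (1 : ℝ) 0).ge (mem_univ y)
    refine ⟨(⟨2 * x - 1, ?_⟩, l), ?_⟩
    · rw [mem_closedBall_zero_iff, Real.norm_eq_abs, abs_le]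
      constructor <;> linarith
    · refine Prod.ext ?_ rfl
      change (((2 * x - 1 + 1) / 2 : ℝ) : UnitAddCircle) = x
      congr 1
      ring

theorem hasEulerNumber_unitAddCircle : HasEulerNumber UnitAddCircle 0 :=
  ((hasEulerNumber_of_finite (X := PUnit)).unitAddCircle_prod).of_homeomorph
    (Homeomorph.prodPUnit _)

theorem hasEulerNumber_torus : HasEulerNumber Torus2 0 :=
  hasEulerNumber_unitAddCircle.unitAddCircle_prod

theorem HasEulerNumber.circle_prod {Z : Type} [TopologicalSpace Z] [CompactSpace Z]
    [T2Space Z] {z : ℤ} (h : HasEulerNumber Z z) : HasEulerNumber (Circle × Z) 0 :=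
  h.unitAddCircle_prod.of_homeomorph
    ((AddCircle.homeomorphCircle one_ne_zero).prodCongr (Homeomorph.refl Z))

theorem hasEulerNumber_circle : HasEulerNumber Circle 0 :=
  hasEulerNumber_unitAddCircle.of_homeomorph (AddCircle.homeomorphCircle one_ne_zero)

/-- The unit circle as a sphere. -/
def circleHomeoSphere : Circle ≃ₜ sphere (0 : ℂ) 1 where
  toFun := fun z => ⟨z, mem_sphere_zero_iff_norm.2 (Circle.norm_coe z)⟩
  invFun := fun z => ⟨z, z.2⟩
  left_inv := fun _ => rfl
  right_inv := fun _ => rfl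
  continuous_toFun := Continuous.subtype_mk continuous_induced_dom _
  continuous_invFun := continuous_induced_rng.2 continuous_subtype_val

theorem HasEulerNumber.complex_sphere_prod {Z : Type} [TopologicalSpace Z] [CompactSpace Z]
    [T2Space Z] {z : ℤ} (h : HasEulerNumber Z z) : HasEulerNumber (sphere (0 : ℂ) 1 × Z) 0 :=
  h.circle_prod.of_homeomorph (circleHomeoSphere.prodCongr (Homeomorph.refl Z))

/-! ### Polygon sides -/

theorem norm_polygonSide (k j : ℕ) (t : ℝ) : ‖polygonSide k j t‖ = 1 := by
  unfold polygonSide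
  rw [show (2 * Real.pi * Complex.I * ((j + t : ℝ) / (k : ℝ) : ℝ) : ℂ) =
    ((2 * Real.pi * ((j + t) / k) : ℝ) : ℂ) * Complex.I by push_cast; ring]
  exact Complex.norm_exp_ofReal_mul_I _

/-- If `x` in [0, 1) is the fraction of a full turn at which z lies, the integral part of `x * k` is
the side and its fractional part is the parameter. -/
theorem exists_polygonSide_eq {k : ℕ} (hk : 0 < k) {z : ℂ} (hz : ‖z‖ = 1) :
    ∃ j : Fin k, ∃ t ∈ Ico (0 : ℝ) 1, polygonSide k j t = z := by
  have hpi := Real.pi_pos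
  have hk' : (0 : ℝ) < k := by exact_mod_cast hk
  obtain ⟨x, ⟨hx0, hx1⟩, hx⟩ := (AddCircle.coe_image_Ico_eq (1 : ℝ) 0).ge
    (mem_univ ((Complex.arg z / (2 * Real.pi) : ℝ) : UnitAddCircle))
  obtain ⟨n, hn⟩ := unitAddCircle_coe_eq_iff.1 hx
  rw [zero_add] at hx1
  have hu : 0 ≤ x * k := by positivity
  have hj : ⌊x * k⌋₊ < k := by
    rw [Nat.floor_lt hu]
    nlinarith
  refine ⟨⟨⌊x * k⌋₊, hj⟩, x * k - ⌊x * k⌋₊, ⟨by linarith [Nat.floor_le hu],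
    by linarith [Nat.lt_floor_add_one (x * k)]⟩, ?_⟩
  have harg : (Complex.arg z : ℂ) = 2 * Real.pi * x + n * (2 * Real.pi) := by
    have : Complex.arg z = 2 * Real.pi * x + n * (2 * Real.pi) := by
      field_simp at hn
      linarith
    exact_mod_cast congrArg (fun r : ℝ => (r : ℂ)) this
  have := Complex.norm_mul_exp_arg_mul_I z
  rw [hz, harg] at this
  rw [← this, polygonSide]
  simp only [Complex.ofReal_one, one_mul]
  rw [Complex.exp_eq_exp_iff_exists_int]
  refine ⟨-n, ?_⟩
  push_cast
  have : (k : ℂ) ≠ 0 := by exact_mod_cast hk.ne'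
  field_simp
  ring

namespace PolygonalGraph

variable (G : PolygonalGraph)

instance : Fintype G.E := G.fintypeE
instance : Fintype G.F := G.fintypeF

theorem isCompact_carrier : IsCompact G.carrier :=
  G.V.finite_toSet.isCompact.union
    (isCompact_iUnion fun e => isCompact_Icc.image_of_continuousOn (G.continuousOn_edge e))

theorem edge_mem_carrier (e : G.E) {t : ℝ} (ht : t ∈ Icc (0 : ℝ) 1) : G.edge e t ∈ G.carrier :=
  Or.inr (mem_iUnion.2 ⟨e, t, ht, rfl⟩)

theorem cell_sphere_mem (φ : G.F) {z : ℂ} (hz : ‖z‖ = 1) : G.cell φ z ∈ G.carrier := by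
  obtain ⟨j, t, ht, rfl⟩ := exists_polygonSide_eq (G.sides_pos φ) hz
  rw [G.cell_side φ j t ⟨ht.1, ht.2.le⟩]
  refine G.edge_mem_carrier _ ?_
  split_ifs
  · exact ⟨ht.1, ht.2.le⟩
  · exact ⟨by linarith [ht.2], by linarith [ht.1]⟩

theorem cell_ball_notMem (φ : G.F) {z : ℂ} (hz : ‖z‖ < 1) : G.cell φ z ∉ G.carrier := by
  have : G.cell φ z ∈ ⋃ f, G.cell f '' ball 0 1 :=
    mem_iUnion.2 ⟨φ, z, mem_ball_zero_iff.2 hz, rfl⟩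
  rw [G.iUnion_cell] at this
  exact this

theorem exists_cell_eq {y : Torus2} (hy : y ∉ G.carrier) :
    ∃ φ, ∃ z : ℂ, ‖z‖ < 1 ∧ G.cell φ z = y := by
  have : y ∈ ⋃ f, G.cell f '' ball 0 1 := by
    rw [G.iUnion_cell]
    exact hy
  obtain ⟨φ, z, hz, h⟩ := mem_iUnion.1 this
  exact ⟨φ, z, mem_ball_zero_iff.1 hz, h⟩

theorem cell_inj {φ φ' : G.F} {z z' : ℂ} (hz : ‖z‖ < 1) (hz' : ‖z'‖ ≤ 1)
    (h : G.cell φ z = G.cell φ' z') : φ = φ' ∧ z = z' := by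
  have hz'' : ‖z'‖ < 1 := lt_of_le_of_ne hz' fun e =>
    G.cell_ball_notMem φ hz (h ▸ G.cell_sphere_mem φ' e)
  have := G.injOn_cell (x₁ := (φ, z)) (x₂ := (φ', z')) ⟨mem_univ _, mem_ball_zero_iff.2 hz⟩
    ⟨mem_univ _, mem_ball_zero_iff.2 hz''⟩ h
  exact ⟨congrArg Prod.fst this, congrArg Prod.snd this⟩

theorem continuous_discrete_family {I Z W : Type} [TopologicalSpace I] [DiscreteTopology I]
    [TopologicalSpace Z] [TopologicalSpace W] {f : Z × I → W}
    (h : ∀ i, Continuous fun z => f (z, i)) : Continuous f := by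
  rw [continuous_prod_of_discrete_right]
  exact h

/-- The faces, as a discrete space. -/
instance : TopologicalSpace G.F := ⊥
instance : DiscreteTopology G.F := ⟨rfl⟩
instance : TopologicalSpace G.E := ⊥
instance : DiscreteTopology G.E := ⟨rfl⟩

/-- All polygons together. -/
def cells : C(closedBall (0 : ℂ) 1 × G.F, Torus2) :=
  ⟨fun m => G.cell m.2 m.1, continuous_discrete_family fun φ =>
    (G.continuousOn_cell φ).comp_continuous continuous_subtype_val fun m => m.2⟩

/-- The Euler number of the graph is minus the number of polygons. -/
theorem hasEulerNumber_carrier : HasEulerNumber G.carrier (-(Nat.card G.F : ℤ)) := by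
  have hF : HasEulerNumber G.F (Nat.card G.F) := hasEulerNumber_of_finite
  -- The torus is the graph with discs attached along circles: with y = 0 for the torus, s = 0 for
  -- the circles and l = |F| the formula gives −|F|.
  have key := HasEulerNumber.boundary_of_attach (E := ℂ) (L := G.F) G.cells
    G.isCompact_carrier.isClosed (fun m hm => G.cell_sphere_mem m.2 hm)
    (fun m hm => G.cell_ball_notMem m.2 hm) ?_ ?_ hasEulerNumber_torus hF hF.complex_sphere_prod
  · simpa using key
  · rintro ⟨z, φ⟩ ⟨z', φ'⟩ hz h
    obtain ⟨rfl, h2⟩ := G.cell_inj hz (mem_closedBall_zero_iff.1 z'.2) h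
    exact Prod.ext (Subtype.ext h2) rfl
  · intro y hy
    obtain ⟨φ, z, hz, rfl⟩ := G.exists_cell_eq hy
    exact ⟨(⟨z, mem_closedBall_zero_iff.2 hz.le⟩, φ), rfl⟩

/-- The edges of the graph, as maps to the graph. -/
def edges : C(closedBall (0 : ℝ) 1 × G.E, G.carrier) :=
  ⟨fun m => ⟨G.edge m.2 (((m.1 : ℝ) + 1) / 2), G.edge_mem_carrier _ (by
      have := m.1.2
      rw [mem_closedBall_zero_iff, Real.norm_eq_abs, abs_le] at this
      constructor <;> linarith [this.1, this.2])⟩, by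
    refine Continuous.subtype_mk (continuous_discrete_family fun e => ?_) _
    refine (G.continuousOn_edge e).comp_continuous (by fun_prop) fun m => ?_
    have := m.2
    rw [mem_closedBall_zero_iff, Real.norm_eq_abs, abs_le] at this
    constructor <;> linarith [this.1, this.2]⟩

/-- The Euler number of the graph is the number of vertices minus the number of edges. -/
theorem hasEulerNumber_carrier' :
    HasEulerNumber G.carrier (G.V.card - (Nat.card G.E : ℤ)) := by
  have hE : HasEulerNumber G.E (Nat.card G.E) := hasEulerNumber_of_finite
  have := isCompact_iff_compactSpace.1 G.isCompact_carrier
  have hmem : ∀ x : ℝ, ‖x‖ < 1 → (x + 1) / 2 ∈ Ioo (0 : ℝ) 1 := by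
    intro x hx
    rw [Real.norm_eq_abs, abs_lt] at hx
    constructor <;> linarith
  have hVfin : (Subtype.val ⁻¹' (G.V : Set Torus2) : Set G.carrier).Finite :=
    G.V.finite_toSet.preimage Subtype.val_injective.injOn
  have := hVfin.to_subtype
  have hV : HasEulerNumber (Subtype.val ⁻¹' (G.V : Set Torus2) : Set G.carrier) G.V.card := by
    convert hasEulerNumber_of_finite (X := (Subtype.val ⁻¹' (G.V : Set Torus2) : Set G.carrier))
      using 2
    rw [Nat.card_coe_set_eq, ncard_preimage_of_injective_subset_range Subtype.val_injective
      (by rw [Subtype.range_coe]; exact subset_union_left), ncard_coe_finset]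
  -- Edges are attached to the vertices along their two ends, which gives |V| + |E| − 2|E|.
  have key := HasEulerNumber.attach (E := ℝ) (L := G.E) (Y := G.carrier) G.edges
    (A := Subtype.val ⁻¹' (G.V : Set Torus2)) hVfin.isClosed
    ?_ ?_ ?_ ?_ hV hE hE.real_sphere_prod
  · convert key using 1
    ring
  · rintro ⟨⟨x, hx⟩, e⟩ h1
    simp only [Real.norm_eq_abs] at h1
    change G.edge e ((x + 1) / 2) ∈ G.V
    rcases (abs_eq zero_le_one).1 h1 with rfl | rfl
    · norm_num
      exact G.edge_one_mem e
    · norm_num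
      exact G.edge_zero_mem e
  · rintro ⟨⟨x, hx⟩, e⟩ h1
    exact G.edge_notMem e _ (hmem x h1)
  · rintro ⟨⟨x, hx⟩, e⟩ ⟨⟨x', hx'⟩, e'⟩ h1 h2
    have h2' : G.edge e ((x + 1) / 2) = G.edge e' ((x' + 1) / 2) := congrArg Subtype.val h2
    have h1' : ‖x'‖ < 1 := by
      refine lt_of_le_of_ne (mem_closedBall_zero_iff.1 hx') fun h3 => ?_
      refine G.edge_notMem e _ (hmem x h1) ?_
      rw [h2']
      rw [Real.norm_eq_abs] at h3
      rcases (abs_eq zero_le_one).1 h3 with rfl | rfl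
      · norm_num
        exact G.edge_one_mem e'
      · norm_num
        exact G.edge_zero_mem e'
    have h4 := G.injOn_edge (x₁ := (e, _)) (x₂ := (e', _)) ⟨mem_univ _, hmem x h1⟩
      ⟨mem_univ _, hmem x' h1'⟩ h2'
    have h5 : x = x' := by
      have := congrArg Prod.snd h4
      simp only at this
      linarith
    have h6 : e = e' := congrArg Prod.fst h4
    subst h5 h6
    rfl
  · rintro ⟨y, hy | hy⟩ hyV
    · exact absurd hy hyV
    · obtain ⟨e, t, ht, rfl⟩ := mem_iUnion.1 hy
      refine ⟨(⟨2 * t - 1, ?_⟩, e), Subtype.ext ?_⟩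
      · rw [mem_closedBall_zero_iff, Real.norm_eq_abs, abs_le]
        constructor <;> linarith [ht.1, ht.2]
      · change G.edge e ((2 * t - 1 + 1) / 2) = _
        congr 1
        ring

/-- Euler's formula on the torus. -/
theorem euler_formula : G.V.card + Nat.card G.F = Nat.card G.E := by
  have := G.hasEulerNumber_carrier.unique G.hasEulerNumber_carrier'
  omega

end PolygonalGraph

/-! ### Collapsed tori -/

section Collapsed

variable {Γ : Set Torus2}

theorem CollapsedTorus.continuous_proj : Continuous (CollapsedTorus.proj Γ) :=
  continuous_fst.quotient_lift _

theorem collapsed_mk_eq_iff {a b : Torus2 × Circle} :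
    (Quotient.mk (collapseSetoid Γ) a) = Quotient.mk _ b ↔ a = b ∨ (a.1 = b.1 ∧ a.1 ∈ Γ) :=
  Quotient.eq

instance : CompactSpace (CollapsedTorus Γ) := Quotient.compactSpace

/-- Points over different base points are separated by the projection. Distinct points over the same
base point lie off Γ, where nothing is identified and, since the complement of Γ is open, the image
of an open product set is open. -/
theorem collapsed_t2 (hΓ : IsClosed Γ) : T2Space (CollapsedTorus Γ) := by
  refine ⟨fun a b hab => ?_⟩
  by_cases h : CollapsedTorus.proj Γ a = CollapsedTorus.proj Γ b
  · induction a using Quotient.inductionOn with | _ a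
    induction b using Quotient.inductionOn with | _ b
    obtain ⟨t, x⟩ := a
    obtain ⟨t', y⟩ := b
    change t = t' at h
    subst h
    have ht : t ∉ Γ := fun ht => hab (collapsed_mk_eq_iff.2 (Or.inr ⟨rfl, ht⟩))
    have hxy : x ≠ y := fun h => hab (by rw [h])
    obtain ⟨U, W, hU, hW, hxU, hyW, hd⟩ := t2_separation hxy
    have key : ∀ U : Set Circle, IsOpen U → IsOpen
        (Quotient.mk (collapseSetoid Γ) '' (Γᶜ ×ˢ U)) ∧ ∀ s z,
        Quotient.mk (collapseSetoid Γ) (s, z) ∈ Quotient.mk (collapseSetoid Γ) '' (Γᶜ ×ˢ U) ↔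
        (s, z) ∈ Γᶜ ×ˢ U := by
      intro U hU
      have h2 : ∀ p, Quotient.mk (collapseSetoid Γ) p ∈
          Quotient.mk (collapseSetoid Γ) '' (Γᶜ ×ˢ U) ↔ p ∈ Γᶜ ×ˢ U := by
        intro p
        refine ⟨?_, fun h => ⟨_, h, rfl⟩⟩
        rintro ⟨q, hq, e⟩
        rcases collapsed_mk_eq_iff.1 e with rfl | ⟨-, h⟩
        · exact hq
        · exact absurd h hq.1
      refine ⟨?_, fun s z => h2 (s, z)⟩
      rw [← isQuotientMap_quotient_mk'.isOpen_preimage]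
      convert hΓ.isOpen_compl.prod hU using 1
      ext p
      exact h2 p
    refine ⟨_, _, (key U hU).1, (key W hW).1, ((key U hU).2 _ _).2 ⟨ht, hxU⟩,
      ((key W hW).2 _ _).2 ⟨ht, hyW⟩, ?_⟩
    rw [disjoint_left]
    intro q hq hq'
    induction q using Quotient.inductionOn with | _ q
    exact disjoint_left.1 hd (((key U hU).2 q.1 q.2).1 hq).2 (((key W hW).2 q.1 q.2).1 hq').2
  · exact separated_by_continuous CollapsedTorus.continuous_proj h

/-- The part of the collapsed torus over the graph. -/
def collapsedOver (hΓ : IsClosed Γ) : (CollapsedTorus.proj Γ ⁻¹' Γ : Set (CollapsedTorus Γ)) ≃ₜ Γ :=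
  haveI : CompactSpace (CollapsedTorus.proj Γ ⁻¹' Γ : Set (CollapsedTorus Γ)) :=
    isCompact_iff_compactSpace.1 (hΓ.preimage CollapsedTorus.continuous_proj).isCompact
  Continuous.homeoOfEquivCompactToT2
    (f := Equiv.ofBijective (Γ.restrictPreimage (CollapsedTorus.proj Γ)) ⟨by
        rintro ⟨a, ha⟩ ⟨b, hb⟩ h
        have h' : CollapsedTorus.proj Γ a = CollapsedTorus.proj Γ b := congrArg Subtype.val h
        apply Subtype.ext
        induction a using Quotient.inductionOn with | _ a
        induction b using Quotient.inductionOn with | _ b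
        exact collapsed_mk_eq_iff.2 (Or.inr ⟨h', ha⟩), by
        rintro ⟨t, ht⟩
        exact ⟨⟨Quotient.mk _ (t, 1), ht⟩, rfl⟩⟩)
    (CollapsedTorus.continuous_proj.restrictPreimage)

end Collapsed

namespace PolygonalGraph

variable (G : PolygonalGraph)

/-- The solid cylinders over the polygons. -/
def solidCells : C(closedBall (0 : ℂ) 1 × (G.F × Circle), CollapsedTorus G.carrier) :=
  ⟨fun m => Quotient.mk _ (G.cell m.2.1 m.1, m.2.2), by
    refine continuous_quotient_mk'.comp (Continuous.prodMk ?_ (by fun_prop))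
    exact G.cells.continuous.comp (by fun_prop :
      Continuous fun m : closedBall (0 : ℂ) 1 × (G.F × Circle) => (m.1, m.2.1))⟩

/-- Over Γ the space is a copy of Γ, and over each open polygon it is an open disc times a circle.
The circle factors make these cells contribute 0, so the value is that of Γ. -/
theorem hasEulerNumber_collapsedTorus :
    HasEulerNumber (CollapsedTorus G.carrier) (-(Nat.card G.F : ℤ)) := by
  have hclosed := G.isCompact_carrier.isClosed
  have := collapsed_t2 hclosed
  have hL : HasEulerNumber (G.F × Circle) 0 := by
    simpa using hasEulerNumber_circle.discrete_prod G.F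
  have ha : HasEulerNumber (CollapsedTorus.proj G.carrier ⁻¹' G.carrier :
      Set (CollapsedTorus G.carrier)) (-(Nat.card G.F : ℤ)) :=
    G.hasEulerNumber_carrier.of_homeomorph (collapsedOver hclosed).symm
  have key := HasEulerNumber.attach (E := ℂ) (L := G.F × Circle) G.solidCells
    (hclosed.preimage CollapsedTorus.continuous_proj) (fun m hm => G.cell_sphere_mem m.2.1 hm)
    (fun m hm => G.cell_ball_notMem m.2.1 hm) ?_ ?_ ha hL hL.complex_sphere_prod
  · simpa using key
  · rintro ⟨z, φ, w⟩ ⟨z', φ', w'⟩ hz h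
    have hz0 := G.cell_ball_notMem φ hz
    rcases collapsed_mk_eq_iff.1 h with h | ⟨-, h⟩
    · obtain ⟨rfl, h2⟩ := G.cell_inj hz (mem_closedBall_zero_iff.1 z'.2) (congrArg Prod.fst h)
      have h3 : w = w' := congrArg Prod.snd h
      exact Prod.ext (Subtype.ext h2) (Prod.ext rfl h3)
    · exact absurd h hz0
  · intro y hy
    induction y using Quotient.inductionOn with | _ y
    obtain ⟨φ, z, hz, h⟩ := G.exists_cell_eq (y := y.1) hy
    exact ⟨(⟨z, mem_closedBall_zero_iff.2 hz.le⟩, φ, y.2),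
      congrArg (Quotient.mk _) (Prod.ext h rfl)⟩

/-- The number of regions is the number of polygons. -/
theorem numRegions_carrier : numRegions G.carrier = Nat.card G.F := by
  have hex : ∀ y : (G.carrierᶜ : Set Torus2), ∃ φ, y.1 ∈ G.cell φ '' ball 0 1 := fun y => by
    obtain ⟨φ, z, hz, h⟩ := G.exists_cell_eq y.2
    exact ⟨φ, z, mem_ball_zero_iff.2 hz, h⟩
  choose c hc using hex
  have huniq : ∀ y φ, y.1 ∈ G.cell φ '' closedBall 0 1 → c y = φ := by
    rintro y φ ⟨z, hz, h⟩
    obtain ⟨z', hz', h'⟩ := hc y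
    exact (G.cell_inj (mem_ball_zero_iff.1 hz') (mem_closedBall_zero_iff.1 hz)
      (h'.trans h.symm)).1
  -- The closed polygons are compact and, off the graph, meet only in equal open polygons, so the
  -- preimage of any finite set of polygons is closed.
  have hcont : Continuous c := by
    refine continuous_iff_isClosed.2 fun s _ => ?_
    have : c ⁻¹' s = Subtype.val ⁻¹' (⋃ φ ∈ s, G.cell φ '' closedBall 0 1) := by
      ext y
      simp only [mem_preimage, mem_iUnion, exists_prop]
      refine ⟨fun h => ⟨c y, h, image_mono ball_subset_closedBall (hc y)⟩, ?_⟩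
      rintro ⟨φ, hφ, h⟩
      rwa [huniq y φ h]
    rw [this]
    refine IsClosed.preimage continuous_subtype_val ?_
    refine (s.toFinite.isClosed_biUnion fun φ _ => ?_)
    exact ((isCompact_closedBall _ _).image_of_continuousOn (G.continuousOn_cell φ)).isClosed
  refine Nat.card_congr (Equiv.ofBijective hcont.connectedComponentsLift ⟨?_, fun φ => ?_⟩)
  · intro a b
    obtain ⟨y, rfl⟩ := _root_.ConnectedComponents.surjective_coe a
    obtain ⟨y', rfl⟩ := _root_.ConnectedComponents.surjective_coe b
    intro h
    simp only [Continuous.connectedComponentsLift_apply_coe] at h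
    rw [_root_.ConnectedComponents.coe_eq_coe']
    have hpre : IsPreconnected (Subtype.val ⁻¹' (G.cell (c y) '' ball 0 1) :
        Set (G.carrierᶜ : Set Torus2)) := by
      rw [← Topology.IsInducing.subtypeVal.isPreconnected_image, Subtype.image_preimage_coe,
        inter_eq_right.2]
      · exact (convex_ball _ _).isPreconnected.image _
          ((G.continuousOn_cell _).mono ball_subset_closedBall)
      · rintro _ ⟨z, hz, rfl⟩
        exact G.cell_ball_notMem _ (mem_ball_zero_iff.1 hz)
    exact hpre.subset_connectedComponent (x := y') (by rw [h]; exact hc y') (hc y)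
  · let y : (G.carrierᶜ : Set Torus2) := ⟨G.cell φ 0, G.cell_ball_notMem φ (by simp)⟩
    exact ⟨(y : _root_.ConnectedComponents _),
      (hcont.connectedComponentsLift_apply_coe y).trans (huniq y φ ⟨0, by simp, rfl⟩)⟩

/-- A type two singular fiber with one region has Euler number `-1` and conversely. -/
theorem hasEulerNumber_fiber_iff {X : Type} [TopologicalSpace X] {p : X → Torus2}
    (h : IsTypeTwoFiber G.carrier p) :
    HasEulerNumber X (-1) ↔ numRegions G.carrier = 1 := by
  obtain ⟨e, -⟩ := h
  have hX := G.hasEulerNumber_collapsedTorus.of_homeomorph e.symm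
  rw [numRegions_carrier]
  constructor
  · intro h1
    have := hX.unique h1
    omega
  · intro h1
    rw [h1] at hX
    exact_mod_cast hX

end PolygonalGraph

end

section

open Metric

/-! ### Lifting to the plane -/

/-- Precomposing with the radial retraction extends the map to the whole plane, which is simply
connected, so it lifts through the covering of the circle by the line. -/
theorem exists_real_lift {f : ℂ → UnitAddCircle} (hf : ContinuousOn f (closedBall 0 1)) :
    ∃ y : ℂ → ℝ, Continuous y ∧ ∀ z, ‖z‖ ≤ 1 → (y z : UnitAddCircle) = f z := by
  obtain ⟨e, he⟩ := QuotientAddGroup.mk_surjective (f (ballRetract (0 : ℂ)))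
  obtain ⟨F, ⟨-, hF⟩, -⟩ := (AddCircle.isCoveringMap_coe (1 : ℝ)).existsUnique_continuousMap_lifts
    (⟨fun z => f (ballRetract z), hf.comp_continuous
      (continuous_subtype_val.comp continuous_ballRetract) fun z => (ballRetract z).2⟩ : C(ℂ, UnitAddCircle))
    0 e he
  refine ⟨F, F.continuous, fun z hz => ?_⟩
  have := congrFun hF z
  simp only [Function.comp_apply, ContinuousMap.coe_mk, ballRetract_of_le hz] at this
  exact this

/-- A continuous real function with countable range is constant. -/
theorem eq_of_countable_range {X : Type} [TopologicalSpace X] [PreconnectedSpace X] {f : X → ℝ}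
    (hf : Continuous f) (hc : (range f).Countable) (x y : X) : f x = f y :=
  hc.isTotallyDisconnected _ subset_rfl (isPreconnected_range hf) (mem_range_self x)
    (mem_range_self y)

theorem int_valued_const {f : ℝ → ℝ} (hf : ContinuousOn f (Icc 0 1))
    (hz : ∀ t ∈ Icc (0 : ℝ) 1, ∃ n : ℤ, f t = n) {s t : ℝ} (hs : s ∈ Icc (0 : ℝ) 1)
    (ht : t ∈ Icc (0 : ℝ) 1) : f s = f t := by
  have := isPreconnected_iff_preconnectedSpace.1 (isPreconnected_Icc (a := (0 : ℝ)) (b := 1))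
  refine eq_of_countable_range (X := Icc (0 : ℝ) 1) (f := fun t => f t)
    hf.domRestrict ((countable_range (fun n : ℤ => (n : ℝ))).mono ?_) ⟨s, hs⟩ ⟨t, ht⟩
  rintro _ ⟨x, rfl⟩
  obtain ⟨n, hn⟩ := hz x x.2
  exact ⟨n, hn.symm⟩

theorem polygonSide_one (k j : ℕ) : polygonSide k j 1 = polygonSide k (j + 1) 0 := by
  simp [polygonSide]

theorem polygonSide_self {k : ℕ} (hk : k ≠ 0) : polygonSide k k 0 = polygonSide k 0 0 := by
  have : (k : ℂ) ≠ 0 := by exact_mod_cast hk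
  simp [polygonSide, div_self this, Complex.exp_two_pi_mul_I]

theorem continuous_polygonSide (k j : ℕ) : Continuous (polygonSide k j) := by
  unfold polygonSide
  fun_prop

theorem ZMod.val_add_one' {n : ℕ} [NeZero n] (j : ZMod n) :
    (j.val + 1 < n ∧ (j + 1).val = j.val + 1) ∨ (j.val + 1 = n ∧ (j + 1).val = 0) := by
  have hc : ((j.val + 1 : ℕ) : ZMod n) = j + 1 := by simp
  rcases (Nat.succ_le_of_lt (ZMod.val_lt j)).lt_or_eq with h | h
  · exact Or.inl ⟨h, by rw [← hc, ZMod.val_cast_of_lt h]⟩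
  · refine Or.inr ⟨h, ?_⟩
    rw [← hc, show j.val + 1 = n from h, ZMod.natCast_self, ZMod.val_zero]

theorem polygonSide_one_zmod {n : ℕ} [NeZero n] (j : ZMod n) :
    polygonSide n j.val 1 = polygonSide n (j + 1).val 0 := by
  rw [polygonSide_one]
  rcases ZMod.val_add_one' j with ⟨-, h⟩ | ⟨h, h'⟩
  · rw [h]
  · rw [h, h', polygonSide_self (NeZero.ne n)]

/-- Induction around a cycle. -/
theorem ZMod.cyclic_induction {n : ℕ} [NeZero n] {p : ZMod n → Prop} (h0 : p 0)
    (hs : ∀ j, p j → p (j + 1)) (j : ZMod n) : p j := by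
  have : ∀ m : ℕ, p (m : ZMod n) := fun m => by
    induction m with
    | zero => simpa using h0
    | succ m ih => simpa using hs _ ih
  simpa using this j.val

namespace PolygonalGraph

variable (G : PolygonalGraph) (φ : G.F)

instance : NeZero (G.sides φ) := ⟨(G.sides_pos φ).ne'⟩

/-- The edge and direction of the side `j`, numbered cyclically. -/
def cside (j : ZMod (G.sides φ)) : G.E × Bool := G.side φ ⟨j.val, ZMod.val_lt j⟩

/-- The starting point of an edge. -/
def src (e : G.E) : G.V := ⟨G.edge e 0, G.edge_zero_mem e⟩

/-- The end point of an edge. -/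
def tgt (e : G.E) : G.V := ⟨G.edge e 1, G.edge_one_mem e⟩

/-- The vertex at the corner `j` of a polygon. -/
def cornerVertex (j : ZMod (G.sides φ)) : G.V :=
  if (G.cside φ j).2 then G.src (G.cside φ j).1 else G.tgt (G.cside φ j).1

/-- The point of the side `j` that corresponds to the parameter `s` of the edge. -/
def sidePoint (j : ZMod (G.sides φ)) (s : ℝ) : ℂ :=
  polygonSide (G.sides φ) j.val (if (G.cside φ j).2 then s else 1 - s)

theorem cell_cside (j : ZMod (G.sides φ)) {t : ℝ} (ht : t ∈ Icc (0 : ℝ) 1) :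
    G.cell φ (polygonSide (G.sides φ) j.val t) =
      G.edge (G.cside φ j).1 (if (G.cside φ j).2 then t else 1 - t) :=
  G.cell_side φ ⟨j.val, ZMod.val_lt j⟩ t ht

theorem cell_sidePoint (j : ZMod (G.sides φ)) {s : ℝ} (hs : s ∈ Icc (0 : ℝ) 1) :
    G.cell φ (G.sidePoint φ j s) = G.edge (G.cside φ j).1 s := by
  unfold sidePoint
  have h1 : 1 - s ∈ Icc (0 : ℝ) 1 := ⟨by linarith [hs.2], by linarith [hs.1]⟩
  cases h : (G.cside φ j).2 with
  | true => simp [G.cell_cside φ j hs, h]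
  | false => simp [G.cell_cside φ j h1, h]

theorem norm_sidePoint (j : ZMod (G.sides φ)) (s : ℝ) : ‖G.sidePoint φ j s‖ = 1 :=
  norm_polygonSide _ _ _

theorem continuous_sidePoint (j : ZMod (G.sides φ)) : Continuous (G.sidePoint φ j) := by
  unfold sidePoint
  split_ifs
  · exact continuous_polygonSide _ _
  · exact (continuous_polygonSide _ _).comp (by fun_prop)

theorem cell_corner (j : ZMod (G.sides φ)) :
    G.cell φ (polygonSide (G.sides φ) j.val 0) = G.cornerVertex φ j := by
  rw [G.cell_cside φ j ⟨le_rfl, zero_le_one⟩, cornerVertex]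
  split_ifs <;> simp [src, tgt]

theorem cornerVertex_add_one (j : ZMod (G.sides φ)) : G.cornerVertex φ (j + 1) =
    if (G.cside φ j).2 then G.tgt (G.cside φ j).1 else G.src (G.cside φ j).1 := by
  apply Subtype.ext
  rw [← cell_corner, ← polygonSide_one_zmod, G.cell_cside φ j ⟨zero_le_one, le_rfl⟩]
  split_ifs <;> simp [src, tgt]

variable {φ} (hφ : ∀ f, f = φ)
include hφ

theorem card_cside (e : G.E) : Nat.card {j : ZMod (G.sides φ) // (G.cside φ j).1 = e} = 2 := by
  rw [← G.card_side e]
  refine Nat.card_congr (Equiv.ofBijective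
    (fun j => ⟨⟨φ, ⟨j.1.val, ZMod.val_lt j.1⟩⟩, j.2⟩) ⟨?_, ?_⟩)
  · intro j j' h
    have h' := eq_of_heq (Sigma.mk.inj_iff.1 (congrArg Subtype.val h)).2
    exact Subtype.ext (ZMod.val_injective _ (congrArg Fin.val h'))
  · rintro ⟨⟨f, j⟩, h⟩
    obtain rfl := hφ f
    have hj : ((j : ℕ) : ZMod (G.sides f)).val = j := ZMod.val_cast_of_lt j.2
    refine ⟨⟨((j : ℕ) : ZMod (G.sides f)), ?_⟩, ?_⟩
    · have : (⟨((j : ℕ) : ZMod (G.sides f)).val, ZMod.val_lt _⟩ : Fin (G.sides f)) = j :=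
        Fin.ext hj
      rw [cside, this]
      exact h
    · exact Subtype.ext (Sigma.ext rfl (heq_of_eq (Fin.ext hj)))

theorem exists_partner (j : ZMod (G.sides φ)) : ∃ k, k ≠ j ∧ (G.cside φ k).1 = (G.cside φ j).1 ∧
    ∀ l, (G.cside φ l).1 = (G.cside φ j).1 → l = j ∨ l = k := by
  have h := G.card_cside hφ (G.cside φ j).1
  obtain ⟨a, b, hab, huniv⟩ := Nat.card_eq_two_iff.1 h
  have hl : ∀ l, (G.cside φ l).1 = (G.cside φ j).1 → l = a ∨ l = b := by
    intro l hl
    have : (⟨l, hl⟩ : {k : ZMod (G.sides φ) // (G.cside φ k).1 = (G.cside φ j).1}) ∈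
      ({a, b} : Set _) := huniv ▸ mem_univ _
    rcases this with h | h
    · exact Or.inl (congrArg Subtype.val h)
    · exact Or.inr (congrArg Subtype.val h)
  have hab' : (a : ZMod (G.sides φ)) ≠ b := fun h => hab (Subtype.ext h)
  rcases hl j rfl with h1 | h1
  · exact ⟨b, fun h2 => hab' (h1.symm.trans h2.symm), b.2,
      fun l h3 => (hl l h3).imp_left fun h => h.trans h1.symm⟩
  · exact ⟨a, fun h2 => hab' (h2.trans h1), a.2,
      fun l h3 => (hl l h3).symm.imp_left fun h => h.trans h1.symm⟩

theorem exists_cside (e : G.E) : ∃ j : ZMod (G.sides φ), (G.cside φ j).1 = e := by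
  have h := G.card_cside hφ e
  obtain ⟨a, -⟩ := Nat.card_eq_two_iff.1 h
  exact ⟨a, a.2⟩

theorem sides_eq : G.sides φ = 2 * Nat.card G.E := by
  have h1 : Nat.card (Σ e : G.E, {j : ZMod (G.sides φ) // (G.cside φ j).1 = e}) = G.sides φ := by
    rw [Nat.card_congr (Equiv.sigmaFiberEquiv fun j => (G.cside φ j).1), Nat.card_zmod]
  rw [← h1, Nat.card_sigma]
  simp only [G.card_cside hφ, Finset.sum_const, Finset.card_univ, smul_eq_mul, Nat.card_eq_fintype_card]
  ring

/-- The degree condition excludes isolated vertices, so every vertex is an end of an edge, and every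
edge is a side of the polygon. -/
theorem exists_cornerVertex_eq (v : G.V) : ∃ j : ZMod (G.sides φ), G.cornerVertex φ j = v := by
  have hdeg := G.two_le_degree v v.2
  have : ∃ e, G.src e = v ∨ G.tgt e = v := by
    by_contra! h
    have h0 : IsEmpty {e : G.E // G.edge e 0 = v} := ⟨fun e => (h e).1 (Subtype.ext e.2)⟩
    have h1 : IsEmpty {e : G.E // G.edge e 1 = v} := ⟨fun e => (h e).2 (Subtype.ext e.2)⟩
    simp at hdeg
  obtain ⟨e, he⟩ := this
  obtain ⟨j, rfl⟩ := G.exists_cside hφ e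
  have h1 := G.cornerVertex_add_one φ j
  have h2 : G.cornerVertex φ j =
    if (G.cside φ j).2 then G.src (G.cside φ j).1 else G.tgt (G.cside φ j).1 := rfl
  cases hb : (G.cside φ j).2 <;> rw [hb] at h1 h2 <;> rcases he with he | he
  · exact ⟨_, h1.trans he⟩
  · exact ⟨_, h2.trans he⟩
  · exact ⟨_, h2.trans he⟩
  · exact ⟨_, h1.trans he⟩

theorem cell_surjective (y : Torus2) : ∃ z : ℂ, ‖z‖ ≤ 1 ∧ G.cell φ z = y := by
  by_cases hy : y ∈ G.carrier
  · have hE : ∀ e, ∀ t ∈ Icc (0 : ℝ) 1, ∃ z : ℂ, ‖z‖ ≤ 1 ∧ G.cell φ z = G.edge e t := by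
      intro e t ht
      obtain ⟨j, rfl⟩ := G.exists_cside hφ e
      exact ⟨G.sidePoint φ j t, (G.norm_sidePoint φ j t).le, G.cell_sidePoint φ j ht⟩
    rcases hy with hy | hy
    · obtain ⟨j, hj⟩ := G.exists_cornerVertex_eq hφ ⟨y, hy⟩
      exact ⟨_, (norm_polygonSide _ _ _).le, (G.cell_corner φ j).trans (congrArg Subtype.val hj)⟩
    · obtain ⟨e, t, ht, rfl⟩ := mem_iUnion.1 hy
      exact hE e t ht
  · obtain ⟨f, z, hz, h⟩ := G.exists_cell_eq hy
    obtain rfl := hφ f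
    exact ⟨z, hz.le, h⟩

omit hφ in
/-- Every point of the circle is on a side. -/
theorem exists_side_eq {z : ℂ} (hz : ‖z‖ = 1) : ∃ j : ZMod (G.sides φ), ∃ t ∈ Ico (0 : ℝ) 1,
    polygonSide (G.sides φ) j.val t = z := by
  obtain ⟨j, t, ht, h⟩ := exists_polygonSide_eq (G.sides_pos φ) hz
  exact ⟨((j : ℕ) : ZMod (G.sides φ)), t, ht, by rwa [ZMod.val_cast_of_lt j.2]⟩

omit hφ in
/-- A boundary point that is not mapped to a vertex is inside a side. -/
theorem exists_sidePoint_eq {z : ℂ} (hz : ‖z‖ = 1) (hV : G.cell φ z ∉ G.V) :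
    ∃ j : ZMod (G.sides φ), ∃ s ∈ Ioo (0 : ℝ) 1, G.sidePoint φ j s = z := by
  obtain ⟨j, t, ht, rfl⟩ := G.exists_side_eq (φ := φ) hz
  have ht0 : t ≠ 0 := by
    rintro rfl
    rw [cell_corner] at hV
    exact hV (G.cornerVertex φ j).2
  have ht' : 0 < t := lt_of_le_of_ne ht.1 ht0.symm
  refine ⟨j, if (G.cside φ j).2 then t else 1 - t, ?_, ?_⟩
  · split_ifs
    · exact ⟨ht', ht.2⟩
    · exact ⟨by linarith [ht.2], by linarith⟩
  · unfold sidePoint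
    split_ifs <;> simp

omit hφ in
theorem edge_inj {e e' : G.E} {s s' : ℝ} (hs : s ∈ Ioo (0 : ℝ) 1) (hs' : s' ∈ Ioo (0 : ℝ) 1)
    (h : G.edge e s = G.edge e' s') : e = e' ∧ s = s' := by
  have := G.injOn_edge (x₁ := (e, s)) (x₂ := (e', s')) ⟨mem_univ _, hs⟩ ⟨mem_univ _, hs'⟩ h
  exact ⟨congrArg Prod.fst this, congrArg Prod.snd this⟩

omit hφ in
/-- Lifts of two sides glued to the same edge differ by a translation. -/
theorem lift_side_sub {y : ℂ → ℝ} (π : Torus2 → UnitAddCircle) (hyc : Continuous y)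
    (hyl : ∀ z, ‖z‖ ≤ 1 → (y z : UnitAddCircle) = π (G.cell φ z)) {j k : ZMod (G.sides φ)}
    (hjk : (G.cside φ j).1 = (G.cside φ k).1) {s : ℝ} (hs : s ∈ Icc (0 : ℝ) 1) :
    y (G.sidePoint φ j s) - y (G.sidePoint φ k s) =
      y (G.sidePoint φ j 0) - y (G.sidePoint φ k 0) := by
  refine int_valued_const (f := fun s => y (G.sidePoint φ j s) - y (G.sidePoint φ k s))
    ((hyc.comp (G.continuous_sidePoint φ j)).sub
      (hyc.comp (G.continuous_sidePoint φ k))).continuousOn (fun t ht => ?_) hs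
      ⟨le_rfl, zero_le_one⟩
  have : (y (G.sidePoint φ k t) : UnitAddCircle) = y (G.sidePoint φ j t) := by
    rw [hyl _ (G.norm_sidePoint φ k t).le, hyl _ (G.norm_sidePoint φ j t).le,
      G.cell_sidePoint φ k ht, G.cell_sidePoint φ j ht, hjk]
  obtain ⟨n, hn⟩ := unitAddCircle_coe_eq_iff.1 this
  exact ⟨n, by linarith⟩

/-- A linear combination of the lifted coordinates that is compatible with the gluing of the
sides is zero. -/
theorem lift_combination_eq_zero {y₁ y₂ : ℂ → ℝ} (hy₁ : Continuous y₁) (hy₂ : Continuous y₂)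
    (hy : ∀ z, ‖z‖ ≤ 1 → torusMk (y₁ z, y₂ z) = G.cell φ z) {a b : ℝ}
    (hab : ∀ j k, (G.cside φ j).1 = (G.cside φ k).1 →
      a * y₁ (G.sidePoint φ j 0) + b * y₂ (G.sidePoint φ j 0) =
        a * y₁ (G.sidePoint φ k 0) + b * y₂ (G.sidePoint φ k 0)) : a = 0 ∧ b = 0 := by
  set F : ℂ → ℝ := fun z => a * y₁ z + b * y₂ z with hF
  have hFc : Continuous F := by fun_prop
  have hy1 : ∀ z, ‖z‖ ≤ 1 → (y₁ z : UnitAddCircle) = (G.cell φ z).1 :=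
    fun z hz => congrArg Prod.fst (hy z hz)
  have hy2 : ∀ z, ‖z‖ ≤ 1 → (y₂ z : UnitAddCircle) = (G.cell φ z).2 :=
    fun z hz => congrArg Prod.snd (hy z hz)
  have hside : ∀ j k, (G.cside φ j).1 = (G.cside φ k).1 → ∀ s ∈ Icc (0 : ℝ) 1,
      F (G.sidePoint φ j s) = F (G.sidePoint φ k s) := by
    intro j k hjk s hs
    have e1 := G.lift_side_sub Prod.fst hy₁ hy1 hjk hs
    have e2 := G.lift_side_sub Prod.snd hy₂ hy2 hjk hs
    have e3 := hab j k hjk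
    simp only [hF]
    linear_combination a * e1 + b * e2 + e3
  have hwd : ∀ z z', ‖z‖ ≤ 1 → ‖z'‖ ≤ 1 → G.cell φ z = G.cell φ z' → G.cell φ z ∉ G.V →
      F z = F z' := by
    intro z z' hz hz' h hV
    rcases hz.lt_or_eq with hz1 | hz1
    · rw [(G.cell_inj hz1 hz' h).2]
    rcases hz'.lt_or_eq with hz1' | hz1'
    · rw [(G.cell_inj hz1' hz h.symm).2]
    obtain ⟨j, s, hs, rfl⟩ := G.exists_sidePoint_eq hz1 hV
    obtain ⟨k, s', hs', rfl⟩ := G.exists_sidePoint_eq hz1' (h ▸ hV)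
    rw [G.cell_sidePoint φ j (Ioo_subset_Icc_self hs),
      G.cell_sidePoint φ k (Ioo_subset_Icc_self hs')] at h
    obtain ⟨h1, rfl⟩ := G.edge_inj hs hs' h
    exact hside j k h1 s (Ioo_subset_Icc_self hs)
  -- The identifications of corners are not known at this stage, so the combination is made into a
  -- function only off the finitely many vertices.
  let U : Set Torus2 := {y | y ∉ G.V}
  let Ft : U → ℝ := fun y => F (G.cell_surjective hφ y).choose
  have hFt : ∀ z, ‖z‖ ≤ 1 → ∀ h : G.cell φ z ∈ U, Ft ⟨G.cell φ z, h⟩ = F z := by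
    intro z hz h
    have h1 := (G.cell_surjective hφ (G.cell φ z)).choose_spec
    exact hwd _ _ h1.1 hz h1.2 (h1.2.symm ▸ h)
  let C : closedBall (0 : ℂ) 1 → Torus2 := fun z => G.cell φ z
  have hC : Continuous C := (G.continuousOn_cell φ).comp_continuous continuous_subtype_val
    fun z => z.2
  have hCs : Function.Surjective C := fun y => by
    obtain ⟨z, hz, h⟩ := G.cell_surjective hφ y
    exact ⟨⟨z, mem_closedBall_zero_iff.2 hz⟩, h⟩
  have hq := (hC.isClosedMap.restrictPreimage U).isQuotientMap hC.restrictPreimage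
    (hCs.restrictPreimage U)
  have hFtc : Continuous Ft := by
    rw [hq.continuous_iff]
    have : Ft ∘ U.restrictPreimage C = fun z => F z.1.1 := by
      funext z
      exact hFt z.1.1 (mem_closedBall_zero_iff.1 z.1.2) z.2
    rw [this]
    fun_prop
  -- Along a closed line that misses the vertices, the descended function differs from a linear one
  -- by values in the countable set aℤ + bℤ, hence by a constant. Comparing both ends of one period
  -- shows that the linear part is zero. Coordinate lines at a position avoided by all vertices then
  -- suffice.
  have hline : ∀ (d₁ d₂ : ℤ) (p : ℝ × ℝ),
      (∀ t : ℝ, torusMk (p.1 + t * d₁, p.2 + t * d₂) ∈ U) → a * d₁ + b * d₂ = 0 := by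
    intro d₁ d₂ p hp
    let f : ℝ → ℝ := fun t => Ft ⟨_, hp t⟩ - (a * (p.1 + t * d₁) + b * (p.2 + t * d₂))
    have hf : Continuous f := by
      refine (hFtc.comp (Continuous.subtype_mk ?_ _)).sub (by fun_prop)
      unfold torusMk
      exact ((AddCircle.continuous_mk' 1).comp (by fun_prop)).prodMk
        ((AddCircle.continuous_mk' 1).comp (by fun_prop))
    have hr : (range f).Countable := by
      refine (countable_range (fun m : ℤ × ℤ => a * m.1 + b * m.2)).mono ?_
      rintro _ ⟨t, rfl⟩
      obtain ⟨z, hz, h⟩ := G.cell_surjective hφ (torusMk (p.1 + t * d₁, p.2 + t * d₂))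
      have h1 : Ft ⟨_, hp t⟩ = F z := by
        rw [← hFt z hz (h.symm ▸ hp t)]
        congr 1
        exact Subtype.ext h.symm
      obtain ⟨m, hm⟩ := unitAddCircle_coe_eq_iff.1
        ((congrArg Prod.fst h).symm.trans (hy1 z hz).symm)
      obtain ⟨k, hk⟩ := unitAddCircle_coe_eq_iff.1
        ((congrArg Prod.snd h).symm.trans (hy2 z hz).symm)
      refine ⟨(m, k), ?_⟩
      simp only [f, h1, hF, hm, hk]
      ring
    have h01 := eq_of_countable_range hf hr 0 1
    have hper : Ft ⟨_, hp 0⟩ = Ft ⟨_, hp 1⟩ := by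
      congr 1
      apply Subtype.ext
      refine Prod.ext (unitAddCircle_coe_eq_iff.2 ⟨d₁, ?_⟩) (unitAddCircle_coe_eq_iff.2 ⟨d₂, ?_⟩)
      · simp
      · simp
    simp only [f, hper] at h01
    linarith
  have hinf : Infinite UnitAddCircle := by
    have : Infinite (Ico (0 : ℝ) (0 + 1)) := (Ico_infinite (by norm_num)).to_subtype
    exact Infinite.of_injective _ (AddCircle.equivIco (1 : ℝ) 0).symm.injective
  obtain ⟨u, hu⟩ := Infinite.exists_notMem_finset (G.V.image Prod.snd)
  obtain ⟨v, hv⟩ := Infinite.exists_notMem_finset (G.V.image Prod.fst)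
  obtain ⟨u, rfl⟩ := QuotientAddGroup.mk_surjective u
  obtain ⟨v, rfl⟩ := QuotientAddGroup.mk_surjective v
  constructor
  · have := hline 1 0 (0, u) fun t h => hu (Finset.mem_image.2 ⟨_, h, by simp [torusMk]⟩)
    simpa using this
  · have := hline 0 1 (v, 0) fun t h => hv (Finset.mem_image.2 ⟨_, h, by simp [torusMk]⟩)
    simpa using this

end PolygonalGraph

end

/-! ### Linear algebra on the corners of a single polygon, and how its boundary is glued -/

section

open Metric

namespace PolygonalGraph

variable (G : PolygonalGraph) (φ : G.F)

/-- The corner `j` of a polygon. -/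
def corner (j : ZMod (G.sides φ)) : ℂ := polygonSide (G.sides φ) j.val 0

/-- The sign with which a side runs along its edge. -/
def sideSign (j : ZMod (G.sides φ)) : ℝ := if (G.cside φ j).2 then 1 else -1

variable {φ}

theorem sidePoint_of_true {j : ZMod (G.sides φ)} (h : (G.cside φ j).2 = true) :
    G.sidePoint φ j 0 = G.corner φ j ∧ G.sidePoint φ j 1 = G.corner φ (j + 1) := by
  simp [sidePoint, h, corner, polygonSide_one_zmod]

theorem sidePoint_of_false {j : ZMod (G.sides φ)} (h : (G.cside φ j).2 = false) :
    G.sidePoint φ j 1 = G.corner φ j ∧ G.sidePoint φ j 0 = G.corner φ (j + 1) := by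
  simp [sidePoint, h, corner, polygonSide_one_zmod]

theorem cornerVertex_of_true {j : ZMod (G.sides φ)} (h : (G.cside φ j).2 = true) :
    G.src (G.cside φ j).1 = G.cornerVertex φ j ∧
      G.tgt (G.cside φ j).1 = G.cornerVertex φ (j + 1) := by
  rw [cornerVertex_add_one, cornerVertex]
  simp [h]

theorem cornerVertex_of_false {j : ZMod (G.sides φ)} (h : (G.cside φ j).2 = false) :
    G.tgt (G.cside φ j).1 = G.cornerVertex φ j ∧
      G.src (G.cside φ j).1 = G.cornerVertex φ (j + 1) := by
  rw [cornerVertex_add_one, cornerVertex]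
  simp [h]

theorem card_V_add_one (hφ : ∀ f, f = φ) : G.V.card + 1 = Nat.card G.E := by
  rw [← G.euler_formula, Nat.card_eq_one_iff_unique.2 ⟨⟨fun f g => (hφ f).trans (hφ g).symm⟩, ⟨φ⟩⟩]

/-- A function on the corners of the only polygon whose differences along the sides are compatible
with the gluing is a sum of a function of the vertices and of the two lifted coordinates. -/
theorem exists_corner_decomposition (hφ : ∀ f, f = φ) : ∃ y₁ y₂ : ℂ → ℝ,
    Continuous y₁ ∧ Continuous y₂ ∧ (∀ z, ‖z‖ ≤ 1 → torusMk (y₁ z, y₂ z) = G.cell φ z) ∧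
    ∀ (x₀ : ℝ) (w : G.E → ℝ), ∃ (h : G.V → ℝ) (a b : ℝ),
      h (G.cornerVertex φ 0) + a * y₁ (G.corner φ 0) + b * y₂ (G.corner φ 0) = x₀ ∧
      ∀ j, h (G.cornerVertex φ (j + 1)) + a * y₁ (G.corner φ (j + 1)) +
          b * y₂ (G.corner φ (j + 1)) =
        h (G.cornerVertex φ j) + a * y₁ (G.corner φ j) + b * y₂ (G.corner φ j) +
          G.sideSign φ j * w (G.cside φ j).1 := by
  obtain ⟨y₁, hy₁, hl₁⟩ := exists_real_lift
    (continuous_fst.comp_continuousOn (G.continuousOn_cell φ))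
  obtain ⟨y₂, hy₂, hl₂⟩ := exists_real_lift
    (continuous_snd.comp_continuousOn (G.continuousOn_cell φ))
  have hy : ∀ z, ‖z‖ ≤ 1 → torusMk (y₁ z, y₂ z) = G.cell φ z :=
    fun z hz => Prod.ext (hl₁ z hz) (hl₂ z hz)
  refine ⟨y₁, y₂, hy₁, hy₂, hy, ?_⟩
  choose r hr using G.exists_cside hφ
  -- The increment of a lifted coordinate along an edge may be computed on either side glued to it,
  -- since the two lifts differ by a constant. The side `r e` is an arbitrary choice.
  let ω : (ℂ → ℝ) → G.E → ℝ := fun y e => y (G.sidePoint φ (r e) 1) - y (G.sidePoint φ (r e) 0)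
  have hω : ∀ (y : ℂ → ℝ) (π : Torus2 → UnitAddCircle), Continuous y →
      (∀ z, ‖z‖ ≤ 1 → (y z : UnitAddCircle) = π (G.cell φ z)) → ∀ j,
      y (G.corner φ (j + 1)) - y (G.corner φ j) = G.sideSign φ j * ω y (G.cside φ j).1 := by
    intro y π hyc hyl j
    have h := G.lift_side_sub π hyc hyl (hr (G.cside φ j).1) (s := 1) ⟨zero_le_one, le_rfl⟩
    simp only [ω]
    cases hb : (G.cside φ j).2
    · obtain ⟨h1, h2⟩ := G.sidePoint_of_false hb
      rw [h1, h2] at h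
      simp only [sideSign, hb]
      norm_num
      linarith
    · obtain ⟨h1, h2⟩ := G.sidePoint_of_true hb
      rw [h1, h2] at h
      simp only [sideSign, hb]
      norm_num
      linarith
  let L : ((G.V → ℝ) × ℝ × ℝ) →ₗ[ℝ] ℝ × (G.E → ℝ) :=
    { toFun := fun m => (m.1 (G.cornerVertex φ 0) + m.2.1 * y₁ (G.corner φ 0) +
          m.2.2 * y₂ (G.corner φ 0),
        fun e => m.1 (G.tgt e) - m.1 (G.src e) + m.2.1 * ω y₁ e + m.2.2 * ω y₂ e)
      map_add' := fun m m' => by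
        ext <;> simp <;> ring
      map_smul' := fun c m => by
        ext <;> simp <;> ring }
  have hstep : ∀ (m : (G.V → ℝ) × ℝ × ℝ) j, m.1 (G.cornerVertex φ (j + 1)) +
      m.2.1 * y₁ (G.corner φ (j + 1)) + m.2.2 * y₂ (G.corner φ (j + 1)) =
      m.1 (G.cornerVertex φ j) + m.2.1 * y₁ (G.corner φ j) + m.2.2 * y₂ (G.corner φ j) +
        G.sideSign φ j * (L m).2 (G.cside φ j).1 := by
    intro m j
    have e1 := hω y₁ Prod.fst hy₁ hl₁ j
    have e2 := hω y₂ Prod.snd hy₂ hl₂ j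
    have e3 : m.1 (G.cornerVertex φ (j + 1)) - m.1 (G.cornerVertex φ j) =
        G.sideSign φ j * (m.1 (G.tgt (G.cside φ j).1) - m.1 (G.src (G.cside φ j).1)) := by
      cases hb : (G.cside φ j).2
      · obtain ⟨h1, h2⟩ := G.cornerVertex_of_false hb
        rw [h1, h2]
        simp [sideSign, hb]
      · obtain ⟨h1, h2⟩ := G.cornerVertex_of_true hb
        rw [h1, h2]
        simp [sideSign, hb]
    change _ = _ + G.sideSign φ j * (m.1 (G.tgt _) - m.1 (G.src _) + m.2.1 * ω y₁ _ +
      m.2.2 * ω y₂ _)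
    linear_combination m.2.1 * e1 + m.2.2 * e2 + e3
  -- For an element of the kernel the combination vanishes at all corners. So a y₁ + b y₂ at the
  -- start of an edge is minus the value of `h` there, which depends only on the edge: this is the
  -- compatibility that forces a = b = 0.
  have hinj : Function.Injective L := by
    rw [injective_iff_map_eq_zero]
    rintro ⟨h, a, b⟩ hm
    have h0 : ∀ j, h (G.cornerVertex φ j) + a * y₁ (G.corner φ j) + b * y₂ (G.corner φ j) = 0 := by
      refine ZMod.cyclic_induction (congrArg Prod.fst hm) fun j hj => ?_
      rw [hstep (h, a, b) j, hm]
      simpa using hj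
    have h1 : ∀ j, a * y₁ (G.sidePoint φ j 0) + b * y₂ (G.sidePoint φ j 0) =
        -h (G.src (G.cside φ j).1) := by
      intro j
      cases hb : (G.cside φ j).2
      · rw [(G.sidePoint_of_false hb).2, (G.cornerVertex_of_false hb).2]
        linarith [h0 (j + 1)]
      · rw [(G.sidePoint_of_true hb).1, (G.cornerVertex_of_true hb).1]
        linarith [h0 j]
    obtain ⟨rfl, rfl⟩ := G.lift_combination_eq_zero hφ hy₁ hy₂ hy (a := a) (b := b)
      fun j k hjk => by rw [h1, h1, hjk]
    refine Prod.ext (funext fun v => ?_) rfl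
    obtain ⟨j, rfl⟩ := G.exists_cornerVertex_eq hφ v
    simpa using h0 j
  -- With one polygon, Euler's formula says |V| + 2 = 1 + |E|.
  have hdim : Module.finrank ℝ ((G.V → ℝ) × ℝ × ℝ) = Module.finrank ℝ (ℝ × (G.E → ℝ)) := by
    have := G.card_V_add_one hφ
    rw [Nat.card_eq_fintype_card] at this
    simp
    omega
  have hsurj := (LinearMap.injective_iff_surjective_of_finrank_eq_finrank hdim).1 hinj
  intro x₀ w
  obtain ⟨m, hm⟩ := hsurj (x₀, w)
  refine ⟨m.1, m.2.1, m.2.2, congrArg Prod.fst hm, fun j => ?_⟩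
  rw [hstep m j, hm]

/-- The two sides glued to an edge run along it in opposite directions. -/
theorem cside_opposite (hφ : ∀ f, f = φ) {j k : ZMod (G.sides φ)} (hjk : j ≠ k)
    (h : (G.cside φ j).1 = (G.cside φ k).1) : (G.cside φ j).2 = !(G.cside φ k).2 := by
  classical
  obtain ⟨y₁, y₂, -, -, -, hdec⟩ := G.exists_corner_decomposition hφ
  -- Prescribe the increment 1 along the edge in question and 0 along the others. The increments
  -- around the closed polygon sum to zero, so the signs of the two sides at this edge must cancel.
  obtain ⟨h0, a, b, -, hstep⟩ := hdec 0 (Pi.single (G.cside φ j).1 1)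
  set g : ZMod (G.sides φ) → ℝ := fun j => h0 (G.cornerVertex φ j) + a * y₁ (G.corner φ j) +
    b * y₂ (G.corner φ j)
  have hsum : ∑ l, G.sideSign φ l *
      (Pi.single (G.cside φ j).1 1 : G.E → ℝ) (G.cside φ l).1 = 0 := by
    have h1 : ∑ l, g (l + 1) = ∑ l, g l := Equiv.sum_comp (Equiv.addRight 1) g
    have h2 : ∑ l, g (l + 1) = ∑ l, (g l + G.sideSign φ l *
      (Pi.single (G.cside φ j).1 1 : G.E → ℝ) (G.cside φ l).1) :=
      Finset.sum_congr rfl fun l _ => hstep l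
    have h3 := h1.symm.trans (h2.trans Finset.sum_add_distrib)
    linarith
  rw [← Finset.sum_subset (Finset.subset_univ {j, k}), Finset.sum_pair hjk] at hsum
  · rw [← h, Pi.single_eq_same] at hsum
    simp only [sideSign] at hsum
    cases hj : (G.cside φ j).2 <;> cases hk : (G.cside φ k).2 <;> simp [hj, hk] at hsum ⊢
  · intro l _ hl
    rw [Pi.single_eq_of_ne, mul_zero]
    intro hlj
    obtain ⟨k', -, -, huniq⟩ := G.exists_partner hφ j
    have h1 := huniq l hlj
    have h2 := huniq k h.symm
    simp only [Finset.mem_insert, Finset.mem_singleton, not_or] at hl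
    rcases h1 with h1 | h1
    · exact hl.1 h1
    · rcases h2 with h2 | h2
      · exact hjk h2.symm
      · exact hl.2 (h1.trans h2.symm)

/-- The side that is glued to the side `j`. -/
def partner (hφ : ∀ f, f = φ) (j : ZMod (G.sides φ)) : ZMod (G.sides φ) :=
  (G.exists_partner hφ j).choose

variable (hφ : ∀ f, f = φ)

theorem partner_ne (j : ZMod (G.sides φ)) : G.partner hφ j ≠ j :=
  (G.exists_partner hφ j).choose_spec.1

theorem cside_partner (j : ZMod (G.sides φ)) :
    (G.cside φ (G.partner hφ j)).1 = (G.cside φ j).1 :=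
  (G.exists_partner hφ j).choose_spec.2.1

theorem eq_or_eq_partner {j l : ZMod (G.sides φ)} (h : (G.cside φ l).1 = (G.cside φ j).1) :
    l = j ∨ l = G.partner hφ j :=
  (G.exists_partner hφ j).choose_spec.2.2 l h

theorem partner_partner (j : ZMod (G.sides φ)) : G.partner hφ (G.partner hφ j) = j :=
  ((G.eq_or_eq_partner hφ (G.cside_partner hφ j).symm).resolve_left
    (G.partner_ne hφ j).symm).symm

theorem cside_partner_snd (j : ZMod (G.sides φ)) :
    (G.cside φ (G.partner hφ j)).2 = !(G.cside φ j).2 :=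
  G.cside_opposite hφ (G.partner_ne hφ j) (G.cside_partner hφ j)

theorem cornerVertex_partner_add_one (j : ZMod (G.sides φ)) :
    G.cornerVertex φ (G.partner hφ j + 1) = G.cornerVertex φ j := by
  rw [cornerVertex_add_one, cside_partner, cside_partner_snd, cornerVertex]
  cases (G.cside φ j).2 <;> rfl

/-- A function on the corners that is compatible with the gluing of the sides is a function of
the vertices. -/
theorem eq_of_cornerVertex_eq {A : ZMod (G.sides φ) → ℝ}
    (hA : ∀ j, A (G.partner hφ j + 1) = A j) {j k : ZMod (G.sides φ)}
    (hjk : G.cornerVertex φ j = G.cornerVertex φ k) : A j = A k := by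
  obtain ⟨y₁, y₂, hy₁, hy₂, hy, hdec⟩ := G.exists_corner_decomposition hφ
  choose r hr using G.exists_cside hφ
  have hA' : ∀ j, A (G.partner hφ j) = A (j + 1) := fun j => by
    rw [← hA (G.partner hφ j), partner_partner]
  -- Decompose `A` itself. Its increment along an edge does not depend on the side used, since
  -- partners run in opposite directions and their end corners have equal values of `A`. The same
  -- compatibility then kills the coordinates and leaves only the function of the vertices.
  obtain ⟨h, a, b, h0, hstep⟩ := hdec (A 0)
    fun e => G.sideSign φ (r e) * (A (r e + 1) - A (r e))
  have hw : ∀ j, G.sideSign φ j * (G.sideSign φ (r (G.cside φ j).1) *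
      (A (r (G.cside φ j).1 + 1) - A (r (G.cside φ j).1))) = A (j + 1) - A j := by
    intro j
    have hs : ∀ j, G.sideSign φ j * G.sideSign φ j = 1 := fun j => by
      unfold sideSign
      split_ifs <;> norm_num
    rcases G.eq_or_eq_partner hφ (hr (G.cside φ j).1) with h | h
    · rw [h, ← mul_assoc, hs, one_mul]
    · have h1 : G.sideSign φ (G.partner hφ j) = -G.sideSign φ j := by
        unfold sideSign
        rw [cside_partner_snd]
        cases (G.cside φ j).2 <;> norm_num
      rw [h, hA, hA', h1]
      linear_combination (A (j + 1) - A j) * hs j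
  have hg : ∀ j, h (G.cornerVertex φ j) + a * y₁ (G.corner φ j) + b * y₂ (G.corner φ j) = A j := by
    refine ZMod.cyclic_induction h0 fun j hj => ?_
    rw [hstep, hw, hj]
    ring
  have hB : ∀ j, a * y₁ (G.sidePoint φ j 0) + b * y₂ (G.sidePoint φ j 0) =
      (if (G.cside φ j).2 then A j else A (j + 1)) - h (G.src (G.cside φ j).1) := by
    intro j
    cases hb : (G.cside φ j).2
    · rw [(G.sidePoint_of_false hb).2, (G.cornerVertex_of_false hb).2, ← hg (j + 1)]
      simp
      ring
    · rw [(G.sidePoint_of_true hb).1, (G.cornerVertex_of_true hb).1, ← hg j]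
      simp
      ring
  obtain ⟨rfl, rfl⟩ := G.lift_combination_eq_zero hφ hy₁ hy₂ hy (a := a) (b := b) fun j k hjk => by
    rw [hB, hB, ← hjk]
    rcases G.eq_or_eq_partner hφ hjk.symm with rfl | rfl
    · rfl
    · rw [cside_partner_snd, hA, hA']
      cases (G.cside φ j).2 <;> simp
  have := hg j
  rw [hjk] at this
  have h2 := hg k
  linarith

/-- The rotation of the corners around the vertices. -/
def cornerPerm : Equiv.Perm (ZMod (G.sides φ)) where
  toFun j := G.partner hφ j + 1
  invFun j := G.partner hφ (j - 1)
  left_inv j := by simp [partner_partner]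
  right_inv j := by simp [partner_partner]

theorem cornerPerm_apply (j : ZMod (G.sides φ)) : G.cornerPerm hφ j = G.partner hφ j + 1 := rfl

/-- The corners at a vertex form a cycle. -/
theorem cornerVertex_eq_iff {j k : ZMod (G.sides φ)} :
    G.cornerVertex φ j = G.cornerVertex φ k ↔ (G.cornerPerm hφ).SameCycle j k := by
  classical
  constructor
  · intro h
    -- Apply this to the indicator function of the cycle of `j`, which is invariant under the
    -- rotation.
    have := G.eq_of_cornerVertex_eq hφ
      (A := fun l => if (G.cornerPerm hφ).SameCycle j l then 1 else 0) (fun l => by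
        simp only [← cornerPerm_apply, Equiv.Perm.sameCycle_apply_right]) h
    by_contra hn
    simp only [hn, if_false, Equiv.Perm.SameCycle.refl, if_true] at this
    exact one_ne_zero this
  · intro h
    have hone : ∀ l, G.cornerVertex φ (G.cornerPerm hφ l) = G.cornerVertex φ l := fun l => by
      rw [cornerPerm_apply, cornerVertex_partner_add_one]
    obtain ⟨m, -, rfl⟩ := h.exists_pow_eq'
    induction m with
    | zero => rfl
    | succ m ih => rw [pow_succ', Equiv.Perm.mul_apply, hone, ih ⟨m, by simp⟩]

/-- There are no free ends, so no vertex has only one corner. -/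
theorem cornerPerm_ne (j : ZMod (G.sides φ)) : G.cornerPerm hφ j ≠ j := by
  intro hj
  have huniq : ∀ k, G.cornerVertex φ k = G.cornerVertex φ j → k = j := by
    intro k hk
    obtain ⟨m, -, h⟩ := ((G.cornerVertex_eq_iff hφ).1 hk.symm).exists_pow_eq'
    rw [← h, Equiv.Perm.pow_apply_eq_self_of_apply_eq_self hj]
  have hdir : ∀ e b, ∃ k, G.cside φ k = (e, b) := by
    intro e b
    obtain ⟨k, rfl⟩ := G.exists_cside hφ e
    by_cases hb : (G.cside φ k).2 = b
    · exact ⟨k, Prod.ext rfl hb⟩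
    · refine ⟨G.partner hφ k, Prod.ext (G.cside_partner hφ k) ?_⟩
      rw [cside_partner_snd]
      revert hb
      cases (G.cside φ k).2 <;> cases b <;> simp
  -- If `j` is the only corner at its vertex, an edge starting there must be side `j` traversed
  -- forwards, and an edge ending there must be side `j` traversed backwards. Degree at least two
  -- requires one of each, a contradiction.
  have hsrc : ∀ e, G.edge e 0 = G.cornerVertex φ j → G.cside φ j = (e, true) := by
    intro e he
    obtain ⟨k, hk⟩ := hdir e true
    have h1 := (G.cornerVertex_of_true (j := k) (by rw [hk])).1
    rw [hk] at h1
    rw [← huniq k (h1.symm.trans (Subtype.ext he)), hk]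
  have htgt : ∀ e, G.edge e 1 = G.cornerVertex φ j → G.cside φ j = (e, false) := by
    intro e he
    obtain ⟨k, hk⟩ := hdir e false
    have h1 := (G.cornerVertex_of_false (j := k) (by rw [hk])).1
    rw [hk] at h1
    rw [← huniq k (h1.symm.trans (Subtype.ext he)), hk]
  have hdeg := G.two_le_degree _ (G.cornerVertex φ j).2
  have h1 : Subsingleton {e : G.E // G.edge e 0 = G.cornerVertex φ j} :=
    ⟨fun e e' => Subtype.ext
      (congrArg Prod.fst ((hsrc e e.2).symm.trans (hsrc e' e'.2)) : (e : G.E) = e')⟩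
  have h2 : Subsingleton {e : G.E // G.edge e 1 = G.cornerVertex φ j} :=
    ⟨fun e e' => Subtype.ext
      (congrArg Prod.fst ((htgt e e.2).symm.trans (htgt e' e'.2)) : (e : G.E) = e')⟩
  have h1' := Finite.card_le_one_iff_subsingleton.2 h1
  have h2' := Finite.card_le_one_iff_subsingleton.2 h2
  have h3 : 0 < Nat.card {e : G.E // G.edge e 0 = G.cornerVertex φ j} := by omega
  have h4 : 0 < Nat.card {e : G.E // G.edge e 1 = G.cornerVertex φ j} := by omega
  obtain ⟨⟨e, he⟩⟩ := (Nat.card_pos_iff.1 h3).1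
  obtain ⟨⟨e', he'⟩⟩ := (Nat.card_pos_iff.1 h4).1
  simpa using congrArg Prod.snd ((hsrc e he).symm.trans (htgt e' he'))

include hφ in
theorem sides_eq_two_mul_card_V_add_two : G.sides φ = 2 * G.V.card + 2 := by
  have h1 := G.sides_eq hφ
  have h2 := G.card_V_add_one hφ
  omega

theorem cell_side_notMem (j : ZMod (G.sides φ)) {t : ℝ} (ht : t ∈ Ioo (0 : ℝ) 1) :
    G.cell φ (polygonSide (G.sides φ) j.val t) ∉ G.V := by
  rw [G.cell_cside φ j (Ioo_subset_Icc_self ht)]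
  refine G.edge_notMem _ _ ?_
  split_ifs
  · exact ht
  · exact ⟨by linarith [ht.2], by linarith [ht.1]⟩

/-- How the boundary of the only polygon is glued. -/
theorem cell_side_eq_iff {j k : ZMod (G.sides φ)} {s t : ℝ} (hs : s ∈ Ico (0 : ℝ) 1)
    (ht : t ∈ Ico (0 : ℝ) 1) :
    G.cell φ (polygonSide (G.sides φ) j.val s) = G.cell φ (polygonSide (G.sides φ) k.val t) ↔
      (s = 0 ∧ t = 0 ∧ (G.cornerPerm hφ).SameCycle j k) ∨
      (0 < s ∧ 0 < t ∧ ((j = k ∧ s = t) ∨ (k = G.partner hφ j ∧ t = 1 - s))) := by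
  rcases hs.1.eq_or_lt with rfl | hs0 <;> rcases ht.1.eq_or_lt with rfl | ht0
  · rw [cell_corner, cell_corner, ← G.cornerVertex_eq_iff hφ, ← Subtype.ext_iff]
    simp
  · refine iff_of_false (fun h => G.cell_side_notMem k ⟨ht0, ht.2⟩ ?_) ?_
    · rw [← h, cell_corner]
      exact Subtype.property _
    · simp [ht0.ne']
  · refine iff_of_false (fun h => G.cell_side_notMem j ⟨hs0, hs.2⟩ ?_) ?_
    · rw [h, cell_corner]
      exact Subtype.property _
    · simp [hs0.ne']
  · have hs' : s ∈ Icc (0 : ℝ) 1 := ⟨hs.1, hs.2.le⟩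
    have ht' : t ∈ Icc (0 : ℝ) 1 := ⟨ht.1, ht.2.le⟩
    have hI : ∀ (b : Bool) {x : ℝ}, 0 < x → x < 1 → (if b then x else 1 - x) ∈ Ioo (0 : ℝ) 1 := by
      intro b x h0 h1
      cases b <;> constructor <;> simp <;> linarith
    simp only [hs0.ne', ht0.ne', hs0, ht0, false_and, false_or, true_and]
    rw [G.cell_cside φ j hs', G.cell_cside φ k ht']
    constructor
    · intro h
      obtain ⟨h1, h2⟩ := G.edge_inj (hI _ hs0 hs.2) (hI _ ht0 ht.2) h
      rcases G.eq_or_eq_partner hφ h1.symm with rfl | rfl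
      · refine Or.inl ⟨rfl, ?_⟩
        split_ifs at h2 <;> linarith
      · refine Or.inr ⟨rfl, ?_⟩
        rw [cside_partner_snd] at h2
        revert h2
        cases (G.cside φ j).2 <;> simp <;> intro h2 <;> linarith
    · rintro (⟨rfl, rfl⟩ | ⟨rfl, rfl⟩)
      · rfl
      · rw [cside_partner, cside_partner_snd]
        cases (G.cside φ j).2 <;> simp

end PolygonalGraph

end

/-! ### Combinatorics of one-polygon gluings -/

theorem involution_sub_mem {m : ℕ} {f : ZMod m → ZMod m} (h1 : ∀ i, f (f i) = i)
    (h2 : ∀ i, f i ≠ i) (h3 : ∀ i, f i + 1 ≠ i) (i : ZMod m) :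
    f i ≠ i ∧ f i ≠ i + 1 ∧ f i + 1 ≠ i :=
  ⟨h2 i, fun h => h3 (f i) (by rw [h1, ← h]), h3 i⟩

theorem involution_zmod_four {f : ZMod 4 → ZMod 4} (h1 : ∀ i, f (f i) = i)
    (h2 : ∀ i, f i ≠ i) (h3 : ∀ i, f i + 1 ≠ i) (i : ZMod 4) : f i = i + 2 := by
  have key : ∀ i y : ZMod 4, y ≠ i ∧ y ≠ i + 1 ∧ y + 1 ≠ i → y = i + 2 := by decide
  exact key i _ (involution_sub_mem h1 h2 h3 i)

/-- The hypothesis `h4` says that the rotation i ↦ f i + 1 has no cycle of length two. If f i = i +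
2, it forces f (i + 3) = i + 1, and then i + 4 has no possible partner. The case f i = i + 4 is this
one with i and f i exchanged. -/
theorem involution_zmod_six {f : ZMod 6 → ZMod 6} (h1 : ∀ i, f (f i) = i)
    (h2 : ∀ i, f i ≠ i) (h3 : ∀ i, f i + 1 ≠ i) (h4 : ∀ i, f (f i + 1) + 1 ≠ i) (i : ZMod 6) :
    f i = i + 3 := by
  have key : ∀ i y : ZMod 6, y ≠ i ∧ y ≠ i + 1 ∧ y + 1 ≠ i →
      y = i + 2 ∨ y = i + 3 ∨ y = i + 4 := by decide
  have tri : ∀ i, f i = i + 2 ∨ f i = i + 3 ∨ f i = i + 4 :=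
    fun i => key i _ (involution_sub_mem h1 h2 h3 i)
  have no2 : ∀ i, f i ≠ i + 2 := by
    intro i hi
    have hi' : f (i + 2) = i := by rw [← hi, h1]
    have h5 : f (i + 3) = i + 1 := by
      rcases tri (i + 3) with h | h | h
      · refine absurd ?_ (h4 i)
        rw [hi, show i + 2 + 1 = i + 3 by ring, h]
        exact (by decide : ∀ i : ZMod 6, i + 3 + 2 + 1 = i) i
      · rw [(by decide : ∀ i : ZMod 6, i + 3 + 3 = i) i] at h
        have := h1 (i + 3)
        rw [h, hi] at this
        exact absurd this ((by decide : ∀ i : ZMod 6, i + 2 ≠ i + 3) i)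
      · rw [h]
        exact (by decide : ∀ i : ZMod 6, i + 3 + 4 = i + 1) i
    have h6 : f (i + 1) = i + 3 := by rw [← h5, h1]
    have h7 := h1 (i + 4)
    rcases tri (i + 4) with h | h | h
    · rw [h, (by decide : ∀ i : ZMod 6, i + 4 + 2 = i) i, hi] at h7
      exact absurd h7 ((by decide : ∀ i : ZMod 6, i + 2 ≠ i + 4) i)
    · rw [h, (by decide : ∀ i : ZMod 6, i + 4 + 3 = i + 1) i, h6] at h7
      exact absurd h7 ((by decide : ∀ i : ZMod 6, i + 3 ≠ i + 4) i)
    · rw [h, (by decide : ∀ i : ZMod 6, i + 4 + 4 = i + 2) i, hi'] at h7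
      exact absurd h7 ((by decide : ∀ i : ZMod 6, i ≠ i + 4) i)
  rcases tri i with h | h | h
  · exact absurd h (no2 i)
  · exact h
  · refine absurd ?_ (no2 (f i))
    rw [h1, h]
    exact (by decide : ∀ i : ZMod 6, i = i + 4 + 2) i

/-- A gluing of the sides of a polygon in pairs, in which adjacent sides are not glued so as to
produce a vertex of degree one. -/
structure SidePairing (n : ℕ) where
  pair : ZMod n → ZMod n
  pair_pair : ∀ j, pair (pair j) = j
  pair_ne : ∀ j, pair j ≠ j
  pair_add_one_ne : ∀ j, pair j + 1 ≠ j

namespace SidePairing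

variable {n : ℕ}

/-- The rotation of the corners around the vertices. -/
def perm (D : SidePairing n) : Equiv.Perm (ZMod n) where
  toFun j := D.pair j + 1
  invFun j := D.pair (j - 1)
  left_inv j := by simp [D.pair_pair]
  right_inv j := by simp [D.pair_pair]

theorem perm_apply (D : SidePairing n) (j : ZMod n) : D.perm j = D.pair j + 1 := rfl

/-- The same pairing, with a different numbering of the sides. -/
def rotate (D : SidePairing n) (a : ZMod n) : SidePairing n where
  pair j := D.pair (j + a) - a
  pair_pair j := by simp [D.pair_pair]
  pair_ne j h := D.pair_ne (j + a) (sub_eq_iff_eq_add.1 h)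
  pair_add_one_ne j h := D.pair_add_one_ne (j + a) (by linear_combination h)

theorem rotate_perm (D : SidePairing n) (a j : ZMod n) :
    (D.rotate a).perm j = D.perm (j + a) - a := by
  simp only [perm_apply, rotate]
  ring

theorem rotate_sameCycle (D : SidePairing n) (a j k : ZMod n) :
    (D.rotate a).perm.SameCycle j k ↔ D.perm.SameCycle (j + a) (k + a) := by
  have : (D.rotate a).perm = (Equiv.addRight a)⁻¹ * D.perm * (Equiv.addRight a)⁻¹⁻¹ := by
    ext j
    simp only [rotate_perm, inv_inv, Equiv.Perm.mul_apply, Equiv.coe_addRight]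
    rw [Equiv.Perm.eq_inv_iff_eq]
    simp
  rw [this, Equiv.Perm.sameCycle_conj]
  simp

variable [NeZero n] (D : SidePairing n)

/-- The corners at vertices of degree at least three. -/
def ess : Finset (ZMod n) := Finset.univ.filter fun j => D.perm (D.perm j) ≠ j

variable {D}

theorem mem_ess {j : ZMod n} : j ∈ D.ess ↔ D.perm (D.perm j) ≠ j := by simp [ess]

theorem perm_mem_ess {j : ZMod n} : D.perm j ∈ D.ess ↔ j ∈ D.ess := by
  rw [mem_ess, mem_ess, Ne, Ne, D.perm.injective.eq_iff]

theorem rotate_mem_ess {a j : ZMod n} : j ∈ (D.rotate a).ess ↔ j + a ∈ D.ess := by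
  rw [mem_ess, mem_ess, rotate_perm, rotate_perm]
  simp [sub_eq_iff_eq_add]

theorem sameCycle_iff_of_notMem {j k : ZMod n} (hj : j ∉ D.ess) :
    D.perm.SameCycle j k ↔ k = j ∨ k = D.perm j := by
  rw [mem_ess, not_not] at hj
  constructor
  · intro h
    obtain ⟨m, -, rfl⟩ := h.exists_pow_eq'
    clear h
    induction m with
    | zero => exact Or.inl rfl
    | succ m ih =>
      rw [pow_succ', Equiv.Perm.mul_apply]
      rcases ih with ih | ih <;> rw [ih]
      · exact Or.inr rfl
      · exact Or.inl hj
  · rintro (rfl | rfl)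
    · exact Equiv.Perm.SameCycle.refl _ _
    · exact Equiv.Perm.sameCycle_apply_right.2 (Equiv.Perm.SameCycle.refl _ _)

theorem sameCycle_mem_ess {j k : ZMod n} (h : D.perm.SameCycle j k) (hj : j ∈ D.ess) :
    k ∈ D.ess := by
  by_contra hk
  rcases (sameCycle_iff_of_notMem hk).1 h.symm with rfl | rfl
  · exact hk hj
  · exact hk (perm_mem_ess.1 hj)

/-- At a vertex of degree two the gluing continues straight on: adjacent sides are glued to adjacent
sides in the reverse order. -/
theorem pair_sub_one {j : ZMod n} (h : j ∉ D.ess) : D.pair (j - 1) = D.pair j + 1 := by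
  rw [mem_ess, not_not, perm_apply, perm_apply, ← eq_sub_iff_add_eq] at h
  rw [← h, D.pair_pair]

variable (D)

/-- The number of the last essential corner before a side. -/
def idx (j : ZMod n) : ℕ := (D.ess.filter fun k => k ≠ 0 ∧ k.val ≤ j.val).card

variable {D}

theorem idx_mono {j k : ZMod n} (h : j.val ≤ k.val) : D.idx j ≤ D.idx k :=
  Finset.card_le_card fun l hl => by
    rw [Finset.mem_filter] at hl ⊢
    exact ⟨hl.1, hl.2.1, hl.2.2.trans h⟩

theorem idx_strictMono {j k : ZMod n} (h : j.val < k.val) (hk : k ∈ D.ess) : D.idx j < D.idx k := by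
  refine Finset.card_lt_card ((Finset.ssubset_iff_of_subset fun l hl => ?_).2 ⟨k, ?_, ?_⟩)
  · rw [Finset.mem_filter] at hl ⊢
    exact ⟨hl.1, hl.2.1, hl.2.2.trans h.le⟩
  · refine Finset.mem_filter.2 ⟨hk, ?_, le_rfl⟩
    rintro rfl
    simp at h
  · rw [Finset.mem_filter]
    omega

/-- Corner 0 is not counted in `idx`, so once it is essential the runs of sides between essential
corners are numbered from 0 to `D.ess.card - 1`. -/
theorem idx_zero : D.idx 0 = 0 := by
  rw [idx, Finset.card_eq_zero, Finset.filter_eq_empty_iff]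
  rintro k - ⟨h1, h2⟩
  rw [ZMod.val_zero, Nat.le_zero, ZMod.val_eq_zero] at h2
  exact h1 h2

theorem val_sub_one {j : ZMod n} (h : j ≠ 0) : j.val = (j - 1).val + 1 := by
  rcases ZMod.val_add_one' (j - 1) with ⟨-, h'⟩ | ⟨-, h'⟩
  · rwa [sub_add_cancel] at h'
  · rw [sub_add_cancel, ZMod.val_eq_zero] at h'
    exact absurd h' h

theorem idx_of_mem {j : ZMod n} (h : j ≠ 0) (hj : j ∈ D.ess) : D.idx j = D.idx (j - 1) + 1 := by
  have hv := val_sub_one h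
  have : (D.ess.filter fun k => k ≠ 0 ∧ k.val ≤ j.val) =
      insert j (D.ess.filter fun k => k ≠ 0 ∧ k.val ≤ (j - 1).val) := by
    ext k
    simp only [Finset.mem_filter, Finset.mem_insert]
    constructor
    · rintro ⟨h1, h2, h3⟩
      rcases h3.eq_or_lt with h4 | h4
      · exact Or.inl (ZMod.val_injective _ h4)
      · exact Or.inr ⟨h1, h2, by omega⟩
    · rintro (rfl | ⟨h1, h2, h3⟩)
      · exact ⟨hj, h, le_rfl⟩
      · exact ⟨h1, h2, by omega⟩
  rw [idx, this, Finset.card_insert_of_notMem, idx]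
  rw [Finset.mem_filter]
  omega

theorem idx_of_notMem {j : ZMod n} (h : j ≠ 0) (hj : j ∉ D.ess) : D.idx j = D.idx (j - 1) := by
  have hv := val_sub_one h
  have : (D.ess.filter fun k => k ≠ 0 ∧ k.val ≤ j.val) =
      D.ess.filter fun k => k ≠ 0 ∧ k.val ≤ (j - 1).val := by
    ext k
    simp only [Finset.mem_filter]
    refine and_congr_right fun h1 => and_congr_right fun h2 => ⟨fun h3 => ?_, fun h3 => by omega⟩
    rcases h3.eq_or_lt with h4 | h4
    · exact absurd h1 (ZMod.val_injective _ h4 ▸ hj)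
    · omega
  rw [idx, this, idx]

theorem idx_injOn {j k : ZMod n} (hj : j ∈ D.ess) (hk : k ∈ D.ess) (h : D.idx j = D.idx k) :
    j = k := by
  rcases lt_trichotomy j.val k.val with h1 | h1 | h1
  · exact absurd h (idx_strictMono h1 hk).ne
  · exact ZMod.val_injective _ h1
  · exact absurd h (idx_strictMono h1 hj).ne'

variable (h0 : (0 : ZMod n) ∈ D.ess)
include h0

theorem idx_lt (j : ZMod n) : D.idx j < D.ess.card :=
  Finset.card_lt_card (Finset.ssubset_iff_of_subset (Finset.filter_subset _ _) |>.2
    ⟨0, h0, by simp⟩)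

theorem idx_last {j : ZMod n} (h : j + 1 = 0) : D.idx j + 1 = D.ess.card := by
  have hj : j.val + 1 = n := by
    rcases ZMod.val_add_one' j with ⟨-, h'⟩ | ⟨h', -⟩
    · rw [h, ZMod.val_zero] at h'
      omega
    · exact h'
  have : (D.ess.filter fun k => k ≠ 0 ∧ k.val ≤ j.val) = D.ess.erase 0 := by
    ext k
    have := ZMod.val_lt k
    simp only [Finset.mem_filter, Finset.mem_erase]
    constructor
    · exact fun h => ⟨h.2.1, h.1⟩
    · exact fun h => ⟨h.2, h.1, by omega⟩
  rw [idx, this, Finset.card_erase_add_one h0]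

theorem exists_idx_eq {i : ℕ} (hi : i < D.ess.card) : ∃ j ∈ D.ess, D.idx j = i := by
  have h1 : D.ess.image D.idx = Finset.range D.ess.card := by
    refine Finset.eq_of_subset_of_card_le (fun x hx => ?_) ?_
    · obtain ⟨j, -, rfl⟩ := Finset.mem_image.1 hx
      exact Finset.mem_range.2 (idx_lt h0 j)
    · rw [Finset.card_range, Finset.card_image_of_injOn fun j hj k hk => idx_injOn hj hk]
  have := Finset.mem_range.2 hi
  rw [← h1, Finset.mem_image] at this
  exact this

theorem ne_zero_of_notMem {j : ZMod n} (h : j ∉ D.ess) : j ≠ 0 := fun h' => h (h' ▸ h0)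

/-- Induction along the sides that follow an essential corner. -/
theorem run_induction {p : ZMod n → Prop} (hess : ∀ j ∈ D.ess, p j)
    (hs : ∀ j ∉ D.ess, p (j - 1) → p j) (j : ZMod n) : p j := by
  induction hm : j.val generalizing j with
  | zero =>
    rw [ZMod.val_eq_zero] at hm
    exact hess _ (hm ▸ h0)
  | succ m ih =>
    by_cases hj : j ∈ D.ess
    · exact hess j hj
    · refine hs j hj (ih _ ?_)
      have := val_sub_one (ne_zero_of_notMem h0 hj)
      omega

theorem idx_pair_sub_one {j : ZMod n} (h : j ∉ D.ess) :
    D.idx (D.pair (j - 1)) = D.idx (D.pair j) := by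
  have h1 : D.pair j + 1 ∉ D.ess := fun h' => h (perm_mem_ess.1 h')
  rw [pair_sub_one h, idx_of_notMem (ne_zero_of_notMem h0 h1) h1, add_sub_cancel_right]

theorem exists_ess_idx_eq (j : ZMod n) :
    ∃ k ∈ D.ess, D.idx k = D.idx j ∧ D.idx (D.pair k) = D.idx (D.pair j) := by
  refine run_induction (p := fun j => ∃ k ∈ D.ess, D.idx k = D.idx j ∧
    D.idx (D.pair k) = D.idx (D.pair j)) h0 (fun j hj => ⟨j, hj, rfl, rfl⟩) (fun j hj ih => ?_) j
  obtain ⟨k, hk, h1, h2⟩ := ih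
  exact ⟨k, hk, h1.trans (idx_of_notMem (ne_zero_of_notMem h0 hj) hj).symm,
    h2.trans (idx_pair_sub_one h0 hj)⟩

/-- Each run begins at an essential corner, and within a run the partners also stay within one run.
Thus the pairing of sides descends to a pairing of runs. -/
theorem idx_pair_congr {j k : ZMod n} (h : D.idx j = D.idx k) :
    D.idx (D.pair j) = D.idx (D.pair k) := by
  obtain ⟨j', hj', h1, h2⟩ := exists_ess_idx_eq h0 j
  obtain ⟨k', hk', h3, h4⟩ := exists_ess_idx_eq h0 k
  rw [← h2, ← h4, idx_injOn hj' hk' (h1.trans (h.trans h3.symm))]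

omit h0
variable (D)

/-- The length given to a side, so that the sides between essential corners have total length
one. -/
def len (j : ZMod n) : ℝ := ((Finset.univ.filter fun k => D.idx k = D.idx j).card : ℝ)⁻¹

theorem len_pos (j : ZMod n) : 0 < D.len j :=
  inv_pos.2 (Nat.cast_pos.2 (Finset.card_pos.2 ⟨j, by simp⟩))

/-- The pairing maps each run injectively into the partner run, and conversely, so both have equally
many sides. -/
theorem len_pair (h0 : (0 : ZMod n) ∈ D.ess) (j : ZMod n) : D.len (D.pair j) = D.len j := by
  have hle : ∀ j, (Finset.univ.filter fun k => D.idx k = D.idx j).card ≤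
      (Finset.univ.filter fun k => D.idx k = D.idx (D.pair j)).card := by
    intro j
    refine Finset.card_le_card_of_injOn D.pair (fun k hk => ?_) fun k _ l _ h => ?_
    · simp only [Finset.coe_filter, Finset.mem_univ, true_and, mem_ofPred_eq] at hk ⊢
      exact idx_pair_congr h0 hk
    · rw [← D.pair_pair k, h, D.pair_pair]
  have h1 := hle j
  have h2 := hle (D.pair j)
  rw [D.pair_pair] at h2
  rw [len, len, h1.antisymm h2]

theorem sum_len_idx_lt (h0 : (0 : ZMod n) ∈ D.ess) {i : ℕ} (hi : i ≤ D.ess.card) :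
    ∑ k with D.idx k < i, D.len k = i := by
  induction i with
  | zero => simp
  | succ i ih =>
    have h1 : (Finset.univ.filter fun k => D.idx k < i + 1) =
        (Finset.univ.filter fun k => D.idx k < i) ∪ (Finset.univ.filter fun k => D.idx k = i) := by
      ext k
      simp
      omega
    rw [h1, Finset.sum_union, ih (by omega)]
    · obtain ⟨j, -, rfl⟩ := exists_idx_eq h0 (show i < _ by omega)
      have h2 : ∀ k ∈ Finset.univ.filter (fun k => D.idx k = D.idx j), D.len k = D.len j := by
        intro k hk
        rw [len, len, (Finset.mem_filter.1 hk).2]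
      rw [Finset.sum_congr rfl h2, Finset.sum_const, nsmul_eq_mul, len, mul_inv_cancel₀]
      · push_cast
        ring
      · exact Nat.cast_ne_zero.2 (Finset.card_pos.2 ⟨j, by simp⟩).ne'
    · rw [Finset.disjoint_filter]
      intro k _ h1 h2
      omega

/-- The length of the boundary up to the parameter `u`. -/
def pos (u : ℝ) : ℝ := ∑ k, D.len k * max 0 (min 1 (u - k.val))

theorem continuous_pos : Continuous D.pos := by
  unfold pos
  fun_prop

/-- The truncated difference in `pos` is 1 for the sides already passed, t for the current side and
0 for the later ones. -/
theorem pos_side (j : ZMod n) {t : ℝ} (ht : t ∈ Icc (0 : ℝ) 1) :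
    D.pos (j.val + t) = ∑ k with k.val < j.val, D.len k + D.len j * t := by
  have h1 : ∀ k : ZMod n, D.len k * max 0 (min 1 ((j.val + t : ℝ) - k.val)) =
      (if k.val < j.val then D.len k else 0) + if k = j then D.len j * t else 0 := by
    intro k
    rcases lt_trichotomy k.val j.val with h | h | h
    · have h' : (k.val : ℝ) + 1 ≤ j.val := by exact_mod_cast h
      rw [min_eq_left (by linarith [ht.1]), max_eq_right zero_le_one, if_pos h, if_neg]
      · simp
      · rintro rfl
        exact lt_irrefl _ h
    · obtain rfl := ZMod.val_injective _ h
      rw [add_sub_cancel_left, min_eq_right ht.2, max_eq_right ht.1]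
      simp
    · have h' : (j.val : ℝ) + 1 ≤ k.val := by exact_mod_cast h
      rw [max_eq_left, if_neg h.not_gt, if_neg]
      · simp
      · rintro rfl
        exact lt_irrefl _ h
      · exact (min_le_right _ _).trans (by linarith [ht.2])
  rw [pos, Finset.sum_congr rfl fun k _ => h1 k, Finset.sum_add_distrib, Finset.sum_ite_eq',
    if_pos (Finset.mem_univ _), Finset.sum_filter]

theorem pos_val (j : ZMod n) : D.pos j.val = ∑ k with k.val < j.val, D.len k := by
  simpa using D.pos_side j (t := 0) ⟨le_rfl, zero_le_one⟩

theorem pos_add (j : ZMod n) {t : ℝ} (ht : t ∈ Icc (0 : ℝ) 1) :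
    D.pos (j.val + t) = D.pos j.val + D.len j * t := by
  rw [pos_side _ _ ht, pos_val]

theorem pos_zero : D.pos 0 = 0 := by
  have := D.pos_val 0
  simpa using this

variable {D}
variable (h0 : (0 : ZMod n) ∈ D.ess)
include h0

theorem pos_card : D.pos n = D.ess.card := by
  have h1 := D.sum_len_idx_lt h0 le_rfl
  rw [Finset.filter_true_of_mem fun k _ => idx_lt h0 k] at h1
  rw [← h1, pos]
  refine Finset.sum_congr rfl fun k _ => ?_
  have : (k.val : ℝ) + 1 ≤ n := by exact_mod_cast ZMod.val_lt k
  rw [min_eq_left (by linarith), max_eq_right zero_le_one, mul_one]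

theorem idx_le_pos (j : ZMod n) : (D.idx j : ℝ) ≤ D.pos j.val := by
  rw [pos_val, ← D.sum_len_idx_lt h0 (idx_lt h0 j).le]
  refine Finset.sum_le_sum_of_subset_of_nonneg (fun k hk => ?_) fun k _ _ => (D.len_pos k).le
  rw [Finset.mem_filter] at hk ⊢
  refine ⟨hk.1, not_le.1 fun h => ?_⟩
  have := idx_mono (D := D) h
  omega

theorem pos_of_mem_ess {j : ZMod n} (hj : j ∈ D.ess) : D.pos j.val = D.idx j := by
  rw [pos_val, ← D.sum_len_idx_lt h0 (idx_lt h0 j).le]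
  congr 1
  ext k
  simp only [Finset.mem_filter, Finset.mem_univ, true_and]
  refine ⟨fun h => idx_strictMono h hj, fun h => not_le.1 fun h' => ?_⟩
  have := idx_mono (D := D) h'
  omega

theorem pos_le_idx_add_one (j : ZMod n) : D.pos (j.val + 1) ≤ D.idx j + 1 := by
  have h2 : ∑ k with k.val < j.val, D.len k + D.len j * 1 =
      ∑ k with k.val ≤ j.val, D.len k := by
    have : (Finset.univ.filter fun k : ZMod n => k.val ≤ j.val) =
        insert j (Finset.univ.filter fun k : ZMod n => k.val < j.val) := by
      ext k
      simp only [Finset.mem_filter, Finset.mem_univ, true_and, Finset.mem_insert]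
      rw [le_iff_lt_or_eq, or_comm, (ZMod.val_injective n).eq_iff]
    rw [this, Finset.sum_insert (by simp), mul_one, add_comm]
  have h3 := D.sum_len_idx_lt h0 (i := D.idx j + 1) (idx_lt h0 j)
  rw [pos_side _ _ ⟨zero_le_one, le_rfl⟩, h2]
  push_cast at h3
  rw [← h3]
  refine Finset.sum_le_sum_of_subset_of_nonneg (fun k hk => ?_) fun k _ _ => (D.len_pos k).le
  rw [Finset.mem_filter] at hk ⊢
  have := idx_mono (D := D) hk.2
  exact ⟨hk.1, by omega⟩

omit h0 in
theorem pos_sub_one {j : ZMod n} (hj : j ≠ 0) :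
    D.pos j.val = D.pos (j - 1).val + D.len (j - 1) := by
  have h := D.pos_add (j - 1) (t := 1) ⟨zero_le_one, le_rfl⟩
  rw [mul_one] at h
  rw [← h, val_sub_one hj]
  push_cast
  rfl

theorem idx_lt_pos {j : ZMod n} (hj : j ∉ D.ess) : (D.idx j : ℝ) < D.pos j.val := by
  have h1 := ne_zero_of_notMem h0 hj
  rw [pos_sub_one h1, idx_of_notMem h1 hj]
  linarith [idx_le_pos h0 (j - 1), D.len_pos (j - 1)]

/-- Glued corners are in symmetric positions. -/
theorem pos_add_pos_pair (j : ZMod n) :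
    D.pos j.val + D.pos ((D.pair j).val + 1) = D.idx j + D.idx (D.pair j) + 1 := by
  refine run_induction (p := fun j => D.pos j.val + D.pos ((D.pair j).val + 1) =
    D.idx j + D.idx (D.pair j) + 1) h0 (fun j hj => ?_) (fun j hj ih => ?_) j
  -- The partner of the first side of a run is the last side of its own run, so it ends at an
  -- essential corner in position idx + 1. If that corner is 0, the position is the total length
  -- instead, which is again idx + 1.
  · have h1 : D.pair j + 1 ∈ D.ess := perm_mem_ess.2 hj
    rw [pos_of_mem_ess h0 hj]
    rcases ZMod.val_add_one' (D.pair j) with ⟨-, h2⟩ | ⟨h2, h3⟩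
    · have h4 := pos_of_mem_ess h0 h1
      rw [idx_of_mem _ h1, add_sub_cancel_right, h2] at h4
      · push_cast at h4
        rw [h4]
        ring
      · intro h
        rw [h, ZMod.val_zero] at h2
        omega
    · rw [ZMod.val_eq_zero] at h3
      have h4 := idx_last h0 h3
      have h5 : ((D.pair j).val : ℝ) + 1 = n := by exact_mod_cast h2
      rw [h5, pos_card h0, ← h4]
      push_cast
      ring
  · have h1 := ne_zero_of_notMem h0 hj
    have h2 : D.pair j + 1 ∉ D.ess := fun h' => hj (perm_mem_ess.1 h')
    have h3 := ne_zero_of_notMem h0 h2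
    have h4 := val_sub_one h3
    rw [add_sub_cancel_right] at h4
    have h5 : ((D.pair j).val : ℝ) + 1 = (D.pair (j - 1)).val := by
      rw [pair_sub_one hj, h4]
      push_cast
      rfl
    have h6 := D.pos_add (D.pair (j - 1)) (t := 1) ⟨zero_le_one, le_rfl⟩
    have h7 := D.len_pair h0 (j - 1)
    rw [pos_sub_one h1, h5, idx_of_notMem h1 hj, ← idx_pair_sub_one h0 hj]
    linarith

/-- Glued points are in symmetric positions. -/
theorem pos_pair (j : ZMod n) {t : ℝ} (ht : t ∈ Icc (0 : ℝ) 1) :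
    D.pos (j.val + t) + D.pos ((D.pair j).val + (1 - t)) = D.idx j + D.idx (D.pair j) + 1 := by
  rw [D.pos_add j ht, D.pos_add _ ⟨by linarith [ht.2], by linarith [ht.1]⟩, len_pair D h0,
    ← pos_add_pos_pair h0, D.pos_add (D.pair j) ⟨zero_le_one, le_rfl⟩, len_pair D h0]
  ring

omit h0 in
theorem pos_strictMonoOn : StrictMonoOn D.pos (Icc 0 n) := by
  have hmono : ∀ {u v : ℝ}, u ≤ v → ∀ k : ZMod n, D.len k * max 0 (min 1 (u - k.val)) ≤
      D.len k * max 0 (min 1 (v - k.val)) := fun h k =>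
    mul_le_mul_of_nonneg_left (max_le_max le_rfl (min_le_min le_rfl (by linarith))) (D.len_pos k).le
  intro u hu v hv huv
  have hn : ⌊u⌋₊ < n := (Nat.floor_lt hu.1).2 (huv.trans_le hv.2)
  set j : ZMod n := (⌊u⌋₊ : ZMod n)
  have hj : (j.val : ℝ) = ⌊u⌋₊ := by rw [ZMod.val_cast_of_lt hn]
  refine Finset.sum_lt_sum (fun k _ => hmono huv.le k) ⟨j, Finset.mem_univ _, ?_⟩
  refine mul_lt_mul_of_pos_left ?_ (D.len_pos j)
  have h1 := Nat.floor_le hu.1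
  have h2 := Nat.lt_floor_add_one u
  rw [hj, min_eq_right (by linarith : u - ⌊u⌋₊ ≤ 1), max_eq_right (by linarith)]
  exact (lt_min (by linarith) (by linarith)).trans_le (le_max_right _ _)

omit h0 [NeZero n] in
theorem exists_val_add_eq {u : ℝ} (hu : u ∈ Ico (0 : ℝ) n) :
    ∃ j : ZMod n, ∃ t ∈ Ico (0 : ℝ) 1, (j.val : ℝ) + t = u := by
  have hn : ⌊u⌋₊ < n := (Nat.floor_lt hu.1).2 hu.2
  refine ⟨(⌊u⌋₊ : ZMod n), u - ⌊u⌋₊, ⟨?_, ?_⟩, ?_⟩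
  · linarith [Nat.floor_le hu.1]
  · linarith [Nat.lt_floor_add_one u]
  · rw [ZMod.val_cast_of_lt hn]
    ring

omit h0 in
theorem val_add_mem (j : ZMod n) {t : ℝ} (ht : t ∈ Icc (0 : ℝ) 1) :
    (j.val : ℝ) + t ∈ Icc (0 : ℝ) n := by
  have : (j.val : ℝ) + 1 ≤ n := by exact_mod_cast ZMod.val_lt j
  exact ⟨add_nonneg (Nat.cast_nonneg _) ht.1, by linarith [ht.2]⟩

theorem pos_mem_Ico (j : ZMod n) {t : ℝ} (ht : t ∈ Ico (0 : ℝ) 1) :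
    D.pos (j.val + t) ∈ Ico (D.idx j : ℝ) (D.idx j + 1) := by
  have h1 := idx_le_pos h0 j
  have h2 := pos_le_idx_add_one h0 j
  have h3 := D.len_pos j
  rw [D.pos_add j ⟨zero_le_one, le_rfl⟩] at h2
  rw [D.pos_add j ⟨ht.1, ht.2.le⟩]
  constructor
  · nlinarith [ht.1]
  · nlinarith [ht.2]

/-- The sides that follow an essential corner are not glued to each other. -/
theorem idx_pair_ne (j : ZMod n) : D.idx (D.pair j) ≠ D.idx j := by
  intro hj
  have hlt : (D.idx j : ℝ) + 1 ≤ D.ess.card := by exact_mod_cast idx_lt h0 j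
  -- If a run were glued to itself, the symmetry of positions would glue its midpoint to itself. Let
  -- `u` be the parameter of that midpoint.
  obtain ⟨u, hu, hpu⟩ := intermediate_value_Icc (Nat.cast_nonneg n) D.continuous_pos.continuousOn
    (show (D.idx j : ℝ) + 1 / 2 ∈ Icc (D.pos 0) (D.pos n) by
      rw [D.pos_zero, pos_card h0]
      exact ⟨by positivity, by linarith⟩)
  have hun : u < n := lt_of_le_of_ne hu.2 fun h => by
    rw [h, pos_card h0] at hpu
    linarith
  obtain ⟨k, t, ht, rfl⟩ := exists_val_add_eq (n := n) ⟨hu.1, hun⟩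
  have hk : D.idx k = D.idx j := by
    have h1 := pos_mem_Ico h0 k ht
    rw [hpu] at h1
    have h2 : (D.idx k : ℝ) < D.idx j + 1 := by linarith [h1.1]
    have h3 : (D.idx j : ℝ) < D.idx k + 1 := by linarith [h1.2]
    have h2' : D.idx k < D.idx j + 1 := by exact_mod_cast h2
    have h3' : D.idx j < D.idx k + 1 := by exact_mod_cast h3
    omega
  have ht' : t ∈ Icc (0 : ℝ) 1 := ⟨ht.1, ht.2.le⟩
  have ht1 : 1 - t ∈ Icc (0 : ℝ) 1 := ⟨by linarith [ht.2], by linarith [ht.1]⟩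
  have h1 := pos_pair h0 k ht'
  rw [idx_pair_congr h0 hk, hj, hk, hpu] at h1
  have h2 : (k.val : ℝ) + t = (D.pair k).val + (1 - t) :=
    pos_strictMonoOn.injOn (val_add_mem k ht') (val_add_mem _ ht1) (by linarith)
  -- If the midpoint is a corner, the two sides adjacent to it are glued and make a free end.
  -- Otherwise it lies inside a side, which would be its own partner.
  rcases ht.1.eq_or_lt with rfl | ht0
  · have h3 : k.val = (D.pair k).val + 1 := by
      have : (k.val : ℝ) = (D.pair k).val + 1 := by linarith
      exact_mod_cast this
    refine D.pair_add_one_ne k ?_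
    have := congrArg (Nat.cast : ℕ → ZMod n) h3
    push_cast at this
    simpa using this.symm
  · have h3 : (k.val : ℝ) < (D.pair k).val + 1 := by linarith
    have h4 : ((D.pair k).val : ℝ) < k.val + 1 := by linarith [ht.2]
    have h3' : k.val < (D.pair k).val + 1 := by exact_mod_cast h3
    have h4' : (D.pair k).val < k.val + 1 := by exact_mod_cast h4
    exact D.pair_ne k (ZMod.val_injective _ (by omega))

/-- The corner after the partner side begins the next run. The equation is taken modulo the number
of runs because the last run is followed by run 0. -/
theorem idx_perm {j : ZMod n} (hj : j ∈ D.ess) :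
    (D.idx (D.perm j) : ZMod D.ess.card) = D.idx (D.pair j) + 1 := by
  have h1 : D.pair j + 1 ∈ D.ess := perm_mem_ess.2 hj
  rw [perm_apply]
  by_cases h : D.pair j + 1 = 0
  · rw [h, idx_zero, Nat.cast_zero]
    have := congrArg (Nat.cast : ℕ → ZMod D.ess.card) (idx_last h0 h)
    push_cast at this
    rw [this]
    simp
  · rw [idx_of_mem h h1, add_sub_cancel_right]
    push_cast
    rfl

omit h0 in
theorem natCast_idx_inj (h0 : (0 : ZMod n) ∈ D.ess) {j k : ZMod n}
    (h : (D.idx j : ZMod D.ess.card) = D.idx k) : D.idx j = D.idx k := by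
  rw [ZMod.natCast_eq_natCast_iff'] at h
  rwa [Nat.mod_eq_of_lt (idx_lt h0 j), Nat.mod_eq_of_lt (idx_lt h0 k)] at h

/-- The sides that follow an essential corner are glued to the opposite ones. -/
theorem idx_pair {M : ℕ} (hM : M = 2 ∨ M = 3) (hN : D.ess.card = 2 * M) (j : ZMod n) :
    (D.idx (D.pair j) : ZMod (2 * M)) = D.idx j + M := by
  have hne : NeZero (2 * M) := ⟨by omega⟩
  have hex : ∀ i : ZMod (2 * M), ∃ j ∈ D.ess, (D.idx j : ZMod (2 * M)) = i := fun i => by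
    obtain ⟨j, hj, h⟩ := exists_idx_eq h0 (i := i.val) (by rw [hN]; exact ZMod.val_lt i)
    exact ⟨j, hj, by rw [h]; simp⟩
  have hinj : ∀ {j k : ZMod n}, (D.idx j : ZMod (2 * M)) = D.idx k → D.idx j = D.idx k := by
    intro j k h
    rw [← hN] at h
    exact natCast_idx_inj h0 h
  have hperm : ∀ {j : ZMod n}, j ∈ D.ess →
      (D.idx (D.perm j) : ZMod (2 * M)) = D.idx (D.pair j) + 1 := by
    intro j hj
    have := idx_perm h0 hj
    rwa [hN] at this
  choose r hr hri using hex
  -- The involution that the pairing induces on the cyclically ordered runs. Its rotation i ↦ f i +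
  -- 1 is that of the essential corners.
  let f : ZMod (2 * M) → ZMod (2 * M) := fun i => D.idx (D.pair (r i))
  have hf : ∀ j, f (D.idx j) = D.idx (D.pair j) := fun j => by
    simp only [f]
    rw [idx_pair_congr h0 (hinj (hri (D.idx j)))]
  have h1 : ∀ i, f (f i) = i := fun i => by
    obtain ⟨j, rfl⟩ : ∃ j, (D.idx j : ZMod (2 * M)) = i := ⟨r i, hri i⟩
    exact (congrArg f (hf j)).trans ((hf _).trans (by rw [D.pair_pair]))
  have h2 : ∀ i, f i ≠ i := fun i h => by
    rw [← hri i, hf] at h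
    exact idx_pair_ne h0 _ (hinj h)
  have hfp : ∀ i, f i + 1 = D.idx (D.perm (r i)) := fun i => (hperm (hr i)).symm
  have h3 : ∀ i, f i + 1 ≠ i := fun i h => by
    rw [hfp] at h
    have := idx_injOn (perm_mem_ess.2 (hr i)) (hr i) (hinj (h.trans (hri i).symm))
    exact D.pair_add_one_ne _ this
  -- A failure would give an essential corner fixed by the square of the rotation, against the
  -- definition of `ess`.
  have h4 : ∀ i, f (f i + 1) + 1 ≠ i := fun i h => by
    rw [hfp i, hf, ← hperm (perm_mem_ess.2 (hr i))] at h
    have := idx_injOn (perm_mem_ess.2 (perm_mem_ess.2 (hr i))) (hr i)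
      (hinj (h.trans (hri i).symm))
    exact mem_ess.1 (hr i) this
  rw [← hf]
  rcases hM with rfl | rfl
  · exact involution_zmod_four h1 h2 h3 _
  · exact involution_zmod_six h1 h2 h3 h4 _

/-- Pairing adds M to the number of a run and passing to the next corner adds 1, so the rotation
acts on essential corners as translation by M + 1: one cycle for M = 2, two cycles for M = 3. -/
theorem sameCycle_ess_iff {M : ℕ} (hM : M = 2 ∨ M = 3) (hN : D.ess.card = 2 * M) {j k : ZMod n}
    (hj : j ∈ D.ess) (hk : k ∈ D.ess) : D.perm.SameCycle j k ↔
      ∃ m : ℕ, (D.idx k : ZMod (2 * M)) = D.idx j + m * (M + 1) := by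
  have hmem : ∀ m : ℕ, (D.perm ^ m) j ∈ D.ess := fun m => by
    induction m with
    | zero => exact hj
    | succ m ih =>
      rw [pow_succ', Equiv.Perm.mul_apply]
      exact perm_mem_ess.2 ih
  have hpow : ∀ m : ℕ, (D.idx ((D.perm ^ m) j) : ZMod (2 * M)) = D.idx j + m * (M + 1) := by
    intro m
    induction m with
    | zero => simp
    | succ m ih =>
      have := idx_perm h0 (hmem m)
      rw [hN] at this
      rw [pow_succ', Equiv.Perm.mul_apply, this, idx_pair h0 hM hN, ih]
      push_cast
      ring
  constructor
  · intro h
    obtain ⟨m, -, rfl⟩ := h.exists_pow_eq'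
    exact ⟨m, hpow m⟩
  · rintro ⟨m, hm⟩
    rw [← hpow m, ← hN] at hm
    exact ⟨m, by simpa using (idx_injOn hk (hmem m) (natCast_idx_inj h0 hm)).symm⟩

omit h0 in
/-- The number of essential corners if the vertices satisfy Euler's formula for the torus. -/
theorem card_ess {K : Type} [Fintype K] {v : ZMod n → K} (hv : Function.Surjective v)
    (hvD : ∀ j k, v j = v k ↔ D.perm.SameCycle j k) (hn : n = 2 * Fintype.card K + 2) :
    ∃ M, (M = 2 ∨ M = 3) ∧ D.ess.card = 2 * M := by
  classical
  let c : K → ℕ := fun w => (Finset.univ.filter fun j => v j = w).card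
  have hsum : ∑ w, c w = n := by
    rw [← Finset.card_eq_sum_card_fiberwise (f := v) (s := Finset.univ) fun _ _ => Finset.mem_univ _,
      Finset.card_univ, ZMod.card]
  have hvp : ∀ j, v (D.perm j) = v j := fun j =>
    (hvD _ _).2 (Equiv.Perm.sameCycle_apply_left.2 (Equiv.Perm.SameCycle.refl _ _))
  have hc2 : ∀ w, 2 ≤ c w := by
    intro w
    obtain ⟨j, rfl⟩ := hv w
    rw [← Finset.card_pair (D.pair_add_one_ne j)]
    refine Finset.card_le_card fun k hk => ?_
    rw [Finset.mem_insert, Finset.mem_singleton] at hk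
    rw [Finset.mem_filter]
    refine ⟨Finset.mem_univ _, ?_⟩
    rcases hk with rfl | rfl
    · exact hvp j
    · rfl
  have hess : ∀ j, j ∈ D.ess ↔ 3 ≤ c (v j) := by
    intro j
    rw [mem_ess]
    constructor
    · intro h
      have h1 : D.perm j ≠ j := D.pair_add_one_ne j
      have h2 : D.perm (D.perm j) ≠ D.perm j := D.pair_add_one_ne _
      rw [← Finset.card_eq_three.2 ⟨_, _, _, h2, h, h1, rfl⟩]
      refine Finset.card_le_card fun k hk => ?_
      simp only [Finset.mem_insert, Finset.mem_singleton] at hk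
      rw [Finset.mem_filter]
      refine ⟨Finset.mem_univ _, ?_⟩
      rcases hk with rfl | rfl | rfl <;> simp [hvp]
    · intro h h'
      have : (Finset.univ.filter fun k => v k = v j) ⊆ {j, D.perm j} := by
        intro k hk
        rw [Finset.mem_insert, Finset.mem_singleton]
        exact (sameCycle_iff_of_notMem (by rwa [mem_ess, not_not])).1
          ((hvD _ _).1 (Finset.mem_filter.1 hk).2.symm)
      have h2 := Finset.card_le_card this
      have h3 := Finset.card_le_two (a := j) (b := D.perm j)
      simp only [c] at h
      omega
  let T : Finset K := Finset.univ.filter fun w => 3 ≤ c w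
  have hcard : D.ess.card = ∑ w ∈ T, c w := by
    rw [Finset.card_eq_sum_card_fiberwise (t := T) (f := v)]
    · refine Finset.sum_congr rfl fun w hw => ?_
      congr 1
      ext j
      simp only [Finset.mem_filter, Finset.mem_univ, true_and, hess, and_iff_right_iff_imp]
      rintro rfl
      exact (Finset.mem_filter.1 hw).2
    · intro j hj
      exact Finset.mem_filter.2 ⟨Finset.mem_univ _, (hess j).1 hj⟩
  -- The corners number 2|K| + 2 and each vertex has at least two of them, so the total excess is 2.
  have hsub : ∑ w, (c w - 2) = 2 := by
    have : ∑ w, (c w - 2) + ∑ w : K, 2 = ∑ w, c w := by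
      rw [← Finset.sum_add_distrib]
      exact Finset.sum_congr rfl fun w _ => Nat.sub_add_cancel (hc2 w)
    rw [hsum, Finset.sum_const, Finset.card_univ, smul_eq_mul] at this
    omega
  have hsubT : ∑ w ∈ T, (c w - 2) = 2 := by
    refine Eq.trans ?_ hsub
    refine Finset.sum_subset (Finset.subset_univ _) fun w _ hw => ?_
    simp only [T, Finset.mem_filter, Finset.mem_univ, true_and] at hw
    omega
  have hT : ∑ w ∈ T, c w = 2 + 2 * T.card := by
    have : ∑ w ∈ T, (c w - 2) + ∑ w ∈ T, 2 = ∑ w ∈ T, c w := by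
      rw [← Finset.sum_add_distrib]
      exact Finset.sum_congr rfl fun w _ => Nat.sub_add_cancel (hc2 w)
    rw [← this, hsubT, Finset.sum_const, smul_eq_mul, mul_comm]
  have hTle : T.card ≤ 2 := by
    calc T.card = ∑ w ∈ T, 1 := by simp
      _ ≤ ∑ w ∈ T, (c w - 2) := Finset.sum_le_sum fun w hw => by
          have := (Finset.mem_filter.1 hw).2
          omega
      _ = 2 := hsubT
  have hTpos : T.card ≠ 0 := by
    intro h
    rw [Finset.card_eq_zero] at h
    rw [h] at hsubT
    simp at hsubT
  -- An excess of 2 is carried either by one vertex with four corners or by two vertices with three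
  -- corners each.
  exact ⟨1 + T.card, by omega, by omega⟩

end SidePairing

/-! ### The standard gluing of the sides of a polygon -/

theorem addCircle_coe_eq_iff {T a b : ℝ} : (a : AddCircle T) = b ↔ ∃ m : ℤ, b = a + m * T := by
  rw [QuotientAddGroup.eq, AddSubgroup.mem_zmultiples_iff]
  refine exists_congr fun n => ?_
  rw [zsmul_eq_mul]
  constructor <;> intro h <;> linarith

theorem addCircle_coe_inj_of_mem {T a b : ℝ} (ha : a ∈ Ico 0 T) (hb : b ∈ Ico 0 T)
    (h : (a : AddCircle T) = b) : a = b := by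
  have hT : 0 < T := ha.1.trans_lt ha.2
  obtain ⟨m, hm⟩ := addCircle_coe_eq_iff.1 h
  have h1 : m < 1 := by
    have : (m : ℝ) * T < 1 * T := by linarith [ha.1, hb.2]
    exact_mod_cast lt_of_mul_lt_mul_right this hT.le
  have h2 : -1 < m := by
    have : (-1 : ℝ) * T < m * T := by linarith [ha.2, hb.1]
    exact_mod_cast lt_of_mul_lt_mul_right this hT.le
  have : m = 0 := by omega
  rw [hm, this]
  simp

/-- The integers as points of a circle of integral length. -/
theorem intCast_addCircle_eq_iff {N : ℕ} {a b : ℤ} :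
    (((a : ℝ) : AddCircle (N : ℝ)) = ((b : ℝ) : AddCircle (N : ℝ))) ↔ (a : ZMod N) = b := by
  rw [addCircle_coe_eq_iff, ZMod.intCast_eq_intCast_iff_dvd_sub]
  constructor
  · rintro ⟨m, hm⟩
    refine ⟨m, ?_⟩
    have : (b : ℝ) - a = N * m := by linarith
    exact_mod_cast this
  · rintro ⟨m, hm⟩
    refine ⟨m, ?_⟩
    have : (b : ℝ) - a = N * m := by exact_mod_cast hm
    linarith

/-- The gluing of the opposite sides of a polygon with `2 * M` sides, where `M` is 2 or 3. -/
def stdRel (M : ℕ) (a b : AddCircle ((2 * M : ℕ) : ℝ)) : Prop :=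
  a = b ∨ (∃ (m : ℤ) (r : ℝ), r ∈ Ioo (0 : ℝ) 1 ∧ a = ((m + r : ℝ) : AddCircle _) ∧
    b = ((m + M + 1 - r : ℝ) : AddCircle _)) ∨
  ∃ (m : ℤ) (k : ℕ), a = ((m : ℝ) : AddCircle _) ∧ b = ((m + k * (M + 1) : ℝ) : AddCircle _)

namespace SidePairing

variable {n : ℕ} (D : SidePairing n)

/-- The relation between points of the boundary, which are given by a side and a parameter in
`[0, 1)`, of being glued. -/
def Glued (j : ZMod n) (s : ℝ) (k : ZMod n) (t : ℝ) : Prop :=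
  (s = 0 ∧ t = 0 ∧ D.perm.SameCycle j k) ∨
    (0 < s ∧ 0 < t ∧ ((j = k ∧ s = t) ∨ (k = D.pair j ∧ t = 1 - s)))

theorem rotate_glued (a j k : ZMod n) (s t : ℝ) :
    (D.rotate a).Glued (j - a) s (k - a) t ↔ D.Glued j s k t := by
  rw [Glued, Glued, rotate_sameCycle]
  simp [rotate]

variable [NeZero n] {D} {M : ℕ}

/-- The position of a boundary point on the standard polygon. -/
def circlePos (D : SidePairing n) (M : ℕ) (j : ZMod n) (s : ℝ) : AddCircle ((2 * M : ℕ) : ℝ) :=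
  (D.pos (j.val + s) : AddCircle _)

variable (h0 : (0 : ZMod n) ∈ D.ess) (hM : M = 2 ∨ M = 3) (hN : D.ess.card = 2 * M)

include h0 hN in
theorem pos_mem (j : ZMod n) {s : ℝ} (hs : s ∈ Ico (0 : ℝ) 1) :
    D.pos (j.val + s) ∈ Ico (0 : ℝ) ((2 * M : ℕ) : ℝ) := by
  have h1 := pos_mem_Ico h0 j hs
  have h2 : (D.idx j : ℝ) + 1 ≤ D.ess.card := by exact_mod_cast idx_lt h0 j
  rw [hN] at h2
  exact ⟨(Nat.cast_nonneg _).trans h1.1, h1.2.trans_le h2⟩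

omit [NeZero n] in
theorem val_add_inj {j k : ZMod n} {s t : ℝ} (hs : s ∈ Ico (0 : ℝ) 1) (ht : t ∈ Ico (0 : ℝ) 1)
    [NeZero n] (h : (j.val : ℝ) + s = k.val + t) : j = k ∧ s = t := by
  have h1 : (j.val : ℝ) < k.val + 1 := by linarith [hs.1, ht.2]
  have h2 : (k.val : ℝ) < j.val + 1 := by linarith [hs.2, ht.1]
  have h1' : j.val < k.val + 1 := by exact_mod_cast h1
  have h2' : k.val < j.val + 1 := by exact_mod_cast h2
  obtain rfl := ZMod.val_injective _ (show j.val = k.val by omega)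
  exact ⟨rfl, by linarith⟩

include h0 hN in
theorem circlePos_inj {j k : ZMod n} {s t : ℝ} (hs : s ∈ Ico (0 : ℝ) 1) (ht : t ∈ Ico (0 : ℝ) 1)
    (h : D.circlePos M j s = D.circlePos M k t) : j = k ∧ s = t :=
  val_add_inj hs ht (pos_strictMonoOn.injOn (val_add_mem j ⟨hs.1, hs.2.le⟩)
    (val_add_mem k ⟨ht.1, ht.2.le⟩)
    (addCircle_coe_inj_of_mem (pos_mem h0 hN j hs) (pos_mem h0 hN k ht) h))

include h0 in
theorem pos_sub_idx_mem {j : ZMod n} {s : ℝ} (hs : s ∈ Ico (0 : ℝ) 1)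
    (hjs : ¬(s = 0 ∧ j ∈ D.ess)) : D.pos (j.val + s) - D.idx j ∈ Ioo (0 : ℝ) 1 := by
  have h1 := pos_mem_Ico h0 j hs
  refine ⟨?_, by linarith [h1.2]⟩
  rcases hs.1.eq_or_lt with rfl | hs0
  · have := idx_lt_pos h0 (j := j) fun h => hjs ⟨rfl, h⟩
    rw [add_zero]
    linarith
  · rw [D.pos_add j ⟨hs.1, hs.2.le⟩]
    have h2 := idx_le_pos h0 j
    have h3 := mul_pos (D.len_pos j) hs0
    linarith

include h0 hM hN in
/-- A boundary point that is not at an essential corner is glued to just one other point, the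
symmetric one on the opposite side. -/
theorem exists_glued {j : ZMod n} {s : ℝ} (hs : s ∈ Ico (0 : ℝ) 1)
    (hjs : ¬(s = 0 ∧ j ∈ D.ess)) : ∃ k', ∃ t' ∈ Ico (0 : ℝ) 1,
      D.circlePos M k' t' = ((D.idx j + M + 1 - (D.pos (j.val + s) - D.idx j) : ℝ) : AddCircle _) ∧
      ∀ k, ∀ t ∈ Ico (0 : ℝ) 1, D.Glued j s k t ↔ (k = j ∧ t = s) ∨ (k = k' ∧ t = t') := by
  -- The congruence from `idx_pair` becomes an equality of real numbers up to a multiple of the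
  -- circumference 2M.
  have hidx : ∃ m : ℤ, (D.idx j + M : ℝ) = D.idx (D.pair j) + m * ((2 * M : ℕ) : ℝ) := by
    have h1 : (((D.idx (D.pair j) : ℤ) : ℝ) : AddCircle ((2 * M : ℕ) : ℝ)) =
        (((D.idx j + M : ℕ) : ℤ) : ℝ) := by
      rw [intCast_addCircle_eq_iff]
      push_cast
      exact idx_pair h0 hM hN j
    obtain ⟨m, hm⟩ := addCircle_coe_eq_iff.1 h1
    push_cast at hm
    exact ⟨m, by push_cast; exact hm⟩
  obtain ⟨m, hm⟩ := hidx
  have hpair := pos_pair h0 j ⟨hs.1, hs.2.le⟩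
  rcases hs.1.eq_or_lt with rfl | hs0
  · have hj : j ∉ D.ess := fun h => hjs ⟨rfl, h⟩
    have h1 : D.pair j + 1 ∉ D.ess := fun h' => hj (perm_mem_ess.1 h')
    have h2 := val_sub_one (ne_zero_of_notMem h0 h1)
    rw [add_sub_cancel_right] at h2
    refine ⟨D.perm j, 0, ⟨le_rfl, zero_lt_one⟩, ?_, fun k t ht => ?_⟩
    · refine addCircle_coe_eq_iff.2 ⟨m, ?_⟩
      rw [perm_apply, h2]
      rw [sub_zero] at hpair
      push_cast at hpair hm ⊢
      rw [add_zero] at hpair ⊢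
      rw [add_zero]
      linarith
    · simp only [Glued, true_and, lt_irrefl, false_and, or_false, sameCycle_iff_of_notMem hj]
      tauto
  · have ht' : 1 - s ∈ Ico (0 : ℝ) 1 := ⟨by linarith [hs.2], by linarith⟩
    refine ⟨D.pair j, 1 - s, ht', addCircle_coe_eq_iff.2 ⟨m, ?_⟩, fun k t ht => ?_⟩
    · linarith
    · simp only [Glued, hs0.ne', hs0, false_and, false_or, true_and]
      constructor
      · rintro ⟨-, ⟨rfl, rfl⟩ | h⟩
        · exact Or.inl ⟨rfl, rfl⟩
        · exact Or.inr h
      · rintro (⟨rfl, rfl⟩ | ⟨rfl, rfl⟩)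
        · exact ⟨hs0, Or.inl ⟨rfl, rfl⟩⟩
        · exact ⟨by linarith [hs.2], Or.inr ⟨rfl, rfl⟩⟩

include h0 in
/-- A boundary point in an integral position is an essential corner. -/
theorem mem_ess_of_circlePos_int {j : ZMod n} {s : ℝ} (hs : s ∈ Ico (0 : ℝ) 1) {m : ℤ}
    (h : D.circlePos M j s = ((m : ℝ) : AddCircle _)) : s = 0 ∧ j ∈ D.ess := by
  by_contra hjs
  have h1 := pos_sub_idx_mem h0 hs hjs
  obtain ⟨l, hl⟩ := addCircle_coe_eq_iff.1 h
  have h2 : D.pos (j.val + s) - D.idx j = ((m - l * (2 * M : ℕ) - D.idx j : ℤ) : ℝ) := by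
    push_cast at hl ⊢
    linarith
  rw [h2] at h1
  have h3 : 0 < m - l * (2 * M : ℕ) - D.idx j := by exact_mod_cast h1.1
  have h4 : m - l * (2 * M : ℕ) - D.idx j < 1 := by exact_mod_cast h1.2
  omega

include h0 hM hN in
-- An essential corner occupies an integral position, where the cycles of the rotation are the
-- translates by multiples of M + 1. Any other point has exactly one partner besides itself, in the
-- symmetric position on the opposite run.
theorem glued_iff_stdRel {j k : ZMod n} {s t : ℝ} (hs : s ∈ Ico (0 : ℝ) 1)
    (ht : t ∈ Ico (0 : ℝ) 1) :
    D.Glued j s k t ↔ stdRel M (D.circlePos M j s) (D.circlePos M k t) := by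
  have hess : ∀ {j}, j ∈ D.ess → D.circlePos M j 0 = (((D.idx j : ℤ) : ℝ) : AddCircle _) := by
    intro j hj
    rw [circlePos, add_zero, pos_of_mem_ess h0 hj]
    rfl
  have hess2 : ∀ {j k}, j ∈ D.ess → k ∈ D.ess → (D.perm.SameCycle j k ↔
      ∃ m : ℕ, D.circlePos M k 0 = (((D.idx j : ℤ) + m * (M + 1) : ℝ) : AddCircle _)) := by
    intro j k hj hk
    rw [sameCycle_ess_iff h0 hM hN hj hk]
    refine exists_congr fun m => ?_
    have h1 := intCast_addCircle_eq_iff (N := 2 * M) (a := D.idx k) (b := D.idx j + m * (M + 1))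
    rw [hess hk]
    push_cast at h1 ⊢
    exact h1.symm
  by_cases hjs : s = 0 ∧ j ∈ D.ess
  · obtain ⟨rfl, hj⟩ := hjs
    constructor
    · rintro (⟨-, rfl, h⟩ | ⟨h, -⟩)
      · obtain ⟨m, hm⟩ := (hess2 hj (sameCycle_mem_ess h hj)).1 h
        exact Or.inr (Or.inr ⟨D.idx j, m, hess hj, hm⟩)
      · exact absurd h (lt_irrefl _)
    · rintro (h | ⟨m, r, hr, h1, -⟩ | ⟨m, l, h1, h2⟩)
      · obtain ⟨rfl, rfl⟩ := circlePos_inj h0 hN hs ht h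
        exact Or.inl ⟨rfl, rfl, Equiv.Perm.SameCycle.refl _ _⟩
      · rw [hess hj] at h1
        obtain ⟨l, hl⟩ := addCircle_coe_eq_iff.1 h1
        have h2 : r = ((D.idx j + l * (2 * M : ℕ) - m : ℤ) : ℝ) := by
          push_cast at hl ⊢
          linarith
        rw [h2] at hr
        have h3 : 0 < D.idx j + l * (2 * M : ℕ) - m := by exact_mod_cast hr.1
        have h4 : D.idx j + l * (2 * M : ℕ) - m < 1 := by exact_mod_cast hr.2
        omega
      · have h3 : D.circlePos M k t = (((m + l * (M + 1) : ℤ) : ℝ) : AddCircle _) := by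
          rw [h2]
          push_cast
          rfl
        obtain ⟨rfl, hk⟩ := mem_ess_of_circlePos_int h0 ht h3
        refine Or.inl ⟨rfl, rfl, (hess2 hj hk).2 ⟨l, ?_⟩⟩
        rw [hess hj] at h1
        rw [h2, AddCircle.coe_add, AddCircle.coe_add, h1]
  · obtain ⟨k', t', ht', hpos, hiff⟩ := exists_glued h0 hM hN hs hjs
    have hr := pos_sub_idx_mem h0 hs hjs
    rw [hiff k t ht]
    constructor
    · rintro (⟨rfl, rfl⟩ | ⟨rfl, rfl⟩)
      · exact Or.inl rfl
      · refine Or.inr (Or.inl ⟨D.idx j, _, hr, ?_, hpos⟩)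
        rw [circlePos]
        push_cast
        congr 1
        ring
    · rintro (h | ⟨m, r, hr', h1, h2⟩ | ⟨m, l, h1, h2⟩)
      · obtain ⟨rfl, rfl⟩ := circlePos_inj h0 hN hs ht h
        exact Or.inl ⟨rfl, rfl⟩
      · obtain ⟨l, hl⟩ := addCircle_coe_eq_iff.1 h1
        -- Both fractional parts lie in (0, 1) and differ by an integer, so they agree. Hence the
        -- two candidates for the partner are in the same position.
        have h3 : r = D.pos (j.val + s) - D.idx j ∧ (m : ℝ) = D.idx j + l * (2 * M : ℕ) := by
          have h5 : r - (D.pos (j.val + s) - D.idx j) =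
              ((D.idx j + l * (2 * M : ℕ) - m : ℤ) : ℝ) := by
            push_cast at hl ⊢
            linarith
          have h6 : (D.idx j + l * (2 * M : ℕ) - m : ℤ) = 0 := by
            have h7 : (-1 : ℝ) < ((D.idx j + l * (2 * M : ℕ) - m : ℤ) : ℝ) := by
              rw [← h5]
              linarith [hr.2, hr'.1]
            have h8 : ((D.idx j + l * (2 * M : ℕ) - m : ℤ) : ℝ) < 1 := by
              rw [← h5]
              linarith [hr.1, hr'.2]
            have h7' : -1 < (D.idx j + l * (2 * M : ℕ) - m : ℤ) := by exact_mod_cast h7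
            have h8' : (D.idx j + l * (2 * M : ℕ) - m : ℤ) < 1 := by exact_mod_cast h8
            omega
          rw [h6] at h5
          refine ⟨by push_cast at h5; linarith, ?_⟩
          have h9 : (m : ℤ) = D.idx j + l * (2 * M : ℕ) := by linarith
          exact_mod_cast congrArg (Int.cast : ℤ → ℝ) h9
        have h4 : D.circlePos M k t = D.circlePos M k' t' := by
          rw [h2, hpos]
          refine addCircle_coe_eq_iff.2 ⟨-l, ?_⟩
          rw [h3.1, h3.2]
          push_cast
          ring
        obtain ⟨rfl, rfl⟩ := circlePos_inj h0 hN ht ht' h4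
        exact Or.inr ⟨rfl, rfl⟩
      · exact absurd (mem_ess_of_circlePos_int h0 hs h1) hjs

include h0 hM hN in
-- The length function `pos` increases strictly and continuously from 0 to 2M on [0, n], so it
-- descends to a continuous bijection of circles, which is a homeomorphism by compactness.
theorem exists_circleHomeo_of_zero_mem : ∃ ψ : AddCircle (n : ℝ) ≃ₜ AddCircle ((2 * M : ℕ) : ℝ),
    ∀ (j : ZMod n), ∀ s ∈ Ico (0 : ℝ) 1,
      ψ ((j.val + s : ℝ) : AddCircle (n : ℝ)) = D.circlePos M j s := by
  have hn0 : (0 : ℝ) < n := Nat.cast_pos.2 (NeZero.pos n)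
  have hM0 : (0 : ℝ) < ((2 * M : ℕ) : ℝ) := Nat.cast_pos.2 (by omega)
  have : Fact ((0 : ℝ) < n) := ⟨hn0⟩
  have : Fact ((0 : ℝ) < ((2 * M : ℕ) : ℝ)) := ⟨hM0⟩
  let f : AddCircle (n : ℝ) → AddCircle ((2 * M : ℕ) : ℝ) :=
    AddCircle.liftIco (n : ℝ) 0 fun u => (D.pos u : AddCircle ((2 * M : ℕ) : ℝ))
  have hfj : ∀ (j : ZMod n), ∀ s ∈ Ico (0 : ℝ) 1,
      f ((j.val + s : ℝ) : AddCircle (n : ℝ)) = D.circlePos M j s := by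
    intro j s hs
    have h1 : (j.val : ℝ) + 1 ≤ n := by exact_mod_cast ZMod.val_lt j
    exact AddCircle.liftIco_coe_apply
      ⟨add_nonneg (Nat.cast_nonneg _) hs.1, by linarith [hs.2]⟩
  have hrep : ∀ x : AddCircle (n : ℝ), ∃ (j : ZMod n), ∃ s ∈ Ico (0 : ℝ) 1,
      ((j.val + s : ℝ) : AddCircle (n : ℝ)) = x := by
    intro x
    obtain ⟨u, hu, rfl⟩ := (AddCircle.coe_image_Ico_eq (n : ℝ) 0).ge (mem_univ x)
    rw [zero_add] at hu
    obtain ⟨j, s, hs, rfl⟩ := exists_val_add_eq (n := n) hu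
    exact ⟨j, s, hs, rfl⟩
  have hfc : Continuous f := by
    refine AddCircle.liftIco_continuous ?_ ?_
    · rw [zero_add, D.pos_zero, pos_card h0, hN]
      exact addCircle_coe_eq_iff.2 ⟨1, by ring⟩
    · exact ((AddCircle.continuous_mk' _).comp D.continuous_pos).continuousOn
  have hfi : Function.Injective f := by
    intro x y h
    obtain ⟨j, s, hs, rfl⟩ := hrep x
    obtain ⟨k, t, ht, rfl⟩ := hrep y
    rw [hfj j s hs, hfj k t ht] at h
    obtain ⟨rfl, rfl⟩ := circlePos_inj h0 hN hs ht h
    rfl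
  have hfs : Function.Surjective f := by
    intro y
    obtain ⟨v, hv, rfl⟩ := (AddCircle.coe_image_Ico_eq ((2 * M : ℕ) : ℝ) 0).ge (mem_univ y)
    rw [zero_add] at hv
    obtain ⟨u, hu, rfl⟩ := intermediate_value_Icc hn0.le D.continuous_pos.continuousOn
      (show v ∈ Icc (D.pos 0) (D.pos n) by
        rw [D.pos_zero, pos_card h0, hN]
        exact ⟨hv.1, hv.2.le⟩)
    have hun : u < n := lt_of_le_of_ne hu.2 fun h => by
      rw [h, pos_card h0, hN] at hv
      exact lt_irrefl _ hv.2
    exact ⟨u, AddCircle.liftIco_coe_apply ⟨hu.1, by linarith⟩⟩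
  exact ⟨hfc.homeoOfEquivCompactToT2 (f := Equiv.ofBijective f ⟨hfi, hfs⟩), hfj⟩

theorem coe_val_sub (j a : ZMod n) (s : ℝ) : (((j - a).val + s : ℝ) : AddCircle (n : ℝ)) =
    ((j.val + s : ℝ) : AddCircle (n : ℝ)) + ((-a.val : ℝ) : AddCircle (n : ℝ)) := by
  rw [← AddCircle.coe_add]
  have h : ((((j - a).val : ℤ) : ℝ) : AddCircle (n : ℝ)) =
      (((j.val - a.val : ℤ) : ℝ) : AddCircle (n : ℝ)) := by
    rw [intCast_addCircle_eq_iff]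
    push_cast
    simp
  obtain ⟨m, hm⟩ := addCircle_coe_eq_iff.1 h
  refine addCircle_coe_eq_iff.2 ⟨m, ?_⟩
  push_cast at hm
  linarith

/-- Up to a homeomorphism, the boundary is glued in one of the two standard ways. -/
theorem exists_circleHomeo (D : SidePairing n) {K : Type} [Fintype K] {v : ZMod n → K}
    (hv : Function.Surjective v) (hvD : ∀ j k, v j = v k ↔ D.perm.SameCycle j k)
    (hn : n = 2 * Fintype.card K + 2) :
    ∃ M, (M = 2 ∨ M = 3) ∧ ∃ ψ : AddCircle (n : ℝ) ≃ₜ AddCircle ((2 * M : ℕ) : ℝ),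
      ∀ j k, ∀ s ∈ Ico (0 : ℝ) 1, ∀ t ∈ Ico (0 : ℝ) 1, D.Glued j s k t ↔
        stdRel M (ψ ((j.val + s : ℝ) : AddCircle (n : ℝ)))
          (ψ ((k.val + t : ℝ) : AddCircle (n : ℝ))) := by
  obtain ⟨M, hM, hN⟩ := card_ess hv hvD hn
  -- The normal form assumes that corner 0 is essential; some corner is, and rotating the numbering
  -- moves it to 0.
  obtain ⟨a, ha⟩ := Finset.card_pos.1 (show 0 < D.ess.card by omega)
  have h0 : (0 : ZMod n) ∈ (D.rotate a).ess := rotate_mem_ess.2 (by rwa [zero_add])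
  have hN' : (D.rotate a).ess.card = 2 * M := by
    rw [← hN]
    refine Finset.card_bij (fun j _ => j + a) (fun j hj => rotate_mem_ess.1 hj)
      (fun j _ k _ h => add_right_cancel h)
      fun k hk => ⟨k - a, rotate_mem_ess.2 (by rwa [sub_add_cancel]), sub_add_cancel _ _⟩
  obtain ⟨ψ, hψ⟩ := exists_circleHomeo_of_zero_mem h0 hM hN'
  refine ⟨M, hM, (Homeomorph.addRight ((-a.val : ℝ) : AddCircle (n : ℝ))).trans ψ, ?_⟩
  intro j k s hs t ht
  rw [← rotate_glued D a, glued_iff_stdRel h0 hM hN' hs ht, ← hψ _ s hs, ← hψ _ t ht,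
    coe_val_sub, coe_val_sub]
  rfl

end SidePairing

theorem exists_polygonSide_zmod {n : ℕ} [NeZero n] {z : ℂ} (hz : ‖z‖ = 1) : ∃ j : ZMod n, ∃ t ∈ Ico (0 : ℝ) 1,
    polygonSide n j.val t = z := by
  obtain ⟨j, t, ht, h⟩ := exists_polygonSide_eq (NeZero.pos n) hz
  exact ⟨((j : ℕ) : ZMod n), t, ht, by rwa [ZMod.val_cast_of_lt j.2]⟩

theorem homeomorphCircle_symm_polygonSide {n : ℕ} [NeZero n] {w : Circle} {j : ZMod n} {t : ℝ}
    (h : polygonSide n j.val t = w) :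
    (AddCircle.homeomorphCircle (Nat.cast_ne_zero.2 (NeZero.ne n) : (n : ℝ) ≠ 0)).symm w =
      ((j.val + t : ℝ) : AddCircle (n : ℝ)) := by
  rw [Homeomorph.symm_apply_eq]
  apply Circle.ext
  rw [← h, AddCircle.homeomorphCircle_apply, AddCircle.toCircle_apply_mk, Circle.coe_exp,
    polygonSide]
  congr 1
  push_cast
  ring

/-- A map of the disc to the torus is glued along the boundary circle in the standard way. -/
def StandardForm (c : ℂ → Torus2) (M : ℕ) : Prop :=
  ∃ χ : Circle ≃ₜ AddCircle ((2 * M : ℕ) : ℝ), ∀ z w : Circle, c z = c w ↔ stdRel M (χ z) (χ w)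

namespace PolygonalGraph

variable (G : PolygonalGraph) {φ : G.F} (hφ : ∀ f, f = φ)

/-- The pairing of the sides of the only polygon. -/
def sidePairing : SidePairing (G.sides φ) where
  pair := G.partner hφ
  pair_pair := G.partner_partner hφ
  pair_ne := G.partner_ne hφ
  pair_add_one_ne := G.cornerPerm_ne hφ

include hφ in
-- By `cell_side_eq_iff` the polygon map identifies boundary points exactly according to its side
-- pairing, so the combinatorial normal form applies.
theorem standardForm : ∃ M, (M = 2 ∨ M = 3) ∧ StandardForm (G.cell φ) M := by
  have hperm : (G.sidePairing hφ).perm = G.cornerPerm hφ := rfl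
  obtain ⟨M, hM, ψ, hψ⟩ := (G.sidePairing hφ).exists_circleHomeo
    (v := G.cornerVertex φ) (fun v => G.exists_cornerVertex_eq hφ v)
    (fun j k => G.cornerVertex_eq_iff hφ)
    (by rw [Fintype.card_coe]; exact G.sides_eq_two_mul_card_V_add_two hφ)
  have hn : ((G.sides φ : ℕ) : ℝ) ≠ 0 := Nat.cast_ne_zero.2 (G.sides_pos φ).ne'
  refine ⟨M, hM, (AddCircle.homeomorphCircle hn).symm.trans ψ, ?_⟩
  have hrep : ∀ z : Circle, ∃ j : ZMod (G.sides φ), ∃ s ∈ Ico (0 : ℝ) 1,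
      polygonSide (G.sides φ) j.val s = z ∧
        (AddCircle.homeomorphCircle hn).symm z = ((j.val + s : ℝ) : AddCircle _) := by
    intro z
    obtain ⟨j, s, hs, h⟩ := exists_polygonSide_zmod (n := G.sides φ) (Circle.norm_coe z)
    exact ⟨j, s, hs, h, homeomorphCircle_symm_polygonSide h⟩
  intro z w
  obtain ⟨j, s, hs, hz, hz'⟩ := hrep z
  obtain ⟨k, t, ht, hw, hw'⟩ := hrep w
  rw [← hz, ← hw, G.cell_side_eq_iff hφ hs ht, Homeomorph.trans_apply, Homeomorph.trans_apply,
    hz', hw', ← hψ j k s hs t ht]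
  rfl

end PolygonalGraph

section

open Metric

/-! ### Cones -/

/-- The direction of a nonzero complex number. -/
def unitDir (z : ℂ) : Circle :=
  if h : z = 0 then 1 else ⟨(‖z‖ : ℂ)⁻¹ * z, mem_sphere_zero_iff_norm.2 (by
    rw [norm_mul, norm_inv, Complex.norm_real, norm_norm,
      inv_mul_cancel₀ (norm_ne_zero_iff.2 h)])⟩

theorem coe_unitDir {z : ℂ} (h : z ≠ 0) : (unitDir z : ℂ) = (‖z‖ : ℂ)⁻¹ * z := by
  simp [unitDir, h]

theorem norm_mul_unitDir (z : ℂ) : (‖z‖ : ℂ) * unitDir z = z := by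
  by_cases h : z = 0
  · simp [h]
  · rw [coe_unitDir h, mul_inv_cancel_left₀]
    exact_mod_cast norm_ne_zero_iff.2 h

theorem unitDir_mul {r : ℝ} (hr : 0 < r) (w : Circle) : unitDir (r * w) = w := by
  have h : (r * w : ℂ) ≠ 0 := mul_ne_zero (by exact_mod_cast hr.ne') (Circle.coe_ne_zero w)
  apply Circle.ext
  rw [coe_unitDir h, norm_mul, Circle.norm_coe, mul_one, Complex.norm_real, Real.norm_of_nonneg hr.le,
    inv_mul_cancel_left₀]
  exact_mod_cast hr.ne'

theorem unitDir_coe (w : Circle) : unitDir w = w := by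
  simpa using unitDir_mul one_pos w

theorem continuousOn_unitDir : ContinuousOn unitDir {z | z ≠ 0} := by
  rw [continuousOn_iff_continuous_domRestrict]
  refine continuous_induced_rng.2 ?_
  refine Continuous.congr (f := fun z : {z : ℂ | z ≠ 0} => ((‖(z : ℂ)‖ : ℂ))⁻¹ * (z : ℂ))
    (Continuous.mul (Continuous.inv₀ (by fun_prop) fun z => ?_) continuous_subtype_val)
    fun z => (coe_unitDir z.2).symm
  exact_mod_cast norm_ne_zero_iff.2 z.2

section Cone

variable {W : Type} [NormedAddCommGroup W] [NormedSpace ℝ W]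

/-- The radial extension of a map of the unit circle to the plane. -/
def cone (β : Circle → W) (z : ℂ) : W := ‖z‖ • β (unitDir z)

theorem cone_coe (β : Circle → W) (w : Circle) : cone β w = β w := by
  rw [cone, Circle.norm_coe, one_smul, unitDir_coe]

/-- Directions are discontinuous at 0, but `β` is bounded on the compact circle, so the norm factor
forces continuity there. -/
theorem continuous_cone {β : Circle → W} (hβ : Continuous β) : Continuous (cone β) := by
  rw [continuous_iff_continuousAt]
  intro z
  by_cases hz : z = 0
  · obtain ⟨C, hC⟩ := (isCompact_range hβ).isBounded.exists_norm_le
    subst hz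
    rw [ContinuousAt, cone, norm_zero, zero_smul]
    refine squeeze_zero_norm (a := fun z => ‖z‖ * C) (fun z => ?_) ?_
    · rw [cone, norm_smul, norm_norm]
      exact mul_le_mul_of_nonneg_left (hC _ (mem_range_self _)) (norm_nonneg _)
    · have : Continuous fun z : ℂ => ‖z‖ * C := by fun_prop
      simpa using this.tendsto 0
  · refine continuous_norm.continuousAt.smul (hβ.continuousAt.comp ?_)
    exact continuousOn_unitDir.continuousAt (isOpen_ne.mem_nhds hz)

end Cone

theorem norm_cone_circle (θ : Circle → Circle) (z : ℂ) :
    ‖cone (fun w => (θ w : ℂ)) z‖ = ‖z‖ := by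
  rw [cone, norm_smul, norm_norm, Circle.norm_coe, mul_one]

theorem cone_cone {θ η : Circle → Circle} (h : ∀ w, θ (η w) = w) (z : ℂ) :
    cone (fun w => (θ w : ℂ)) (cone (fun w => (η w : ℂ)) z) = z := by
  by_cases hz : z = 0
  · simp [hz, cone]
  · have h1 : 0 < ‖z‖ := norm_pos_iff.2 hz
    rw [cone, norm_cone_circle, cone]
    simp only [Complex.real_smul]
    rw [unitDir_mul h1, h, norm_mul_unitDir]

/-! ### Homeomorphisms of the torus -/

/-- Two quotients of a compact space by the same relation are homeomorphic. -/
theorem exists_homeomorph_of_same_fibers {X Y Z : Type} [TopologicalSpace X] [CompactSpace X]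
    [TopologicalSpace Y] [T2Space Y] [TopologicalSpace Z] [T2Space Z] {f : X → Y}
    {g : X → Z} (hf : Continuous f) (hg : Continuous g) (hfs : Function.Surjective f)
    (hgs : Function.Surjective g) (h : ∀ x x', f x = f x' ↔ g x = g x') :
    ∃ e : Y ≃ₜ Z, ∀ x, e (f x) = g x := by
  have hq := hf.isClosedMap.isQuotientMap hf hfs
  let k : Y → Z := fun y => g (hfs y).choose
  have hk : ∀ x, k (f x) = g x := fun x => (h _ _).1 (hfs (f x)).choose_spec
  have hkc : Continuous k := by
    rw [hq.continuous_iff, show k ∘ f = g from funext hk]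
    exact hg
  have hki : Function.Injective k := fun y y' hyy => by
    obtain ⟨x, rfl⟩ := hfs y
    obtain ⟨x', rfl⟩ := hfs y'
    rw [hk, hk] at hyy
    exact (h _ _).2 hyy
  have hks : Function.Surjective k := fun z => by
    obtain ⟨x, rfl⟩ := hgs z
    exact ⟨f x, hk x⟩
  have : CompactSpace Y := hfs.compactSpace hf
  exact ⟨hkc.homeoOfEquivCompactToT2 (f := Equiv.ofBijective k ⟨hki, hks⟩), hk⟩

namespace PolygonalGraph

theorem cell_mem_carrier_iff (G : PolygonalGraph) (φ : G.F) {z : ℂ} (hz : ‖z‖ ≤ 1) :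
    G.cell φ z ∈ G.carrier ↔ ‖z‖ = 1 :=
  ⟨fun h => hz.eq_or_lt.resolve_right fun h' => G.cell_ball_notMem φ h' h, G.cell_sphere_mem φ⟩

/-- Two graphs with one region and the same standard form differ by a homeomorphism of the
torus. -/
theorem exists_homeomorph {G G' : PolygonalGraph} {φ : G.F} {φ' : G'.F} (hφ : ∀ f, f = φ)
    (hφ' : ∀ f, f = φ') {M : ℕ} (h : StandardForm (G.cell φ) M)
    (h' : StandardForm (G'.cell φ') M) :
    ∃ e : Torus2 ≃ₜ Torus2, ∀ t, e t ∈ G'.carrier ↔ t ∈ G.carrier := by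
  obtain ⟨χ, hχ⟩ := h
  obtain ⟨χ', hχ'⟩ := h'
  let θ : Circle ≃ₜ Circle := χ.trans χ'.symm
  have hθ : ∀ z w : Circle, G.cell φ z = G.cell φ w ↔ G'.cell φ' (θ z) = G'.cell φ' (θ w) := by
    intro z w
    rw [hχ, hχ']
    simp [θ]
  -- The homeomorphism of boundary circles is extended radially to the disc. It preserves norms, so
  -- it respects interior and boundary, that is, regions and graphs.
  let Θ : ℂ → ℂ := cone fun w => (θ w : ℂ)
  let Θ' : ℂ → ℂ := cone fun w => (θ.symm w : ℂ)
  have hΘ : Continuous Θ := continuous_cone (continuous_induced_dom.comp θ.continuous)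
  have hnorm : ∀ z, ‖Θ z‖ = ‖z‖ := norm_cone_circle θ
  have hinv : ∀ z, Θ' (Θ z) = z := cone_cone θ.symm_apply_apply
  have hinv' : ∀ z, Θ (Θ' z) = z := cone_cone θ.apply_symm_apply
  have hnorm' : ∀ z, ‖Θ' z‖ = ‖z‖ := norm_cone_circle θ.symm
  obtain ⟨e, he⟩ := exists_homeomorph_of_same_fibers
    (f := fun z : closedBall (0 : ℂ) 1 => G.cell φ z)
    (g := fun z : closedBall (0 : ℂ) 1 => G'.cell φ' (Θ z))
    ((G.continuousOn_cell φ).comp_continuous continuous_subtype_val fun z => z.2)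
    ((G'.continuousOn_cell φ').comp_continuous (hΘ.comp continuous_subtype_val) fun z => by
      exact mem_closedBall_zero_iff.2 ((hnorm z).trans_le (mem_closedBall_zero_iff.1 z.2)))
    (fun y => by
      obtain ⟨z, hz, h⟩ := G.cell_surjective hφ y
      exact ⟨⟨z, mem_closedBall_zero_iff.2 hz⟩, h⟩)
    (fun y => by
      obtain ⟨z, hz, h⟩ := G'.cell_surjective hφ' y
      refine ⟨⟨Θ' z, mem_closedBall_zero_iff.2 ((hnorm' z).trans_le hz)⟩, ?_⟩
      rw [← h]
      exact congrArg _ (hinv' z))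
    (by
      rintro ⟨z, hz⟩ ⟨w, hw⟩
      rw [mem_closedBall_zero_iff] at hz hw
      change G.cell φ z = G.cell φ w ↔ G'.cell φ' (Θ z) = G'.cell φ' (Θ w)
      have hΘi : Θ z = Θ w → z = w := fun h => by rw [← hinv z, h, hinv]
      -- Interior points are identified with nothing but themselves in either polygon; only pairs of
      -- boundary points use the standard form.
      rcases hz.lt_or_eq with hz1 | hz1
      · exact ⟨fun h => by rw [(G.cell_inj hz1 hw h).2],
          fun h => by rw [hΘi (G'.cell_inj (by rwa [hnorm]) (by rwa [hnorm]) h).2]⟩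
      rcases hw.lt_or_eq with hw1 | hw1
      · exact ⟨fun h => by rw [(G.cell_inj hw1 hz h.symm).2],
          fun h => by rw [hΘi (G'.cell_inj (by rwa [hnorm]) (by rwa [hnorm]) h.symm).2.symm]⟩
      · have h1 := hθ ⟨z, mem_sphere_zero_iff_norm.2 hz1⟩ ⟨w, mem_sphere_zero_iff_norm.2 hw1⟩
        have h2 := cone_coe (fun w => (θ w : ℂ)) ⟨z, mem_sphere_zero_iff_norm.2 hz1⟩
        have h3 := cone_coe (fun w => (θ w : ℂ)) ⟨w, mem_sphere_zero_iff_norm.2 hw1⟩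
        rw [← h2, ← h3] at h1
        exact h1)
  refine ⟨e, fun t => ?_⟩
  obtain ⟨z, hz, rfl⟩ := G.cell_surjective hφ t
  have := he ⟨z, mem_closedBall_zero_iff.2 hz⟩
  simp only at this
  rw [this, G.cell_mem_carrier_iff φ hz, G'.cell_mem_carrier_iff φ' (by rwa [hnorm]), hnorm]

end PolygonalGraph

/-! ### Types of fibers -/

theorem SameType.symm {X Y : Type} [TopologicalSpace X] [TopologicalSpace Y]
    {p : X → Torus2} {q : Y → Torus2} (h : SameType p q) : SameType q p := by
  obtain ⟨Φ, e, h⟩ := h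
  refine ⟨Φ.symm, e.symm, fun y => ?_⟩
  rw [Homeomorph.eq_symm_apply, ← h, Φ.apply_symm_apply]

theorem SameType.trans {X Y Z : Type} [TopologicalSpace X] [TopologicalSpace Y]
    [TopologicalSpace Z] {p : X → Torus2} {q : Y → Torus2} {r : Z → Torus2} (h : SameType p q)
    (h' : SameType q r) : SameType p r := by
  obtain ⟨Φ, e, h⟩ := h
  obtain ⟨Φ', e', h'⟩ := h'
  exact ⟨Φ.trans Φ', e.trans e', fun x => by simp [h, h']⟩

theorem IsTypeTwoFiber.sameType {X : Type} [TopologicalSpace X] {p : X → Torus2} {Γ : Set Torus2}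
    (h : IsTypeTwoFiber Γ p) : SameType p (CollapsedTorus.proj Γ) := by
  obtain ⟨Φ, h⟩ := h
  exact ⟨Φ, Homeomorph.refl _, h⟩

/-- A homeomorphism of the torus that maps one graph to another extends to the collapsed tori. -/
theorem sameType_of_homeomorph {Γ Γ' : Set Torus2} (e : Torus2 ≃ₜ Torus2)
    (he : ∀ t, e t ∈ Γ' ↔ t ∈ Γ) :
    SameType (CollapsedTorus.proj Γ) (CollapsedTorus.proj Γ') := by
  have hmap : ∀ {Γ Γ' : Set Torus2} (e : Torus2 ≃ₜ Torus2), (∀ t, e t ∈ Γ' ↔ t ∈ Γ) →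
      ∀ a b : Torus2 × Circle, collapseSetoid Γ a b →
        collapseSetoid Γ' (e a.1, a.2) (e b.1, b.2) := by
    rintro Γ Γ' e he a b (rfl | ⟨h1, h2⟩)
    · exact Or.inl rfl
    · exact Or.inr ⟨congrArg e h1, (he _).2 h2⟩
  have he' : ∀ t, e.symm t ∈ Γ ↔ t ∈ Γ' := fun t => by rw [← he, e.apply_symm_apply]
  refine ⟨{ toFun := Quotient.map' _ (hmap e he)
            invFun := Quotient.map' _ (hmap e.symm he')
            left_inv := ?_
            right_inv := ?_
            continuous_toFun := Continuous.quotient_map' (by fun_prop) _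
            continuous_invFun := Continuous.quotient_map' (by fun_prop) _ }, e, ?_⟩
  · intro x
    induction x using Quotient.inductionOn with
    | h a => exact congrArg (Quotient.mk _) (Prod.ext (e.symm_apply_apply _) rfl)
  · intro x
    induction x using Quotient.inductionOn with
    | h a => exact congrArg (Quotient.mk _) (Prod.ext (e.apply_symm_apply _) rfl)
  · intro x
    induction x using Quotient.inductionOn with
    | h a => rfl

/-- This characterizes the graph by the projection alone. The points 1 and −1 of the circle already
distinguish an uncollapsed fiber. -/
theorem subsingleton_fiber_iff {Γ : Set Torus2} {t : Torus2} :
    (CollapsedTorus.proj Γ ⁻¹' {t}).Subsingleton ↔ t ∈ Γ := by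
  constructor
  · intro h
    have h1 : (Quotient.mk (collapseSetoid Γ) (t, (1 : Circle))) =
        Quotient.mk (collapseSetoid Γ) (t, Circle.exp Real.pi) := h rfl rfl
    rcases Quotient.exact h1 with h2 | h2
    · have h3 := congrArg (fun x => (x.2 : ℂ)) h2
      simp only [Circle.coe_one, Circle.coe_exp, Complex.exp_pi_mul_I] at h3
      norm_num at h3
    · exact h2.2
  · intro h x hx y hy
    induction x using Quotient.inductionOn with
    | h a =>
      induction y using Quotient.inductionOn with
      | h b =>
        have hx' : a.1 = t := hx
        have hy' : b.1 = t := hy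
        exact Quotient.sound (Or.inr ⟨hx'.trans hy'.symm, by rwa [hx']⟩)

/-- Fibers of the same type have homeomorphic graphs. -/
theorem SameType.exists_homeomorph {Γ Γ' : Set Torus2}
    (h : SameType (CollapsedTorus.proj Γ) (CollapsedTorus.proj Γ')) :
    ∃ e : Torus2 ≃ₜ Torus2, ∀ t, e t ∈ Γ' ↔ t ∈ Γ := by
  obtain ⟨Φ, e, h⟩ := h
  refine ⟨e, fun t => ?_⟩
  rw [← subsingleton_fiber_iff, ← subsingleton_fiber_iff]
  have : CollapsedTorus.proj Γ ⁻¹' {t} = Φ ⁻¹' (CollapsedTorus.proj Γ' ⁻¹' {e t}) := by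
    ext x
    simp [h]
  rw [this]
  refine ⟨fun h => h.preimage Φ.injective, fun h => ?_⟩
  rw [← Φ.surjective.image_preimage (CollapsedTorus.proj Γ' ⁻¹' {e t})]
  exact h.image _

end

section

open Metric

/-! ### Polygonal paths -/

section Path

variable {n : ℕ} [NeZero n] {W : Type} [NormedAddCommGroup W] [NormedSpace ℝ W]

/-- The closed polygonal path with given vertices. -/
def polyPath (v : ZMod n → W) (u : ℝ) : W :=
  v 0 + ∑ k, max 0 (min 1 (u - k.val)) • (v (k + 1) - v k)

theorem continuous_polyPath (v : ZMod n → W) : Continuous (polyPath v) := by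
  unfold polyPath
  fun_prop

omit [NormedSpace ℝ W] in
theorem sum_sub_eq (v : ZMod n → W) (j : ZMod n) :
    ∑ k with k.val < j.val, (v (k + 1) - v k) = v j - v 0 := by
  induction hm : j.val generalizing j with
  | zero =>
    rw [ZMod.val_eq_zero] at hm
    simp [hm]
  | succ m ih =>
    have hj : j ≠ 0 := by
      rintro rfl
      simp at hm
    have h1 := SidePairing.val_sub_one hj
    have h2 : (Finset.univ.filter fun k : ZMod n => k.val < m + 1) =
        insert (j - 1) (Finset.univ.filter fun k : ZMod n => k.val < m) := by
      ext k
      have h3 : k = j - 1 ↔ k.val = (j - 1).val := (ZMod.val_injective n).eq_iff.symm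
      simp only [Finset.mem_filter, Finset.mem_univ, true_and, Finset.mem_insert, h3]
      omega
    rw [h2, Finset.sum_insert, ih (j - 1) (by omega), sub_add_cancel]
    · abel
    · simp only [Finset.mem_filter, Finset.mem_univ, true_and]
      omega

theorem polyPath_side (v : ZMod n → W) (j : ZMod n) {t : ℝ} (ht : t ∈ Icc (0 : ℝ) 1) :
    polyPath v (j.val + t) = v j + t • (v (j + 1) - v j) := by
  have h1 : ∀ k : ZMod n, max 0 (min 1 ((j.val + t : ℝ) - k.val)) • (v (k + 1) - v k) =
      (if k.val < j.val then v (k + 1) - v k else 0) +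
        if k = j then t • (v (j + 1) - v j) else 0 := by
    intro k
    rcases lt_trichotomy k.val j.val with h | h | h
    · have h' : (k.val : ℝ) + 1 ≤ j.val := by exact_mod_cast h
      rw [min_eq_left (by linarith [ht.1]), max_eq_right zero_le_one, if_pos h, if_neg]
      · simp
      · rintro rfl
        exact lt_irrefl _ h
    · obtain rfl := ZMod.val_injective _ h
      rw [add_sub_cancel_left, min_eq_right ht.2, max_eq_right ht.1]
      simp
    · have h' : (j.val : ℝ) + 1 ≤ k.val := by exact_mod_cast h
      rw [max_eq_left, if_neg h.not_gt, if_neg]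
      · simp
      · rintro rfl
        exact lt_irrefl _ h
      · exact (min_le_right _ _).trans (by linarith [ht.2])
  rw [polyPath, Finset.sum_congr rfl fun k _ => h1 k, Finset.sum_add_distrib, Finset.sum_ite_eq',
    if_pos (Finset.mem_univ _), ← Finset.sum_filter, sum_sub_eq]
  abel

theorem polyPath_card (v : ZMod n → W) : polyPath v n = polyPath v 0 := by
  have h1 : ∀ k : ZMod n, max 0 (min 1 ((n : ℝ) - k.val)) • (v (k + 1) - v k) =
      v (k + 1) - v k := by
    intro k
    have : (k.val : ℝ) + 1 ≤ n := by exact_mod_cast ZMod.val_lt k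
    rw [min_eq_left (by linarith), max_eq_right zero_le_one, one_smul]
  have h2 := polyPath_side v 0 (t := 0) ⟨le_rfl, zero_le_one⟩
  have h3 : ∑ k, v (k + 1) = ∑ k, v k := Equiv.sum_comp (Equiv.addRight 1) v
  rw [polyPath, Finset.sum_congr rfl fun k _ => h1 k, Finset.sum_sub_distrib, h3, sub_self,
    add_zero]
  simpa using h2.symm

/-- The closed polygonal path, parametrized by the unit circle. -/
def polyLoop (v : ZMod n → W) (w : Circle) : W :=
  haveI : Fact ((0 : ℝ) < n) := ⟨Nat.cast_pos.2 (NeZero.pos n)⟩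
  AddCircle.liftIco (n : ℝ) 0 (polyPath v)
    ((AddCircle.homeomorphCircle (Nat.cast_ne_zero.2 (NeZero.ne n))).symm w)

theorem continuous_polyLoop (v : ZMod n → W) : Continuous (polyLoop v) := by
  have : Fact ((0 : ℝ) < n) := ⟨Nat.cast_pos.2 (NeZero.pos n)⟩
  refine Continuous.comp (AddCircle.liftIco_continuous ?_
    (continuous_polyPath v).continuousOn) (Homeomorph.continuous _)
  rw [zero_add, polyPath_card]

theorem polyLoop_of_eq (v : ZMod n → W) {w : Circle} {j : ZMod n} {t : ℝ}
    (ht : t ∈ Ico (0 : ℝ) 1) (h : polygonSide n j.val t = w) :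
    polyLoop v w = v j + t • (v (j + 1) - v j) := by
  have : Fact ((0 : ℝ) < n) := ⟨Nat.cast_pos.2 (NeZero.pos n)⟩
  have h1 : (j.val : ℝ) + 1 ≤ n := by exact_mod_cast ZMod.val_lt j
  rw [polyLoop, homeomorphCircle_symm_polygonSide h, AddCircle.liftIco_coe_apply,
    polyPath_side v j ⟨ht.1, ht.2.le⟩]
  exact ⟨add_nonneg (Nat.cast_nonneg _) ht.1, by linarith [ht.2]⟩

end Path

/-! ### Centrally symmetric polygons that tile the plane -/

theorem torusMk_eq_iff {x y : ℝ × ℝ} :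
    torusMk x = torusMk y ↔ ∃ p q : ℤ, y = x + ((p : ℝ), (q : ℝ)) := by
  simp only [torusMk, unitAddCircle_coe_eq_iff, Prod.ext_iff, Prod.fst_add,
    Prod.snd_add]
  constructor
  · rintro ⟨⟨p, hp⟩, q, hq⟩
    exact ⟨p, q, hp, hq⟩
  · rintro ⟨p, q, hp, hq⟩
    exact ⟨⟨p, hp⟩, q, hq⟩

theorem torusMk_add_left (c : ℝ × ℝ) {x y : ℝ × ℝ} :
    torusMk (c + x) = torusMk (c + y) ↔ torusMk x = torusMk y := by
  simp only [torusMk_eq_iff, add_assoc, add_right_inj]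

theorem continuous_torusMk : Continuous torusMk :=
  ((AddCircle.continuous_mk' 1).comp continuous_fst).prodMk
    ((AddCircle.continuous_mk' 1).comp continuous_snd)

/-- A centrally symmetric polygon with `2 * m` sides whose translates tile the plane, described by
its gauge function. -/
structure SymmetricTile (m : ℕ) where
  v : ZMod (2 * m) → ℝ × ℝ
  gauge : ℝ × ℝ → ℝ
  continuous_gauge : Continuous gauge
  gauge_smul : ∀ r : ℝ, 0 ≤ r → ∀ x, gauge (r • x) = r * gauge x
  gauge_add : ∀ x y, gauge (x + y) ≤ gauge x + gauge y
  gauge_pos : ∀ x, x ≠ 0 → 0 < gauge x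
  gauge_side : ∀ j, ∀ t ∈ Icc (0 : ℝ) 1, gauge (v j + t • (v (j + 1) - v j)) = 1
  exists_side : ∀ x, gauge x = 1 → ∃ j, ∃ t ∈ Icc (0 : ℝ) 1, v j + t • (v (j + 1) - v j) = x
  side_inj : ∀ j k, ∀ s ∈ Ico (0 : ℝ) 1, ∀ t ∈ Ico (0 : ℝ) 1,
    v j + s • (v (j + 1) - v j) = v k + t • (v (k + 1) - v k) → j = k ∧ s = t
  v_opposite : ∀ j, v (j + m) = -v j
  v_add_v : ∀ j, ∃ p q : ℤ, v j + v (j + 1) = ((p : ℝ), (q : ℝ))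
  torus_inj : ∀ x y, gauge x < 1 → gauge y ≤ 1 → torusMk x = torusMk y → x = y
  torus_surj : ∀ x, ∃ y, gauge y ≤ 1 ∧ torusMk y = torusMk x
  edge_inj : ∀ i j : Fin m, ∀ s ∈ Ioo (0 : ℝ) 1, ∀ t ∈ Icc (0 : ℝ) 1,
    torusMk (v (i : ℕ) + s • (v ((i : ℕ) + 1) - v (i : ℕ))) =
      torusMk (v (j : ℕ) + t • (v ((j : ℕ) + 1) - v (j : ℕ))) → i = j ∧ s = t
  degree : ∀ j, 2 ≤ Nat.card {e : Fin m // torusMk (v (e : ℕ)) = torusMk (v j)} +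
    Nat.card {e : Fin m // torusMk (v ((e : ℕ) + 1)) = torusMk (v j)}

namespace SymmetricTile

variable {m : ℕ} [NeZero m] (T : SymmetricTile m)

/-- The point with parameter `t` on a side. -/
def pt (j : ZMod (2 * m)) (t : ℝ) : ℝ × ℝ := T.v j + t • (T.v (j + 1) - T.v j)

omit [NeZero m] in
theorem pt_zero (j : ZMod (2 * m)) : T.pt j 0 = T.v j := by simp [pt]

omit [NeZero m] in
theorem pt_one (j : ZMod (2 * m)) : T.pt j 1 = T.v (j + 1) := by simp [pt]

omit [NeZero m] in
theorem gauge_v (j : ZMod (2 * m)) : T.gauge (T.v j) = 1 := by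
  rw [← pt_zero]
  exact T.gauge_side j 0 ⟨le_rfl, zero_le_one⟩

omit [NeZero m] in
theorem gauge_zero : T.gauge 0 = 0 := by
  simpa using T.gauge_smul 0 le_rfl 0

omit [NeZero m] in
theorem gauge_nonneg (x : ℝ × ℝ) : 0 ≤ T.gauge x := by
  by_cases h : x = 0
  · rw [h, gauge_zero]
  · exact (T.gauge_pos x h).le

omit [NeZero m] in
theorem pt_opposite (j : ZMod (2 * m)) (t : ℝ) : T.pt (j + m) t = -T.pt j t := by
  have h : T.v (j + m + 1) = -T.v (j + 1) := by rw [← T.v_opposite, add_right_comm]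
  rw [pt, pt, h, T.v_opposite, neg_add, ← smul_neg]
  congr 2
  abel

omit [NeZero m] in
-- Central symmetry gives the point −`pt j t` on the opposite side, and it differs from `pt j (1 -
-- t)` by `v j + v (j + 1)`, a lattice vector. So opposite sides are glued with reversed parameters.
theorem torusMk_pt_opposite (j : ZMod (2 * m)) (t : ℝ) :
    torusMk (T.pt (j + m) t) = torusMk (T.pt j (1 - t)) := by
  obtain ⟨p, q, h⟩ := T.v_add_v j
  refine torusMk_eq_iff.2 ⟨p, q, ?_⟩
  rw [← h, pt_opposite, pt, pt, sub_smul, one_smul]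
  abel

theorem exists_half (j : ZMod (2 * m)) :
    ∃ i : Fin m, j = (i : ℕ) ∨ j = (i : ℕ) + m := by
  have h := ZMod.val_lt j
  have hj : ((j.val : ℕ) : ZMod (2 * m)) = j := by simp
  by_cases hm : j.val < m
  · exact ⟨⟨j.val, hm⟩, Or.inl hj.symm⟩
  · refine ⟨⟨j.val - m, by omega⟩, Or.inr ?_⟩
    rw [← Nat.cast_add, Nat.sub_add_cancel (not_lt.1 hm), hj]

/-- The boundary, parametrized by the circle. -/
def loop (w : Circle) : ℝ × ℝ := polyLoop T.v w

theorem loop_of_eq {w : Circle} {j : ZMod (2 * m)} {t : ℝ} (ht : t ∈ Icc (0 : ℝ) 1)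
    (h : polygonSide (2 * m) j.val t = w) : T.loop w = T.pt j t := by
  rcases ht.2.lt_or_eq with h1 | rfl
  · exact polyLoop_of_eq T.v ⟨ht.1, h1⟩ h
  · rw [polygonSide_one_zmod] at h
    rw [pt_one, ← pt_zero]
    exact polyLoop_of_eq T.v ⟨le_rfl, zero_lt_one⟩ h

theorem gauge_loop (w : Circle) : T.gauge (T.loop w) = 1 := by
  obtain ⟨j, t, ht, h⟩ := exists_polygonSide_zmod (n := 2 * m) (Circle.norm_coe w)
  have ht' : t ∈ Icc (0 : ℝ) 1 := ⟨ht.1, ht.2.le⟩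
  rw [T.loop_of_eq ht' h]
  exact T.gauge_side j t ht'

theorem loop_injective : Function.Injective T.loop := by
  intro w w' hw
  obtain ⟨j, t, ht, h⟩ := exists_polygonSide_zmod (n := 2 * m) (Circle.norm_coe w)
  obtain ⟨k, s, hs, h'⟩ := exists_polygonSide_zmod (n := 2 * m) (Circle.norm_coe w')
  rw [T.loop_of_eq ⟨ht.1, ht.2.le⟩ h, T.loop_of_eq ⟨hs.1, hs.2.le⟩ h'] at hw
  obtain ⟨rfl, rfl⟩ := T.side_inj j k t ht s hs hw
  exact Circle.ext (h.symm.trans h')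

theorem exists_loop_eq {x : ℝ × ℝ} (hx : T.gauge x = 1) : ∃ w, T.loop w = x := by
  obtain ⟨j, t, ht, rfl⟩ := T.exists_side x hx
  exact ⟨⟨_, mem_sphere_zero_iff_norm.2 (norm_polygonSide (2 * m) j.val t)⟩, T.loop_of_eq ht rfl⟩

/-- The parametrization of the polygon by the disc. -/
def disc (z : ℂ) : ℝ × ℝ := cone T.loop z

theorem gauge_disc (z : ℂ) : T.gauge (T.disc z) = ‖z‖ := by
  rw [disc, cone, T.gauge_smul _ (norm_nonneg _), gauge_loop, mul_one]

theorem disc_injective : Function.Injective T.disc := by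
  intro z w h
  have h1 : ‖z‖ = ‖w‖ := by rw [← T.gauge_disc, h, T.gauge_disc]
  by_cases hz : ‖z‖ = 0
  · rw [norm_eq_zero.1 hz, norm_eq_zero.1 (h1.symm.trans hz)]
  · rw [disc, disc, cone, cone, ← h1] at h
    have h2 := T.loop_injective (smul_right_injective _ hz h)
    rw [← norm_mul_unitDir z, ← norm_mul_unitDir w, h1, h2]

theorem exists_disc_eq (x : ℝ × ℝ) : ∃ z, T.disc z = x := by
  by_cases hx : x = 0
  · exact ⟨0, by simp [disc, cone, hx]⟩
  · have h := T.gauge_pos x hx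
    obtain ⟨w, hw⟩ := T.exists_loop_eq (x := (T.gauge x)⁻¹ • x) (by
      rw [T.gauge_smul _ (inv_nonneg.2 h.le), inv_mul_cancel₀ h.ne'])
    refine ⟨T.gauge x * w, ?_⟩
    rw [disc, cone, unitDir_mul h, hw, norm_mul, Circle.norm_coe, mul_one, Complex.norm_real,
      Real.norm_of_nonneg h.le, smul_inv_smul₀ h.ne']

theorem continuous_disc : Continuous T.disc := continuous_cone (continuous_polyLoop T.v)

theorem disc_polygonSide (j : ZMod (2 * m)) {t : ℝ} (ht : t ∈ Icc (0 : ℝ) 1) :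
    T.disc (polygonSide (2 * m) j.val t) = T.pt j t := by
  rw [← T.loop_of_eq (w := ⟨_, mem_sphere_zero_iff_norm.2 (norm_polygonSide (2 * m) j.val t)⟩) ht
    rfl]
  exact cone_coe T.loop ⟨_, mem_sphere_zero_iff_norm.2 (norm_polygonSide (2 * m) j.val t)⟩

variable (c : ℝ × ℝ)

open Classical in
/-- The vertices of the tiling. -/
def vertices : Finset Torus2 := Finset.univ.image fun j => torusMk (c + T.v j)

theorem mem_vertices {y : Torus2} : y ∈ T.vertices c ↔ ∃ j, torusMk (c + T.v j) = y := by
  simp [vertices]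

/-- The first m sides suffice as edges, since every other side coincides in the torus with its
opposite one. -/
theorem tile_graph_eq :
    (T.vertices c : Set Torus2) ∪
      ⋃ e : Fin m, (fun t => torusMk (c + T.pt (e : ℕ) t)) '' Icc (0 : ℝ) 1 =
    (fun x => torusMk (c + x)) '' {x | T.gauge x = 1} := by
  ext y
  constructor
  · rintro (h | h)
    · obtain ⟨j, rfl⟩ := (T.mem_vertices c).1 h
      exact ⟨_, T.gauge_v j, rfl⟩
    · obtain ⟨e, t, ht, rfl⟩ := mem_iUnion.1 h
      exact ⟨_, T.gauge_side _ t ht, rfl⟩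
  · rintro ⟨x, hx, rfl⟩
    obtain ⟨j, t, ht, rfl⟩ := T.exists_side x hx
    change torusMk (c + T.pt j t) ∈ _
    obtain ⟨i, rfl | rfl⟩ := exists_half j
    · exact Or.inr (mem_iUnion.2 ⟨i, t, ht, rfl⟩)
    · refine Or.inr (mem_iUnion.2 ⟨i, 1 - t, ⟨by linarith [ht.2], by linarith [ht.1]⟩, ?_⟩)
      exact (torusMk_add_left c).2 (T.torusMk_pt_opposite _ t).symm

omit [NeZero m] in
theorem tile_interior_eq :
    (fun x => torusMk (c + x)) '' {x | T.gauge x < 1} =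
      ((fun x => torusMk (c + x)) '' {x | T.gauge x = 1})ᶜ := by
  ext y
  constructor
  · rintro ⟨x, hx, rfl⟩ ⟨x', hx', h⟩
    have := T.torus_inj x x' hx (le_of_eq hx') ((torusMk_add_left c).1 h.symm)
    rw [this] at hx
    exact absurd hx' (ne_of_lt hx)
  · intro h
    obtain ⟨a, ha⟩ := QuotientAddGroup.mk_surjective y.1
    obtain ⟨b, hb⟩ := QuotientAddGroup.mk_surjective y.2
    obtain ⟨x, hx, hxy⟩ := T.torus_surj ((a, b) - c)
    have hy : torusMk (c + x) = y := by
      rw [(torusMk_add_left c).2 hxy, add_sub_cancel]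
      exact Prod.ext ha hb
    exact ⟨x, lt_of_le_of_ne hx fun h1 => h ⟨x, h1, hy⟩, hy⟩

/-- The graph formed by the boundary of the tile with center `c`. -/
def graph : PolygonalGraph where
  V := T.vertices c
  E := Fin m
  edge e t := torusMk (c + T.pt (e : ℕ) t)
  continuousOn_edge e := by
    unfold pt
    exact (continuous_torusMk.comp (by fun_prop)).continuousOn
  edge_zero_mem e := (T.mem_vertices c).2 ⟨_, by rw [pt_zero]⟩
  edge_one_mem e := (T.mem_vertices c).2 ⟨_, by rw [pt_one]⟩
  injOn_edge := by
    rintro ⟨e, s⟩ ⟨-, hs⟩ ⟨e', s'⟩ ⟨-, hs'⟩ h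
    obtain ⟨rfl, rfl⟩ := T.edge_inj e e' s hs s' (Ioo_subset_Icc_self hs')
      ((torusMk_add_left c).1 h)
    rfl
  edge_notMem e t ht h := by
    obtain ⟨j, hj⟩ := (T.mem_vertices c).1 h
    rw [torusMk_add_left, ← pt_zero] at hj
    obtain ⟨i, rfl | rfl⟩ := exists_half j
    · obtain ⟨-, rfl⟩ := T.edge_inj e i t ht 0 ⟨le_rfl, zero_le_one⟩ hj.symm
      exact lt_irrefl _ ht.1
    · rw [torusMk_pt_opposite, sub_zero] at hj
      obtain ⟨-, rfl⟩ := T.edge_inj e i t ht 1 ⟨zero_le_one, le_rfl⟩ hj.symm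
      exact lt_irrefl _ ht.2
  two_le_degree v hv := by
    obtain ⟨j, rfl⟩ := (T.mem_vertices c).1 hv
    simp only [torusMk_add_left, pt_zero, pt_one]
    exact T.degree j
  F := Unit
  sides _ := 2 * m
  sides_pos _ := NeZero.pos (2 * m)
  cell _ z := torusMk (c + T.disc z)
  continuousOn_cell _ :=
    (continuous_torusMk.comp (continuous_const.add T.continuous_disc)).continuousOn
  injOn_cell := by
    rintro ⟨⟨⟩, z⟩ ⟨-, hz⟩ ⟨⟨⟩, z'⟩ ⟨-, hz'⟩ h
    rw [mem_ball_zero_iff, ← T.gauge_disc] at hz hz'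
    exact Prod.ext rfl (T.disc_injective (T.torus_inj _ _ hz hz'.le ((torusMk_add_left c).1 h)))
  iUnion_cell := by
    rw [iUnion_const, tile_graph_eq, ← tile_interior_eq]
    ext y
    constructor
    · rintro ⟨z, hz, rfl⟩
      exact ⟨T.disc z, (T.gauge_disc z).trans_lt (mem_ball_zero_iff.1 hz), rfl⟩
    · rintro ⟨x, hx, rfl⟩
      obtain ⟨z, rfl⟩ := T.exists_disc_eq x
      exact ⟨z, mem_ball_zero_iff.2 ((T.gauge_disc z).symm.trans_lt hx), rfl⟩
  -- The second half of the sides runs backwards through the edges given by the first half.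
  side _ j := (⟨j % m, Nat.mod_lt _ (NeZero.pos m)⟩, decide (j < m))
  cell_side := by
    rintro ⟨⟩ j t ht
    have h1 := T.disc_polygonSide ((j : ℕ) : ZMod (2 * m)) ht
    rw [ZMod.val_cast_of_lt j.2] at h1
    rw [h1, torusMk_add_left]
    by_cases hj : (j : ℕ) < m
    · simp [hj, Nat.mod_eq_of_lt]
    · have h2 : (j : ℕ) % m = j - m := by
        rw [Nat.mod_eq_sub_mod (not_lt.1 hj), Nat.mod_eq_of_lt]
        omega
      have h3 : ((j : ℕ) : ZMod (2 * m)) = ((j - m : ℕ) : ZMod (2 * m)) + m := by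
        rw [← Nat.cast_add, Nat.sub_add_cancel (not_lt.1 hj)]
      simp only [hj, decide_false, Bool.false_eq_true, if_false, h2]
      rw [h3, torusMk_pt_opposite]
  card_side e := by
    rw [Nat.card_eq_two_iff]
    have he := e.2
    refine ⟨⟨⟨(), ⟨e, by omega⟩⟩, Fin.ext (Nat.mod_eq_of_lt he)⟩,
      ⟨⟨(), ⟨e + m, by omega⟩⟩, Fin.ext (by simp [Nat.mod_eq_of_lt he])⟩, ?_, ?_⟩
    · intro h
      have h1 := eq_of_heq (Sigma.mk.inj_iff.1 (congrArg Subtype.val h)).2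
      have h2 := congrArg Fin.val h1
      have := NeZero.pos m
      simp at h2
      omega
    · rw [eq_univ_iff_forall]
      rintro ⟨⟨⟨⟩, j⟩, h⟩
      have h1 : (j : ℕ) % m = e := congrArg Fin.val h
      by_cases hj : (j : ℕ) < m
      · rw [Nat.mod_eq_of_lt hj] at h1
        exact Or.inl (Subtype.ext (Sigma.ext rfl (heq_of_eq (Fin.ext h1))))
      · have h2 : (j : ℕ) % m = j - m := by
          rw [Nat.mod_eq_sub_mod (not_lt.1 hj), Nat.mod_eq_of_lt]
          omega
        exact Or.inr (Subtype.ext (Sigma.ext rfl (heq_of_eq (Fin.ext (by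
          change (j : ℕ) = e + m
          omega)))))

theorem carrier_graph :
    (T.graph c).carrier = (fun x => torusMk (c + x)) '' {x | T.gauge x = 1} :=
  T.tile_graph_eq c

/-- The tile with center `c`. -/
def tile : Set (ℝ × ℝ) := {x | T.gauge (x - c) ≤ 1}

omit [NeZero m] in
-- A point of gauge 1 is a limit of its multiples by factors r > 1, which have gauge r and lie
-- outside.
theorem interior_gauge_le : interior {x | T.gauge x ≤ 1} = {x | T.gauge x < 1} := by
  refine Subset.antisymm (fun x hx => ?_) ?_
  · have h0 : T.gauge x ≤ 1 := (interior_subset hx : x ∈ {x | T.gauge x ≤ 1})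
    refine lt_of_le_of_ne h0 fun h1 => ?_
    have hc : Filter.Tendsto (fun r : ℝ => r • x) (nhds 1) (nhds x) := by
      have : Continuous fun r : ℝ => r • x := by fun_prop
      simpa using this.tendsto 1
    have hev := hc (mem_interior_iff_mem_nhds.1 hx)
    obtain ⟨r, hr, hr1⟩ := ((frequently_gt_nhds (1 : ℝ)).and_eventually hev).exists
    have h2 : T.gauge (r • x) ≤ 1 := hr1
    rw [T.gauge_smul r (by linarith), h1] at h2
    linarith
  · have h0 : {x | T.gauge x < 1} ⊆ {x | T.gauge x ≤ 1} :=
      fun x (hx : T.gauge x < 1) => le_of_lt hx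
    exact interior_maximal h0 (isOpen_lt T.continuous_gauge continuous_const)

omit [NeZero m] in
theorem interior_tile : interior (T.tile c) = {x | T.gauge (x - c) < 1} := by
  have h := (Homeomorph.subRight c).preimage_interior {x | T.gauge x ≤ 1}
  rw [interior_gauge_le] at h
  exact h.symm

omit [NeZero m] in
theorem frontier_tile : frontier (T.tile c) = {x | T.gauge (x - c) = 1} := by
  have hcl : IsClosed (T.tile c) :=
    isClosed_le (T.continuous_gauge.comp (by fun_prop)) continuous_const
  rw [frontier, hcl.closure_eq, interior_tile]
  ext x
  simp only [tile, mem_sdiff, mem_ofPred_eq, not_lt]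
  exact ⟨fun h => h.1.antisymm h.2, fun h => ⟨h.le, h.ge⟩⟩

theorem boundaryGraph_tile : boundaryGraph (T.tile c) = (T.graph c).carrier := by
  rw [boundaryGraph, frontier_tile, carrier_graph]
  ext y
  constructor
  · rintro ⟨x, hx, rfl⟩
    exact ⟨x - c, hx, by simp⟩
  · rintro ⟨x, hx, rfl⟩
    exact ⟨c + x, by simpa using hx, rfl⟩

omit [NeZero m] in
theorem isFundamentalPolygon_tile : IsFundamentalPolygon (T.tile c) := by
  constructor
  · rw [eq_univ_iff_forall]
    intro y
    by_cases h : y ∈ (fun x => torusMk (c + x)) '' {x | T.gauge x = 1}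
    · obtain ⟨x, hx, rfl⟩ := h
      exact ⟨c + x, by simpa [tile] using le_of_eq hx, rfl⟩
    · rw [← mem_compl_iff, ← tile_interior_eq] at h
      obtain ⟨x, hx, rfl⟩ := h
      exact ⟨c + x, by simpa [tile] using le_of_lt hx, rfl⟩
  · rw [interior_tile]
    intro x hx y hy h
    have := T.torus_inj (x - c) (y - c) hx (le_of_lt hy)
      ((torusMk_add_left c).1 (by simpa using h))
    simpa using this

omit [NeZero m] in
/-- The tile is the convex hull of its vertices. -/
theorem convexHull_eq_tile : convexHull ℝ (range fun j => c + T.v j) = T.tile c := by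
  refine Subset.antisymm (convexHull_min ?_ ?_) ?_
  · rintro _ ⟨j, rfl⟩
    simpa [tile] using (T.gauge_v j).le
  · intro x hx y hy a b ha hb hab
    have h1 : a • x + b • y - c = a • (x - c) + b • (y - c) := by
      rw [smul_sub, smul_sub, sub_add_sub_comm, ← add_smul, hab, one_smul]
    have h2 := T.gauge_add (a • (x - c)) (b • (y - c))
    have hx' : T.gauge (x - c) ≤ 1 := hx
    have hy' : T.gauge (y - c) ≤ 1 := hy
    rw [T.gauge_smul a ha, T.gauge_smul b hb] at h2
    change T.gauge _ ≤ 1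
    rw [h1]
    nlinarith
  · intro x hx
    have hcv := convex_convexHull ℝ (range fun j => c + T.v j)
    have hv : ∀ j, c + T.v j ∈ convexHull ℝ (range fun j => c + T.v j) :=
      fun j => subset_convexHull ℝ _ (mem_range_self j)
    -- The center is the midpoint of two opposite vertices.
    have hc : c ∈ convexHull ℝ (range fun j => c + T.v j) := by
      have := hcv (hv 0) (hv (0 + m)) (a := 1 / 2) (b := 1 / 2) (by norm_num) (by norm_num)
        (by norm_num)
      rw [T.v_opposite] at this
      convert this using 1
      rw [← smul_add, add_add_add_comm, add_neg_cancel, add_zero, ← two_smul ℝ c, smul_smul]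
      norm_num
    have hg0 := T.gauge_nonneg (x - c)
    have hg1 : T.gauge (x - c) ≤ 1 := hx
    rcases hg0.eq_or_lt with h | h
    · have : x - c = 0 := by
        by_contra hne
        exact (T.gauge_pos _ hne).ne h
      rwa [sub_eq_zero.1 this]
    -- Scaling from the center by the inverse of the gauge gives a point on a side; the given point
    -- lies on the segment from the center to it.
    · obtain ⟨j, t, ht, hjt⟩ := T.exists_side ((T.gauge (x - c))⁻¹ • (x - c)) (by
        rw [T.gauge_smul _ (inv_nonneg.2 hg0), inv_mul_cancel₀ h.ne'])
      have h1 : c + (T.v j + t • (T.v (j + 1) - T.v j)) ∈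
          convexHull ℝ (range fun j => c + T.v j) := by
        have := hcv (hv j) (hv (j + 1)) (a := 1 - t) (b := t) (by linarith [ht.2]) ht.1 (by ring)
        convert this using 1
        module
      have h2 := hcv hc h1 (a := 1 - T.gauge (x - c)) (b := T.gauge (x - c)) (by linarith) hg0
        (by ring)
      rw [hjt] at h2
      convert h2 using 1
      rw [smul_add, smul_inv_smul₀ h.ne']
      module

end SymmetricTile

end

/-! ### The hexagon -/

theorem int_eq_zero_of_lt {p : ℤ} (h1 : (-1 : ℝ) < p) (h2 : (p : ℝ) < 1) : p = 0 := by
  have h1' : (-1 : ℤ) < p := by exact_mod_cast h1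
  have h2' : p < (1 : ℤ) := by exact_mod_cast h2
  omega

theorem two_le_card_subtype {ι : Type} [Finite ι] {P : ι → Prop} {a b : ι} (ha : P a) (hb : P b)
    (hab : a ≠ b) : 2 ≤ Nat.card {i // P i} := by
  have : Nontrivial {i // P i} := ⟨⟨⟨a, ha⟩, ⟨b, hb⟩, fun h => hab (congrArg Subtype.val h)⟩⟩
  exact Finite.one_lt_card

/-- The vertices of the hexagon. -/
def hexVertex : ZMod (2 * 3) → ℝ × ℝ :=
  ![(2/3, 1/3), (1/3, 2/3), (-1/3, 1/3), (-2/3, -1/3), (-1/3, -2/3), (1/3, -1/3)]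

/-- The gauge function of the hexagon. -/
def hexGauge (x : ℝ × ℝ) : ℝ := max |x.1 + x.2| (max |2 * x.1 - x.2| |2 * x.2 - x.1|)

theorem hexGauge_le_one {x : ℝ × ℝ} : hexGauge x ≤ 1 ↔ (-1 ≤ x.1 + x.2 ∧ x.1 + x.2 ≤ 1) ∧
    (-1 ≤ 2 * x.1 - x.2 ∧ 2 * x.1 - x.2 ≤ 1) ∧ (-1 ≤ 2 * x.2 - x.1 ∧ 2 * x.2 - x.1 ≤ 1) := by
  simp only [hexGauge, max_le_iff, abs_le]

theorem hexGauge_lt_one {x : ℝ × ℝ} : hexGauge x < 1 ↔ (-1 < x.1 + x.2 ∧ x.1 + x.2 < 1) ∧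
    (-1 < 2 * x.1 - x.2 ∧ 2 * x.1 - x.2 < 1) ∧ (-1 < 2 * x.2 - x.1 ∧ 2 * x.2 - x.1 < 1) := by
  simp only [hexGauge, max_lt_iff, abs_lt]

theorem one_le_hexGauge {x : ℝ × ℝ} : 1 ≤ hexGauge x ↔ (1 ≤ x.1 + x.2 ∨ 1 ≤ -(x.1 + x.2)) ∨
    (1 ≤ 2 * x.1 - x.2 ∨ 1 ≤ -(2 * x.1 - x.2)) ∨ (1 ≤ 2 * x.2 - x.1 ∨ 1 ≤ -(2 * x.2 - x.1)) := by
  simp only [hexGauge, le_max_iff, le_abs]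

/-- Explicit coordinates for all six sides, which reduce the conditions on the hexagon to linear
arithmetic. -/
theorem hexSide (j : ZMod (2 * 3)) (t : ℝ) :
    (j = 0 ∧ hexVertex j + t • (hexVertex (j + 1) - hexVertex j) = (2/3 - t/3, 1/3 + t/3)) ∨
    (j = 1 ∧ hexVertex j + t • (hexVertex (j + 1) - hexVertex j) = (1/3 - 2*t/3, 2/3 - t/3)) ∨
    (j = 2 ∧ hexVertex j + t • (hexVertex (j + 1) - hexVertex j) = (-1/3 - t/3, 1/3 - 2*t/3)) ∨
    (j = 3 ∧ hexVertex j + t • (hexVertex (j + 1) - hexVertex j) = (-2/3 + t/3, -1/3 - t/3)) ∨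
    (j = 4 ∧ hexVertex j + t • (hexVertex (j + 1) - hexVertex j) = (-1/3 + 2*t/3, -2/3 + t/3)) ∨
    (j = 5 ∧ hexVertex j + t • (hexVertex (j + 1) - hexVertex j) = (1/3 + t/3, -1/3 + 2*t/3)) := by
  have h0 : hexVertex 0 = (2/3, 1/3) := rfl
  have h1 : hexVertex 1 = (1/3, 2/3) := rfl
  have h2 : hexVertex 2 = (-1/3, 1/3) := rfl
  have h3 : hexVertex 3 = (-2/3, -1/3) := rfl
  have h4 : hexVertex 4 = (-1/3, -2/3) := rfl
  have h5 : hexVertex 5 = (1/3, -1/3) := rfl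
  have hj : j = 0 ∨ j = 1 ∨ j = 2 ∨ j = 3 ∨ j = 4 ∨ j = 5 := by
    revert j
    decide
  rcases hj with rfl | rfl | rfl | rfl | rfl | rfl
  · refine Or.inl ⟨rfl, ?_⟩
    rw [show (0 + 1 : ZMod (2 * 3)) = 1 from rfl, h0, h1]
    ext <;> simp <;> ring
  · refine Or.inr (Or.inl ⟨rfl, ?_⟩)
    rw [show (1 + 1 : ZMod (2 * 3)) = 2 from rfl, h1, h2]
    ext <;> simp <;> ring
  · refine Or.inr (Or.inr (Or.inl ⟨rfl, ?_⟩))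
    rw [show (2 + 1 : ZMod (2 * 3)) = 3 from rfl, h2, h3]
    ext <;> simp <;> ring
  · refine Or.inr (Or.inr (Or.inr (Or.inl ⟨rfl, ?_⟩)))
    rw [show (3 + 1 : ZMod (2 * 3)) = 4 from rfl, h3, h4]
    ext <;> simp <;> ring
  · refine Or.inr (Or.inr (Or.inr (Or.inr (Or.inl ⟨rfl, ?_⟩))))
    rw [show (4 + 1 : ZMod (2 * 3)) = 5 from rfl, h4, h5]
    ext <;> simp <;> ring
  · refine Or.inr (Or.inr (Or.inr (Or.inr (Or.inr ⟨rfl, ?_⟩))))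
    rw [show (5 + 1 : ZMod (2 * 3)) = 0 from rfl, h5, h0]
    ext <;> simp <;> ring

theorem hexVertex_opposite (j : ZMod (2 * 3)) : hexVertex (j + (3 : ℕ)) = -hexVertex j := by
  have hj : j = 0 ∨ j = 1 ∨ j = 2 ∨ j = 3 ∨ j = 4 ∨ j = 5 := by
    revert j
    decide
  rcases hj with rfl | rfl | rfl | rfl | rfl | rfl
  · change ((-2/3, -1/3) : ℝ × ℝ) = -(2/3, 1/3)
    ext <;> norm_num
  · change ((-1/3, -2/3) : ℝ × ℝ) = -(1/3, 2/3)
    ext <;> norm_num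
  · change ((1/3, -1/3) : ℝ × ℝ) = -(-1/3, 1/3)
    ext <;> norm_num
  · change ((2/3, 1/3) : ℝ × ℝ) = -(-2/3, -1/3)
    ext <;> norm_num
  · change ((1/3, 2/3) : ℝ × ℝ) = -(-1/3, -2/3)
    ext <;> norm_num
  · change ((-1/3, 1/3) : ℝ × ℝ) = -(1/3, -1/3)
    ext <;> norm_num

theorem hexVertex_add (j : ZMod (2 * 3)) :
    ∃ p q : ℤ, hexVertex j + hexVertex (j + 1) = ((p : ℝ), (q : ℝ)) := by
  have hj : j = 0 ∨ j = 1 ∨ j = 2 ∨ j = 3 ∨ j = 4 ∨ j = 5 := by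
    revert j
    decide
  rcases hj with rfl | rfl | rfl | rfl | rfl | rfl
  · refine ⟨1, 1, ?_⟩
    change ((2/3, 1/3) : ℝ × ℝ) + (1/3, 2/3) = _
    ext <;> norm_num
  · refine ⟨0, 1, ?_⟩
    change ((1/3, 2/3) : ℝ × ℝ) + (-1/3, 1/3) = _
    ext <;> norm_num
  · refine ⟨-1, 0, ?_⟩
    change ((-1/3, 1/3) : ℝ × ℝ) + (-2/3, -1/3) = _
    ext <;> norm_num
  · refine ⟨-1, -1, ?_⟩
    change ((-2/3, -1/3) : ℝ × ℝ) + (-1/3, -2/3) = _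
    ext <;> norm_num
  · refine ⟨0, -1, ?_⟩
    change ((-1/3, -2/3) : ℝ × ℝ) + (1/3, -1/3) = _
    ext <;> norm_num
  · refine ⟨1, 0, ?_⟩
    change ((1/3, -1/3) : ℝ × ℝ) + (2/3, 1/3) = _
    ext <;> norm_num

/-- The vertices of the hexagon give two points of the torus. -/
theorem torusMk_hexVertex (j : ZMod (2 * 3)) :
    torusMk (hexVertex j) = torusMk (hexVertex 0) ∧
      torusMk (hexVertex (j + 1)) = torusMk (hexVertex 1) ∨
    torusMk (hexVertex j) = torusMk (hexVertex 1) ∧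
      torusMk (hexVertex (j + 1)) = torusMk (hexVertex 0) := by
  -- The difference of vertices two apart is the difference of two consecutive sums `v j + v (j +
  -- 1)`, both of which are lattice vectors.
  have h : ∀ j : ZMod (2 * 3), torusMk (hexVertex (j + 1 + 1)) = torusMk (hexVertex j) := by
    intro j
    obtain ⟨p, q, h1⟩ := hexVertex_add j
    obtain ⟨p', q', h2⟩ := hexVertex_add (j + 1)
    refine torusMk_eq_iff.2 ⟨p - p', q - q', ?_⟩
    have h3 : (((p - p' : ℤ) : ℝ), ((q - q' : ℤ) : ℝ)) =
      ((p : ℝ), (q : ℝ)) - ((p' : ℝ), (q' : ℝ)) := by ext <;> simp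
    rw [h3, ← h1, ← h2]
    abel
  refine ZMod.cyclic_induction (p := fun j =>
    torusMk (hexVertex j) = torusMk (hexVertex 0) ∧
      torusMk (hexVertex (j + 1)) = torusMk (hexVertex 1) ∨
    torusMk (hexVertex j) = torusMk (hexVertex 1) ∧
      torusMk (hexVertex (j + 1)) = torusMk (hexVertex 0)) (Or.inl ⟨rfl, rfl⟩) (fun j hj => ?_) j
  rcases hj with ⟨h1, h2⟩ | ⟨h1, h2⟩
  · exact Or.inr ⟨h2, (h j).trans h1⟩
  · exact Or.inl ⟨h2, (h j).trans h1⟩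

theorem hexGauge_side (j : ZMod (2 * 3)) {t : ℝ} (ht : t ∈ Icc (0 : ℝ) 1) :
    hexGauge (hexVertex j + t • (hexVertex (j + 1) - hexVertex j)) = 1 := by
  have h0 := ht.1
  have h1 := ht.2
  refine le_antisymm (hexGauge_le_one.2 ?_) (one_le_hexGauge.2 ?_)
  · rcases hexSide j t with ⟨-, h⟩ | ⟨-, h⟩ | ⟨-, h⟩ | ⟨-, h⟩ | ⟨-, h⟩ | ⟨-, h⟩ <;> rw [h] <;>
      refine ⟨⟨?_, ?_⟩, ⟨?_, ?_⟩, ?_, ?_⟩ <;> dsimp only <;> linarith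
  · rcases hexSide j t with ⟨-, h⟩ | ⟨-, h⟩ | ⟨-, h⟩ | ⟨-, h⟩ | ⟨-, h⟩ | ⟨-, h⟩ <;> rw [h]
    · exact Or.inl (Or.inl (by dsimp only; linarith))
    · exact Or.inr (Or.inr (Or.inl (by dsimp only; linarith)))
    · exact Or.inr (Or.inl (Or.inr (by dsimp only; linarith)))
    · exact Or.inl (Or.inr (by dsimp only; linarith))
    · exact Or.inr (Or.inr (Or.inr (by dsimp only; linarith)))
    · exact Or.inr (Or.inl (Or.inl (by dsimp only; linarith)))

theorem exists_hexSide {x : ℝ × ℝ} (hx : hexGauge x = 1) :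
    ∃ j, ∃ t ∈ Icc (0 : ℝ) 1, hexVertex j + t • (hexVertex (j + 1) - hexVertex j) = x := by
  obtain ⟨⟨h1, h2⟩, ⟨h3, h4⟩, h5, h6⟩ := hexGauge_le_one.1 hx.le
  have mk : ∀ (j : ZMod (2 * 3)) (t : ℝ), 0 ≤ t → t ≤ 1 →
      hexVertex j + t • (hexVertex (j + 1) - hexVertex j) = x → ∃ j : ZMod (2 * 3),
        ∃ t ∈ Icc (0 : ℝ) 1, hexVertex j + t • (hexVertex (j + 1) - hexVertex j) = x :=
    fun j t h0 h1 h => ⟨j, t, ⟨h0, h1⟩, h⟩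
  rcases one_le_hexGauge.1 hx.ge with (h | h) | (h | h) | (h | h)
  · refine mk 0 (3 * x.2 - 1) (by linarith) (by linarith) ?_
    have := hexSide 0 (3 * x.2 - 1)
    simp (decide := true) only [false_and, or_false, true_and] at this
    rw [this]
    ext <;> dsimp only <;> linarith
  · refine mk 3 (-1 - 3 * x.2) (by linarith) (by linarith) ?_
    have := hexSide 3 (-1 - 3 * x.2)
    simp (decide := true) only [false_and, or_false, false_or, true_and] at this
    rw [this]
    ext <;> dsimp only <;> linarith
  · refine mk 5 (3 * x.1 - 1) (by linarith) (by linarith) ?_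
    have := hexSide 5 (3 * x.1 - 1)
    simp (decide := true) only [false_and, false_or, true_and] at this
    rw [this]
    ext <;> dsimp only <;> linarith
  · refine mk 2 (-1 - 3 * x.1) (by linarith) (by linarith) ?_
    have := hexSide 2 (-1 - 3 * x.1)
    simp (decide := true) only [false_and, or_false, false_or, true_and] at this
    rw [this]
    ext <;> dsimp only <;> linarith
  · refine mk 1 (2 - 3 * x.2) (by linarith) (by linarith) ?_
    have := hexSide 1 (2 - 3 * x.2)
    simp (decide := true) only [false_and, or_false, false_or, true_and] at this
    rw [this]
    ext <;> dsimp only <;> linarith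
  · refine mk 4 (2 + 3 * x.2) (by linarith) (by linarith) ?_
    have := hexSide 4 (2 + 3 * x.2)
    simp (decide := true) only [false_and, or_false, false_or, true_and] at this
    rw [this]
    ext <;> dsimp only <;> linarith

theorem hexSide_inj {j k : ZMod (2 * 3)} {s t : ℝ} (hs : s ∈ Ico (0 : ℝ) 1)
    (ht : t ∈ Ico (0 : ℝ) 1) (h : hexVertex j + s • (hexVertex (j + 1) - hexVertex j) =
      hexVertex k + t • (hexVertex (k + 1) - hexVertex k)) : j = k ∧ s = t := by
  have hs0 := hs.1
  have hs1 := hs.2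
  have ht0 := ht.1
  have ht1 := ht.2
  rcases hexSide j s with ⟨rfl, h1⟩ | ⟨rfl, h1⟩ | ⟨rfl, h1⟩ | ⟨rfl, h1⟩ | ⟨rfl, h1⟩ | ⟨rfl, h1⟩ <;>
    rcases hexSide k t with ⟨rfl, h2⟩ | ⟨rfl, h2⟩ | ⟨rfl, h2⟩ | ⟨rfl, h2⟩ | ⟨rfl, h2⟩ |
      ⟨rfl, h2⟩ <;>
    rw [h1, h2, Prod.mk.injEq] at h <;> obtain ⟨h3, h4⟩ := h <;>
    first
      | exact ⟨rfl, by linarith⟩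
      | (exfalso; linarith)

/-- The lattice vector (p, q) between the points has gauge less than 2, so p + q, 2p − q and 2q − p
lie in {−1, 0, 1}. Since 3p and 3q are sums of two of these, both coordinates vanish. -/
theorem hex_torus_inj {x y : ℝ × ℝ} (hx : hexGauge x < 1) (hy : hexGauge y ≤ 1)
    (h : torusMk x = torusMk y) : x = y := by
  obtain ⟨p, q, rfl⟩ := torusMk_eq_iff.1 h
  obtain ⟨⟨a1, a2⟩, ⟨a3, a4⟩, a5, a6⟩ := hexGauge_lt_one.1 hx
  obtain ⟨⟨b1, b2⟩, ⟨b3, b4⟩, b5, b6⟩ := hexGauge_le_one.1 hy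
  simp only [Prod.fst_add, Prod.snd_add] at b1 b2 b3 b4 b5 b6
  have c1 : (-2 : ℝ) < p + q := by linarith
  have c2 : (p : ℝ) + q < 2 := by linarith
  have c3 : (-2 : ℝ) < 2 * p - q := by linarith
  have c4 : 2 * (p : ℝ) - q < 2 := by linarith
  have c5 : (-2 : ℝ) < 2 * q - p := by linarith
  have c6 : 2 * (q : ℝ) - p < 2 := by linarith
  have d1 : -2 < p + q := by exact_mod_cast c1
  have d2 : p + q < 2 := by exact_mod_cast c2
  have d3 : -2 < 2 * p - q := by exact_mod_cast c3
  have d4 : 2 * p - q < 2 := by exact_mod_cast c4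
  have d5 : -2 < 2 * q - p := by exact_mod_cast c5
  have d6 : 2 * q - p < 2 := by exact_mod_cast c6
  obtain rfl : p = 0 := by omega
  obtain rfl : q = 0 := by omega
  simp

theorem hex_torus_surj (x : ℝ × ℝ) : ∃ y, hexGauge y ≤ 1 ∧ torusMk y = torusMk x := by
  have h1 := Int.floor_le x.1
  have h2 := Int.lt_floor_add_one x.1
  have h3 := Int.floor_le x.2
  have h4 := Int.lt_floor_add_one x.2
  have mk : ∀ p q : ℤ, hexGauge (x + ((p : ℝ), (q : ℝ))) ≤ 1 →
      ∃ y, hexGauge y ≤ 1 ∧ torusMk y = torusMk x :=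
    fun p q h => ⟨_, h, (torusMk_eq_iff.2 ⟨p, q, rfl⟩).symm⟩
  set a := x.1 - ⌊x.1⌋ with ha
  set b := x.2 - ⌊x.2⌋ with hb
  have key : ∀ p q : ℤ, (-1 ≤ a + p + (b + q) ∧ a + p + (b + q) ≤ 1) ∧
      (-1 ≤ 2 * (a + p) - (b + q) ∧ 2 * (a + p) - (b + q) ≤ 1) ∧
      (-1 ≤ 2 * (b + q) - (a + p) ∧ 2 * (b + q) - (a + p) ≤ 1) →
      ∃ y, hexGauge y ≤ 1 ∧ torusMk y = torusMk x := by
    intro p q h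
    refine mk (p - ⌊x.1⌋) (q - ⌊x.2⌋) (hexGauge_le_one.2 ?_)
    have e1 : (x + (((p - ⌊x.1⌋ : ℤ) : ℝ), ((q - ⌊x.2⌋ : ℤ) : ℝ))).1 = a + p := by
      rw [ha, Prod.fst_add]
      push_cast
      ring
    have e2 : (x + (((p - ⌊x.1⌋ : ℤ) : ℝ), ((q - ⌊x.2⌋ : ℤ) : ℝ))).2 = b + q := by
      rw [hb, Prod.snd_add]
      push_cast
      ring
    rw [e1, e2]
    exact h
  -- The hexagon and its translates cut the unit square of fractional parts (a, b) into pieces. Each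
  -- piece is carried into the hexagon by subtracting (0, 0), (1, 0), (0, 1) or (1, 1).
  by_cases c1 : a + b ≤ 1
  · by_cases c2 : 2 * a - b ≤ 1
    · by_cases c3 : 2 * b - a ≤ 1
      · refine key 0 0 ?_
        refine ⟨⟨?_, ?_⟩, ⟨?_, ?_⟩, ?_, ?_⟩ <;> push_cast <;> linarith
      · refine key 0 (-1) ?_
        refine ⟨⟨?_, ?_⟩, ⟨?_, ?_⟩, ?_, ?_⟩ <;> push_cast <;> linarith
    · refine key (-1) 0 ?_
      refine ⟨⟨?_, ?_⟩, ⟨?_, ?_⟩, ?_, ?_⟩ <;> push_cast <;> linarith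
  · by_cases c2 : 2 * a - b ≥ 1
    · by_cases c3 : a - 2 * b ≤ 0
      · refine key (-1) (-1) ?_
        refine ⟨⟨?_, ?_⟩, ⟨?_, ?_⟩, ?_, ?_⟩ <;> push_cast <;> linarith
      · refine key (-1) 0 ?_
        refine ⟨⟨?_, ?_⟩, ⟨?_, ?_⟩, ?_, ?_⟩ <;> push_cast <;> linarith
    · by_cases c3 : b - 2 * a ≤ 0
      · refine key (-1) (-1) ?_
        refine ⟨⟨?_, ?_⟩, ⟨?_, ?_⟩, ?_, ?_⟩ <;> push_cast <;> linarith
      · refine key 0 (-1) ?_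
        refine ⟨⟨?_, ?_⟩, ⟨?_, ?_⟩, ?_, ?_⟩ <;> push_cast <;> linarith

theorem hexEdge (i : Fin 3) (t : ℝ) :
    (i = 0 ∧ hexVertex (i : ℕ) + t • (hexVertex ((i : ℕ) + 1) - hexVertex (i : ℕ)) =
      (2/3 - t/3, 1/3 + t/3)) ∨
    (i = 1 ∧ hexVertex (i : ℕ) + t • (hexVertex ((i : ℕ) + 1) - hexVertex (i : ℕ)) =
      (1/3 - 2*t/3, 2/3 - t/3)) ∨
    (i = 2 ∧ hexVertex (i : ℕ) + t • (hexVertex ((i : ℕ) + 1) - hexVertex (i : ℕ)) =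
      (-1/3 - t/3, 1/3 - 2*t/3)) := by
  have h3 : ∀ i : Fin 3, ((i : ℕ) : ZMod (2 * 3)) ≠ 3 ∧ ((i : ℕ) : ZMod (2 * 3)) ≠ 4 ∧
    ((i : ℕ) : ZMod (2 * 3)) ≠ 5 := by decide
  have h0 : ∀ i : Fin 3, (((i : ℕ) : ZMod (2 * 3)) = 0 → i = 0) ∧
    (((i : ℕ) : ZMod (2 * 3)) = 1 → i = 1) ∧ (((i : ℕ) : ZMod (2 * 3)) = 2 → i = 2) := by decide
  rcases hexSide ((i : ℕ) : ZMod (2 * 3)) t with h | h | h | h | h | h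
  · exact Or.inl ⟨(h0 i).1 h.1, h.2⟩
  · exact Or.inr (Or.inl ⟨(h0 i).2.1 h.1, h.2⟩)
  · exact Or.inr (Or.inr ⟨(h0 i).2.2 h.1, h.2⟩)
  · exact absurd h.1 (h3 i).1
  · exact absurd h.1 (h3 i).2.1
  · exact absurd h.1 (h3 i).2.2

/-- For each pair of edges some coordinate of the lattice vector lies strictly between −1 and 1 and
so is zero; the remaining equations are linear. -/
theorem hexEdge_inj {i j : Fin 3} {s t : ℝ} (hs : s ∈ Ioo (0 : ℝ) 1) (ht : t ∈ Icc (0 : ℝ) 1)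
    (h : torusMk (hexVertex (i : ℕ) + s • (hexVertex ((i : ℕ) + 1) - hexVertex (i : ℕ))) =
      torusMk (hexVertex (j : ℕ) + t • (hexVertex ((j : ℕ) + 1) - hexVertex (j : ℕ)))) :
    i = j ∧ s = t := by
  have hs0 := hs.1
  have hs1 := hs.2
  have ht0 := ht.1
  have ht1 := ht.2
  obtain ⟨p, q, h⟩ := torusMk_eq_iff.1 h
  have key : ∀ r : ℤ, (-1 : ℝ) < r → (r : ℝ) < 1 → (r : ℝ) = 0 := fun r h1 h2 => by
    rw [int_eq_zero_of_lt h1 h2, Int.cast_zero]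
  rcases hexEdge i s with ⟨rfl, h1⟩ | ⟨rfl, h1⟩ | ⟨rfl, h1⟩ <;>
    rcases hexEdge j t with ⟨rfl, h2⟩ | ⟨rfl, h2⟩ | ⟨rfl, h2⟩ <;>
    rw [h1, h2, Prod.mk_add_mk, Prod.mk.injEq] at h <;> obtain ⟨h3, h4⟩ := h
  · have := key p (by linarith) (by linarith)
    exact ⟨rfl, by linarith⟩
  · have := key p (by linarith) (by linarith)
    exfalso
    linarith
  · have := key q (by linarith) (by linarith)
    exfalso
    linarith
  · have := key p (by linarith) (by linarith)
    exfalso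
    linarith
  · have := key q (by linarith) (by linarith)
    exact ⟨rfl, by linarith⟩
  · have := key p (by linarith) (by linarith)
    exfalso
    linarith
  · have := key q (by linarith) (by linarith)
    exfalso
    linarith
  · have := key p (by linarith) (by linarith)
    exfalso
    linarith
  · have := key p (by linarith) (by linarith)
    exact ⟨rfl, by linarith⟩

/-- The edges 0 and 2 both start at the class of vertex 0 and both end at the class of vertex 1, and
there are no other classes. -/
theorem hex_degree (j : ZMod (2 * 3)) :
    2 ≤ Nat.card {e : Fin 3 // torusMk (hexVertex (e : ℕ)) = torusMk (hexVertex j)} +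
      Nat.card {e : Fin 3 // torusMk (hexVertex ((e : ℕ) + 1)) = torusMk (hexVertex j)} := by
  have h02 : (0 : Fin 3) ≠ 2 := by decide
  rcases torusMk_hexVertex j with ⟨h, -⟩ | ⟨h, -⟩ <;> rw [h]
  · refine le_trans (two_le_card_subtype (P := fun e : Fin 3 => torusMk (hexVertex (e : ℕ)) =
      torusMk (hexVertex 0)) (a := 0) (b := 2) rfl ?_ h02) (Nat.le_add_right _ _)
    refine torusMk_eq_iff.2 ⟨1, 0, ?_⟩
    change ((2/3, 1/3) : ℝ × ℝ) = (-1/3, 1/3) + _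
    ext <;> norm_num
  · refine le_trans (two_le_card_subtype (P := fun e : Fin 3 => torusMk (hexVertex ((e : ℕ) + 1)) =
      torusMk (hexVertex 1)) (a := 0) (b := 2) rfl ?_ h02) (Nat.le_add_left _ _)
    refine torusMk_eq_iff.2 ⟨1, 1, ?_⟩
    change ((1/3, 2/3) : ℝ × ℝ) = (-2/3, -1/3) + _
    ext <;> norm_num

/-- The hexagon as a symmetric tile. -/
def hexTile : SymmetricTile 3 where
  v := hexVertex
  gauge := hexGauge
  continuous_gauge := by
    unfold hexGauge
    fun_prop
  gauge_smul r hr x := by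
    have h : ∀ a : ℝ, |r * a| = r * |a| := fun a => by rw [abs_mul, abs_of_nonneg hr]
    simp only [hexGauge, Prod.smul_fst, Prod.smul_snd, smul_eq_mul]
    rw [← mul_add, show 2 * (r * x.1) - r * x.2 = r * (2 * x.1 - x.2) by ring,
      show 2 * (r * x.2) - r * x.1 = r * (2 * x.2 - x.1) by ring, h, h, h,
      mul_max_of_nonneg _ _ hr, mul_max_of_nonneg _ _ hr]
  gauge_add x y := by
    simp only [hexGauge, Prod.fst_add, Prod.snd_add]
    refine max_le ?_ (max_le ?_ ?_)
    · rw [add_add_add_comm]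
      exact (abs_add_le _ _).trans (add_le_add (le_max_left _ _) (le_max_left _ _))
    · rw [show 2 * (x.1 + y.1) - (x.2 + y.2) = (2 * x.1 - x.2) + (2 * y.1 - y.2) by ring]
      exact (abs_add_le _ _).trans (add_le_add ((le_max_left _ _).trans (le_max_right _ _))
        ((le_max_left _ _).trans (le_max_right _ _)))
    · rw [show 2 * (x.2 + y.2) - (x.1 + y.1) = (2 * x.2 - x.1) + (2 * y.2 - y.1) by ring]
      exact (abs_add_le _ _).trans (add_le_add ((le_max_right _ _).trans (le_max_right _ _))
        ((le_max_right _ _).trans (le_max_right _ _)))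
  gauge_pos x hx := by
    by_contra h
    simp only [hexGauge, not_lt, max_le_iff, abs_nonpos_iff] at h
    exact hx (Prod.ext (by simp; linarith [h.1, h.2.1]) (by simp; linarith [h.1, h.2.2]))
  gauge_side := fun j _ ht => hexGauge_side j ht
  exists_side := fun _ hx => exists_hexSide hx
  side_inj := fun _ _ _ hs _ ht h => hexSide_inj hs ht h
  v_opposite := hexVertex_opposite
  v_add_v := hexVertex_add
  torus_inj := fun _ _ hx hy h => hex_torus_inj hx hy h
  torus_surj := hex_torus_surj
  edge_inj := fun _ _ _ hs _ ht h => hexEdge_inj hs ht h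
  degree := hex_degree

theorem parallelHexagon_eq : parallelHexagon = hexTile.tile 0 := by
  rw [← hexTile.convexHull_eq_tile, parallelHexagon]
  congr 1
  simp only [zero_add]
  change _ = range hexVertex
  rw [hexVertex]
  change _ = range (![(2/3, 1/3), (1/3, 2/3), (-1/3, 1/3), (-2/3, -1/3), (-1/3, -2/3),
    (1/3, -1/3)] : Fin 6 → ℝ × ℝ)
  simp only [Matrix.range_cons, Matrix.range_empty, union_empty, singleton_union]

/-! ### The square -/

/-- The vertices of the square, relative to its center. -/
def squareVertex : ZMod (2 * 2) → ℝ × ℝ :=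
  ![(-1/2, -1/2), (1/2, -1/2), (1/2, 1/2), (-1/2, 1/2)]

/-- The gauge function of the square. -/
def squareGauge (x : ℝ × ℝ) : ℝ := max |2 * x.1| |2 * x.2|

theorem squareGauge_le_one {x : ℝ × ℝ} : squareGauge x ≤ 1 ↔
    (-1 ≤ 2 * x.1 ∧ 2 * x.1 ≤ 1) ∧ (-1 ≤ 2 * x.2 ∧ 2 * x.2 ≤ 1) := by
  simp only [squareGauge, max_le_iff, abs_le]

theorem squareGauge_lt_one {x : ℝ × ℝ} : squareGauge x < 1 ↔
    (-1 < 2 * x.1 ∧ 2 * x.1 < 1) ∧ (-1 < 2 * x.2 ∧ 2 * x.2 < 1) := by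
  simp only [squareGauge, max_lt_iff, abs_lt]

theorem one_le_squareGauge {x : ℝ × ℝ} : 1 ≤ squareGauge x ↔
    (1 ≤ 2 * x.1 ∨ 1 ≤ -(2 * x.1)) ∨ (1 ≤ 2 * x.2 ∨ 1 ≤ -(2 * x.2)) := by
  simp only [squareGauge, le_max_iff, le_abs]

theorem squareSide (j : ZMod (2 * 2)) (t : ℝ) :
    (j = 0 ∧ squareVertex j + t • (squareVertex (j + 1) - squareVertex j) = (-1/2 + t, -1/2)) ∨
    (j = 1 ∧ squareVertex j + t • (squareVertex (j + 1) - squareVertex j) = (1/2, -1/2 + t)) ∨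
    (j = 2 ∧ squareVertex j + t • (squareVertex (j + 1) - squareVertex j) = (1/2 - t, 1/2)) ∨
    (j = 3 ∧ squareVertex j + t • (squareVertex (j + 1) - squareVertex j) = (-1/2, 1/2 - t)) := by
  have h0 : squareVertex 0 = (-1/2, -1/2) := rfl
  have h1 : squareVertex 1 = (1/2, -1/2) := rfl
  have h2 : squareVertex 2 = (1/2, 1/2) := rfl
  have h3 : squareVertex 3 = (-1/2, 1/2) := rfl
  have hj : j = 0 ∨ j = 1 ∨ j = 2 ∨ j = 3 := by
    revert j
    decide
  rcases hj with rfl | rfl | rfl | rfl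
  · refine Or.inl ⟨rfl, ?_⟩
    rw [show (0 + 1 : ZMod (2 * 2)) = 1 from rfl, h0, h1]
    ext <;> simp
    ring
  · refine Or.inr (Or.inl ⟨rfl, ?_⟩)
    rw [show (1 + 1 : ZMod (2 * 2)) = 2 from rfl, h1, h2]
    ext <;> simp
    ring
  · refine Or.inr (Or.inr (Or.inl ⟨rfl, ?_⟩))
    rw [show (2 + 1 : ZMod (2 * 2)) = 3 from rfl, h2, h3]
    ext <;> simp
    ring
  · refine Or.inr (Or.inr (Or.inr ⟨rfl, ?_⟩))
    rw [show (3 + 1 : ZMod (2 * 2)) = 0 from rfl, h3, h0]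
    ext <;> simp
    ring

theorem squareVertex_opposite (j : ZMod (2 * 2)) :
    squareVertex (j + (2 : ℕ)) = -squareVertex j := by
  have hj : j = 0 ∨ j = 1 ∨ j = 2 ∨ j = 3 := by
    revert j
    decide
  rcases hj with rfl | rfl | rfl | rfl
  · change ((1/2, 1/2) : ℝ × ℝ) = -(-1/2, -1/2)
    ext <;> norm_num
  · change ((-1/2, 1/2) : ℝ × ℝ) = -(1/2, -1/2)
    ext <;> norm_num
  · change ((-1/2, -1/2) : ℝ × ℝ) = -(1/2, 1/2)
    ext <;> norm_num
  · change ((1/2, -1/2) : ℝ × ℝ) = -(-1/2, 1/2)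
    ext <;> norm_num

theorem squareVertex_add (j : ZMod (2 * 2)) :
    ∃ p q : ℤ, squareVertex j + squareVertex (j + 1) = ((p : ℝ), (q : ℝ)) := by
  have hj : j = 0 ∨ j = 1 ∨ j = 2 ∨ j = 3 := by
    revert j
    decide
  rcases hj with rfl | rfl | rfl | rfl
  · refine ⟨0, -1, ?_⟩
    change ((-1/2, -1/2) : ℝ × ℝ) + (1/2, -1/2) = _
    ext <;> norm_num
  · refine ⟨1, 0, ?_⟩
    change ((1/2, -1/2) : ℝ × ℝ) + (1/2, 1/2) = _
    ext <;> norm_num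
  · refine ⟨0, 1, ?_⟩
    change ((1/2, 1/2) : ℝ × ℝ) + (-1/2, 1/2) = _
    ext <;> norm_num
  · refine ⟨-1, 0, ?_⟩
    change ((-1/2, 1/2) : ℝ × ℝ) + (-1/2, -1/2) = _
    ext <;> norm_num

/-- The vertices of the square give one point of the torus. -/
theorem torusMk_squareVertex (j : ZMod (2 * 2)) :
    torusMk (squareVertex j) = torusMk (squareVertex 0) := by
  have hj : j = 0 ∨ j = 1 ∨ j = 2 ∨ j = 3 := by
    revert j
    decide
  rcases hj with rfl | rfl | rfl | rfl
  · rfl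
  · refine torusMk_eq_iff.2 ⟨-1, 0, ?_⟩
    change ((-1/2, -1/2) : ℝ × ℝ) = (1/2, -1/2) + _
    ext <;> norm_num
  · refine torusMk_eq_iff.2 ⟨-1, -1, ?_⟩
    change ((-1/2, -1/2) : ℝ × ℝ) = (1/2, 1/2) + _
    ext <;> norm_num
  · refine torusMk_eq_iff.2 ⟨0, -1, ?_⟩
    change ((-1/2, -1/2) : ℝ × ℝ) = (-1/2, 1/2) + _
    ext <;> norm_num

theorem squareGauge_side (j : ZMod (2 * 2)) {t : ℝ} (ht : t ∈ Icc (0 : ℝ) 1) :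
    squareGauge (squareVertex j + t • (squareVertex (j + 1) - squareVertex j)) = 1 := by
  have h0 := ht.1
  have h1 := ht.2
  refine le_antisymm (squareGauge_le_one.2 ?_) (one_le_squareGauge.2 ?_)
  · rcases squareSide j t with ⟨-, h⟩ | ⟨-, h⟩ | ⟨-, h⟩ | ⟨-, h⟩ <;> rw [h] <;>
      refine ⟨⟨?_, ?_⟩, ?_, ?_⟩ <;> dsimp only <;> linarith
  · rcases squareSide j t with ⟨-, h⟩ | ⟨-, h⟩ | ⟨-, h⟩ | ⟨-, h⟩ <;> rw [h]
    · exact Or.inr (Or.inr (by dsimp only; linarith))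
    · exact Or.inl (Or.inl (by dsimp only; linarith))
    · exact Or.inr (Or.inl (by dsimp only; linarith))
    · exact Or.inl (Or.inr (by dsimp only; linarith))

theorem exists_squareSide {x : ℝ × ℝ} (hx : squareGauge x = 1) : ∃ j, ∃ t ∈ Icc (0 : ℝ) 1,
    squareVertex j + t • (squareVertex (j + 1) - squareVertex j) = x := by
  obtain ⟨⟨h1, h2⟩, h3, h4⟩ := squareGauge_le_one.1 hx.le
  rcases one_le_squareGauge.1 hx.ge with (h | h) | (h | h)
  · refine ⟨1, x.2 + 1 / 2, ⟨by linarith, by linarith⟩, ?_⟩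
    have := squareSide 1 (x.2 + 1 / 2)
    simp (decide := true) only [false_and, or_false, false_or, true_and] at this
    rw [this]
    ext <;> dsimp only <;> linarith
  · refine ⟨3, 1 / 2 - x.2, ⟨by linarith, by linarith⟩, ?_⟩
    have := squareSide 3 (1 / 2 - x.2)
    simp (decide := true) only [false_and, false_or, true_and] at this
    rw [this]
    ext <;> dsimp only <;> linarith
  · refine ⟨2, 1 / 2 - x.1, ⟨by linarith, by linarith⟩, ?_⟩
    have := squareSide 2 (1 / 2 - x.1)
    simp (decide := true) only [false_and, or_false, false_or, true_and] at this
    rw [this]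
    ext <;> dsimp only <;> linarith
  · refine ⟨0, x.1 + 1 / 2, ⟨by linarith, by linarith⟩, ?_⟩
    have := squareSide 0 (x.1 + 1 / 2)
    simp (decide := true) only [false_and, or_false, true_and] at this
    rw [this]
    ext <;> dsimp only <;> linarith

theorem squareSide_inj {j k : ZMod (2 * 2)} {s t : ℝ} (hs : s ∈ Ico (0 : ℝ) 1)
    (ht : t ∈ Ico (0 : ℝ) 1) (h : squareVertex j + s • (squareVertex (j + 1) - squareVertex j) =
      squareVertex k + t • (squareVertex (k + 1) - squareVertex k)) : j = k ∧ s = t := by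
  have hs0 := hs.1
  have hs1 := hs.2
  have ht0 := ht.1
  have ht1 := ht.2
  rcases squareSide j s with ⟨rfl, h1⟩ | ⟨rfl, h1⟩ | ⟨rfl, h1⟩ | ⟨rfl, h1⟩ <;>
    rcases squareSide k t with ⟨rfl, h2⟩ | ⟨rfl, h2⟩ | ⟨rfl, h2⟩ | ⟨rfl, h2⟩ <;>
    rw [h1, h2, Prod.mk.injEq] at h <;> obtain ⟨h3, h4⟩ := h <;>
    first
      | exact ⟨rfl, by linarith⟩
      | (exfalso; linarith)

theorem square_torus_inj {x y : ℝ × ℝ} (hx : squareGauge x < 1) (hy : squareGauge y ≤ 1)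
    (h : torusMk x = torusMk y) : x = y := by
  obtain ⟨p, q, rfl⟩ := torusMk_eq_iff.1 h
  obtain ⟨⟨a1, a2⟩, a3, a4⟩ := squareGauge_lt_one.1 hx
  obtain ⟨⟨b1, b2⟩, b3, b4⟩ := squareGauge_le_one.1 hy
  simp only [Prod.fst_add, Prod.snd_add] at b1 b2 b3 b4
  obtain rfl := int_eq_zero_of_lt (p := p) (by linarith) (by linarith)
  obtain rfl := int_eq_zero_of_lt (p := q) (by linarith) (by linarith)
  simp

theorem square_torus_surj (x : ℝ × ℝ) : ∃ y, squareGauge y ≤ 1 ∧ torusMk y = torusMk x := by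
  have h1 := Int.floor_le (x.1 + 1 / 2)
  have h2 := Int.lt_floor_add_one (x.1 + 1 / 2)
  have h3 := Int.floor_le (x.2 + 1 / 2)
  have h4 := Int.lt_floor_add_one (x.2 + 1 / 2)
  refine ⟨x + (((-⌊x.1 + 1 / 2⌋ : ℤ) : ℝ), ((-⌊x.2 + 1 / 2⌋ : ℤ) : ℝ)), squareGauge_le_one.2 ?_,
    (torusMk_eq_iff.2 ⟨_, _, rfl⟩).symm⟩
  rw [Prod.fst_add, Prod.snd_add]
  push_cast
  refine ⟨⟨?_, ?_⟩, ?_, ?_⟩ <;> linarith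

theorem squareEdge (i : Fin 2) (t : ℝ) :
    (i = 0 ∧ squareVertex (i : ℕ) + t • (squareVertex ((i : ℕ) + 1) - squareVertex (i : ℕ)) =
      (-1/2 + t, -1/2)) ∨
    (i = 1 ∧ squareVertex (i : ℕ) + t • (squareVertex ((i : ℕ) + 1) - squareVertex (i : ℕ)) =
      (1/2, -1/2 + t)) := by
  have h3 : ∀ i : Fin 2, ((i : ℕ) : ZMod (2 * 2)) ≠ 2 ∧ ((i : ℕ) : ZMod (2 * 2)) ≠ 3 := by decide
  have h0 : ∀ i : Fin 2, (((i : ℕ) : ZMod (2 * 2)) = 0 → i = 0) ∧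
    (((i : ℕ) : ZMod (2 * 2)) = 1 → i = 1) := by decide
  rcases squareSide ((i : ℕ) : ZMod (2 * 2)) t with h | h | h | h
  · exact Or.inl ⟨(h0 i).1 h.1, h.2⟩
  · exact Or.inr ⟨(h0 i).2 h.1, h.2⟩
  · exact absurd h.1 (h3 i).1
  · exact absurd h.1 (h3 i).2

theorem squareEdge_inj {i j : Fin 2} {s t : ℝ} (hs : s ∈ Ioo (0 : ℝ) 1) (ht : t ∈ Icc (0 : ℝ) 1)
    (h : torusMk (squareVertex (i : ℕ) + s • (squareVertex ((i : ℕ) + 1) - squareVertex (i : ℕ))) =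
      torusMk (squareVertex (j : ℕ) + t • (squareVertex ((j : ℕ) + 1) - squareVertex (j : ℕ)))) :
    i = j ∧ s = t := by
  have hs0 := hs.1
  have hs1 := hs.2
  have ht0 := ht.1
  have ht1 := ht.2
  obtain ⟨p, q, h⟩ := torusMk_eq_iff.1 h
  have key : ∀ r : ℤ, (-1 : ℝ) < r → (r : ℝ) < 1 → (r : ℝ) = 0 := fun r h1 h2 => by
    rw [int_eq_zero_of_lt h1 h2, Int.cast_zero]
  rcases squareEdge i s with ⟨rfl, h1⟩ | ⟨rfl, h1⟩ <;>
    rcases squareEdge j t with ⟨rfl, h2⟩ | ⟨rfl, h2⟩ <;>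
    rw [h1, h2, Prod.mk_add_mk, Prod.mk.injEq] at h <;> obtain ⟨h3, h4⟩ := h
  · have := key p (by linarith) (by linarith)
    exact ⟨rfl, by linarith⟩
  · have := key p (by linarith) (by linarith)
    exfalso
    linarith
  · have := key q (by linarith) (by linarith)
    exfalso
    linarith
  · have := key q (by linarith) (by linarith)
    exact ⟨rfl, by linarith⟩

/-- The square as a symmetric tile. -/
def squareTile : SymmetricTile 2 where
  v := squareVertex
  gauge := squareGauge
  continuous_gauge := by
    unfold squareGauge
    fun_prop
  gauge_smul r hr x := by
    have h : ∀ a : ℝ, |r * a| = r * |a| := fun a => by rw [abs_mul, abs_of_nonneg hr]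
    simp only [squareGauge, Prod.smul_fst, Prod.smul_snd, smul_eq_mul]
    rw [mul_left_comm, mul_left_comm 2 r, h, h, mul_max_of_nonneg _ _ hr]
  gauge_add x y := by
    simp only [squareGauge, Prod.fst_add, Prod.snd_add, mul_add]
    exact max_le ((abs_add_le _ _).trans (add_le_add (le_max_left _ _) (le_max_left _ _)))
      ((abs_add_le _ _).trans (add_le_add (le_max_right _ _) (le_max_right _ _)))
  gauge_pos x hx := by
    by_contra h
    simp only [squareGauge, not_lt, max_le_iff, abs_nonpos_iff] at h
    exact hx (Prod.ext (by simp; linarith [h.1]) (by simp; linarith [h.2]))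
  gauge_side := fun j _ ht => squareGauge_side j ht
  exists_side := fun _ hx => exists_squareSide hx
  side_inj := fun _ _ _ hs _ ht h => squareSide_inj hs ht h
  v_opposite := squareVertex_opposite
  v_add_v := squareVertex_add
  torus_inj := fun _ _ hx hy h => square_torus_inj hx hy h
  torus_surj := square_torus_surj
  edge_inj := fun _ _ _ hs _ ht h => squareEdge_inj hs ht h
  degree j := le_trans (two_le_card_subtype (P := fun e : Fin 2 => torusMk (squareVertex (e : ℕ)) =
    torusMk (squareVertex j)) (a := 0) (b := 1)
    ((torusMk_squareVertex _).trans (torusMk_squareVertex j).symm)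
    ((torusMk_squareVertex _).trans (torusMk_squareVertex j).symm) (by decide))
    (Nat.le_add_right _ _)

theorem parallelogram_eq : parallelogram = squareTile.tile (1/2, 1/2) := by
  rw [← squareTile.convexHull_eq_tile, parallelogram]
  congr 1
  change _ = range ((fun x => ((1/2, 1/2) : ℝ × ℝ) + x) ∘ squareVertex)
  rw [range_comp, squareVertex]
  change _ = (fun x => ((1/2, 1/2) : ℝ × ℝ) + x) '' range
    (![(-1/2, -1/2), (1/2, -1/2), (1/2, 1/2), (-1/2, 1/2)] : Fin 4 → ℝ × ℝ)
  simp only [Matrix.range_cons, Matrix.range_empty, union_empty, singleton_union,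
    image_insert_eq, image_singleton, Prod.mk_add_mk]
  norm_num

/-! ### The two graphs are not homeomorphic -/

section ThetaGraph

variable {X ι : Type} [TopologicalSpace X] {γ : ι → ℝ → X}

/-- Removing one common end leaves half-open arcs that all contain the other end. -/
theorem theta_diff_end_isPreconnected {A B : X}
    (hγ : ∀ i, ContinuousOn (γ i) (Icc 0 1)) (hAB : A ≠ B)
    (hends : ∀ i, (γ i 0 = A ∧ γ i 1 = B) ∨ (γ i 0 = B ∧ γ i 1 = A))
    (hinj : ∀ i j, ∀ s ∈ Ioo (0 : ℝ) 1, ∀ t ∈ Icc (0 : ℝ) 1, γ i s = γ j t → i = j ∧ s = t) :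
    IsPreconnected ((⋃ i, γ i '' Icc 0 1) \ {A}) := by
  refine isPreconnected_of_forall B ?_
  rintro y ⟨hy, hyA⟩
  obtain ⟨i, t, ht, rfl⟩ := mem_iUnion.1 hy
  rcases hends i with ⟨h0, h1⟩ | ⟨h0, h1⟩
  · have ht0 : 0 < t := lt_of_le_of_ne ht.1 fun h => hyA (by rw [← h, h0]; rfl)
    refine ⟨γ i '' Ioc 0 1, ?_, ⟨1, ⟨zero_lt_one, le_rfl⟩, h1⟩, ⟨t, ⟨ht0, ht.2⟩, rfl⟩,
      isPreconnected_Ioc.image _ ((hγ i).mono Ioc_subset_Icc_self)⟩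
    rintro _ ⟨u, hu, rfl⟩
    refine ⟨mem_iUnion.2 ⟨i, u, Ioc_subset_Icc_self hu, rfl⟩, fun h => ?_⟩
    rw [mem_singleton_iff] at h
    rcases hu.2.lt_or_eq with hu1 | rfl
    · exact hu.1.ne' (hinj i i u ⟨hu.1, hu1⟩ 0 ⟨le_rfl, zero_le_one⟩ (h.trans h0.symm)).2
    · exact hAB (h.symm.trans h1)
  · have ht1 : t < 1 := lt_of_le_of_ne ht.2 fun h => hyA (by rw [h, h1]; rfl)
    refine ⟨γ i '' Ico 0 1, ?_, ⟨0, ⟨le_rfl, zero_lt_one⟩, h0⟩, ⟨t, ⟨ht.1, ht1⟩, rfl⟩,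
      isPreconnected_Ico.image _ ((hγ i).mono Ico_subset_Icc_self)⟩
    rintro _ ⟨u, hu, rfl⟩
    refine ⟨mem_iUnion.2 ⟨i, u, Ico_subset_Icc_self hu, rfl⟩, fun h => ?_⟩
    rw [mem_singleton_iff] at h
    rcases hu.1.eq_or_lt with rfl | hu0
    · exact hAB (h.symm.trans h0)
    · exact hu.2.ne (hinj i i u ⟨hu0, hu.2⟩ 1 ⟨zero_le_one, le_rfl⟩ (h.trans h1.symm)).2

/-- A graph formed by several edges that all join the same two vertices has no cut point. -/
theorem theta_diff_singleton_isPreconnected {A B : X}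
    (hγ : ∀ i, ContinuousOn (γ i) (Icc 0 1)) (hAB : A ≠ B)
    (hends : ∀ i, (γ i 0 = A ∧ γ i 1 = B) ∨ (γ i 0 = B ∧ γ i 1 = A))
    (hinj : ∀ i j, ∀ s ∈ Ioo (0 : ℝ) 1, ∀ t ∈ Icc (0 : ℝ) 1, γ i s = γ j t → i = j ∧ s = t)
    (hne : ∀ k : ι, ∃ i, i ≠ k) {p : X} (hp : p ∈ ⋃ i, γ i '' Icc 0 1) :
    IsPreconnected ((⋃ i, γ i '' Icc 0 1) \ {p}) := by
  by_cases hpA : p = A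
  · rw [hpA]
    exact theta_diff_end_isPreconnected hγ hAB hends hinj
  by_cases hpB : p = B
  · rw [hpB]
    exact theta_diff_end_isPreconnected hγ hAB.symm (fun i => (hends i).symm) hinj
  obtain ⟨k, s, hs, rfl⟩ := mem_iUnion.1 hp
  have hs' : s ∈ Ioo (0 : ℝ) 1 := by
    refine ⟨lt_of_le_of_ne hs.1 ?_, lt_of_le_of_ne hs.2 ?_⟩ <;> rintro rfl <;>
      rcases hends k with h | h
    · exact hpA h.1
    · exact hpB h.1
    · exact hpB h.2
    · exact hpA h.2
  have h0m : (0 : ℝ) ∈ Icc (0 : ℝ) 1 := ⟨le_rfl, zero_le_one⟩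
  have h1m : (1 : ℝ) ∈ Icc (0 : ℝ) 1 := ⟨zero_le_one, le_rfl⟩
  have hsub : ∀ i, i ≠ k → γ i '' Icc 0 1 ⊆ (⋃ i, γ i '' Icc 0 1) \ {γ k s} := by
    rintro i hi _ ⟨t, ht, rfl⟩
    exact ⟨mem_iUnion.2 ⟨i, t, ht, rfl⟩, fun h => hi (hinj k i s hs' t ht (Eq.symm h)).1.symm⟩
  have hsubk : ∀ J ⊆ Icc (0 : ℝ) 1, s ∉ J → γ k '' J ⊆ (⋃ i, γ i '' Icc 0 1) \ {γ k s} := by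
    rintro J hJ hsJ _ ⟨t, ht, rfl⟩
    exact ⟨mem_iUnion.2 ⟨k, t, hJ ht, rfl⟩,
      fun h => hsJ ((hinj k k s hs' t (hJ ht) (Eq.symm h)).2 ▸ ht)⟩
  have hmem : ∀ i, A ∈ γ i '' Icc 0 1 ∧ B ∈ γ i '' Icc 0 1 := fun i => by
    rcases hends i with h | h
    · exact ⟨⟨0, h0m, h.1⟩, ⟨1, h1m, h.2⟩⟩
    · exact ⟨⟨1, h1m, h.2⟩, ⟨0, h0m, h.1⟩⟩
  have hconn : ∀ i, IsPreconnected (γ i '' Icc 0 1) := fun i => isPreconnected_Icc.image _ (hγ i)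
  obtain ⟨i, hi⟩ := hne k
  have hend : ∀ x, x = A ∨ x = B → x ∈ γ i '' Icc 0 1 := by
    rintro x (rfl | rfl)
    · exact (hmem i).1
    · exact (hmem i).2
  -- A remnant of the cut edge still contains one of its ends, where it meets the intact edge `i`,
  -- and that edge reaches A.
  have hunion : ∀ J ⊆ Icc (0 : ℝ) 1, s ∉ J → IsPreconnected J → ∀ u ∈ J,
      (γ k u = A ∨ γ k u = B) → ∀ t ∈ J, ∃ C ⊆ (⋃ i, γ i '' Icc 0 1) \ {γ k s},
        A ∈ C ∧ γ k t ∈ C ∧ IsPreconnected C := by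
    intro J hJ hsJ hJc u hu hk t ht
    exact ⟨γ k '' J ∪ γ i '' Icc 0 1, union_subset (hsubk J hJ hsJ) (hsub i hi),
      Or.inr (hmem i).1, Or.inl ⟨t, ht, rfl⟩,
      (hJc.image _ ((hγ k).mono hJ)).union (γ k u) ⟨u, hu, rfl⟩ (hend _ hk) (hconn i)⟩
  refine isPreconnected_of_forall A ?_
  rintro y ⟨hy, hyp⟩
  obtain ⟨j, t, ht, rfl⟩ := mem_iUnion.1 hy
  by_cases hj : j = k
  · subst hj
    have hts : t ≠ s := fun h => hyp (by rw [h]; rfl)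
    rcases lt_or_gt_of_ne hts with h | h
    · refine hunion (Ico 0 s) (fun u hu => ⟨hu.1, hu.2.le.trans hs.2⟩) (fun h => lt_irrefl _ h.2)
        isPreconnected_Ico 0 ⟨le_rfl, hs'.1⟩ ?_ t ⟨ht.1, h⟩
      rcases hends j with h | h
      · exact Or.inl h.1
      · exact Or.inr h.1
    · refine hunion (Ioc s 1) (fun u hu => ⟨hs.1.trans hu.1.le, hu.2⟩) (fun h => lt_irrefl _ h.1)
        isPreconnected_Ioc 1 ⟨hs'.2, le_rfl⟩ ?_ t ⟨h, ht.2⟩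
      rcases hends j with h | h
      · exact Or.inr h.2
      · exact Or.inl h.2
  · exact ⟨_, hsub j hj, (hmem j).1, ⟨t, ht, rfl⟩, hconn j⟩

end ThetaGraph

/-- The graph of the hexagon. -/
def hexGraph : PolygonalGraph := hexTile.graph 0

/-- The graph of the square. -/
def squareGraph : PolygonalGraph := squareTile.graph (1/2, 1/2)

theorem hexGraph_carrier : hexGraph.carrier = boundaryGraph parallelHexagon := by
  rw [parallelHexagon_eq, hexTile.boundaryGraph_tile]
  rfl

theorem squareGraph_carrier : squareGraph.carrier = boundaryGraph parallelogram := by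
  rw [parallelogram_eq, squareTile.boundaryGraph_tile]
  rfl

/-- In the torus the hexagon has two vertices, and each of its three edges joins them: a theta
graph. -/
theorem hexGraph_diff_singleton_isPreconnected {p : Torus2} (hp : p ∈ hexGraph.carrier) :
    IsPreconnected (hexGraph.carrier \ {p}) := by
  let γ : Fin 3 → ℝ → Torus2 := fun i t => torusMk (0 + hexTile.pt (i : ℕ) t)
  have hends : ∀ i, (γ i 0 = torusMk (hexVertex 0) ∧ γ i 1 = torusMk (hexVertex 1)) ∨
      (γ i 0 = torusMk (hexVertex 1) ∧ γ i 1 = torusMk (hexVertex 0)) := by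
    intro i
    simp only [γ, zero_add, SymmetricTile.pt_zero, SymmetricTile.pt_one]
    exact torusMk_hexVertex _
  have hcar : hexGraph.carrier = ⋃ i, γ i '' Icc 0 1 := by
    refine union_eq_right.2 fun y hy => ?_
    obtain ⟨j, rfl⟩ := (hexTile.mem_vertices 0).1 hy
    rw [zero_add]
    have h1 : ∀ i : Fin 3, γ i 0 ∈ ⋃ i, γ i '' Icc 0 1 :=
      fun i => mem_iUnion.2 ⟨i, 0, ⟨le_rfl, zero_le_one⟩, rfl⟩
    have h2 : ∀ i : Fin 3, γ i 1 ∈ ⋃ i, γ i '' Icc 0 1 :=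
      fun i => mem_iUnion.2 ⟨i, 1, ⟨zero_le_one, le_rfl⟩, rfl⟩
    change torusMk (hexVertex j) ∈ _
    rcases torusMk_hexVertex j with ⟨h, -⟩ | ⟨h, -⟩ <;> rw [h] <;>
      rcases hends 0 with ⟨h3, h4⟩ | ⟨h3, h4⟩
    · exact h3 ▸ h1 0
    · exact h4 ▸ h2 0
    · exact h4 ▸ h2 0
    · exact h3 ▸ h1 0
  rw [hcar] at hp ⊢
  have hcont : ∀ i, ContinuousOn (γ i) (Icc 0 1) := fun i => hexGraph.continuousOn_edge i
  have hne : ∀ k : Fin 3, ∃ i, i ≠ k := by decide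
  refine theta_diff_singleton_isPreconnected (γ := γ) hcont ?_ hends
    (fun i j s hs t ht h => hexEdge_inj hs ht ?_) hne hp
  · intro h
    obtain ⟨p, q, h⟩ := torusMk_eq_iff.1 h
    have h0 : ((1/3, 2/3) : ℝ × ℝ) = (2/3, 1/3) + ((p : ℝ), (q : ℝ)) := h
    rw [Prod.mk_add_mk, Prod.mk.injEq] at h0
    have h1 := h0.1
    have h2 := int_eq_zero_of_lt (p := p) (by linarith) (by linarith)
    rw [h2] at h1
    norm_num at h1
  · have h' : torusMk (0 + hexTile.pt (i : ℕ) s) = torusMk (0 + hexTile.pt (j : ℕ) t) := h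
    rwa [zero_add, zero_add] at h'

/-- The boundary of the square gives the two coordinate circles, which meet only at 0. Without that
point, the open sets where the first or the second coordinate is nonzero separate them. -/
theorem squareGraph_diff_not_isPreconnected :
    (0 : Torus2) ∈ squareGraph.carrier ∧ ¬IsPreconnected (squareGraph.carrier \ {0}) := by
  have hc : squareGraph.carrier =
      (fun x => torusMk ((1/2, 1/2) + x)) '' {x | squareGauge x = 1} :=
    squareTile.carrier_graph _
  have hone : ((1 : ℝ) : UnitAddCircle) = 0 := AddCircle.coe_period 1
  have hzero : ((0 : ℝ) : UnitAddCircle) = 0 := rfl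
  have hhalf : ((1/2 : ℝ) : UnitAddCircle) ≠ 0 := by
    intro h
    obtain ⟨p, hp⟩ := unitAddCircle_coe_eq_iff.1 (h.trans hzero.symm)
    have h2 := int_eq_zero_of_lt (p := p) (by linarith) (by linarith)
    rw [h2] at hp
    norm_num at hp
  have hsub : ∀ y ∈ squareGraph.carrier, y.1 = 0 ∨ y.2 = 0 := by
    rw [hc]
    rintro _ ⟨x, hx, rfl⟩
    simp only [torusMk, Prod.fst_add, Prod.snd_add]
    rcases one_le_squareGauge.1 hx.ge with (h | h) | (h | h) <;>
      obtain ⟨⟨h1, h2⟩, h3, h4⟩ := squareGauge_le_one.1 hx.le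
    · left
      rw [show 1/2 + x.1 = 1 by linarith, hone]
    · left
      rw [show 1/2 + x.1 = 0 by linarith, hzero]
    · right
      rw [show 1/2 + x.2 = 1 by linarith, hone]
    · right
      rw [show 1/2 + x.2 = 0 by linarith, hzero]
  have hmem : ∀ x : ℝ × ℝ, squareGauge x = 1 → torusMk ((1/2, 1/2) + x) ∈ squareGraph.carrier := by
    intro x hx
    rw [hc]
    exact ⟨x, hx, rfl⟩
  have h0 : (0 : Torus2) ∈ squareGraph.carrier := by
    have := hmem (-1/2, -1/2) (by simp [squareGauge]; norm_num)
    convert this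
    ext <;> simp [torusMk] <;> norm_num
  refine ⟨h0, fun hpre => ?_⟩
  have h1 : (((1/2 : ℝ) : UnitAddCircle), (0 : UnitAddCircle)) ∈ squareGraph.carrier := by
    have := hmem (0, -1/2) (by simp [squareGauge]; norm_num)
    rwa [show ((1/2, 1/2) : ℝ × ℝ) + (0, -1/2) = (1/2, 0) by ext <;> norm_num] at this
  have h2 : ((0 : UnitAddCircle), ((1/2 : ℝ) : UnitAddCircle)) ∈ squareGraph.carrier := by
    have := hmem (-1/2, 0) (by simp [squareGauge]; norm_num)
    rwa [show ((1/2, 1/2) : ℝ × ℝ) + (-1/2, 0) = (0, 1/2) by ext <;> norm_num] at this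
  obtain ⟨y, ⟨hy, -⟩, hy1, hy2⟩ := hpre {y | y.1 ≠ 0} {y | y.2 ≠ 0}
    (isOpen_ne_fun continuous_fst continuous_const)
    (isOpen_ne_fun continuous_snd continuous_const)
    (by
      rintro y ⟨-, hy⟩
      by_contra h
      simp only [mem_union, mem_ofPred_eq, not_or, not_not] at h
      exact hy (Prod.ext h.1 h.2))
    ⟨_, ⟨h1, fun h => hhalf (congrArg Prod.fst h)⟩, hhalf⟩
    ⟨_, ⟨h2, fun h => hhalf (congrArg Prod.snd h)⟩, hhalf⟩
  rcases hsub y hy with h | h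
  · exact hy1 h
  · exact hy2 h

/-- The two types of fibers are different. -/
theorem not_sameType_hex_square : ¬SameType (CollapsedTorus.proj hexGraph.carrier)
    (CollapsedTorus.proj squareGraph.carrier) := by
  intro h
  obtain ⟨e, he⟩ := h.exists_homeomorph
  obtain ⟨h0, hn⟩ := squareGraph_diff_not_isPreconnected
  refine hn ?_
  have h1 : e.symm 0 ∈ hexGraph.carrier := by rwa [← he, e.apply_symm_apply]
  have h2 : squareGraph.carrier \ {0} = e '' (hexGraph.carrier \ {e.symm 0}) := by
    ext y
    constructor
    · rintro ⟨hy, hy0⟩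
      refine ⟨e.symm y, ⟨by rwa [← he, e.apply_symm_apply], fun h => hy0 ?_⟩, e.apply_symm_apply y⟩
      exact e.symm.injective h
    · rintro ⟨x, ⟨hx, hx0⟩, rfl⟩
      refine ⟨(he x).2 hx, fun h => hx0 ?_⟩
      rw [mem_singleton_iff] at h ⊢
      rw [← h, e.symm_apply_apply]
  rw [h2]
  exact (hexGraph_diff_singleton_isPreconnected h1).image _ e.continuous.continuousOn

theorem sameType_of_standardForm {G G' : PolygonalGraph} {φ : G.F} {φ' : G'.F}
    (hφ : ∀ f, f = φ) (hφ' : ∀ f, f = φ') {M : ℕ} (h : StandardForm (G.cell φ) M)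
    (h' : StandardForm (G'.cell φ') M) :
    SameType (CollapsedTorus.proj G.carrier) (CollapsedTorus.proj G'.carrier) := by
  obtain ⟨e, he⟩ := PolygonalGraph.exists_homeomorph hφ hφ' h h'
  exact sameType_of_homeomorph e he

theorem hexGraph_numRegions : numRegions hexGraph.carrier = 1 := by
  rw [PolygonalGraph.numRegions_carrier]
  change Nat.card Unit = 1
  simp

theorem squareGraph_numRegions : numRegions squareGraph.carrier = 1 := by
  rw [PolygonalGraph.numRegions_carrier]
  change Nat.card Unit = 1
  simp

theorem isTypeTwoFiber_proj (Γ : Set Torus2) : IsTypeTwoFiber Γ (CollapsedTorus.proj Γ) :=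
  ⟨Homeomorph.refl _, fun _ => rfl⟩

/-- A graph with one region has one of the two types. -/
theorem sameType_hex_or_square {G : PolygonalGraph} (hG : numRegions G.carrier = 1) :
    SameType (CollapsedTorus.proj G.carrier) (CollapsedTorus.proj hexGraph.carrier) ∨
      SameType (CollapsedTorus.proj G.carrier) (CollapsedTorus.proj squareGraph.carrier) := by
  rw [PolygonalGraph.numRegions_carrier, Nat.card_eq_one_iff_unique] at hG
  obtain ⟨hs, ⟨φ⟩⟩ := hG
  have hφ : ∀ f, f = φ := fun f => Subsingleton.elim f φ
  have hH : ∀ f : hexGraph.F, f = (() : Unit) := fun _ => rfl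
  have hS : ∀ f : squareGraph.F, f = (() : Unit) := fun _ => rfl
  obtain ⟨M, hM, h⟩ := G.standardForm hφ
  obtain ⟨M₁, hM₁, h₁⟩ := hexGraph.standardForm hH
  obtain ⟨M₂, hM₂, h₂⟩ := squareGraph.standardForm hS
  -- There is no need to determine which value belongs to which model. The models have different
  -- types, so their values differ and exhaust {2, 3}.
  have hne : M₁ ≠ M₂ := by
    rintro rfl
    exact not_sameType_hex_square (sameType_of_standardForm hH hS h₁ h₂)
  have hor : M = M₁ ∨ M = M₂ := by omega
  rcases hor with rfl | rfl
  · exact Or.inl (sameType_of_standardForm hφ hH h h₁)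
  · exact Or.inr (sameType_of_standardForm hφ hS h h₂)

end

theorem mainTheorem12 :
    (∀ (G : PolygonalGraph) (X : Type) [TopologicalSpace X] (p : X → Torus2),
      IsTypeTwoFiber G.carrier p →
        (HasEulerNumber X (-1) ↔ numRegions G.carrier = 1) ∧
        (HasEulerNumber X (-1) → Xor (IsTypeII p) (IsTypeIITilde p))) ∧
    (IsFundamentalPolygon parallelHexagon ∧
      (∃ G : PolygonalGraph, G.carrier = boundaryGraph parallelHexagon) ∧
      HasEulerNumber (CollapsedTorus (boundaryGraph parallelHexagon)) (-1)) ∧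
    (IsFundamentalPolygon parallelogram ∧
      (∃ G : PolygonalGraph, G.carrier = boundaryGraph parallelogram) ∧
      HasEulerNumber (CollapsedTorus (boundaryGraph parallelogram)) (-1)) := by
  refine ⟨fun G X _ p hp => ⟨G.hasEulerNumber_fiber_iff hp, fun hχ => ?_⟩,
    ⟨?_, ⟨hexGraph, hexGraph_carrier⟩, ?_⟩, ?_, ⟨squareGraph, squareGraph_carrier⟩, ?_⟩
  · have hG := (G.hasEulerNumber_fiber_iff hp).1 hχ
    rw [IsTypeII, IsTypeIITilde, ← hexGraph_carrier, ← squareGraph_carrier]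
    rcases sameType_hex_or_square hG with h | h
    · refine Or.inl ⟨hp.sameType.trans h, fun h' => not_sameType_hex_square ?_⟩
      exact (hp.sameType.trans h).symm.trans h'
    · refine Or.inr ⟨hp.sameType.trans h, fun h' => not_sameType_hex_square ?_⟩
      exact h'.symm.trans (hp.sameType.trans h)
  · rw [parallelHexagon_eq]
    exact hexTile.isFundamentalPolygon_tile 0
  · rw [← hexGraph_carrier]
    exact (hexGraph.hasEulerNumber_fiber_iff (isTypeTwoFiber_proj _)).2 hexGraph_numRegions
  · rw [parallelogram_eq]
    exact squareTile.isFundamentalPolygon_tile _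
  · rw [← squareGraph_carrier]
    exact (squareGraph.hasEulerNumber_fiber_iff (isTypeTwoFiber_proj _)).2 squareGraph_numRegions
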